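/- **Model.** Algorithms are randomized word-RAM programs: finitely many registers and arrays of $w$-bit words, the usual arithmetic, bitwise and comparison operations modulo $2^w$, conditionals and loops, fair coin tosses; every elementary operation costs one step and allocating an array of length $\ell$ costs $\ell$ additional steps. An algorithm solves a problem *in time $t$ with probability at least $p$* if for some constant $c\ge 1$, on every instance $I$ and for every word length $w\ge c\log_2(N+2)$, where $N$ is the total length of the input arrays plus the sum of all input numbers, it always halts within $t(I)$ steps, and its output is correct with probability at least $p(I)$. We write $f\le\widetilde O(g)$ if there are constants $C,k$ with $f\le C\,g\,\lfloor\log_2 (g+2)\rfloor^k$ everywhere. **Problems.** Fix a constant $K\ge 1$. *Bounded monotone MaxConv* on length-$n$ sequences: given monotone non-decreasing $A[0,\dots,n]$, $B[0,\dots,n]$ with entries in $\{0,\dots,Kn\}\cup\{-\infty\}$, compute $C[0,\dots,2n]$ with $C[k]=\max_{i+j=k}(A[i]+B[j])$. *0-1 Knapsack*: given $n$ items with profits $p_i\in\mathbb N$ and weights $w_i\in\mathbb N$ and a capacity $W\in\mathbb N$, where $\mathbb N=\{0,1,2,\dots\}$, compute $x\in\{0,1\}^n$ with $\sum_i w_ix_i\le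 W$ and $\sum_i p_ix_i=\mathrm{OPT}$, where $\mathrm{OPT}$ is the maximum of $\sum_i p_ix_i$ over all $x\in\{0,1\}^n$ with $\sum_i w_ix_i\le W$. **Theorem 4.2.** Let $T:\mathbb N\to\mathbb N$ satisfy $T(g(n))\le\widetilde O(T(n))$ for every $g:\mathbb N\to\mathbb N$ with $g(n)\le\widetilde O(n)$, and $k\,T(n)\le O(T(kn))$ for all $k,n\ge 1$. Suppose that bounded monotone MaxConv on length-$n$ sequences can be solved in time $T(n)$, by an algorithm that is deterministic or, more generally, correct with probability at least $2/3$. Then 0-1 Knapsack can be solved in time $\widetilde O(n+T(W+\mathrm{OPT}))$ with high probability, that is: for every constant $c\in\mathbb N$ there is a randomized algorithm that solves it in time $\widetilde O(n+T(W+\mathrm{OPT}))$ with probability at least $1-(n+W+\mathrm{OPT}+2)^{-c}$. -/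

import Mathlib

/-! ### A randomized word RAM, as a structured programming language

A program has finitely many registers, each holding one `w`-bit word, and finitely many arrays of
words.  Arithmetic is done modulo `2 ^ w`.  Every elementary operation costs one step, allocating
an array costs its length, and `flip` tosses a fair coin. -/

/-- The binary operations on words. -/
inductive BinOp
  | add | sub | mul | div | mod | band | bor | bxor | shl | shr | eq | lt

/-- The value of a binary operation before reduction modulo `2 ^ w`.  Subtraction is truncated at
`0`, division and remainder by `0` have the conventions of `ℕ`, comparisons return `0` or `1`. -/
def BinOp.apply : BinOp → ℕ → ℕ → ℕ
  | .add, x, y => x + y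
  | .sub, x, y => x - y
  | .mul, x, y => x * y
  | .div, x, y => x / y
  | .mod, x, y => x % y
  | .band, x, y => x &&& y
  | .bor, x, y => x ||| y
  | .bxor, x, y => x ^^^ y
  | .shl, x, y => x <<< y
  | .shr, x, y => x >>> y
  | .eq, x, y => if x = y then 1 else 0
  | .lt, x, y => if x < y then 1 else 0

/-- A memory state: the registers, the arrays, and the coin tosses that are still to come. -/
structure RamState where
  reg : ℕ → ℕ
  arr : ℕ → List ℕ
  coins : ℕ → Bool

/-- Expressions over registers and arrays. -/
inductive RamExpr
  | const (k : ℕ)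
  | var (x : ℕ)
  /-- the entry of array `a` at position `i` -/
  | read (a : ℕ) (i : RamExpr)
  /-- the length of array `a` -/
  | len (a : ℕ)
  | bin (o : BinOp) (e f : RamExpr)

/-- The value of an expression on a RAM with words of `w` bits.  Reading outside the bounds of an
array gives `0`. -/
def RamExpr.eval (w : ℕ) (s : RamState) : RamExpr → ℕ
  | .const k => k % 2 ^ w
  | .var x => s.reg x
  | .read a i => (s.arr a).getD (i.eval w s) 0
  | .len a => (s.arr a).length % 2 ^ w
  | .bin o e f => o.apply (e.eval w s) (f.eval w s) % 2 ^ w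

/-- The number of elementary operations in an expression. -/
def RamExpr.cost : RamExpr → ℕ
  | .const _ => 1
  | .var _ => 1
  | .read _ i => i.cost + 1
  | .len _ => 1
  | .bin _ e f => e.cost + f.cost + 1

/-- Programs. A condition counts as true if its value is not `0`. -/
inductive RamProg
  | skip
  /-- store the value of `e` in register `x` -/
  | assign (x : ℕ) (e : RamExpr)
  /-- store the value of `e` in array `a` at position `i` -/
  | write (a : ℕ) (i e : RamExpr)
  /-- let `a` be a new array of `e` zeros -/
  | alloc (a : ℕ) (e : RamExpr)
  /-- toss a fair coin and store the result, `0` or `1`, in register `x` -/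
  | flip (x : ℕ)
  | seq (c d : RamProg)
  | ite (e : RamExpr) (c d : RamProg)
  | loop (e : RamExpr) (c : RamProg)

/-- `RamExec w c s s' t`: on a RAM with words of `w` bits, the program `c` started in the state `s`
halts in the state `s'` after exactly `t` steps. Writing outside the bounds of an array has no
effect. -/
inductive RamExec (w : ℕ) : RamProg → RamState → RamState → ℕ → Prop
  | skip (s : RamState) : RamExec w .skip s s 1
  | assign (x : ℕ) (e : RamExpr) (s : RamState) :
      RamExec w (.assign x e) s { s with reg := Function.update s.reg x (e.eval w s) } (e.cost + 1)
  | write (a : ℕ) (i e : RamExpr) (s : RamState) :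
      RamExec w (.write a i e) s
        { s with arr := Function.update s.arr a ((s.arr a).set (i.eval w s) (e.eval w s)) }
        (i.cost + e.cost + 1)
  | alloc (a : ℕ) (e : RamExpr) (s : RamState) :
      RamExec w (.alloc a e) s
        { s with arr := Function.update s.arr a (List.replicate (e.eval w s) 0) }
        (e.cost + e.eval w s + 1)
  | flip (x : ℕ) (s : RamState) :
      RamExec w (.flip x) s
        { s with
          reg := Function.update s.reg x (if s.coins 0 then 1 % 2 ^ w else 0)
          coins := fun k => s.coins (k + 1) } 1
  | seq {c d : RamProg} {s s₁ s₂ : RamState} {t₁ t₂ : ℕ} :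
      RamExec w c s s₁ t₁ → RamExec w d s₁ s₂ t₂ → RamExec w (.seq c d) s s₂ (t₁ + t₂)
  | ite_true {e : RamExpr} {c d : RamProg} {s s' : RamState} {t : ℕ} :
      e.eval w s ≠ 0 → RamExec w c s s' t → RamExec w (.ite e c d) s s' (e.cost + t + 1)
  | ite_false {e : RamExpr} {c d : RamProg} {s s' : RamState} {t : ℕ} :
      e.eval w s = 0 → RamExec w d s s' t → RamExec w (.ite e c d) s s' (e.cost + t + 1)
  | loop_done {e : RamExpr} {c : RamProg} {s : RamState} :
      e.eval w s = 0 → RamExec w (.loop e c) s s (e.cost + 1)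
  | loop_step {e : RamExpr} {c : RamProg} {s s₁ s₂ : RamState} {t₁ t₂ : ℕ} :
      e.eval w s ≠ 0 → RamExec w c s s₁ t₁ → RamExec w (.loop e c) s₁ s₂ t₂ →
      RamExec w (.loop e c) s s₂ (e.cost + t₁ + t₂ + 1)

/-- The initial state: the input is a list of arrays, everything else is empty or `0`. -/
def RamState.init (input : List (List ℕ)) (ω : ℕ → Bool) : RamState where
  reg := fun _ => 0
  arr := fun a => input.getD a []
  coins := ω

/-- The law of an infinite sequence of independent fair coin tosses. -/
noncomputable def coinMeasure : MeasureTheory.Measure (ℕ → Bool) :=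
  MeasureTheory.Measure.infinitePi fun _ => (PMF.uniformOfFintype Bool).toMeasure

/-! ### Computational problems and running times -/

/-- A computational problem: the input of each instance, as a list of arrays of numbers, and which
outputs are correct for it. -/
structure CompProblem (ι : Type) where
  input : ι → List (List ℕ)
  correct : ι → List ℕ → Prop

/-- The total length of the input arrays plus the sum of all numbers in them.  (Up to a polynomial
this is the number of input words plus the largest input number.) -/
def inputMagnitude (input : List (List ℕ)) : ℕ :=
  (input.map fun a => a.length + a.sum).sum

/-- The program `P` solves the problem `Q` in time `t` with probability at least `p`: there is a
constant `c ≥ 1` such that on every instance `I`, on every RAM whose word length `w` is at least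
`c * log₂ (N + 2)` with `N` the magnitude of the input, `P` halts after at most `t I` steps
whatever the coin tosses are, and with probability at least `p I` the output (array `0` at the
end) is correct. -/
def SolvesInTime {ι : Type} (P : RamProg) (Q : CompProblem ι) (t : ι → ℕ) (p : ι → ℝ) : Prop :=
  ∃ c : ℕ, 1 ≤ c ∧ ∀ (I : ι) (w : ℕ), (inputMagnitude (Q.input I) + 2) ^ c ≤ 2 ^ w →
    (∀ ω : ℕ → Bool, ∃ (s' : RamState) (τ : ℕ),
      RamExec w P (RamState.init (Q.input I) ω) s' τ ∧ τ ≤ t I) ∧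
    p I ≤ coinMeasure.real {ω | ∃ (s' : RamState) (τ : ℕ),
      RamExec w P (RamState.init (Q.input I) ω) s' τ ∧ Q.correct I (s'.arr 0)}

/-- `f = Õ(g)`, that is, `f ≤ C * g * (log g) ^ k` for some constants `C` and `k`. -/
def SoftO {ι : Type} (f g : ι → ℕ) : Prop :=
  ∃ C k : ℕ, ∀ i, f i ≤ C * (g i * Nat.log 2 (g i + 2) ^ k)

/-- The niceness assumptions on time bounds: `T(Õ(n)) ≤ Õ(T(n))`, and `k * T(n) ≤ O(T(k * n))` for
`k, n ≥ 1`. -/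
structure NiceTimeBound (T : ℕ → ℕ) : Prop where
  softO_comp : ∀ g : ℕ → ℕ, SoftO g (fun n => n) → SoftO (fun n => T (g n)) T
  mul_le : ∃ C : ℕ, ∀ k n : ℕ, 1 ≤ k → 1 ≤ n → k * T n ≤ C * T (k * n)

/-! ### Bounded monotone (max,+)-convolution -/

/-- The (max,+)-convolution `C[0, …, 2n]` of `A[0, …, n]` and `B[0, …, n]`; the value `-∞` is
`⊥`. -/
def maxConv {n : ℕ} (A B : Fin (n + 1) → WithBot ℕ) (k : Fin (2 * n + 1)) : WithBot ℕ :=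
  (Finset.univ.filter fun q : Fin (n + 1) × Fin (n + 1) => (q.1 : ℕ) + (q.2 : ℕ) = (k : ℕ)).sup
    fun q => A q.1 + B q.2

/-- Two monotone non-decreasing sequences with entries in `{0, …, K * n} ∪ {-∞}`. -/
structure BMMaxConvInstance (K : ℕ) where
  n : ℕ
  A : Fin (n + 1) → WithBot ℕ
  B : Fin (n + 1) → WithBot ℕ
  monotone_A : Monotone A
  monotone_B : Monotone B
  bounded_A : ∀ i, A i ≤ ((K * n : ℕ) : WithBot ℕ)
  bounded_B : ∀ i, B i ≤ ((K * n : ℕ) : WithBot ℕ)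

/-- In the memory, `-∞` is represented by `0` and a number `v` by `v + 1`. -/
def encodeEntry : WithBot ℕ → ℕ :=
  WithBot.recBotCoe 0 fun v => v + 1

/-- The problem of computing the (max,+)-convolution of two monotone non-decreasing sequences
`A[0, …, n]` and `B[0, …, n]` with entries in `{0, …, K * n} ∪ {-∞}`. -/
def bmMaxConv (K : ℕ) : CompProblem (BMMaxConvInstance K) where
  input I := [List.ofFn fun i => encodeEntry (I.A i), List.ofFn fun i => encodeEntry (I.B i)]
  correct I out := out = List.ofFn fun k => encodeEntry (maxConv I.A I.B k)

/-! ### 0-1 Knapsack -/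

/-- Items with profits `p i` and weights `w i`, and a capacity `W`. -/
structure KnapsackInstance where
  n : ℕ
  p : Fin n → ℕ
  w : Fin n → ℕ
  W : ℕ

/-- The total profit of a solution `x ∈ {0,1}ⁿ`. -/
def KnapsackInstance.profit (I : KnapsackInstance) (x : Fin I.n → Fin 2) : ℕ :=
  ∑ i, I.p i * (x i : ℕ)

/-- The total weight of a solution `x ∈ {0,1}ⁿ`. -/
def KnapsackInstance.weight (I : KnapsackInstance) (x : Fin I.n → Fin 2) : ℕ :=
  ∑ i, I.w i * (x i : ℕ)

/-- The maximum profit of a feasible solution. (The solution `0` is always feasible.) -/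
def KnapsackInstance.opt (I : KnapsackInstance) : ℕ :=
  (Finset.univ.filter fun x : Fin I.n → Fin 2 => I.weight x ≤ I.W).sup I.profit

/-- The problem of computing an optimal solution `x ∈ {0,1}ⁿ`. -/
def zeroOneKnapsack : CompProblem KnapsackInstance where
  input I := [List.ofFn I.p, List.ofFn I.w, [I.W]]
  correct I out := ∃ x : Fin I.n → Fin 2,
    out = List.ofFn (fun i => (x i : ℕ)) ∧ I.weight x ≤ I.W ∧ I.profit x = I.opt

/-!
Let `n`, `W`, `opt` be the number of items, the capacity and the optimum.  The algorithm splits the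
items into polylogarithmically many classes by the binary lengths of weight and profit, so that the
items of a class agree in both up to a factor of two.  An optimal solution contains at most
`z = min (number of items) (W / weight)` items of a class, up to rounding.  Each class gets about
`z` buckets, and every item is put into a random bucket of its class.  With high probability every
bucket contains only `O(log)` items of a fixed optimal solution (`KP.hash`, with the expectation of
`2 ^ load`, summed over all buckets, as potential).  A few small moduli then suffice to find one,
the colour of the bucket, modulo which these few items have different indices
(`exists_separating`; the proof uses that the central binomial coefficient divides every common
multiple of `1, …, 2 * n`).

This leads to a binary tree.  A leaf stands for a bucket, a colour and a remainder modulo that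
colour; its profile assigns to each weight the best profit of a single item in it.  Going up, the
remainders are combined by (max,+)-convolution, the colours of a bucket by a maximum, and the
buckets again by convolution.  All profiles are monotone, and a node has a size that bounds its
weights and profits, so every convolution is a bounded monotone one for which the given algorithm
can be used.  If all profiles are correct, the profile of the root at `W` is at least the profit of
the solution (`KP.Correct.le_root`).  Conversely, a demand for the capacity `W` at the root is passed
down the tree.  An item is in one leaf for each colour of its bucket, but a maximum passes its demand
on to one child only, so demands never reach two leaves that contain the same item.  Hence the
demands of the leaves can be met by a feasible set of items (`KP.DemInv`, `KP.SelInv`).  The set is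
feasible whether or not the profiles are correct.

The randomized subroutine is run `R = O(log)` times at each node, and each entry of the output is
determined by a majority vote (`conv_spec`).  The total size of the leaves is `Õ(W + opt)`, and so
is the total size of each level of the tree.  Since `T` is superlinear, the convolutions need time
`Õ(T (W + opt))` altogether (`KnapsackInstance.softO_totalTime`).  A time bound for convolution is at
least linear because the output has to be written, so `T (W + opt)` also covers the rest of the
work, up to `Õ(n)`.

The program is verified with a small program logic.  `Det` and `RT` say that a program halts in
time, with a postcondition and, for `RT`, a bound on the expectation of a function of the final
memory.  A program that always halts consumes finitely many coin tosses, so it is a finite decision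
tree (`exists_coinTree`), and probabilities become averages over its leaves (`coinMeasure_run`).
-/

open MeasureTheory

/-! ### Coin trees -/

/-- A finite decision tree whose inner nodes toss a fair coin. -/
inductive CoinTree (α : Type) : Type
  | leaf (a : α)
  | node (l r : CoinTree α)

namespace CoinTree
variable {α β : Type}

/-- The leaf reached with the coin tosses `ω`, and the tosses that are left over. -/
def run : CoinTree α → (ℕ → Bool) → α × (ℕ → Bool)
  | leaf a, ω => (a, ω)
  | node l r, ω => if ω 0 then l.run (fun k => ω (k + 1)) else r.run (fun k => ω (k + 1))

/-- The expectation of `f` at the leaf that is reached. -/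
noncomputable def mean (f : α → ℝ) : CoinTree α → ℝ
  | leaf a => f a
  | node l r => (l.mean f + r.mean f) / 2

/-- All leaves satisfy `p`. -/
def All (p : α → Prop) : CoinTree α → Prop
  | leaf a => p a
  | node l r => l.All p ∧ r.All p

/-- Continue with the tree `k a` at each leaf `a`. -/
def bind (k : α → CoinTree β) : CoinTree α → CoinTree β
  | leaf a => k a
  | node l r => node (l.bind k) (r.bind k)

theorem run_bind (k : α → CoinTree β) (t : CoinTree α) (ω : ℕ → Bool) :
    (t.bind k).run ω = (k (t.run ω).1).run (t.run ω).2 := by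
  induction t generalizing ω with
  | leaf a => rfl
  | node l r hl hr => simp only [bind, run]; split <;> simp [hl, hr]

theorem All.run {p : α → Prop} {t : CoinTree α} (h : t.All p) (ω : ℕ → Bool) : p (t.run ω).1 := by
  induction t generalizing ω with
  | leaf a => exact h
  | node l r hl hr =>
    simp only [CoinTree.run]; split
    · exact hl h.1 _
    · exact hr h.2 _

theorem all_of_run {p : α → Prop} {t : CoinTree α} (h : ∀ ω, p (t.run ω).1) : t.All p := by
  induction t with
  | leaf a => exact h (fun _ => true)
  | node l r hl hr =>
    refine ⟨hl fun ω => ?_, hr fun ω => ?_⟩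
    · simpa [CoinTree.run] using h (fun k => Nat.casesOn k true ω)
    · simpa [CoinTree.run] using h (fun k => Nat.casesOn k false ω)

theorem All.bind {p : α → Prop} {q : β → Prop} {k : α → CoinTree β} {t : CoinTree α}
    (h : t.All p) (hk : ∀ a, p a → (k a).All q) : (t.bind k).All q := by
  induction t with
  | leaf a => exact hk a h
  | node l r hl hr => exact ⟨hl h.1, hr h.2⟩

theorem mean_bind_le {p : α → Prop} {f : α → ℝ} {g : β → ℝ} {k : α → CoinTree β} {t : CoinTree α}
    (h : t.All p) (hk : ∀ a, p a → (k a).mean g ≤ f a) : (t.bind k).mean g ≤ t.mean f := by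
  induction t with
  | leaf a => exact hk a h
  | node l r hl hr => simp only [bind, mean]; linarith [hl h.1, hr h.2]

theorem mean_mono {p : α → Prop} {f g : α → ℝ} {t : CoinTree α}
    (h : t.All p) (hk : ∀ a, p a → f a ≤ g a) : t.mean f ≤ t.mean g := by
  induction t with
  | leaf a => exact hk a h
  | node l r hl hr => simp only [mean]; linarith [hl h.1, hr h.2]

theorem mean_affine (a b : ℝ) (f : α → ℝ) (t : CoinTree α) :
    t.mean (fun x => a * f x + b) = a * t.mean f + b := by
  induction t with
  | leaf a => rfl
  | node l r hl hr => simp only [mean, hl, hr]; ring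

end CoinTree

instance : IsProbabilityMeasure coinMeasure := by
  unfold coinMeasure; infer_instance

/-- An infinite sequence of fair coin tosses is one toss followed by such a sequence. -/
theorem coinMeasure_cons :
    ((PMF.uniformOfFintype Bool).toMeasure.prod coinMeasure).map
      (fun q : Bool × (ℕ → Bool) => fun k => Nat.casesOn k q.1 q.2) = coinMeasure := by
  have hmeas : Measurable (fun q : Bool × (ℕ → Bool) => (fun k => Nat.casesOn k q.1 q.2 : ℕ → Bool)) := by
    refine measurable_pi_lambda _ fun k => ?_
    cases k with
    | zero => exact measurable_fst
    | succ k => exact (measurable_pi_apply k).comp measurable_snd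
  refine Measure.eq_infinitePi _ fun s t ht => ?_
  rw [Measure.map_apply hmeas (MeasurableSet.pi s.countable_toSet fun i _ => ht i)]
  classical
  set t' : ℕ → Set Bool := fun i => if i ∈ s then t i else Set.univ with ht'
  set N := s.sup id + 1 with hN
  have hsN : s ⊆ Finset.range (N + 1) := fun i hi => by
    have := Finset.le_sup (f := id) hi
    simp at this ⊢; omega
  have hpre : (fun q : Bool × (ℕ → Bool) => (fun k => Nat.casesOn k q.1 q.2 : ℕ → Bool)) ⁻¹'
      (Set.pi ↑s t) = t' 0 ×ˢ Set.pi (Finset.range N : Set ℕ) (fun i => t' (i + 1)) := by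
    ext q
    simp only [Set.mem_preimage, Set.mem_pi, Finset.mem_coe, Set.mem_prod, Finset.mem_range]
    constructor
    · intro h
      refine ⟨?_, fun i hi => ?_⟩
      · by_cases h0 : 0 ∈ s
        · simpa [ht', h0] using h 0 h0
        · simp [ht', h0]
      · by_cases h0 : i + 1 ∈ s
        · simpa [ht', h0] using h (i + 1) h0
        · simp [ht', h0]
    · rintro ⟨h0, h1⟩ i hi
      cases i with
      | zero => simpa [ht', hi] using h0
      | succ i =>
        have := Finset.mem_range.1 (hsN hi)
        simpa [ht', hi] using h1 i (by omega)
  rw [hpre, Measure.prod_prod, coinMeasure, Measure.infinitePi_pi _ (fun i _ => by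
    by_cases h0 : i + 1 ∈ s <;> simp [ht', h0])]
  have hprod : ∏ i ∈ s, (PMF.uniformOfFintype Bool).toMeasure (t i)
      = ∏ i ∈ Finset.range (N + 1), (PMF.uniformOfFintype Bool).toMeasure (t' i) := by
    rw [← Finset.prod_subset hsN]
    · exact Finset.prod_congr rfl fun i hi => by simp [ht', hi]
    · intro i _ hi
      simp only [ht', if_neg hi, measure_univ]
  rw [hprod, Finset.prod_range_succ' _ N, mul_comm]

theorem measurableSet_run {α : Type} (φ : α → Prop) (t : CoinTree α) :
    MeasurableSet {ω : ℕ → Bool | φ (t.run ω).1} := by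
  induction t with
  | leaf a => simp [CoinTree.run]
  | node l r hl hr =>
    have hsh : Measurable (fun ω : ℕ → Bool => fun k => ω (k + 1)) :=
      measurable_pi_lambda _ fun k => measurable_pi_apply (k + 1)
    have h0 : MeasurableSet {ω : ℕ → Bool | ω 0 = true} :=
      (measurable_pi_apply (X := fun _ : ℕ => Bool) 0) (MeasurableSet.singleton true)
    have : {ω : ℕ → Bool | φ ((CoinTree.node l r).run ω).1} =
        ({ω | ω 0 = true} ∩ (fun ω : ℕ → Bool => fun k => ω (k + 1)) ⁻¹' {ω | φ (l.run ω).1}) ∪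
        ({ω | ω 0 = true}ᶜ ∩ (fun ω : ℕ → Bool => fun k => ω (k + 1)) ⁻¹' {ω | φ (r.run ω).1}) := by
      ext ω
      by_cases h : ω 0 = true <;> simp [CoinTree.run, h]
    rw [this]
    exact (h0.inter (hsh hl)).union (h0.compl.inter (hsh hr))

open Classical in
/-- The probability that a coin tree reaches a leaf with the property `φ`. -/
theorem coinMeasure_run {α : Type} (φ : α → Prop) (t : CoinTree α) :
    coinMeasure.real {ω | φ (t.run ω).1} = t.mean fun a => if φ a then 1 else 0 := by
  induction t with
  | leaf a =>
    by_cases h : φ a <;> simp [CoinTree.run, CoinTree.mean, h]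
  | node l r hl hr =>
    have hmeas : Measurable (fun q : Bool × (ℕ → Bool) =>
        (fun k => Nat.casesOn k q.1 q.2 : ℕ → Bool)) := by
      refine measurable_pi_lambda _ fun k => ?_
      cases k with
      | zero => exact measurable_fst
      | succ k => exact (measurable_pi_apply k).comp measurable_snd
    have hpre : (fun q : Bool × (ℕ → Bool) => (fun k => Nat.casesOn k q.1 q.2 : ℕ → Bool)) ⁻¹'
        {ω | φ ((CoinTree.node l r).run ω).1} =
        ({true} ×ˢ {ω | φ (l.run ω).1}) ∪ ({false} ×ˢ {ω | φ (r.run ω).1}) := by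
      ext ⟨b, ω⟩
      cases b <;> simp [CoinTree.run]
    have hb : ∀ b : Bool, (PMF.uniformOfFintype Bool).toMeasure.real {b} = 1 / 2 := fun b => by
      simp [Measure.real]
    rw [← coinMeasure_cons, map_measureReal_apply hmeas (measurableSet_run φ _), hpre,
      measureReal_union (by
        rw [Set.disjoint_left]
        rintro ⟨b, ω⟩ h1 h2
        simp at h1 h2
        simp_all) ((MeasurableSet.singleton _).prod (measurableSet_run φ r)),
      measureReal_prod_prod, measureReal_prod_prod, hb, hb, hl, hr, CoinTree.mean]
    ring

/-! ### Memory states and frames -/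

/-- The registers and arrays of a RAM, without the coin tosses. -/
structure St where
  reg : ℕ → ℕ
  arr : ℕ → List ℕ

namespace St

/-- The memory state together with a sequence of coin tosses. -/
def wc (σ : St) (ω : ℕ → Bool) : RamState := ⟨σ.reg, σ.arr, ω⟩

/-- The entry of array `a` at position `i`, or `0` outside the bounds. -/
def rd (σ : St) (a i : ℕ) : ℕ := (σ.arr a).getD i 0

/-- The length of array `a`. -/
def ln (σ : St) (a : ℕ) : ℕ := (σ.arr a).length

/-- Store `v` in register `x`. -/
def setR (σ : St) (x v : ℕ) : St := ⟨Function.update σ.reg x v, σ.arr⟩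

/-- Store `v` in array `a` at position `i`; nothing happens outside the bounds. -/
def wr (σ : St) (a i v : ℕ) : St := ⟨σ.reg, Function.update σ.arr a ((σ.arr a).set i v)⟩

/-- Let array `a` consist of `n` zeros. -/
def al (σ : St) (a n : ℕ) : St := ⟨σ.reg, Function.update σ.arr a (List.replicate n 0)⟩

variable (σ : St) (x y v a b i j n : ℕ)

@[simp] theorem reg_setR : (σ.setR x v).reg y = if y = x then v else σ.reg y := by
  simp [setR, Function.update_apply]
@[simp] theorem rd_setR : (σ.setR x v).rd a i = σ.rd a i := rfl
@[simp] theorem ln_setR : (σ.setR x v).ln a = σ.ln a := rfl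
@[simp] theorem arr_setR : (σ.setR x v).arr a = σ.arr a := rfl
@[simp] theorem reg_wr : (σ.wr a i v).reg x = σ.reg x := rfl
@[simp] theorem reg_al : (σ.al a n).reg x = σ.reg x := rfl
@[simp] theorem ln_wr : (σ.wr a i v).ln b = σ.ln b := by
  unfold ln wr; by_cases h : b = a <;> simp [h]
@[simp] theorem ln_al : (σ.al a n).ln b = if b = a then n else σ.ln b := by
  unfold ln al; by_cases h : b = a <;> simp [h]
@[simp] theorem rd_wr : (σ.wr a i v).rd b j
    = if b = a ∧ j = i ∧ i < σ.ln a then v else σ.rd b j := by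
  unfold rd wr ln
  by_cases h : b = a
  · subst h
    by_cases hj : j = i
    · subst hj
      by_cases hl : j < (σ.arr b).length <;>
        simp [hl, List.getD_eq_getElem?_getD]
    · have : i ≠ j := fun h => hj h.symm
      simp [hj, List.getD_eq_getElem?_getD, this]
  · simp [h]
@[simp] theorem rd_al : (σ.al a n).rd b j = if b = a then 0 else σ.rd b j := by
  unfold rd al
  by_cases h : b = a
  · subst h
    by_cases hj : j < n <;>
      simp [List.getD_eq_getElem?_getD, hj]
  · simp [h]

theorem rd_eq_zero {σ : St} {a i : ℕ} (h : σ.ln a ≤ i) : σ.rd a i = 0 := by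
  unfold rd ln at *
  simp [List.getD_eq_getElem?_getD, h]

theorem arr_eq_ofFn {σ : St} {a n : ℕ} {f : Fin n → ℕ} (h : σ.ln a = n)
    (h' : ∀ i : Fin n, σ.rd a i = f i) : σ.arr a = List.ofFn f := by
  refine List.ext_getElem (by simpa [ln] using h) fun i h1 h2 => ?_
  have := h' ⟨i, by simpa using h2⟩
  simp only [rd, List.getD_eq_getElem?_getD, List.getElem?_eq_getElem h1, Option.getD_some] at this
  simpa using this

end St

/-- The memory part of a state. -/
def RamState.st (s : RamState) : St := ⟨s.reg, s.arr⟩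

@[simp] theorem RamState.st_wc (s : RamState) : s.st.wc s.coins = s := rfl
@[simp] theorem St.wc_st (σ : St) (ω : ℕ → Bool) : (σ.wc ω).st = σ := rfl

/-- `c` may change register `x`. -/
def modR : RamProg → ℕ → Bool
  | .skip, _ => false
  | .assign y _, x => y == x
  | .write _ _ _, _ => false
  | .alloc _ _, _ => false
  | .flip y, x => y == x
  | .seq c d, x => modR c x || modR d x
  | .ite _ c d, x => modR c x || modR d x
  | .loop _ c, x => modR c x

/-- `c` may change array `a`. -/
def modA : RamProg → ℕ → Bool
  | .skip, _ => false
  | .assign _ _, _ => false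
  | .write b _ _, a => b == a
  | .alloc b _, a => b == a
  | .flip _, _ => false
  | .seq c d, a => modA c a || modA d a
  | .ite _ c d, a => modA c a || modA d a
  | .loop _ c, a => modA c a

theorem RamExec.frame {w : ℕ} {c : RamProg} {s s' : RamState} {t : ℕ} (h : RamExec w c s s' t) :
    (∀ x, modR c x = false → s'.reg x = s.reg x) ∧
    (∀ a, modA c a = false → s'.arr a = s.arr a) := by
  induction h with
  | skip s => simp
  | assign x e s =>
    refine ⟨fun y hy => ?_, fun a _ => rfl⟩
    have : y ≠ x := fun h => by simp [modR, h] at hy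
    simp [this]
  | write a i e s =>
    refine ⟨fun y hy => rfl, fun b hb => ?_⟩
    have : b ≠ a := fun h => by simp [modA, h] at hb
    simp [this]
  | alloc a e s =>
    refine ⟨fun y hy => rfl, fun b hb => ?_⟩
    have : b ≠ a := fun h => by simp [modA, h] at hb
    simp [this]
  | flip x s =>
    refine ⟨fun y hy => ?_, fun a _ => rfl⟩
    have : y ≠ x := fun h => by simp [modR, h] at hy
    simp [this]
  | seq _ _ h1 h2 =>
    simp only [modR, modA, Bool.or_eq_false_iff]
    exact ⟨fun x hx => (h2.1 x hx.2).trans (h1.1 x hx.1),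
      fun x hx => (h2.2 x hx.2).trans (h1.2 x hx.1)⟩
  | ite_true _ _ h1 =>
    simp only [modR, modA, Bool.or_eq_false_iff]
    exact ⟨fun x hx => h1.1 x hx.1, fun x hx => h1.2 x hx.1⟩
  | ite_false _ _ h1 =>
    simp only [modR, modA, Bool.or_eq_false_iff]
    exact ⟨fun x hx => h1.1 x hx.2, fun x hx => h1.2 x hx.2⟩
  | loop_done _ => exact ⟨fun _ _ => rfl, fun _ _ => rfl⟩
  | loop_step _ _ _ h1 h2 =>
    exact ⟨fun x hx => (h2.1 x hx).trans (h1.1 x hx), fun x hx => (h2.2 x hx).trans (h1.2 x hx)⟩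

/-- `σ'` agrees with `σ` outside the registers and arrays that `c` may change. -/
structure SameOn (c : RamProg) (σ σ' : St) : Prop where
  reg : ∀ x, modR c x = false → σ'.reg x = σ.reg x
  arr : ∀ a, modA c a = false → σ'.arr a = σ.arr a

theorem SameOn.rd {c : RamProg} {σ σ' : St} (h : SameOn c σ σ') {a : ℕ} (ha : modA c a = false)
    (i : ℕ) : σ'.rd a i = σ.rd a i := by unfold St.rd; rw [h.arr a ha]

theorem SameOn.ln {c : RamProg} {σ σ' : St} (h : SameOn c σ σ') {a : ℕ} (ha : modA c a = false) :
    σ'.ln a = σ.ln a := by unfold St.ln; rw [h.arr a ha]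

/-! ### Judgements -/

instance : Nonempty St := ⟨⟨fun _ => 0, fun _ => []⟩⟩

instance : Nonempty (CoinTree St) := ⟨.leaf (Classical.arbitrary St)⟩

/-- The program `c`, started in the memory `σ`, tosses no coins, halts after at most `t` steps, and
the final memory satisfies `Q`. -/
def Det (w : ℕ) (c : RamProg) (σ : St) (t : ℕ) (Q : St → Prop) : Prop :=
  ∃ σ', Q σ' ∧ ∀ ω, ∃ τ ≤ t, RamExec w c (σ.wc ω) (σ'.wc ω) τ

/-- The program `c`, started in the memory `σ`, halts after at most `t` steps and with a final
memory that satisfies `Q` whatever the coins are, and the expectation of `f` at the final memory is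
at most `v`.  The coin tosses that `c` consumes form a finite decision tree. -/
def RT (w : ℕ) (c : RamProg) (σ : St) (t : ℕ) (Q : St → Prop) (f : St → ℝ) (v : ℝ) : Prop :=
  ∃ tr : CoinTree St, tr.All Q ∧ tr.mean f ≤ v ∧
    ∀ ω, ∃ τ ≤ t, RamExec w c (σ.wc ω) ((tr.run ω).1.wc (tr.run ω).2) τ

section Rules
variable {w : ℕ} {c d : RamProg} {σ : St} {t t₁ t₂ : ℕ} {Q R : St → Prop} {f g : St → ℝ} {v : ℝ}

theorem Det.frame (h : Det w c σ t Q) : Det w c σ t fun σ' => SameOn c σ σ' ∧ Q σ' := by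
  obtain ⟨σ', hq, he⟩ := h
  obtain ⟨τ, -, h⟩ := he fun _ => true
  exact ⟨σ', ⟨⟨h.frame.1, h.frame.2⟩, hq⟩, he⟩

theorem Det.mono (h : Det w c σ t₁ Q) (ht : t₁ ≤ t₂) (hq : ∀ σ', SameOn c σ σ' → Q σ' → R σ') :
    Det w c σ t₂ R := by
  obtain ⟨σ', hq', he⟩ := h.frame
  exact ⟨σ', hq _ hq'.1 hq'.2, fun ω => let ⟨τ, h1, h2⟩ := he ω; ⟨τ, h1.trans ht, h2⟩⟩

theorem Det.seq (h : Det w c σ t₁ R) (h' : ∀ σ', SameOn c σ σ' → R σ' → Det w d σ' t₂ Q) :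
    Det w (.seq c d) σ (t₁ + t₂) Q := by
  obtain ⟨σ₁, hq, he⟩ := h.frame
  obtain ⟨σ₂, hq', he'⟩ := h' σ₁ hq.1 hq.2
  refine ⟨σ₂, hq', fun ω => ?_⟩
  obtain ⟨τ, h1, h2⟩ := he ω
  obtain ⟨τ', h3, h4⟩ := he' ω
  exact ⟨τ + τ', by omega, .seq h2 h4⟩

theorem Det.rt (h : Det w c σ t Q) (hf : ∀ σ', SameOn c σ σ' → Q σ' → f σ' ≤ v) :
    RT w c σ t Q f v := by
  obtain ⟨σ', hq, he⟩ := h.frame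
  exact ⟨.leaf σ', hq.2, hf _ hq.1 hq.2, he⟩

theorem RT.frame (h : RT w c σ t Q f v) : RT w c σ t (fun σ' => SameOn c σ σ' ∧ Q σ') f v := by
  obtain ⟨tr, hq, hf, he⟩ := h
  refine ⟨tr, CoinTree.all_of_run fun ω => ?_, hf, he⟩
  obtain ⟨τ, -, h⟩ := he ω
  exact ⟨⟨h.frame.1, h.frame.2⟩, hq.run ω⟩

theorem RT.mono {v' : ℝ} (h : RT w c σ t₁ Q f v) (ht : t₁ ≤ t₂)
    (hq : ∀ σ', SameOn c σ σ' → Q σ' → R σ')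
    (hf : ∀ σ', SameOn c σ σ' → Q σ' → g σ' ≤ f σ') (hv : v ≤ v') : RT w c σ t₂ R g v' := by
  obtain ⟨tr, hq', hf', he⟩ := h.frame
  refine ⟨tr, CoinTree.all_of_run fun ω => ?_, ?_, fun ω => ?_⟩
  · exact hq _ (hq'.run ω).1 (hq'.run ω).2
  · exact (CoinTree.mean_mono hq' fun a ha => hf a ha.1 ha.2).trans (hf'.trans hv)
  · obtain ⟨τ, h1, h2⟩ := he ω
    exact ⟨τ, h1.trans ht, h2⟩

/-- The bound `f` for the expectation after `c` serves as the bound for `d` at each memory that `c`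
can reach: the law of total expectation. -/
theorem RT.seq (h : RT w c σ t₁ R f v)
    (h' : ∀ σ', SameOn c σ σ' → R σ' → RT w d σ' t₂ Q g (f σ')) :
    RT w (.seq c d) σ (t₁ + t₂) Q g v := by
  classical
  obtain ⟨tr, hq, hf, he⟩ := h.frame
  choose! k hk using fun σ' (h : SameOn c σ σ' ∧ R σ') => h' σ' h.1 h.2
  refine ⟨tr.bind k, hq.bind fun a ha => (hk a ha).1, ?_, fun ω => ?_⟩
  · exact (CoinTree.mean_bind_le hq fun a ha => (hk a ha).2.1).trans hf
  · obtain ⟨τ, h1, h2⟩ := he ω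
    obtain ⟨τ', h3, h4⟩ := (hk _ (hq.run ω)).2.2 (tr.run ω).2
    rw [CoinTree.run_bind]
    exact ⟨τ + τ', by omega, .seq h2 h4⟩

theorem RT.affine (a b : ℝ) (ha : 0 ≤ a) (h : RT w c σ t Q f v) :
    RT w c σ t Q (fun σ' => a * f σ' + b) (a * v + b) := by
  obtain ⟨tr, hq, hf, he⟩ := h
  refine ⟨tr, hq, ?_, he⟩
  rw [CoinTree.mean_affine]
  nlinarith

end Rules

/-! ### Expressions without overflow -/

/-- The value of an expression, computed in `ℕ`. -/
def RamExpr.val (σ : St) : RamExpr → ℕ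
  | .const k => k
  | .var x => σ.reg x
  | .read a i => σ.rd a (i.val σ)
  | .len a => σ.ln a
  | .bin o e f => o.apply (e.val σ) (f.val σ)

/-- No intermediate result of the expression overflows. -/
def RamExpr.ok (w : ℕ) (σ : St) : RamExpr → Prop
  | .const k => k < 2 ^ w
  | .var _ => True
  | .read _ i => i.ok w σ
  | .len a => σ.ln a < 2 ^ w
  | .bin .eq e f => e.ok w σ ∧ f.ok w σ
  | .bin .lt e f => e.ok w σ ∧ f.ok w σ
  | .bin o e f => e.ok w σ ∧ f.ok w σ ∧ o.apply (e.val σ) (f.val σ) < 2 ^ w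

theorem RamExpr.eval_eq_val {w : ℕ} (hw : 1 ≤ w) {σ : St} (ω : ℕ → Bool) (e : RamExpr)
    (h : e.ok w σ) : e.eval w (σ.wc ω) = e.val σ := by
  have h1 : 1 < 2 ^ w := Nat.one_lt_two_pow (by omega)
  induction e with
  | const k => exact Nat.mod_eq_of_lt h
  | var x => rfl
  | read a i ih => simp only [eval, val, ih h]; rfl
  | len a => exact Nat.mod_eq_of_lt h
  | bin o e f he hf =>
    cases o
    case eq =>
      obtain ⟨h2, h3⟩ := h
      simp only [eval, val, he h2, hf h3, BinOp.apply]
      split <;> exact Nat.mod_eq_of_lt (by omega)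
    case lt =>
      obtain ⟨h2, h3⟩ := h
      simp only [eval, val, he h2, hf h3, BinOp.apply]
      split <;> exact Nat.mod_eq_of_lt (by omega)
    all_goals
      obtain ⟨h2, h3, h4⟩ := h
      simp only [eval, val, he h2, hf h3]
      exact Nat.mod_eq_of_lt h4

/-! ### Straight-line programs -/

/-- A bound on the running time of a program without loops and allocations. -/
def RamProg.scost : RamProg → ℕ
  | .skip => 1
  | .assign _ e => e.cost + 1
  | .write _ i e => i.cost + e.cost + 1
  | .alloc _ _ => 0
  | .flip _ => 1
  | .seq c d => c.scost + d.scost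
  | .ite e c d => e.cost + c.scost + d.scost + 1
  | .loop _ _ => 0

/-- The weakest precondition of a program without loops, allocations and coin tosses. -/
def WP (w : ℕ) : RamProg → (St → Prop) → St → Prop
  | .skip, Q, σ => Q σ
  | .assign x e, Q, σ => e.ok w σ ∧ Q (σ.setR x (e.val σ))
  | .write a i e, Q, σ => i.ok w σ ∧ e.ok w σ ∧ Q (σ.wr a (i.val σ) (e.val σ))
  | .seq c d, Q, σ => WP w c (WP w d Q) σ
  | .ite e c d, Q, σ => e.ok w σ ∧ (e.val σ ≠ 0 → WP w c Q σ) ∧ (e.val σ = 0 → WP w d Q σ)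
  | _, _, _ => False

theorem Det.straight {w : ℕ} (hw : 1 ≤ w) {c : RamProg} {σ : St} {Q : St → Prop}
    (h : WP w c Q σ) : Det w c σ c.scost Q := by
  induction c generalizing σ Q with
  | skip => exact ⟨σ, h, fun ω => ⟨1, le_rfl, .skip _⟩⟩
  | assign x e =>
    refine ⟨_, h.2, fun ω => ⟨e.cost + 1, le_rfl, ?_⟩⟩
    have := RamExec.assign (w := w) x e (σ.wc ω)
    rw [RamExpr.eval_eq_val hw ω e h.1] at this
    exact this
  | write a i e =>
    refine ⟨_, h.2.2, fun ω => ⟨_, le_rfl, ?_⟩⟩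
    have := RamExec.write (w := w) a i e (σ.wc ω)
    rw [RamExpr.eval_eq_val hw ω e h.2.1, RamExpr.eval_eq_val hw ω i h.1] at this
    exact this
  | alloc a e => exact h.elim
  | flip x => exact h.elim
  | seq c d hc hd =>
    exact (hc h).seq fun σ' _ h' => hd h'
  | ite e c d hc hd =>
    by_cases he : e.val σ = 0
    · obtain ⟨σ', hq, hx⟩ := hd (h.2.2 he)
      refine ⟨σ', hq, fun ω => ?_⟩
      obtain ⟨τ, h1, h2⟩ := hx ω
      refine ⟨e.cost + τ + 1, by simp only [RamProg.scost]; omega, .ite_false ?_ h2⟩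
      rw [RamExpr.eval_eq_val hw ω e h.1, he]
    · obtain ⟨σ', hq, hx⟩ := hc (h.2.1 he)
      refine ⟨σ', hq, fun ω => ?_⟩
      obtain ⟨τ, h1, h2⟩ := hx ω
      refine ⟨e.cost + τ + 1, by simp only [RamProg.scost]; omega, .ite_true ?_ h2⟩
      rw [RamExpr.eval_eq_val hw ω e h.1]
      exact he
  | loop e c => exact h.elim

theorem Det.straight_le {w : ℕ} (hw : 1 ≤ w) {c : RamProg} {σ : St} {Q : St → Prop} {t : ℕ}
    (ht : Nat.ble c.scost t = true) (h : WP w c Q σ) : Det w c σ t Q :=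
  (Det.straight hw h).mono (Nat.le_of_ble_eq_true ht) fun _ _ h => h

theorem Det.alloc {w : ℕ} (hw : 1 ≤ w) {a : ℕ} {e : RamExpr} {σ : St} {Q : St → Prop}
    (he : e.ok w σ) (h : Q (σ.al a (e.val σ))) :
    Det w (.alloc a e) σ (e.cost + e.val σ + 1) Q := by
  refine ⟨_, h, fun ω => ⟨e.cost + e.val σ + 1, le_rfl, ?_⟩⟩
  have := RamExec.alloc (w := w) a e (σ.wc ω)
  rw [RamExpr.eval_eq_val hw ω e he] at this
  exact this

attribute [simp] WP RamExpr.ok RamExpr.val BinOp.apply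

/-- Like `Det`, but the postcondition may also refer to the time bound. -/
def Run (w : ℕ) (c : RamProg) (σ : St) (Q : St → ℕ → Prop) : Prop :=
  ∃ t, Det w c σ t fun σ' => Q σ' t

section Run
variable {w : ℕ} {c d : RamProg} {σ : St} {t : ℕ} {R : St → Prop} {Q : St → ℕ → Prop}

theorem Run.det {R : St → Prop} (h : Run w c σ fun σ' τ => τ ≤ t ∧ R σ') : Det w c σ t R := by
  obtain ⟨τ, σ', hq, he⟩ := h
  exact ⟨σ', hq.2, fun ω => let ⟨τ', h1, h2⟩ := he ω; ⟨τ', h1.trans hq.1, h2⟩⟩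

theorem Run.last (h : Det w c σ t R) (hq : ∀ σ', SameOn c σ σ' → R σ' → Q σ' t) :
    Run w c σ Q := ⟨t, h.mono le_rfl hq⟩

theorem Run.seq (h : Det w c σ t R)
    (h' : ∀ σ', SameOn c σ σ' → R σ' → Run w d σ' fun σ'' τ => Q σ'' (t + τ)) :
    Run w (.seq c d) σ Q := by
  obtain ⟨σ₁, hq, he⟩ := h.frame
  obtain ⟨τ, σ₂, h2, he2⟩ := h' σ₁ hq.1 hq.2
  refine ⟨t + τ, σ₂, h2, fun ω => ?_⟩
  obtain ⟨τ₁, h3, h4⟩ := he ω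
  obtain ⟨τ₂, h5, h6⟩ := he2 ω
  exact ⟨τ₁ + τ₂, by omega, .seq h4 h6⟩

theorem Run.assign (hw : 1 ≤ w) {x : ℕ} {e : RamExpr} (he : e.ok w σ)
    (h : Run w d (σ.setR x (e.val σ)) fun σ' τ => Q σ' (e.cost + 1 + τ)) :
    Run w (.seq (.assign x e) d) σ Q :=
  Run.seq (Det.straight (c := .assign x e) (Q := fun σ' => σ' = σ.setR x (e.val σ)) hw
    ⟨he, rfl⟩) fun σ' _ h' => by rw [h']; exact h

theorem Run.write (hw : 1 ≤ w) {a : ℕ} {i e : RamExpr} (hi : i.ok w σ) (he : e.ok w σ)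
    (h : Run w d (σ.wr a (i.val σ) (e.val σ)) fun σ' τ => Q σ' (i.cost + e.cost + 1 + τ)) :
    Run w (.seq (.write a i e) d) σ Q :=
  Run.seq (Det.straight (c := .write a i e) (Q := fun σ' => σ' = σ.wr a (i.val σ) (e.val σ)) hw
    ⟨hi, he, rfl⟩) fun σ' _ h' => by rw [h']; exact h

theorem Run.alloc (hw : 1 ≤ w) {a : ℕ} {e : RamExpr} (he : e.ok w σ)
    (h : Run w d (σ.al a (e.val σ)) fun σ' τ => Q σ' (e.cost + e.val σ + 1 + τ)) :
    Run w (.seq (.alloc a e) d) σ Q :=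
  Run.seq (Det.alloc (Q := fun σ' => σ' = σ.al a (e.val σ)) hw he rfl) fun σ' _ h' => by
    rw [h']; exact h

theorem Run.straight (hw : 1 ≤ w) (h : WP w c (fun σ' => Q σ' c.scost) σ) : Run w c σ Q :=
  ⟨_, Det.straight hw h⟩

end Run

section Branch
variable {w : ℕ} {c d : RamProg} {σ : St} {t t₁ t₂ : ℕ} {Q : St → Prop} {f : St → ℝ} {v : ℝ}

theorem Det.ite (hw : 1 ≤ w) {e : RamExpr} (he : e.ok w σ) (h1 : e.val σ ≠ 0 → Det w c σ t Q)
    (h2 : e.val σ = 0 → Det w d σ t Q) : Det w (.ite e c d) σ (e.cost + t + 1) Q := by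
  by_cases h0 : e.val σ = 0
  · obtain ⟨σ', hq, hx⟩ := h2 h0
    refine ⟨σ', hq, fun ω => ?_⟩
    obtain ⟨τ, h1, h2⟩ := hx ω
    refine ⟨e.cost + τ + 1, by omega, .ite_false ?_ h2⟩
    rw [RamExpr.eval_eq_val hw ω e he, h0]
  · obtain ⟨σ', hq, hx⟩ := h1 h0
    refine ⟨σ', hq, fun ω => ?_⟩
    obtain ⟨τ, h1, h2⟩ := hx ω
    refine ⟨e.cost + τ + 1, by omega, .ite_true ?_ h2⟩
    rw [RamExpr.eval_eq_val hw ω e he]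
    exact h0

theorem RT.ite (hw : 1 ≤ w) {e : RamExpr} (he : e.ok w σ) (h1 : e.val σ ≠ 0 → RT w c σ t Q f v)
    (h2 : e.val σ = 0 → RT w d σ t Q f v) : RT w (.ite e c d) σ (e.cost + t + 1) Q f v := by
  by_cases h0 : e.val σ = 0
  · obtain ⟨tr, hq, hf, hx⟩ := h2 h0
    refine ⟨tr, hq, hf, fun ω => ?_⟩
    obtain ⟨τ, h1, h2⟩ := hx ω
    refine ⟨e.cost + τ + 1, by omega, .ite_false ?_ h2⟩
    rw [RamExpr.eval_eq_val hw ω e he, h0]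
  · obtain ⟨tr, hq, hf, hx⟩ := h1 h0
    refine ⟨tr, hq, hf, fun ω => ?_⟩
    obtain ⟨τ, h1, h2⟩ := hx ω
    refine ⟨e.cost + τ + 1, by omega, .ite_true ?_ h2⟩
    rw [RamExpr.eval_eq_val hw ω e he]
    exact h0

theorem RT.flip (hw : 1 ≤ w) {x : ℕ} (h1 : Q (σ.setR x 1)) (h0 : Q (σ.setR x 0))
    (hv : (f (σ.setR x 1) + f (σ.setR x 0)) / 2 ≤ v) : RT w (.flip x) σ 1 Q f v := by
  refine ⟨.node (.leaf (σ.setR x 1)) (.leaf (σ.setR x 0)), ⟨h1, h0⟩, hv, fun ω => ⟨1, le_rfl, ?_⟩⟩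
  have := RamExec.flip (w := w) x (σ.wc ω)
  have h2 : 1 % 2 ^ w = 1 := Nat.mod_eq_of_lt (Nat.one_lt_two_pow (by omega))
  rw [h2] at this
  simp only [CoinTree.run]
  by_cases h : ω 0 = true
  · simp only [St.wc, h, if_true] at this ⊢
    exact this
  · simp only [Bool.not_eq_true] at h
    simp only [St.wc, h] at this ⊢
    exact this

end Branch

/-! ### Loops -/

/-- A loop whose condition is true exactly as long as the counter `k` of the invariant is
positive. -/
theorem Det.while {w : ℕ} (hw : 1 ≤ w) {e : RamExpr} {c : RamProg} {tb : ℕ} (I : ℕ → St → Prop)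
    {Q : St → Prop} (hok : ∀ k σ, I k σ → e.ok w σ)
    (h0 : ∀ σ, I 0 σ → e.val σ = 0 ∧ Q σ)
    (hs : ∀ k σ, I (k + 1) σ → e.val σ ≠ 0 ∧ Det w c σ tb (I k)) (k : ℕ) (σ : St) (h : I k σ) :
    Det w (.loop e c) σ (k * (tb + e.cost + 1) + (e.cost + 1)) Q := by
  induction k generalizing σ with
  | zero =>
    refine ⟨σ, (h0 σ h).2, fun ω => ⟨e.cost + 1, by omega, .loop_done ?_⟩⟩
    rw [RamExpr.eval_eq_val hw ω e (hok _ _ h), (h0 σ h).1]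
  | succ k ih =>
    obtain ⟨h1, σ₁, h2, h3⟩ := hs k σ h
    obtain ⟨σ₂, h4, h5⟩ := ih σ₁ h2
    refine ⟨σ₂, h4, fun ω => ?_⟩
    obtain ⟨τ, h6, h7⟩ := h3 ω
    obtain ⟨τ', h8, h9⟩ := h5 ω
    refine ⟨e.cost + τ + τ' + 1, ?_, .loop_step ?_ h7 h9⟩
    · rw [add_mul, one_mul]; omega
    · rw [RamExpr.eval_eq_val hw ω e (hok _ _ h)]; exact h1

/-- The randomized version of `Det.while`, with a potential `f` whose expectation does not
increase. -/
theorem RT.while {w : ℕ} (hw : 1 ≤ w) {e : RamExpr} {c : RamProg} {tb : ℕ} (I : ℕ → St → Prop)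
    (f : ℕ → St → ℝ) (hok : ∀ k σ, I k σ → e.ok w σ)
    (h0 : ∀ σ, I 0 σ → e.val σ = 0)
    (hs : ∀ k σ, I (k + 1) σ → e.val σ ≠ 0 ∧ RT w c σ tb (I k) (f k) (f (k + 1) σ))
    (k : ℕ) (σ : St) (h : I k σ) :
    RT w (.loop e c) σ (k * (tb + e.cost + 1) + (e.cost + 1)) (I 0) (f 0) (f k σ) := by
  induction k generalizing σ with
  | zero =>
    refine ⟨.leaf σ, h, le_rfl, fun ω => ⟨e.cost + 1, by omega, .loop_done ?_⟩⟩
    rw [RamExpr.eval_eq_val hw ω e (hok _ _ h), h0 σ h]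
  | succ k ih =>
    obtain ⟨h1, tr, h2, h2', h3⟩ := hs k σ h
    choose! t ht using ih
    refine ⟨tr.bind t, h2.bind fun a ha => (ht a ha).1, ?_, fun ω => ?_⟩
    · exact (CoinTree.mean_bind_le h2 fun a ha => (ht a ha).2.1).trans h2'
    · obtain ⟨τ, h6, h7⟩ := h3 ω
      obtain ⟨τ', h8, h9⟩ := (ht _ (h2.run ω)).2.2 (tr.run ω).2
      rw [CoinTree.run_bind]
      refine ⟨e.cost + τ + τ' + 1, ?_, .loop_step ?_ h7 h9⟩
      · rw [add_mul, one_mul]; omega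
      · rw [RamExpr.eval_eq_val hw ω e (hok _ _ h)]; exact h1

/-- Run `c` for `i = 0, 1, …` below the value of register `m`. -/
def FOR (i m : ℕ) (c : RamProg) : RamProg :=
  .seq (.assign i (.const 0))
    (.loop (.bin .lt (.var i) (.var m)) (.seq c (.assign i (.bin .add (.var i) (.const 1)))))

theorem RT.for {w : ℕ} (hw : 1 ≤ w) {i m : ℕ} {c : RamProg} {σ : St} {n : ℕ} (tb : ℕ → ℕ)
    (I : ℕ → St → Prop) (f : ℕ → St → ℝ)
    (hn : σ.reg m = n) (hnw : n < 2 ^ w) (him : m ≠ i)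
    (hi : modR c i = false) (hm : modR c m = false) (h0 : I 0 (σ.setR i 0))
    (hs : ∀ k < n, ∀ σ', SameOn (FOR i m c) σ σ' → σ'.reg i = k → I k σ' →
      RT w c σ' (tb k) (fun σ'' => I (k + 1) (σ''.setR i (k + 1)))
        (fun σ'' => f (k + 1) (σ''.setR i (k + 1))) (f k σ')) :
    RT w (FOR i m c) σ (6 + ∑ k ∈ Finset.range n, (tb k + 8))
      (fun σ' => σ'.reg i = n ∧ I n σ') (f n) (f 0 (σ.setR i 0)) := by
  have hw1 : 1 < 2 ^ w := Nat.one_lt_two_pow (by omega)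
  have key : ∀ j k, k + j = n → ∀ σ', SameOn (FOR i m c) σ σ' → σ'.reg i = k → I k σ' →
      RT w (.loop (.bin .lt (.var i) (.var m)) (.seq c (.assign i (.bin .add (.var i) (.const 1)))))
        σ' (4 + ∑ k ∈ Finset.Ico k n, (tb k + 8)) (fun σ' => σ'.reg i = n ∧ I n σ') (f n)
        (f k σ') := by
    have hmi : modR (FOR i m c) m = false := by simpa [FOR, modR, hm] using him.symm
    have hev : ∀ σ' : St, SameOn (FOR i m c) σ σ' → ∀ ω,
        (RamExpr.bin .lt (.var i) (.var m)).eval w (σ'.wc ω) = if σ'.reg i < n then 1 else 0 := by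
      intro σ' hS ω
      rw [RamExpr.eval_eq_val hw _ _ (by simp [RamExpr.ok])]
      simp [RamExpr.val, BinOp.apply, hS.reg m hmi, hn]
    intro j
    induction j with
    | zero =>
      intro k hk σ' hS hr hI
      obtain rfl : k = n := by omega
      refine ⟨.leaf σ', ⟨hr, hI⟩, le_rfl, fun ω => ⟨_, ?_, .loop_done ?_⟩⟩
      · simp [RamExpr.cost]
      · rw [hev σ' hS ω]; simp [hr]
    | succ j ih =>
      intro k hk σ' hS hr hI
      have hb := (hs k (by omega) σ' hS hr hI).frame
      have ha : ∀ σ'', (SameOn c σ' σ'' ∧ I (k + 1) (σ''.setR i (k + 1))) →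
          SameOn (FOR i m c) σ (σ''.setR i (k + 1)) := by
        rintro σ'' ⟨h1, h2⟩
        refine ⟨fun x hx => ?_, fun a hx => ?_⟩
        · have hx' : x ≠ i ∧ modR c x = false := by
            simp [FOR, modR] at hx; exact ⟨fun h => hx.1 h.symm, hx.2.1⟩
          rw [St.reg_setR, if_neg hx'.1, h1.reg x hx'.2, hS.reg x hx]
        · have hx' : modA c a = false := by simpa [FOR, modA] using hx
          rw [St.arr_setR, h1.arr a hx', hS.arr a hx]
      have := fun σ'' h => ih (k + 1) (by omega) _ (ha σ'' h) (by simp) h.2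
      obtain ⟨tr, h2, h2', h3⟩ := hb
      choose! t ht using this
      refine ⟨tr.bind t, h2.bind fun a ha => (ht a ha).1, ?_, fun ω => ?_⟩
      · exact (CoinTree.mean_bind_le h2 fun a ha => (ht a ha).2.1).trans h2'
      · obtain ⟨τ, h6, h7⟩ := h3 ω
        obtain ⟨τ', h8, h9⟩ := (ht _ (h2.run ω)).2.2 (tr.run ω).2
        rw [CoinTree.run_bind]
        have hri : (tr.run ω).1.reg i = k := by rw [(h2.run ω).1.reg i hi, hr]
        have hass := RamExec.assign (w := w) i (.bin .add (.var i) (.const 1))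
          ((tr.run ω).1.wc (tr.run ω).2)
        rw [RamExpr.eval_eq_val hw _ _ (by
          simp only [RamExpr.ok, RamExpr.val, BinOp.apply, hri]
          exact ⟨trivial, hw1, by omega⟩)] at hass
        simp only [RamExpr.val, BinOp.apply, hri] at hass
        refine ⟨_, ?_, .loop_step ?_ (.seq h7 hass) h9⟩
        · rw [Finset.sum_eq_sum_Ico_succ_bot (by omega : k < n)]
          simp only [RamExpr.cost]
          omega
        · rw [hev σ' hS ω]; simp [hr]; omega
  have h2 : SameOn (FOR i m c) σ (σ.setR i 0) := by
    refine ⟨fun x hx => ?_, fun a hx => rfl⟩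
    have hx' : x ≠ i := by simp [FOR, modR] at hx; exact fun h => hx.1 h.symm
    simp [hx']
  have h1 : Det w (.assign i (.const 0)) σ 2 (fun σ' => σ' = σ.setR i 0) :=
    Det.straight hw ⟨by simp [RamExpr.ok], rfl⟩
  have h3 := key n 0 (by omega) _ h2 (by simp) h0
  refine (RT.seq (h1.rt (f := fun σ' => f 0 σ') (fun σ' _ h => by rw [h]))
    (fun σ' _ h => by rw [h]; exact h3)).mono ?_ (fun _ _ h => h) (fun _ _ _ => le_rfl) le_rfl
  rw [Finset.range_eq_Ico]; omega

theorem Det.for {w : ℕ} (hw : 1 ≤ w) {i m : ℕ} {c : RamProg} {σ : St} {n : ℕ} (tb : ℕ → ℕ)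
    (I : ℕ → St → Prop)
    (hn : σ.reg m = n) (hnw : n < 2 ^ w) (him : m ≠ i)
    (hi : modR c i = false) (hm : modR c m = false) (h0 : I 0 (σ.setR i 0))
    (hs : ∀ k < n, ∀ σ', SameOn (FOR i m c) σ σ' → σ'.reg i = k → I k σ' →
      Det w c σ' (tb k) (fun σ'' => I (k + 1) (σ''.setR i (k + 1)))) :
    Det w (FOR i m c) σ (6 + ∑ k ∈ Finset.range n, (tb k + 8))
      (fun σ' => σ'.reg i = n ∧ I n σ') := by
  have hw1 : 1 < 2 ^ w := Nat.one_lt_two_pow (by omega)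
  have hmi : modR (FOR i m c) m = false := by simpa [FOR, modR, hm] using him.symm
  have hev : ∀ σ' : St, SameOn (FOR i m c) σ σ' → ∀ ω,
      (RamExpr.bin .lt (.var i) (.var m)).eval w (σ'.wc ω) = if σ'.reg i < n then 1 else 0 := by
    intro σ' hS ω
    rw [RamExpr.eval_eq_val hw _ _ (by simp [RamExpr.ok])]
    simp [RamExpr.val, BinOp.apply, hS.reg m hmi, hn]
  have key : ∀ j k, k + j = n → ∀ σ', SameOn (FOR i m c) σ σ' → σ'.reg i = k → I k σ' →
      Det w (.loop (.bin .lt (.var i) (.var m)) (.seq c (.assign i (.bin .add (.var i) (.const 1)))))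
        σ' (4 + ∑ k ∈ Finset.Ico k n, (tb k + 8)) (fun σ' => σ'.reg i = n ∧ I n σ') := by
    intro j
    induction j with
    | zero =>
      intro k hk σ' hS hr hI
      obtain rfl : k = n := by omega
      refine ⟨σ', ⟨hr, hI⟩, fun ω => ⟨_, ?_, .loop_done ?_⟩⟩
      · simp [RamExpr.cost]
      · rw [hev σ' hS ω]; simp [hr]
    | succ j ih =>
      intro k hk σ' hS hr hI
      obtain ⟨σ₁, ⟨h1, h2⟩, h3⟩ := (hs k (by omega) σ' hS hr hI).frame
      have ha : SameOn (FOR i m c) σ (σ₁.setR i (k + 1)) := by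
        refine ⟨fun x hx => ?_, fun a hx => ?_⟩
        · have hx' : x ≠ i ∧ modR c x = false := by
            simp [FOR, modR] at hx; exact ⟨fun h => hx.1 h.symm, hx.2.1⟩
          rw [St.reg_setR, if_neg hx'.1, h1.reg x hx'.2, hS.reg x hx]
        · have hx' : modA c a = false := by simpa [FOR, modA] using hx
          rw [St.arr_setR, h1.arr a hx', hS.arr a hx]
      obtain ⟨σ₂, h4, h5⟩ := ih (k + 1) (by omega) _ ha (by simp) h2
      refine ⟨σ₂, h4, fun ω => ?_⟩
      obtain ⟨τ, h6, h7⟩ := h3 ω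
      obtain ⟨τ', h8, h9⟩ := h5 ω
      have hri : σ₁.reg i = k := by rw [h1.reg i hi, hr]
      have hass := RamExec.assign (w := w) i (.bin .add (.var i) (.const 1)) (σ₁.wc ω)
      rw [RamExpr.eval_eq_val hw _ _ (by
        simp only [RamExpr.ok, RamExpr.val, BinOp.apply, hri]
        exact ⟨trivial, hw1, by omega⟩)] at hass
      simp only [RamExpr.val, BinOp.apply, hri] at hass
      refine ⟨_, ?_, .loop_step ?_ (.seq h7 hass) h9⟩
      · rw [Finset.sum_eq_sum_Ico_succ_bot (by omega : k < n)]
        simp only [RamExpr.cost]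
        omega
      · rw [hev σ' hS ω]; simp [hr]; omega
  have h2 : SameOn (FOR i m c) σ (σ.setR i 0) := by
    refine ⟨fun x hx => ?_, fun a hx => rfl⟩
    have hx' : x ≠ i := by simp [FOR, modR] at hx; exact fun h => hx.1 h.symm
    simp [hx']
  have h1 : Det w (.assign i (.const 0)) σ 2 (fun σ' => σ' = σ.setR i 0) :=
    Det.straight hw ⟨by simp [RamExpr.ok], rfl⟩
  refine (h1.seq (t₂ := 4 + ∑ k ∈ Finset.Ico 0 n, (tb k + 8)) fun σ' _ h => ?_).mono ?_
    (fun _ _ h => h)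
  · rw [h]; exact key n 0 (by omega) _ h2 (by simp) h0
  · rw [Finset.range_eq_Ico]; omega

/-! ### Decision trees of programs that always halt -/

theorem RamExpr.eval_coins (w : ℕ) (r : ℕ → ℕ) (a : ℕ → List ℕ) (ω ω' : ℕ → Bool) (e : RamExpr) :
    e.eval w ⟨r, a, ω⟩ = e.eval w ⟨r, a, ω'⟩ := by
  induction e with
  | const k => rfl
  | var x => rfl
  | read b i ih => simp only [eval, ih]
  | len b => rfl
  | bin o e f he hf => simp only [eval, he, hf]

/-- The value of an expression, which does not depend on the coins. -/
def RamExpr.evalSt (w : ℕ) (σ : St) (e : RamExpr) : ℕ := e.eval w (σ.wc fun _ => false)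

theorem RamExpr.eval_eq_evalSt (w : ℕ) (s : RamState) (e : RamExpr) :
    e.eval w s = e.evalSt w s.st := e.eval_coins w s.reg s.arr s.coins _

/-- The decision tree of a program that is stopped after `fuel` rounds of its loops; the value
`none` means that it was stopped. -/
def evalTree (w : ℕ) (fuel : ℕ) (c : RamProg) (σ : St) : CoinTree (Option St) :=
  match fuel, c with
  | _, .skip => .leaf (some σ)
  | _, .assign x e => .leaf (some (σ.setR x (e.evalSt w σ)))
  | _, .write a i e => .leaf (some (σ.wr a (i.evalSt w σ) (e.evalSt w σ)))
  | _, .alloc a e => .leaf (some (σ.al a (e.evalSt w σ)))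
  | _, .flip x => .node (.leaf (some (σ.setR x (1 % 2 ^ w)))) (.leaf (some (σ.setR x 0)))
  | n, .seq c d => (evalTree w n c σ).bind fun o => o.elim (.leaf none) (evalTree w n d)
  | n, .ite e c d => if e.evalSt w σ = 0 then evalTree w n d σ else evalTree w n c σ
  | 0, .loop _ _ => .leaf none
  | n + 1, .loop e c =>
    if e.evalSt w σ = 0 then .leaf (some σ)
    else (evalTree w n c σ).bind fun o => o.elim (.leaf none) (evalTree w n (.loop e c))
termination_by (fuel, sizeOf c)

theorem RamExec.evalTree {w : ℕ} {c : RamProg} {s s' : RamState} {t : ℕ}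
    (h : RamExec w c s s' t) :
    ∀ fuel, t ≤ fuel → (evalTree w fuel c s.st).run s.coins = (some s'.st, s'.coins) := by
  induction h with
  | skip s => intro fuel _; rw [_root_.evalTree]; rfl
  | assign x e s => intro fuel _; rw [_root_.evalTree, ← RamExpr.eval_eq_evalSt]; rfl
  | write a i e s =>
    intro fuel _; rw [_root_.evalTree, ← RamExpr.eval_eq_evalSt, ← RamExpr.eval_eq_evalSt]; rfl
  | alloc a e s => intro fuel _; rw [_root_.evalTree, ← RamExpr.eval_eq_evalSt]; rfl
  | flip x s =>
    intro fuel _; rw [_root_.evalTree]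
    by_cases h : s.coins 0 = true <;> simp [CoinTree.run, h, St.setR, RamState.st]
  | seq _ _ h1 h2 =>
    intro fuel hf
    rw [_root_.evalTree, CoinTree.run_bind, h1 fuel (by omega)]
    exact h2 fuel (by omega)
  | ite_true he _ h1 =>
    intro fuel hf
    rw [RamExpr.eval_eq_evalSt] at he
    rw [_root_.evalTree, if_neg he]
    exact h1 fuel (by omega)
  | ite_false he _ h1 =>
    intro fuel hf
    rw [RamExpr.eval_eq_evalSt] at he
    rw [_root_.evalTree, if_pos he]
    exact h1 fuel (by omega)
  | loop_done he =>
    intro fuel hf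
    rw [RamExpr.eval_eq_evalSt] at he
    obtain ⟨n, rfl⟩ : ∃ n, fuel = n + 1 := ⟨fuel - 1, by omega⟩
    rw [_root_.evalTree, if_pos he]
    rfl
  | loop_step he _ _ h1 h2 =>
    intro fuel hf
    rw [RamExpr.eval_eq_evalSt] at he
    obtain ⟨n, rfl⟩ : ∃ n, fuel = n + 1 := ⟨fuel - 1, by omega⟩
    rw [_root_.evalTree, if_neg he, CoinTree.run_bind, h1 n (by omega)]
    exact h2 n (by omega)

/-- Executions are deterministic once the coins are fixed. -/
theorem RamExec.unique {w : ℕ} {c : RamProg} {s s₁ s₂ : RamState} {t₁ t₂ : ℕ}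
    (h₁ : RamExec w c s s₁ t₁) (h₂ : RamExec w c s s₂ t₂) : s₁ = s₂ := by
  have h := (h₁.evalTree _ (le_max_left t₁ t₂)).symm.trans (h₂.evalTree _ (le_max_right t₁ t₂))
  simp only [Prod.mk.injEq, Option.some.injEq, RamState.st, St.mk.injEq] at h
  cases s₁; cases s₂; simp_all

/-- A program that halts within `t` steps for all coin sequences has a finite decision tree. -/
theorem exists_coinTree {w : ℕ} {c : RamProg} {σ : St} {t : ℕ}
    (h : ∀ ω, ∃ s' τ, RamExec w c (σ.wc ω) s' τ ∧ τ ≤ t) :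
    ∃ tr : CoinTree St, ∀ ω, ∃ τ ≤ t,
      RamExec w c (σ.wc ω) ((tr.run ω).1.wc (tr.run ω).2) τ := by
  refine ⟨(evalTree w t c σ).bind fun o => .leaf (o.getD σ), fun ω => ?_⟩
  obtain ⟨s', τ, h1, h2⟩ := h ω
  refine ⟨τ, h2, ?_⟩
  have h3 := h1.evalTree t h2
  rw [CoinTree.run_bind]
  simp only [St.wc_st] at h3
  rw [show (σ.wc ω).coins = ω from rfl] at h3
  rw [h3]
  exact h1

open Classical in
/-- A bound `v` on the expectation of a function that is at least `1` at all failures makes `v` a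
bound on the probability of failure. -/
theorem RT.measure_ge {w : ℕ} {c : RamProg} {σ : St} {t : ℕ} {Q : St → Prop} {f : St → ℝ} {v : ℝ}
    (h : RT w c σ t Q f v) (φ : St → Prop) (hf : ∀ σ', Q σ' → (if φ σ' then 0 else 1) ≤ f σ') :
    1 - v ≤ coinMeasure.real {ω | ∃ s' τ, RamExec w c (σ.wc ω) s' τ ∧ φ s'.st} := by
  obtain ⟨tr, hq, hv, he⟩ := h
  have h1 : coinMeasure.real {ω | φ (tr.run ω).1} ≤
      coinMeasure.real {ω | ∃ s' τ, RamExec w c (σ.wc ω) s' τ ∧ φ s'.st} := by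
    refine measureReal_mono fun ω hω => ?_
    obtain ⟨τ, -, h⟩ := he ω
    exact ⟨_, τ, h, hω⟩
  refine le_trans ?_ h1
  rw [coinMeasure_run]
  have h2 : tr.mean (fun a => if φ a then (1 : ℝ) else 0)
      = tr.mean (fun a => (-1) * (if φ a then 0 else 1) + 1) := by
    congr 1; ext a; split <;> norm_num
  rw [h2, CoinTree.mean_affine]
  have := CoinTree.mean_mono hq hf
  linarith

/-! ### Subroutines in their own part of the memory -/

/-- The expression on the registers and arrays with numbers at least `k`. -/
def RamExpr.shift (k : ℕ) : RamExpr → RamExpr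
  | .const m => .const m
  | .var x => .var (x + k)
  | .read a i => .read (a + k) (i.shift k)
  | .len a => .len (a + k)
  | .bin o e f => .bin o (e.shift k) (f.shift k)

/-- The program `c` on the registers and arrays with numbers at least `k`. -/
def RamProg.shift (k : ℕ) : RamProg → RamProg
  | .skip => .skip
  | .assign x e => .assign (x + k) (e.shift k)
  | .write a i e => .write (a + k) (i.shift k) (e.shift k)
  | .alloc a e => .alloc (a + k) (e.shift k)
  | .flip x => .flip (x + k)
  | .seq c d => .seq (c.shift k) (d.shift k)
  | .ite e c d => .ite (e.shift k) (c.shift k) (d.shift k)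
  | .loop e c => .loop (e.shift k) (c.shift k)

theorem modR_shift {k x : ℕ} (c : RamProg) (h : x < k) : modR (c.shift k) x = false := by
  induction c <;> simp_all [RamProg.shift, modR] <;> omega

theorem modA_shift {k a : ℕ} (c : RamProg) (h : a < k) : modA (c.shift k) a = false := by
  induction c <;> simp_all [RamProg.shift, modA] <;> omega

theorem modR_shift_add {k x : ℕ} (c : RamProg) : modR (c.shift k) (x + k) = modR c x := by
  induction c <;> simp_all [RamProg.shift, modR, Bool.beq_eq_decide_eq]

theorem modA_shift_add {k a : ℕ} (c : RamProg) : modA (c.shift k) (a + k) = modA c a := by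
  induction c <;> simp_all [RamProg.shift, modA]

/-- The memory that is `σ` below `k` and a copy of `τ` from `k` on. -/
def St.merge (k : ℕ) (σ τ : St) : St where
  reg x := if x < k then σ.reg x else τ.reg (x - k)
  arr a := if a < k then σ.arr a else τ.arr (a - k)

theorem St.merge_setR (k : ℕ) (σ τ : St) (x v : ℕ) :
    St.merge k σ (τ.setR x v) = (St.merge k σ τ).setR (x + k) v := by
  simp only [St.merge, St.setR, St.mk.injEq, and_true]
  ext y
  by_cases h : y < k
  · simp [h, show y ≠ x + k by omega]
  · by_cases h2 : y = x + k
    · simp [h2]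
    · simp [h, h2, show y - k ≠ x by omega]

theorem St.merge_arr (k : ℕ) (σ τ : St) (a : ℕ) (l : List ℕ) :
    St.merge k σ ⟨τ.reg, Function.update τ.arr a l⟩ =
      ⟨(St.merge k σ τ).reg, Function.update (St.merge k σ τ).arr (a + k) l⟩ := by
  simp only [St.merge, St.mk.injEq, true_and]
  ext1 y
  by_cases h : y < k
  · simp [h, show y ≠ a + k by omega]
  · by_cases h2 : y = a + k
    · simp [h2]
    · simp [h, h2, show y - k ≠ a by omega]

theorem RamExpr.eval_shift (w k : ℕ) (σ : St) (s : RamState) (ω : ℕ → Bool) (e : RamExpr) :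
    (e.shift k).eval w ((St.merge k σ s.st).wc ω) = e.eval w s := by
  induction e with
  | const m => rfl
  | var x => simp [shift, eval, St.wc, St.merge, RamState.st]
  | read a i ih => simp only [shift, eval, ih]; simp [St.wc, St.merge, RamState.st]
  | len a => simp [shift, eval, St.wc, St.merge, RamState.st]
  | bin o e f he hf => simp only [shift, eval, he, hf]

theorem RamExpr.cost_shift (k : ℕ) (e : RamExpr) : (e.shift k).cost = e.cost := by
  induction e <;> simp_all [shift, cost]

theorem RamExec.shift {w : ℕ} {c : RamProg} {s s' : RamState} {t : ℕ} (k : ℕ) (σ : St)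
    (h : RamExec w c s s' t) :
    RamExec w (c.shift k) ((St.merge k σ s.st).wc s.coins) ((St.merge k σ s'.st).wc s'.coins) t := by
  induction h with
  | skip s => exact .skip _
  | assign x e s =>
    have := RamExec.assign (w := w) (x + k) (e.shift k) ((St.merge k σ s.st).wc s.coins)
    rw [RamExpr.eval_shift, RamExpr.cost_shift] at this
    rw [RamProg.shift]
    convert this using 1
    exact congrArg (fun τ : St => τ.wc s.coins) (St.merge_setR k σ s.st x _)
  | write a i e s =>
    have := RamExec.write (w := w) (a + k) (i.shift k) (e.shift k)
      ((St.merge k σ s.st).wc s.coins)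
    rw [RamExpr.eval_shift, RamExpr.eval_shift, RamExpr.cost_shift, RamExpr.cost_shift] at this
    rw [RamProg.shift]
    convert this using 1
    have h2 : ((St.merge k σ s.st).wc s.coins).arr (a + k) = s.arr a := by
      simp [St.wc, St.merge, RamState.st]
    rw [h2]
    exact congrArg (fun τ : St => τ.wc s.coins) (St.merge_arr k σ s.st a _)
  | alloc a e s =>
    have := RamExec.alloc (w := w) (a + k) (e.shift k) ((St.merge k σ s.st).wc s.coins)
    rw [RamExpr.eval_shift, RamExpr.cost_shift] at this
    rw [RamProg.shift]
    convert this using 1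
    exact congrArg (fun τ : St => τ.wc s.coins) (St.merge_arr k σ s.st a _)
  | flip x s =>
    have := RamExec.flip (w := w) (x + k) ((St.merge k σ s.st).wc s.coins)
    rw [RamProg.shift]
    convert this using 1
    exact congrArg (fun τ : St => τ.wc fun j => s.coins (j + 1)) (St.merge_setR k σ s.st x _)
  | seq _ _ h1 h2 => exact .seq h1 h2
  | @ite_true e c d _ _ _ he _ h1 =>
    have := RamExec.ite_true (w := w) (e := e.shift k) (d := d.shift k)
      (by rwa [RamExpr.eval_shift]) h1
    rw [RamExpr.cost_shift] at this
    exact this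
  | @ite_false e c d _ _ _ he _ h1 =>
    have := RamExec.ite_false (w := w) (e := e.shift k) (c := c.shift k)
      (by rwa [RamExpr.eval_shift]) h1
    rw [RamExpr.cost_shift] at this
    exact this
  | @loop_done e c s he =>
    have := RamExec.loop_done (w := w) (e := e.shift k) (c := c.shift k)
      (s := (St.merge k σ s.st).wc s.coins) (by rwa [RamExpr.eval_shift])
    rw [RamExpr.cost_shift] at this
    exact this
  | @loop_step e _ _ _ _ _ _ he _ _ h1 h2 =>
    have := RamExec.loop_step (w := w) (e := e.shift k) (by rwa [RamExpr.eval_shift]) h1 h2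
    rw [RamExpr.cost_shift] at this
    exact this

/-- An array can only grow at the price of its length. -/
theorem RamExec.length_le {w : ℕ} {c : RamProg} {s s' : RamState} {t : ℕ}
    (h : RamExec w c s s' t) (a : ℕ) : (s'.arr a).length ≤ max (s.arr a).length t := by
  induction h with
  | skip s => simp
  | assign x e s => simp
  | write b i e s =>
    by_cases hb : a = b
    · subst hb; simp
    · simp [hb]
  | alloc b e s =>
    by_cases hb : a = b
    · subst hb; simp; omega
    · simp [hb]
  | flip x s => simp
  | seq _ _ h1 h2 => omega
  | ite_true he _ h1 => omega
  | ite_false he _ h1 => omega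
  | loop_done he => simp
  | loop_step he _ _ h1 h2 => omega

theorem RamExec.time_pos {w : ℕ} {c : RamProg} {s s' : RamState} {t : ℕ}
    (h : RamExec w c s s' t) : 1 ≤ t := by
  induction h <;> omega

/-! ### The program

Registers and arrays below `100` belong to the algorithm, those from `100` on to the subroutine. The
input arrays are `0` for the profits, `1` for the weights and `2` for the capacity. A truncated
difference is used for minima and maxima, as in `x - (x - y)` and `x + (y - x)`. The nodes of the
tree are numbered as in a binary heap: the root is `1`, the children of `v` are `2 * v` and
`2 * v + 1`. An entry of `d + 1` in the array `11` is a demand of `d`, and `0` is no demand. -/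

infixr:55 " ;; " => RamProg.seq
infix:60 " ⇐ " => RamProg.assign
prefix:max "§" => RamExpr.var
prefix:max "♯" => RamExpr.const
infixl:65 " +ʷ " => RamExpr.bin BinOp.add
infixl:65 " -ʷ " => RamExpr.bin BinOp.sub
infixl:70 " *ʷ " => RamExpr.bin BinOp.mul
infixl:70 " /ʷ " => RamExpr.bin BinOp.div
infixl:70 " %ʷ " => RamExpr.bin BinOp.mod
infix:62 " <ʷ " => RamExpr.bin BinOp.lt

/-- Store the number of binary digits of register `y` in register `d`; `y` becomes `0`. -/
def bitsProg (d y : ℕ) : RamProg :=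
  d ⇐ ♯ 0 ;; .loop (§ y) (y ⇐ § y /ʷ ♯ 2 ;; d ⇐ § d +ʷ ♯ 1)

/-- Store the least power of two that is at least register `s` in register `d`. -/
def pow2Prog (d s : ℕ) : RamProg :=
  d ⇐ ♯ 1 ;; .loop (§ d <ʷ § s) (d ⇐ § d +ʷ § d)

/-- The sizes: register `0` is the number `n` of items, `1` the capacity `W`, `2` the largest profit
of an item of weight at most `W`, `3` and `4` their numbers of digits, `5` the number of digits of
everything, `6` the maximal load of a bucket, `7` the number of colours, `8` the number of classes. -/
def sizesProg (κ : ℕ) : RamProg :=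
  0 ⇐ .len 0 ;; 1 ⇐ .read 2 (♯ 0) ;; 2 ⇐ ♯ 0 ;;
  FOR 20 0 (.ite (§ 1 <ʷ .read 1 (§ 20)) .skip (2 ⇐ § 2 +ʷ (.read 0 (§ 20) -ʷ § 2))) ;;
  21 ⇐ § 1 ;; bitsProg 3 21 ;; 21 ⇐ § 2 ;; bitsProg 4 21 ;;
  21 ⇐ § 0 +ʷ § 1 +ʷ § 2 +ʷ ♯ 2 ;; bitsProg 5 21 ;; 8 ⇐ § 3 *ʷ § 4 ;;
  6 ⇐ ♯ κ *ʷ § 5 ;; 21 ⇐ ♯ 2 *ʷ § 5 *ʷ (§ 6 *ʷ § 6) +ʷ ♯ 2 ;; pow2Prog 7 21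

/-- Array `3` is the class of each item plus one, or `0`; array `4` the number of items of each
class; the items of weight `0` are put into the solution, array `12`. -/
def classesProg : RamProg :=
  .alloc 3 (§ 0) ;; .alloc 4 (§ 8) ;; .alloc 12 (§ 0) ;;
  FOR 20 0 (.ite (§ 1 <ʷ .read 1 (§ 20)) .skip (.ite (.read 1 (§ 20)) (.ite (.read 0 (§ 20))
    (21 ⇐ .read 1 (§ 20) ;; bitsProg 22 21 ;; 21 ⇐ .read 0 (§ 20) ;; bitsProg 23 21 ;;
      24 ⇐ (§ 22 -ʷ ♯ 1) *ʷ § 4 +ʷ (§ 23 -ʷ ♯ 1) ;; .write 3 (§ 20) (§ 24 +ʷ ♯ 1) ;;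
      .write 4 (§ 24) (.read 4 (§ 24) +ʷ ♯ 1)) .skip) (.write 12 (§ 20) (♯ 1))))

/-- Array `5` is the number of buckets of each class, array `6` the size of its leaves, register
`12` the maximal size of a node. -/
def bucketsProg : RamProg :=
  .alloc 5 (§ 8) ;; .alloc 6 (§ 8) ;; 12 ⇐ § 1 +ʷ ♯ 1 ;;
  FOR 20 8 (21 ⇐ § 20 /ʷ § 4 ;; 22 ⇐ § 20 %ʷ § 4 ;; 23 ⇐ .bin .shr (§ 1) (§ 21) ;;
    23 ⇐ .read 4 (§ 20) -ʷ (.read 4 (§ 20) -ʷ § 23) ;; pow2Prog 24 23 ;;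
    25 ⇐ .bin .shl (♯ 2) (§ 21 +ʷ (§ 22 -ʷ § 21)) ;;
    .write 5 (§ 20) (§ 24) ;; .write 6 (§ 20) (§ 25) ;; 12 ⇐ § 12 +ʷ § 23 *ʷ § 25)

/-- The tree: register `13` is the number of buckets reserved for a class, `9` the number of
buckets, `10` the number of leaves, `11` the number of nodes, `14` the total size; array `8` is the
size of each node and array `9` its offset. -/
def layoutProg : RamProg :=
  13 ⇐ § 1 +ʷ § 1 +ʷ ♯ 1 ;; 9 ⇐ § 8 *ʷ § 13 +ʷ ♯ 1 ;; 15 ⇐ § 9 *ʷ § 7 ;; 10 ⇐ § 15 *ʷ § 7 ;;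
  11 ⇐ § 10 +ʷ § 10 ;; 16 ⇐ § 11 -ʷ ♯ 1 ;; .alloc 8 (§ 11) ;; .alloc 9 (§ 11) ;; 14 ⇐ ♯ 0 ;;
  FOR 20 16 (21 ⇐ § 16 -ʷ § 20 ;;
    .ite (§ 21 <ʷ § 10) (22 ⇐ .read 8 (§ 21 +ʷ § 21) +ʷ .read 8 (§ 21 +ʷ § 21 +ʷ ♯ 1))
      (23 ⇐ (§ 21 -ʷ § 10) /ʷ (§ 7 *ʷ § 7) ;;
        .ite (§ 23 %ʷ § 13 <ʷ .read 5 (§ 23 /ʷ § 13)) (22 ⇐ .read 6 (§ 23 /ʷ § 13)) (22 ⇐ ♯ 1)) ;;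
    22 ⇐ § 12 -ʷ (§ 12 -ʷ § 22) ;; .write 8 (§ 21) (§ 22) ;; .write 9 (§ 21) (§ 14) ;;
    14 ⇐ § 14 +ʷ (§ 22 +ʷ ♯ 1))

/-- Array `10` holds the profiles of all nodes, array `11` the demands, array `7` the bucket of each
item; register `17` is the number of runs per convolution. -/
def memoryProg (κ : ℕ) : RamProg :=
  .alloc 10 (§ 14) ;; .alloc 11 (§ 11) ;; .alloc 7 (§ 0) ;; 21 ⇐ § 11 ;; bitsProg 17 21 ;;
  17 ⇐ ♯ 13 *ʷ (§ 17 +ʷ ♯ κ *ʷ § 5)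

/-- A random bucket for each item. -/
def hashProg : RamProg :=
  FOR 20 0 (.ite (.read 3 (§ 20))
    (21 ⇐ .read 3 (§ 20) -ʷ ♯ 1 ;; 22 ⇐ .read 5 (§ 21) ;; 23 ⇐ ♯ 0 ;; 24 ⇐ ♯ 1 ;;
      .loop (§ 24 <ʷ § 22) (.flip 25 ;; 23 ⇐ § 23 +ʷ § 23 +ʷ § 25 ;; 24 ⇐ § 24 +ʷ § 24) ;;
      .write 7 (§ 20) (§ 21 *ʷ § 13 +ʷ § 23)) .skip)

/-- The leaf of the item in register `20` for the colour in register `22`, if its bucket is in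
register `21`. -/
def leafExpr : RamExpr :=
  § 10 +ʷ ((§ 21 *ʷ § 7 +ʷ § 22) *ʷ § 7 +ʷ § 20 %ʷ (§ 22 +ʷ ♯ 1))

/-- Enter the items into the leaves. -/
def fillProg : RamProg :=
  FOR 20 0 (.ite (.read 3 (§ 20)) (21 ⇐ .read 7 (§ 20) ;;
    FOR 22 7 (23 ⇐ leafExpr ;; 24 ⇐ .read 9 (§ 23) +ʷ .read 1 (§ 20) ;;
      .ite (.read 10 (§ 24) <ʷ .read 0 (§ 20)) (.write 10 (§ 24) (.read 0 (§ 20))) .skip)) .skip)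

/-- Clear the first `k` registers and arrays of the subroutine. -/
def resetProg : ℕ → RamProg
  | 0 => .skip
  | k + 1 => resetProg k ;; (k + 100) ⇐ ♯ 0 ;; .alloc (k + 100) (♯ 0)

/-- Positions in the profiles of the two children that belong to the index `31` and the index in
register `s`. -/
def childIdx (s : RamExpr) : RamProg :=
  33 ⇐ § 31 -ʷ (§ 31 -ʷ § 25) ;; 34 ⇐ s -ʷ (s -ʷ § 27)

/-- Load the profiles of both children as input of the subroutine. -/
def loadProg : RamProg :=
  .alloc 100 (§ 24) ;; .alloc 101 (§ 24) ;;
  FOR 31 24 (childIdx (§ 31) ;; .write 100 (§ 31) (.read 10 (§ 26 +ʷ § 33) +ʷ ♯ 1) ;;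
    .write 101 (§ 31) (.read 10 (§ 28 +ʷ § 34) +ʷ ♯ 1))

/-- One round of the majority vote, for each entry of the output of the subroutine. -/
def voteProg : RamProg :=
  FOR 31 24 (.ite (.read 14 (§ 31))
    (.ite (.bin .eq (.read 13 (§ 31)) (.read 100 (§ 31)))
      (.write 14 (§ 31) (.read 14 (§ 31) +ʷ ♯ 1)) (.write 14 (§ 31) (.read 14 (§ 31) -ʷ ♯ 1)))
    (.write 13 (§ 31) (.read 100 (§ 31)) ;; .write 14 (§ 31) (♯ 1)))

/-- The convolution of the profiles of both children, by majority vote. -/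
def convProg (P : RamProg) (B : ℕ) : RamProg :=
  .alloc 13 (§ 24) ;; .alloc 14 (§ 24) ;;
  FOR 37 17 (resetProg B ;; loadProg ;; P.shift 100 ;; voteProg) ;;
  FOR 31 24 (.write 10 (§ 23 +ʷ § 31) ((§ 24 -ʷ (§ 24 -ʷ .read 13 (§ 31))) -ʷ ♯ 1))

/-- The maximum of the profiles of both children. -/
def maxProg : RamProg :=
  FOR 31 24 (childIdx (§ 31) ;; 35 ⇐ .read 10 (§ 26 +ʷ § 33) ;; 36 ⇐ .read 10 (§ 28 +ʷ § 34) ;;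
    .write 10 (§ 23 +ʷ § 31) (§ 35 +ʷ (§ 36 -ʷ § 35)))

/-- Make a profile monotone and bounded by its size. -/
def sanitizeProg : RamProg :=
  30 ⇐ ♯ 0 ;; FOR 31 24 (32 ⇐ § 22 -ʷ (§ 22 -ʷ .read 10 (§ 23 +ʷ § 31)) ;;
    30 ⇐ § 30 +ʷ (§ 32 -ʷ § 30) ;; .write 10 (§ 23 +ʷ § 31) (§ 30))

/-- Load the sizes and offsets of the children of the node in register `21`. -/
def childrenProg : RamProg :=
  25 ⇐ .read 8 (§ 21 +ʷ § 21) ;; 26 ⇐ .read 9 (§ 21 +ʷ § 21) ;;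
  27 ⇐ .read 8 (§ 21 +ʷ § 21 +ʷ ♯ 1) ;; 28 ⇐ .read 9 (§ 21 +ʷ § 21 +ʷ ♯ 1)

/-- Nonzero if the node in register `21` is a convolution. -/
def isConvExpr : RamExpr := (§ 21 <ʷ § 9) +ʷ (♯ 1 -ʷ (§ 21 <ʷ § 15))

/-- Compute the profiles of all nodes, from the leaves to the root. Profiles are made monotone and
bounded in any case, so that the input of the subroutine is legal even after a failure. -/
def evalProg (P : RamProg) (B : ℕ) : RamProg :=
  FOR 20 16 (21 ⇐ § 16 -ʷ § 20 ;; 22 ⇐ .read 8 (§ 21) ;; 23 ⇐ .read 9 (§ 21) ;; 24 ⇐ § 22 +ʷ ♯ 1 ;;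
    .ite (§ 21 <ʷ § 10) (childrenProg ;; .ite isConvExpr (convProg P B) maxProg) .skip ;;
    sanitizeProg)

/-- Distribute the demand in register `40`, with its value in register `22`, of a convolution to the
children. -/
def splitProg : RamProg :=
  24 ⇐ § 40 +ʷ ♯ 1 ;; FOR 31 24 (childIdx (§ 40 -ʷ § 31) ;;
    .ite (.read 10 (§ 26 +ʷ § 33) +ʷ .read 10 (§ 28 +ʷ § 34) <ʷ § 22) .skip
      (.write 11 (§ 21 +ʷ § 21) (§ 33 +ʷ ♯ 1) ;; .write 11 (§ 21 +ʷ § 21 +ʷ ♯ 1) (§ 34 +ʷ ♯ 1)))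

/-- Pass the demand in register `40`, with its value in register `22`, of a maximum to one child. -/
def chooseProg : RamProg :=
  31 ⇐ § 40 ;; childIdx (§ 40) ;;
  .ite (.read 10 (§ 26 +ʷ § 33) <ʷ § 22) (.write 11 (§ 21 +ʷ § 21 +ʷ ♯ 1) (§ 34 +ʷ ♯ 1))
    (.write 11 (§ 21 +ʷ § 21) (§ 33 +ʷ ♯ 1))

/-- Distribute the demand of the root to the leaves. -/
def demandProg : RamProg :=
  .write 11 (♯ 1) (§ 1 +ʷ ♯ 1) ;;
  FOR 20 10 (21 ⇐ § 20 ;; .ite (.read 11 (§ 21)) (40 ⇐ .read 11 (§ 21) -ʷ ♯ 1 ;;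
    22 ⇐ .read 10 (.read 9 (§ 21) +ʷ § 40) ;; .write 11 (§ 21) (♯ 0) ;; childrenProg ;;
    .ite isConvExpr splitProg chooseProg) .skip)

/-- Satisfy the demands of the leaves with items. -/
def selectProg : RamProg :=
  FOR 20 0 (.ite (.read 3 (§ 20)) (21 ⇐ .read 7 (§ 20) ;;
    FOR 22 7 (23 ⇐ leafExpr ;; .ite (.read 11 (§ 23)) (24 ⇐ .read 11 (§ 23) -ʷ ♯ 1 ;;
      .ite (§ 24 <ʷ .read 1 (§ 20)) .skip
        (.ite (.read 0 (§ 20) <ʷ .read 10 (.read 9 (§ 23) +ʷ § 24)) .skip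
          (.write 12 (§ 20) (♯ 1) ;; .write 11 (§ 23) (♯ 0)))) .skip)) .skip)

/-- Copy the solution to the output. -/
def outputProg : RamProg :=
  .alloc 0 (§ 0) ;; FOR 20 0 (.write 0 (§ 20) (.read 12 (§ 20)))

/-- The knapsack algorithm with the convolution algorithm `P`, which uses at most `B` registers and
arrays. -/
def knapsackProg (P : RamProg) (B κ : ℕ) : RamProg :=
  sizesProg κ ;; classesProg ;; bucketsProg ;; layoutProg ;; memoryProg κ ;; hashProg ;; fillProg ;;
  evalProg P B ;; demandProg ;; selectProg ;; outputProg

theorem Det.bits {w : ℕ} (hw : 1 ≤ w) {d y : ℕ} (hdy : d ≠ y) {σ : St} {m : ℕ}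
    (hm : σ.reg y = m) (hy : m < 2 ^ w) (hw2 : 2 < 2 ^ w) :
    Det w (bitsProg d y) σ (16 * Nat.size m + 4) fun σ' => σ'.reg d = Nat.size m := by
  subst hm
  have hlt : Nat.size (σ.reg y) < 2 ^ w := by
    exact lt_of_le_of_lt (Nat.size_le.2 Nat.lt_two_pow_self) hy
  have h1 : Det w (d ⇐ ♯ 0) σ 2 (fun σ' => σ' = σ.setR d 0) :=
    Det.straight hw ⟨by simp [RamExpr.ok], rfl⟩
  refine (h1.seq fun σ' _ h => ?_).mono (t₁ := 2 + (Nat.size (σ.reg y) * (8 + 1 + 1) + (1+1))) (by omega) fun _ _ h => h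
  refine Det.while hw (tb := 8) (fun k σ' => k = Nat.size (σ'.reg y) ∧ σ'.reg y ≤ σ.reg y ∧ k + σ'.reg d = Nat.size (σ.reg y)) ?_ ?_ ?_ _ _ ?_
  · intros; trivial
  · rintro σ₁ ⟨h1, -, h2⟩
    refine ⟨?_, by omega⟩
    simpa [RamExpr.val] using Nat.size_eq_zero.1 h1.symm
  · rintro k σ₁ ⟨h1, h2, h3⟩
    have h4 : σ₁.reg y ≠ 0 := fun h => by simp [h] at h1
    refine ⟨h4, Det.straight hw ?_⟩
    have h5 : Nat.size (σ₁.reg y / 2) = k := by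
      have := Nat.size_bit (b := (σ₁.reg y).bodd) (n := (σ₁.reg y).div2)  (by rw [Nat.bit_bodd_div2]; exact h4)
      rw [Nat.bit_bodd_div2, ← h1, Nat.div2_val] at this
      omega
    have h6 : σ₁.reg y / 2 ≤ σ₁.reg y := Nat.div_le_self _ _
    simp [WP, RamExpr.ok, RamExpr.val, BinOp.apply, hdy, hdy.symm, h5, hw2]
    omega
  · subst h
    simp [hdy.symm]

/-- The power of two that `pow2Prog` computes. -/
def pow2 (s : ℕ) : ℕ := 2 ^ Nat.clog 2 s

theorem Det.pow2 {w : ℕ} (hw : 1 ≤ w) {d s : ℕ} (hds : d ≠ s) {σ : St} {m : ℕ}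
    (hm : σ.reg s = m) (hy : _root_.pow2 m < 2 ^ w) :
    Det w (pow2Prog d s) σ (8 * Nat.clog 2 m + 8) fun σ' => σ'.reg d = _root_.pow2 m := by
  subst hm
  have h1 : Det w (d ⇐ ♯ 1) σ 2 (fun σ' => σ' = σ.setR d 1) :=
    Det.straight hw ⟨by simpa [RamExpr.ok] using by omega, rfl⟩
  refine (h1.seq fun σ' _ h => ?_).mono (t₁ := 2 + (Nat.clog 2 (σ.reg s) * (4 + 3 + 1) + (3+1))) (by omega) fun _ _ h => h
  refine Det.while hw (tb := 4) (fun k σ' => σ'.reg s = σ.reg s ∧ ∃ j, j + k = Nat.clog 2 (σ.reg s) ∧ σ'.reg d = 2 ^ j) ?_ ?_ ?_ _ _ ?_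
  · intros; simp [RamExpr.ok]
  · rintro σ₁ ⟨h1, j, h2, h3⟩
    have h4 : σ.reg s ≤ 2 ^ Nat.clog 2 (σ.reg s) := Nat.le_pow_clog (by norm_num) _
    simp only [add_zero] at h2
    subst h2
    simp [RamExpr.val, BinOp.apply, h1, h3, h4, _root_.pow2]
  · rintro k σ₁ ⟨h1, j, h2, h3⟩
    have h4 : 2 ^ j < σ.reg s := (Nat.lt_clog_iff_pow_lt (by norm_num)).1 (by omega)
    have h5 : 2 ^ (j + 1) ≤ _root_.pow2 (σ.reg s) := Nat.pow_le_pow_right (by norm_num) (by omega)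
    refine ⟨by simp [RamExpr.val, BinOp.apply, h1, h3, h4], Det.straight hw ?_⟩
    simp only [WP, RamExpr.ok, RamExpr.val, BinOp.apply, St.reg_setR, h3, h1, true_and, if_true, hds.symm, if_false]
    rw [pow_succ] at h5
    exact ⟨by omega, j + 1, by omega, by rw [pow_succ]; ring⟩
  · subst h
    simp only [St.reg_setR, hds.symm, if_false, if_true, true_and]
    exact ⟨0, by simp, by simp⟩

/-- A knapsack instance, with items indexed by all of `ℕ`, and the parameter `κ` that controls the
error probability. -/
structure KP where
  n : ℕ
  W : ℕ
  κ : ℕ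
  p : ℕ → ℕ
  wt : ℕ → ℕ

namespace KP
variable (I : KP)

/-- The largest profit of an item that fits. -/
def pm : ℕ := (Finset.range I.n).sup fun t => if I.wt t ≤ I.W then I.p t else 0
/-- The number of binary digits of the capacity. -/
def LW : ℕ := Nat.size I.W
/-- The number of binary digits of the largest profit. -/
def LP : ℕ := Nat.size I.pm
/-- The logarithmic scale of the instance. -/
def ell : ℕ := Nat.size (I.n + I.W + I.pm + 2)
/-- The number of classes. -/
def C : ℕ := I.LW * I.LP
/-- The load that no bucket should exceed. -/
def L : ℕ := I.κ * I.ell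
/-- A lower bound for the number of colours, chosen to suit `exists_separating`. -/
def Q₀ : ℕ := 2 * I.ell * (I.L * I.L) + 2
/-- The number of colours. -/
def Q : ℕ := pow2 I.Q₀
/-- The items that have to be decided. -/
def Valid (t : ℕ) : Prop := t < I.n ∧ 1 ≤ I.wt t ∧ I.wt t ≤ I.W ∧ 1 ≤ I.p t
instance : DecidablePred I.Valid := fun _ => by unfold Valid; infer_instance
/-- The class of an item: it determines the weight and the profit up to a factor of two. -/
def cls (t : ℕ) : ℕ := (Nat.size (I.wt t) - 1) * I.LP + (Nat.size (I.p t) - 1)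
/-- The entry of the table of classes: the class plus one, or `0` for an item that is not valid. -/
def ci (t : ℕ) : ℕ := if I.Valid t then I.cls t + 1 else 0
/-- The number of items of class `c`. -/
def cnt (c : ℕ) : ℕ := ((Finset.range I.n).filter fun t => I.ci t = c + 1).card
/-- An upper bound for the number of items of class `c` in a solution. -/
def z (c : ℕ) : ℕ := min (I.cnt c) (I.W / 2 ^ (c / I.LP))
/-- The number of buckets of class `c`. -/
def M (c : ℕ) : ℕ := pow2 (I.z c)
/-- An upper bound for the weights and the profits of class `c`. -/
def u (c : ℕ) : ℕ := 2 * 2 ^ max (c / I.LP) (c % I.LP)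
/-- The maximal size of a node. -/
def ntop : ℕ := I.W + 1 + ∑ c ∈ Finset.range I.C, I.z c * I.u c
/-- The number of bucket numbers that are reserved for each class. -/
def Mx : ℕ := 2 * I.W + 1
/-- The number of buckets, including one that no item belongs to, so that it is positive. -/
def G : ℕ := I.C * I.Mx + 1
/-- The number of leaves: for each bucket and each of `Q` colours there are `Q` remainders. -/
def N : ℕ := I.G * I.Q * I.Q

/-- The size of the leaf at position `l` of the list of leaves. -/
def leafSz (l : ℕ) : ℕ :=
  if l / (I.Q * I.Q) / I.Mx < I.C ∧ l / (I.Q * I.Q) % I.Mx < I.M (l / (I.Q * I.Q) / I.Mx) then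
    I.u (l / (I.Q * I.Q) / I.Mx) else 1

/-- The size of a node: its profile is indexed by `0, …, sz v`, and has values in the same range. -/
def sz (v : ℕ) : ℕ :=
  if 1 ≤ v ∧ v < I.N then min I.ntop (sz (2 * v) + sz (2 * v + 1))
  else min I.ntop (I.leafSz (v - I.N))
termination_by I.N - v
decreasing_by all_goals omega

/-- The offset of the profile of node `v` in the heap. -/
def off (v : ℕ) : ℕ := ∑ x ∈ Finset.Ioo v (2 * I.N), (I.sz x + 1)

/-- The number of runs for each convolution. The factor `13` makes `(17 / 18) ^ 13 ≤ 1 / 2`. -/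
def R : ℕ := 13 * (Nat.size (2 * I.N) + I.κ * I.ell)

/-- The word length suffices for all numbers that occur. -/
structure Fits (w : ℕ) : Prop where
  hw : 1 ≤ w
  h_sum : I.n + I.W + I.pm + 2 < 2 ^ w
  h_C : I.C < 2 ^ w
  h_κ : I.κ < 2 ^ w
  h_Q₀ : I.Q₀ < 2 ^ w
  h_Q : I.Q * I.Q < 2 ^ w
  h_M : ∀ c < I.C, I.M c < 2 ^ w
  h_u : ∀ c < I.C, I.u c < 2 ^ w
  h_ntop : 2 * I.ntop + 2 < 2 ^ w
  h_N : 2 * I.N + 2 < 2 ^ w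
  h_off : I.off 0 < 2 ^ w
  h_offW : I.off 0 + I.W < 2 ^ w
  h_R : I.R < 2 ^ w
  h_ell : 2 * I.ell < 2 ^ w

/-- The input is in the memory. -/
structure Input (σ : St) : Prop where
  rd0 : ∀ t, σ.rd 0 t = I.p t
  rd1 : ∀ t, σ.rd 1 t = I.wt t
  ln0 : σ.ln 0 = I.n

structure Sizes (σ : St) : Prop extends I.Input σ where
  r0 : σ.reg 0 = I.n
  r1 : σ.reg 1 = I.W
  r2 : σ.reg 2 = I.pm
  r3 : σ.reg 3 = I.LW
  r4 : σ.reg 4 = I.LP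
  r5 : σ.reg 5 = I.ell
  r6 : σ.reg 6 = I.L
  r7 : σ.reg 7 = I.Q
  r8 : σ.reg 8 = I.C

variable {I}

theorem Input.of_same {c : RamProg} {σ σ' : St} (h : I.Input σ) (hs : SameOn c σ σ')
    (ha : ∀ a < 3, modA c a = false) : I.Input σ' :=
  ⟨fun t => by rw [hs.rd (ha 0 (by norm_num)), h.rd0],
    fun t => by rw [hs.rd (ha 1 (by norm_num)), h.rd1],
    by rw [hs.ln (ha 0 (by norm_num)), h.ln0]⟩

theorem Sizes.of_same {c : RamProg} {σ σ' : St} (h : I.Sizes σ) (hs : SameOn c σ σ')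
    (ha : ∀ a < 3, modA c a = false) (hr : ∀ x < 9, modR c x = false) : I.Sizes σ' where
  toInput := h.toInput.of_same hs ha
  r0 := by rw [hs.reg 0 (hr 0 (by norm_num)), h.r0]
  r1 := by rw [hs.reg 1 (hr 1 (by norm_num)), h.r1]
  r2 := by rw [hs.reg 2 (hr 2 (by norm_num)), h.r2]
  r3 := by rw [hs.reg 3 (hr 3 (by norm_num)), h.r3]
  r4 := by rw [hs.reg 4 (hr 4 (by norm_num)), h.r4]
  r5 := by rw [hs.reg 5 (hr 5 (by norm_num)), h.r5]
  r6 := by rw [hs.reg 6 (hr 6 (by norm_num)), h.r6]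
  r7 := by rw [hs.reg 7 (hr 7 (by norm_num)), h.r7]
  r8 := by rw [hs.reg 8 (hr 8 (by norm_num)), h.r8]

variable {w : ℕ}

theorem Fits.two_lt (hF : I.Fits w) : 2 < 2 ^ w := by have := hF.h_sum; omega

theorem pm_loop (hF : I.Fits w) {σ : St} (hI : I.Input σ) (h0 : σ.reg 0 = I.n)
    (h1 : σ.reg 1 = I.W) (h2 : σ.reg 2 = 0) :
    Det w (FOR 20 0 (.ite (§ 1 <ʷ .read 1 (§ 20)) .skip (2 ⇐ § 2 +ʷ (.read 0 (§ 20) -ʷ § 2)))) σ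
      (6 + I.n * 30) fun σ' => σ'.reg 2 = I.pm := by
  have hle : ∀ k ≤ I.n, ((Finset.range k).sup fun t => if I.wt t ≤ I.W then I.p t else 0) ≤ I.pm :=
    fun k hk => Finset.sup_mono (Finset.range_subset_range.2 hk)
  have := hF.h_sum
  refine (Det.for hF.hw (fun _ => 22)
    (fun k σ' => σ'.reg 2 = (Finset.range k).sup fun t => if I.wt t ≤ I.W then I.p t else 0)
    h0 (by omega) (by norm_num) rfl rfl (by simp [h2]) fun k hk σ' hS hk' hinv => ?_).mono
    (by simp) fun σ' _ h => h.2
  have e1 : σ'.reg 1 = I.W := (hS.reg 1 rfl).trans h1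
  have e2 : σ'.rd 1 k = I.wt k := (hS.rd rfl k).trans (hI.rd1 k)
  have e3 : σ'.rd 0 k = I.p k := (hS.rd rfl k).trans (hI.rd0 k)
  refine Det.straight_le hF.hw rfl ?_
  have hle' := hle (k+1) hk
  rw [Finset.range_add_one, Finset.sup_insert] at *
  rw [← hinv] at hle' ⊢
  by_cases hc : I.W < I.wt k
  · simp [WP, RamExpr.ok, RamExpr.val, BinOp.apply, hk', e1, e2, e3, hc, not_le.2 hc]
  · simp only [not_lt.1 hc, if_true, sup_le_iff] at hle'
    simp [WP, RamExpr.ok, RamExpr.val, BinOp.apply, hk', e1, e2, e3, hc, not_lt.1 hc]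
    omega

theorem sizes (hF : I.Fits w) {σ : St} (hI : I.Input σ) (h2 : σ.rd 2 0 = I.W) :
    Det w (sizesProg I.κ) σ (200 + 30 * I.n + 16 * (I.LW + I.LP + I.ell) + 8 * Nat.clog 2 I.Q₀)
      I.Sizes := by
  have hw := hF.hw
  have h_sum := hF.h_sum
  have h_C := hF.h_C
  have h_Q₀ := hF.h_Q₀
  have h_Q := hF.h_Q
  have h2w := hF.two_lt
  have hκ := hF.h_κ
  have hLL : I.L ≤ I.L * I.L := Nat.le_mul_self _
  have hell : 1 ≤ I.ell := Nat.size_pos.2 (by omega)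
  have hL1 : I.L * I.L ≤ 2 * I.ell * (I.L * I.L) := Nat.le_mul_of_pos_left _ (by omega)
  have hL2 : 2 * I.ell * (I.L * I.L) + 2 < 2 ^ w := h_Q₀
  have hl4 := hF.h_ell
  have hL : I.κ * I.ell = I.L := rfl
  have hQQ : pow2 I.Q₀ < 2 ^ w := lt_of_le_of_lt (Nat.le_mul_self _) h_Q
  unfold sizesProg
  apply Run.det
  · refine Run.assign hw (by simp [hI.ln0]; omega) (Run.assign hw (by simp)
      (Run.assign hw (by simp) ?_))
    refine Run.seq (pm_loop hF ⟨by simpa using hI.rd0, by simpa using hI.rd1, by simpa using hI.ln0⟩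
      (by simp [hI.ln0]) (by simp [h2]) (by simp)) fun σ₁ hs₁ hq₁ => ?_
    refine Run.assign hw (by simp) (Run.seq (Det.bits hw (by norm_num) (m := I.W) ?_ (by omega) h2w)
      fun σ₂ hs₂ hq₂ => ?_)
    · simp [hs₁.reg 1 rfl, h2]
    refine Run.assign hw (by simp) (Run.seq (Det.bits hw (by norm_num) (m := I.pm) ?_ (by omega) h2w)
      fun σ₃ hs₃ hq₃ => ?_)
    · simp [hs₂.reg 2 rfl, hq₁]
    have a0 : σ₃.reg 0 = I.n := by simp [hs₃.reg 0 rfl, hs₂.reg 0 rfl, hs₁.reg 0 rfl, hI.ln0]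
    have a1 : σ₃.reg 1 = I.W := by simp [hs₃.reg 1 rfl, hs₂.reg 1 rfl, hs₁.reg 1 rfl, h2]
    have a2 : σ₃.reg 2 = I.pm := by simp [hs₃.reg 2 rfl, hs₂.reg 2 rfl, hq₁]
    have a3 : σ₃.reg 3 = I.LW := by simp [hs₃.reg 3 rfl, hq₂, LW]
    have a4 : σ₃.reg 4 = I.LP := by simp [hq₃, LP]
    refine Run.assign hw (by simp [a0, a1, a2]; omega)
      (Run.seq (Det.bits hw (by norm_num) ?_ h_sum h2w) fun σ₄ hs₄ hq₄ => ?_)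
    · simp [a0, a1, a2]
    have b5 : σ₄.reg 5 = I.ell := by simp [hq₄, ell]
    refine Run.assign hw (by simp [hs₄.reg 3 rfl, hs₄.reg 4 rfl, a3, a4]; exact h_C)
      (Run.assign hw (by simp [b5]; simp only [hL]; omega)
      (Run.assign hw ?_ (Run.last (Det.pow2 hw (by norm_num) (m := I.Q₀) ?_ hQQ) fun σ₅ hs₅ hq₅ => ?_)))
    · simp [b5, hL]
      omega
    · simp [b5]; rfl
    · have b : ∀ x < 5, σ₅.reg x = σ₃.reg x := by
        intro x hx
        interval_cases x
        · simp [hs₅.reg 0 rfl, hs₄.reg 0 rfl]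
        · simp [hs₅.reg 1 rfl, hs₄.reg 1 rfl]
        · simp [hs₅.reg 2 rfl, hs₄.reg 2 rfl]
        · simp [hs₅.reg 3 rfl, hs₄.reg 3 rfl]
        · simp [hs₅.reg 4 rfl, hs₄.reg 4 rfl]
      refine ⟨?_, ⟨fun t => ?_, fun t => ?_, ?_⟩, by simp [b, a0], by simp [b, a1], by simp [b, a2],
        by simp [b, a3], by simp [b, a4], by simp [hs₅.reg 5 rfl, b5],
        by simp [hs₅.reg 6 rfl, b5]; rfl, by simp [hq₅]; rfl,
        by simp [hs₅.reg 8 rfl, hs₄.reg 3 rfl, hs₄.reg 4 rfl, a3, a4]; rfl⟩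
      · clear * -
        simp only [RamExpr.cost, LW, LP, ell]
        omega
      · simp [hs₅.rd (a := 0) rfl, hs₄.rd (a := 0) rfl, hs₃.rd (a := 0) rfl, hs₂.rd (a := 0) rfl,
          hs₁.rd (a := 0) rfl, hI.rd0]
      · simp [hs₅.rd (a := 1) rfl, hs₄.rd (a := 1) rfl, hs₃.rd (a := 1) rfl, hs₂.rd (a := 1) rfl,
          hs₁.rd (a := 1) rfl, hI.rd1]
      · simp [hs₅.ln (a := 0) rfl, hs₄.ln (a := 0) rfl, hs₃.ln (a := 0) rfl, hs₂.ln (a := 0) rfl,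
          hs₁.ln (a := 0) rfl, hI.ln0]

end KP

namespace KP
variable {I : KP} {w : ℕ}

/-- The items are classified. -/
structure Classes (I : KP) (σ : St) : Prop extends I.Sizes σ where
  rd3 : ∀ t, σ.rd 3 t = I.ci t
  rd4 : ∀ c, σ.rd 4 c = I.cnt c
  ln12 : σ.ln 12 = I.n
  rd12 : ∀ t, σ.rd 12 t = if t < I.n ∧ I.wt t = 0 then 1 else 0

theorem Valid.p_le {t : ℕ} (h : I.Valid t) : I.p t ≤ I.pm := by
  have := Finset.le_sup (f := fun t => if I.wt t ≤ I.W then I.p t else 0)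
    (Finset.mem_range.2 h.1)
  simp only [h.2.2.1, if_true] at this
  exact this

theorem Valid.cls_lt {t : ℕ} (h : I.Valid t) : I.cls t < I.C := by
  have h1 : Nat.size (I.wt t) ≤ I.LW := Nat.size_le_size h.2.2.1
  have h2 : Nat.size (I.p t) ≤ I.LP := Nat.size_le_size h.p_le
  have h3 : 1 ≤ Nat.size (I.wt t) := Nat.size_pos.2 h.2.1
  have h4 : 1 ≤ Nat.size (I.p t) := Nat.size_pos.2 h.2.2.2
  unfold cls C
  calc (Nat.size (I.wt t) - 1) * I.LP + (Nat.size (I.p t) - 1)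
      < (Nat.size (I.wt t) - 1) * I.LP + I.LP := by omega
    _ = (Nat.size (I.wt t) - 1 + 1) * I.LP := by ring
    _ ≤ I.LW * I.LP := Nat.mul_le_mul_right _ (by omega)

/-- The number of items below `k` in class `c`. -/
def cntBelow (I : KP) (k c : ℕ) : ℕ := ((Finset.range k).filter fun t => I.ci t = c + 1).card

theorem cntBelow_succ (k c : ℕ) :
    I.cntBelow (k + 1) c = I.cntBelow k c + if I.ci k = c + 1 then 1 else 0 := by
  unfold cntBelow
  rw [Finset.range_add_one, Finset.filter_insert]
  split
  · rw [Finset.card_insert_of_notMem (by simp)]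
  · rfl

theorem cntBelow_le (k c : ℕ) : I.cntBelow k c ≤ k :=
  (Finset.card_filter_le _ _).trans (by simp)

theorem classes_loop (hF : I.Fits w) {σ : St} (hI : I.Sizes σ) :
    Det w classesProg σ (100 + 2 * I.n + I.C + I.n * (16 * (I.LW + I.LP) + 100)) I.Classes := by
  have hw := hF.hw
  have h_sum := hF.h_sum
  have h_C := hF.h_C
  have h2w := hF.two_lt
  unfold classesProg
  apply Run.det
  refine Run.alloc hw (by simp) (Run.alloc hw (by simp) (Run.alloc hw (by simp) ?_))
  have hI' : I.Sizes (((σ.al 3 I.n).al 4 I.C).al 12 I.n) :=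
    ⟨⟨by simpa using hI.rd0, by simpa using hI.rd1, by simpa using hI.ln0⟩, by simp [hI.r0],
      by simp [hI.r1], by simp [hI.r2], by simp [hI.r3], by simp [hI.r4], by simp [hI.r5],
      by simp [hI.r6], by simp [hI.r7], by simp [hI.r8]⟩
  simp only [RamExpr.val, St.reg_al, hI.r0, hI.r8]
  refine Run.last (Det.for hw (fun _ => 16 * (I.LW + I.LP) + 90) (fun k σ' =>
    σ'.ln 3 = I.n ∧ σ'.ln 4 = I.C ∧ σ'.ln 12 = I.n ∧
    (∀ t, σ'.rd 3 t = if t < k then I.ci t else 0) ∧ (∀ c, σ'.rd 4 c = I.cntBelow k c) ∧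
    (∀ t, σ'.rd 12 t = if t < k ∧ I.wt t = 0 then 1 else 0))
    hI'.r0 (by omega) (by norm_num) rfl rfl ?_ ?_) ?_
  · simp [cntBelow]
  · intro k hk σ' hS hk' hinv
    obtain ⟨l3, l4, l12, i3, i4, i12⟩ := hinv
    have hI' := hI'.of_same hS (fun a ha => by interval_cases a <;> rfl)
      (fun a ha => by interval_cases a <;> rfl)
    clear hI hS
    -- the invariant after an item that does not need to be decided
    have skip_case : ¬ I.Valid k → I.wt k ≠ 0 →
        (σ'.setR 20 (k + 1)).ln 3 = I.n ∧ (σ'.setR 20 (k + 1)).ln 4 = I.C ∧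
        (σ'.setR 20 (k + 1)).ln 12 = I.n ∧
        (∀ t, (σ'.setR 20 (k + 1)).rd 3 t = if t < k + 1 then I.ci t else 0) ∧
        (∀ c, (σ'.setR 20 (k + 1)).rd 4 c = I.cntBelow (k + 1) c) ∧
        (∀ t, (σ'.setR 20 (k + 1)).rd 12 t = if t < k + 1 ∧ I.wt t = 0 then 1 else 0) := by
      intro hv h0
      have hci : I.ci k = 0 := if_neg hv
      refine ⟨l3, l4, l12, fun t => ?_, fun c => ?_, fun t => ?_⟩
      · simp only [St.rd_setR, i3]
        rcases lt_trichotomy t k with h | h | h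
        · simp [h, h.trans (Nat.lt_succ_self k)]
        · subst h; simp [hci]
        · simp [show ¬ t < k by omega, show ¬ t < k + 1 by omega]
      · simp [i4, cntBelow_succ, hci]
      · simp only [St.rd_setR, i12]
        rcases lt_trichotomy t k with h | h | h
        · simp [h, h.trans (Nat.lt_succ_self k)]
        · subst h; simp [h0]
        · simp [show ¬ t < k by omega, show ¬ t < k + 1 by omega]
    refine (Det.ite (t := 16 * (I.LW + I.LP) + 85) hw (by simp) (fun h => ?_) fun h => ?_).mono
      (by simp only [RamExpr.cost]; omega) fun _ _ h => h
    · refine Det.straight_le (c := .skip) hw (by simp [RamProg.scost]) ?_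
      have h : I.W < I.wt k := by simpa [hI'.r1, hk', hI'.rd1] using h
      refine skip_case (fun hv => absurd hv.2.2.1 (by omega)) (by omega)
    have hle : I.wt k ≤ I.W := by simpa [hI'.r1, hk', hI'.rd1] using h
    refine (Det.ite (t := 16 * (I.LW + I.LP) + 80) hw (by simp) (fun h => ?_) fun h => ?_).mono
      (by simp only [RamExpr.cost]; omega) fun _ _ h => h
    · have h0 : I.wt k ≠ 0 := by simpa [hk', hI'.rd1] using h
      refine (Det.ite (t := 16 * (I.LW + I.LP) + 75) hw (by simp) (fun h => ?_) fun h => ?_).mono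
        (by simp only [RamExpr.cost]; omega) fun _ _ h => h
      · have hp0 : I.p k ≠ 0 := by simpa [hk', hI'.rd0] using h
        have hv : I.Valid k := ⟨hk, by omega, hle, by omega⟩
        have hcl := hv.cls_lt
        have hci : I.ci k = I.cls k + 1 := if_pos hv
        have hpl := hv.p_le
        have hsw : Nat.size (I.wt k) ≤ I.LW := Nat.size_le_size hle
        have hsp : Nat.size (I.p k) ≤ I.LP := Nat.size_le_size hv.p_le
        have hLW : I.LW ≤ I.W := Nat.size_le.2 Nat.lt_two_pow_self
        have hLP : I.LP ≤ I.pm := Nat.size_le.2 Nat.lt_two_pow_self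
        have hprod : (Nat.size (I.wt k) - 1) * I.LP ≤ I.cls k := Nat.le_add_right _ _
        have hcnt := I.cntBelow_le k (I.cls k)
        apply Run.det
        refine Run.assign hw (by simp) (Run.seq (Det.bits hw (by norm_num) (m := I.wt k) ?_
          (by omega) h2w) fun σ₁ hs₁ hq₁ => ?_)
        · simp [hk', hI'.rd1]
        refine Run.assign hw (by simp) (Run.seq (Det.bits hw (by norm_num) (m := I.p k) ?_
          (by omega) h2w) fun σ₂ hs₂ hq₂ => ?_)
        · simp [hs₁.reg 20 rfl, hs₁.rd (a := 0) rfl, hk', hI'.rd0]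
        refine Run.straight hw ?_
        have e22 : σ₂.reg 22 = Nat.size (I.wt k) := by simp [hs₂.reg 22 rfl, hq₁]
        have e4 : σ₂.reg 4 = I.LP := by simp [hs₂.reg 4 rfl, hs₁.reg 4 rfl, hI'.r4]
        have e20 : σ₂.reg 20 = k := by simp [hs₂.reg 20 rfl, hs₁.reg 20 rfl, hk']
        have r3 : ∀ t, σ₂.rd 3 t = if t < k then I.ci t else 0 := fun t => by
          simp [hs₂.rd (a := 3) rfl, hs₁.rd (a := 3) rfl, i3]
        have r4 : ∀ t, σ₂.rd 4 t = I.cntBelow k t := fun t => by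
          simp [hs₂.rd (a := 4) rfl, hs₁.rd (a := 4) rfl, i4]
        have r12 : ∀ t, σ₂.rd 12 t = if t < k ∧ I.wt t = 0 then 1 else 0 := fun t => by
          simp [hs₂.rd (a := 12) rfl, hs₁.rd (a := 12) rfl, i12]
        have m3 : σ₂.ln 3 = I.n := by simp [hs₂.ln (a := 3) rfl, hs₁.ln (a := 3) rfl, l3]
        have m4 : σ₂.ln 4 = I.C := by simp [hs₂.ln (a := 4) rfl, hs₁.ln (a := 4) rfl, l4]
        have m12 : σ₂.ln 12 = I.n := by simp [hs₂.ln (a := 12) rfl, hs₁.ln (a := 12) rfl, l12]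
        have ecls : (Nat.size (I.wt k) - 1) * I.LP + (Nat.size (I.p k) - 1) = I.cls k := rfl
        simp [e22, e4, e20, hq₂, m3, m4, m12, ecls, r4]
        refine ⟨by omega, by omega, by omega, ?_, fun t => ?_, fun c => ?_, fun t => ?_⟩
        · simp only [RamProg.scost, RamExpr.cost]; clear * - hsw hsp; omega
        · rw [r3]
          rcases lt_trichotomy t k with h | h | h
          · simp [h, h.le, h.ne]
          · subst h; simp [hci, hk]
          · simp [show ¬ t < k by omega, show ¬ t ≤ k by omega, h.ne']
        · rw [cntBelow_succ, hci]
          by_cases h : c = I.cls k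
          · subst h; simp [hcl]
          · simp [h]; exact fun h' => h h'.symm
        · rw [r12]
          rcases lt_trichotomy t k with h | h | h
          · simp [h, h.le]
          · subst h; simp [h0]
          · simp [show ¬ t < k by omega, show ¬ t ≤ k by omega]
      · have hp0 : I.p k = 0 := by simpa [hk', hI'.rd0] using h
        refine Det.straight_le (c := .skip) hw (by simp [RamProg.scost]) ?_
        exact skip_case (fun hv => absurd hv.2.2.2 (by omega)) h0
    · have h0 : I.wt k = 0 := by simpa [hk', hI'.rd1] using h
      have hci : I.ci k = 0 := if_neg fun hv => absurd hv.2.1 (by omega)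
      refine Det.straight_le hw (by simp [RamProg.scost, RamExpr.cost]) ?_
      simp [hk', l3, l4, l12]
      refine ⟨by omega, fun t => ?_, fun c => ?_, fun t => ?_⟩
      · rw [i3]
        rcases lt_trichotomy t k with h | h | h
        · simp [h, h.le]
        · subst h; simp [hci]
        · simp [show ¬ t < k by omega, show ¬ t ≤ k by omega]
      · simp [i4, cntBelow_succ, hci]
      · rw [i12]
        rcases lt_trichotomy t k with h | h | h
        · simp [h, h.le, h.ne]
        · subst h; simp [h0, hk]
        · simp [show ¬ t < k by omega, show ¬ t ≤ k by omega, h.ne']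
  · intro σ' hS hq
    refine ⟨?_, hI'.of_same hS (fun a ha => by interval_cases a <;> rfl)
      (fun a ha => by interval_cases a <;> rfl), fun t => ?_, hq.2.2.2.2.2.1, hq.2.2.2.1,
      hq.2.2.2.2.2.2⟩
    · clear * -
      simp [RamExpr.cost, mul_add]
      ring_nf
      omega
    · rw [hq.2.2.2.2.1 t]
      split
      · rfl
      · rename_i h; exact (if_neg fun hv => h hv.1).symm

end KP

namespace KP
variable {I : KP} {w : ℕ}

theorem Classes.of_same {c : RamProg} {σ σ' : St} (h : I.Classes σ) (hs : SameOn c σ σ')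
    (ha : ∀ a < 5, modA c a = false) (ha' : modA c 12 = false) (hr : ∀ x < 9, modR c x = false) :
    I.Classes σ' where
  toSizes := h.toSizes.of_same hs (fun a h => ha a (by omega)) hr
  rd3 t := by rw [hs.rd (ha 3 (by norm_num)), h.rd3]
  rd4 t := by rw [hs.rd (ha 4 (by norm_num)), h.rd4]
  ln12 := by rw [hs.ln ha', h.ln12]
  rd12 t := by rw [hs.rd ha', h.rd12]

/-- The sizes of the classes are known. -/
structure Buckets (I : KP) (σ : St) : Prop extends I.Classes σ where
  rd5 : ∀ c, σ.rd 5 c = if c < I.C then I.M c else 0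
  rd6 : ∀ c, σ.rd 6 c = if c < I.C then I.u c else 0
  r12 : σ.reg 12 = I.ntop

theorem clog_z_le (c : ℕ) : Nat.clog 2 (I.z c) ≤ I.LW := by
  refine Nat.clog_le_of_le_pow ?_
  have h1 : I.z c ≤ I.W := (min_le_right _ _).trans (Nat.div_le_self _ _)
  exact h1.trans (Nat.lt_size_self _).le

theorem buckets_loop (hF : I.Fits w) {σ : St} (hI : I.Classes σ) :
    Det w bucketsProg σ (30 + 2 * I.C + I.C * (8 * I.LW + 120)) I.Buckets := by
  have hw := hF.hw
  have h_sum := hF.h_sum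
  have h_C := hF.h_C
  have h_ntop := hF.h_ntop
  have h2w := hF.two_lt
  unfold bucketsProg
  apply Run.det
  refine Run.alloc hw (by simp) (Run.alloc hw (by simp) (Run.assign hw ?_ ?_))
  · simp [hI.r1]; omega
  have hI' : I.Classes (((σ.al 5 I.C).al 6 I.C).setR 12 (I.W + 1)) :=
    ⟨⟨⟨by simpa using hI.rd0, by simpa using hI.rd1, by simpa using hI.ln0⟩, by simp [hI.r0],
      by simp [hI.r1], by simp [hI.r2], by simp [hI.r3], by simp [hI.r4], by simp [hI.r5],
      by simp [hI.r6], by simp [hI.r7], by simp [hI.r8]⟩, by simpa using hI.rd3,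
      by simpa using hI.rd4, by simpa using hI.ln12, by simpa using hI.rd12⟩
  simp only [RamExpr.val, St.reg_al, hI.r1, hI.r8, BinOp.apply]
  refine Run.last (Det.for hw (fun _ => 8 * I.LW + 110) (fun k σ' =>
    σ'.ln 5 = I.C ∧ σ'.ln 6 = I.C ∧ (∀ c, σ'.rd 5 c = if c < k then I.M c else 0) ∧
    (∀ c, σ'.rd 6 c = if c < k then I.u c else 0) ∧
    σ'.reg 12 = I.W + 1 + ∑ c ∈ Finset.range k, I.z c * I.u c)
    hI'.r8 h_C (by norm_num) rfl rfl ?_ ?_) ?_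
  · simp
  · intro k hk σ' hS hk' hinv
    obtain ⟨l5, l6, i5, i6, i12⟩ := hinv
    have hI' := hI'.of_same hS (fun a ha => by interval_cases a <;> rfl) rfl
      (fun a ha => by interval_cases a <;> rfl)
    clear hI hS
    have hsum : I.W + 1 + ∑ c ∈ Finset.range k, I.z c * I.u c + I.z k * I.u k ≤ I.ntop := by
      rw [add_assoc, ← Finset.sum_range_succ]
      exact Nat.add_le_add_left (Finset.sum_le_sum_of_subset
        (Finset.range_subset_range.2 (by omega))) _
    have hshr : I.W >>> (k / I.LP) = I.W / 2 ^ (k / I.LP) := Nat.shiftRight_eq_div_pow _ _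
    have hcnt : I.cntBelow I.n k ≤ I.n := I.cntBelow_le _ _
    have hz : I.cnt k - (I.cnt k - I.W / 2 ^ (k / I.LP)) = I.z k := by
      unfold z; generalize I.W / 2 ^ (k / I.LP) = D; omega
    have hdiv : I.W / 2 ^ (k / I.LP) ≤ I.W := Nat.div_le_self _ _
    have hcnt' : I.cnt k ≤ I.n := hcnt
    have hkl : k / I.LP ≤ k := Nat.div_le_self _ _
    have hkm : k % I.LP ≤ k := Nat.mod_le _ _
    have hu : 2 <<< (k / I.LP + (k % I.LP - k / I.LP)) = I.u k := by
      rw [Nat.shiftLeft_eq, u]; congr 2; omega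
    have hM := hF.h_M k hk
    have hul := hF.h_u k hk
    have hcl := I.clog_z_le k
    apply Run.det
    refine Run.assign hw ?_ (Run.assign hw ?_ (Run.assign hw ?_ (Run.assign hw ?_ (Run.seq
      (Det.pow2 hw (by norm_num) (m := I.z k) ?_ hM) fun σ₁ hs₁ hq₁ => Run.straight hw ?_))))
    · simp [hk', hI'.r4]; omega
    · simp [hk', hI'.r4]; omega
    · simp [hk', hI'.r4, hI'.r1, hshr]; omega
    · have hzn : I.z k < 2 ^ w := by
        have : I.z k ≤ I.cnt k := min_le_left _ _
        omega
      simp [hk', hI'.r4, hI'.r1, hshr, hI'.rd4, hz, hzn]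
      exact (Nat.sub_le _ _).trans_lt (by omega)
    · simp [hk', hI'.r4, hI'.r1, hshr, hI'.rd4, hz]
    have e21 : σ₁.reg 21 = k / I.LP := by simp [hs₁.reg 21 rfl, hk', hI'.r4]
    have e22 : σ₁.reg 22 = k % I.LP := by simp [hs₁.reg 22 rfl, hk', hI'.r4]
    have e23 : σ₁.reg 23 = I.z k := by
      simp [hs₁.reg 23 rfl, hk', hI'.r4, hI'.r1, hshr, hI'.rd4, hz]
    have e24 : σ₁.reg 24 = I.M k := hq₁
    have e20 : σ₁.reg 20 = k := by simp [hs₁.reg 20 rfl, hk']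
    have e12 : σ₁.reg 12 = I.W + 1 + ∑ c ∈ Finset.range k, I.z c * I.u c := by
      simp [hs₁.reg 12 rfl, i12]
    have m5 : σ₁.ln 5 = I.C := by simp [hs₁.ln (a := 5) rfl, l5]
    have m6 : σ₁.ln 6 = I.C := by simp [hs₁.ln (a := 6) rfl, l6]
    have d5 : ∀ c, σ₁.rd 5 c = if c < k then I.M c else 0 := fun c => by
      simp [hs₁.rd (a := 5) rfl, i5]
    have d6 : ∀ c, σ₁.rd 6 c = if c < k then I.u c else 0 := fun c => by
      simp [hs₁.rd (a := 6) rfl, i6]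
    simp [e20, e21, e22, e23, e24, e12, m5, m6, hu]
    refine ⟨by omega, by omega, ?_, fun c => ?_, fun c => ?_, ?_⟩
    · simp only [RamProg.scost, RamExpr.cost]; clear * - hcl; omega
    · rw [d5]
      rcases lt_trichotomy c k with h | h | h
      · simp [h, h.le, h.ne]
      · subst h; simp [hk]
      · simp [show ¬ c < k by omega, show ¬ c ≤ k by omega, h.ne']
    · rw [d6]
      rcases lt_trichotomy c k with h | h | h
      · simp [h, h.le, h.ne]
      · subst h; simp [hk]
      · simp [show ¬ c < k by omega, show ¬ c ≤ k by omega, h.ne']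
    · rw [Finset.sum_range_succ]; ring
  · intro σ' hS hq
    refine ⟨?_, hI'.of_same hS (fun a ha => by interval_cases a <;> rfl) rfl
      (fun a ha => by interval_cases a <;> rfl), hq.2.2.2.1, hq.2.2.2.2.1, hq.2.2.2.2.2⟩
    clear * -
    simp [RamExpr.cost, mul_add]
    ring_nf
    omega

end KP

namespace KP
variable {I : KP} {w : ℕ}

theorem Buckets.of_same {c : RamProg} {σ σ' : St} (h : I.Buckets σ) (hs : SameOn c σ σ')
    (ha : ∀ a < 7, modA c a = false) (ha' : modA c 12 = false) (hr : ∀ x < 9, modR c x = false)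
    (hr' : modR c 12 = false) : I.Buckets σ' where
  toClasses := h.toClasses.of_same hs (fun a h => ha a (by omega)) ha' hr
  rd5 t := by rw [hs.rd (ha 5 (by norm_num)), h.rd5]
  rd6 t := by rw [hs.rd (ha 6 (by norm_num)), h.rd6]
  r12 := by rw [hs.reg _ hr', h.r12]

/-- The tree is laid out in memory. -/
structure Layout (I : KP) (σ : St) : Prop extends I.Buckets σ where
  r9 : σ.reg 9 = I.G
  r10 : σ.reg 10 = I.N
  r11 : σ.reg 11 = 2 * I.N
  r13 : σ.reg 13 = I.Mx
  r14 : σ.reg 14 = I.off 0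
  r15 : σ.reg 15 = I.G * I.Q
  r16 : σ.reg 16 = 2 * I.N - 1
  rd8 : ∀ v, 1 ≤ v → v < 2 * I.N → σ.rd 8 v = I.sz v
  rd9 : ∀ v, 1 ≤ v → v < 2 * I.N → σ.rd 9 v = I.off v

theorem Layout.of_same {c : RamProg} {σ σ' : St} (h : I.Layout σ) (hs : SameOn c σ σ')
    (ha : ∀ a < 10, a ≠ 7 → modA c a = false) (ha' : modA c 12 = false)
    (hr : ∀ x < 17, modR c x = false) : I.Layout σ' where
  toBuckets := h.toBuckets.of_same hs (fun a h => ha a (by omega) (by omega)) ha'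
    (fun x h => hr x (by omega)) (hr 12 (by norm_num))
  r9 := by rw [hs.reg _ (hr _ (by norm_num)), h.r9]
  r10 := by rw [hs.reg _ (hr _ (by norm_num)), h.r10]
  r11 := by rw [hs.reg _ (hr _ (by norm_num)), h.r11]
  r13 := by rw [hs.reg _ (hr _ (by norm_num)), h.r13]
  r14 := by rw [hs.reg _ (hr _ (by norm_num)), h.r14]
  r15 := by rw [hs.reg _ (hr _ (by norm_num)), h.r15]
  r16 := by rw [hs.reg _ (hr _ (by norm_num)), h.r16]
  rd8 v h1 h2 := by rw [hs.rd (ha 8 (by norm_num) (by norm_num)), h.rd8 v h1 h2]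
  rd9 v h1 h2 := by rw [hs.rd (ha 9 (by norm_num) (by norm_num)), h.rd9 v h1 h2]

theorem pow2_pos (s : ℕ) : 0 < pow2 s := by unfold pow2; positivity
theorem Q_pos : 0 < I.Q := pow2_pos _
theorem G_pos : 0 < I.G := Nat.succ_pos _
theorem N_pos : 0 < I.N := Nat.mul_pos (Nat.mul_pos I.G_pos I.Q_pos) I.Q_pos
theorem Mx_pos : 0 < I.Mx := Nat.succ_pos _

theorem sz_inner {v : ℕ} (h1 : 1 ≤ v) (h2 : v < I.N) :
    I.sz v = min I.ntop (I.sz (2 * v) + I.sz (2 * v + 1)) := by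
  rw [sz, if_pos ⟨h1, h2⟩]

theorem sz_leaf {v : ℕ} (h : I.N ≤ v) : I.sz v = min I.ntop (I.leafSz (v - I.N)) := by
  rw [sz, if_neg (by omega)]

theorem sz_le_ntop (v : ℕ) : I.sz v ≤ I.ntop := by
  rw [sz]; split <;> exact min_le_left _ _

theorem off_pred {v : ℕ} (h1 : 1 ≤ v) (h2 : v < 2 * I.N) :
    I.off (v - 1) = I.off v + (I.sz v + 1) := by
  unfold off
  have : Finset.Ioo (v - 1) (2 * I.N) = insert v (Finset.Ioo v (2 * I.N)) := by
    ext x; simp only [Finset.mem_Ioo, Finset.mem_insert]; omega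
  rw [this, Finset.sum_insert (by simp), add_comm]

theorem off_le {v v' : ℕ} (h : v ≤ v') : I.off v' ≤ I.off v :=
  Finset.sum_le_sum_of_subset fun x hx => by
    simp only [Finset.mem_Ioo] at *; omega

theorem off_last : I.off (2 * I.N - 1) = 0 := by
  unfold off
  rw [Finset.sum_eq_zero]
  intro x hx; simp only [Finset.mem_Ioo] at hx; omega

theorem leafSz_eq (l : ℕ) : I.leafSz l =
    if l / (I.Q * I.Q) % I.Mx <
      (if l / (I.Q * I.Q) / I.Mx < I.C then I.M (l / (I.Q * I.Q) / I.Mx) else 0) then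
    (if l / (I.Q * I.Q) / I.Mx < I.C then I.u (l / (I.Q * I.Q) / I.Mx) else 0) else 1 := by
  unfold leafSz
  by_cases h : l / (I.Q * I.Q) / I.Mx < I.C <;> simp [h]

theorem leafSz_lt (hF : I.Fits w) (l : ℕ) : I.leafSz l < 2 ^ w := by
  have := hF.two_lt
  unfold leafSz
  split
  · rename_i h; exact hF.h_u _ h.1
  · omega

theorem layout (hF : I.Fits w) {σ : St} (hI : I.Buckets σ) :
    Det w layoutProg σ (100 + 300 * I.N) I.Layout := by
  have hw := hF.hw
  have h_sum := hF.h_sum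
  have h_N := hF.h_N
  have h_QQ := hF.h_Q
  have h_ntop := hF.h_ntop
  have h_off := hF.h_off
  have h2w := hF.two_lt
  have hGN : I.G * I.Q ≤ I.N := Nat.le_mul_of_pos_right _ I.Q_pos
  have hG : I.G ≤ I.G * I.Q := Nat.le_mul_of_pos_right _ I.Q_pos
  have hN0 := I.N_pos
  have hMx0 := I.Mx_pos
  have hG' : I.G = I.C * I.Mx + 1 := rfl
  have hMx : I.Mx = I.W + I.W + 1 := by unfold Mx; ring
  have hMxw : I.C * I.Mx + 1 < 2 ^ w := by omega
  have hntop' : I.W < I.ntop := by unfold ntop; omega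
  have eN : I.N = I.G * I.Q * I.Q := rfl
  unfold layoutProg
  apply Run.det
  refine Run.assign hw ?_ (Run.assign hw ?_ (Run.assign hw ?_ (Run.assign hw ?_ (Run.assign hw ?_
    (Run.assign hw ?_ (Run.alloc hw ?_ (Run.alloc hw ?_ (Run.assign hw ?_ ?_))))))))
  · simp [hI.r1]; omega
  · simp [hI.r1, hI.r8, ← hMx]; omega
  · simp [hI.r1, hI.r8, ← hMx, ← hG', hI.r7]; omega
  · simp [hI.r1, hI.r8, ← hMx, ← hG', hI.r7, ← eN]; omega
  · simp [hI.r1, hI.r8, ← hMx, ← hG', hI.r7, ← eN]; omega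
  · simp [hI.r1, hI.r8, ← hMx, ← hG', hI.r7, ← eN]; omega
  · simp
  · simp
  · simp
  simp only [RamExpr.val, St.reg_al, St.reg_setR, hI.r1, hI.r8, hI.r7, BinOp.apply]
  simp [← hMx, ← hG', ← eN]
  generalize hτ : ((((((((σ.setR 13 I.Mx).setR 9 I.G).setR 15 (I.G * I.Q)).setR 10 I.N).setR 11
    (I.N + I.N)).setR 16 (I.N + I.N - 1)).al 8 (I.N + I.N)).al 9 (I.N + I.N)).setR 14 0 = τ
  have hI' : I.Buckets τ := by
    subst hτ
    exact ⟨⟨⟨⟨by simpa using hI.rd0, by simpa using hI.rd1, by simpa using hI.ln0⟩, by simp [hI.r0],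
      by simp [hI.r1], by simp [hI.r2], by simp [hI.r3], by simp [hI.r4], by simp [hI.r5],
      by simp [hI.r6], by simp [hI.r7], by simp [hI.r8]⟩, by simpa using hI.rd3,
      by simpa using hI.rd4, by simpa using hI.ln12, by simpa using hI.rd12⟩,
      by simpa using hI.rd5, by simpa using hI.rd6, by simp [hI.r12]⟩
  have b9 : τ.reg 9 = I.G := by subst hτ; simp
  have b10 : τ.reg 10 = I.N := by subst hτ; simp
  have b11 : τ.reg 11 = 2 * I.N := by subst hτ; simp; omega
  have b13 : τ.reg 13 = I.Mx := by subst hτ; simp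
  have b14 : τ.reg 14 = 0 := by subst hτ; simp
  have b15 : τ.reg 15 = I.G * I.Q := by subst hτ; simp
  have b16 : τ.reg 16 = 2 * I.N - 1 := by subst hτ; simp; omega
  have l8 : τ.ln 8 = 2 * I.N := by subst hτ; simp; omega
  have l9 : τ.ln 9 = 2 * I.N := by subst hτ; simp; omega
  clear hτ hI
  refine Run.last (Det.for hw (fun _ => 120) (fun k σ' =>
    σ'.ln 8 = 2 * I.N ∧ σ'.ln 9 = 2 * I.N ∧
    (∀ v, 2 * I.N - 1 - k < v → v < 2 * I.N → σ'.rd 8 v = I.sz v) ∧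
    (∀ v, 2 * I.N - 1 - k < v → v < 2 * I.N → σ'.rd 9 v = I.off v) ∧
    σ'.reg 14 = I.off (2 * I.N - 1 - k))
    b16 (by omega) (by norm_num) rfl rfl ?_ ?_) ?_
  · refine ⟨by simp [l8], by simp [l9], fun v h1 h2 => ?_, fun v h1 h2 => ?_, ?_⟩
    · omega
    · omega
    · simp [b14, off_last]
  · intro k hk σ' hS hk' hinv
    obtain ⟨i8, i9, d8, d9, i14⟩ := hinv
    have hI' := hI'.of_same hS (fun a ha => by interval_cases a <;> rfl) rfl
      (fun a ha => by interval_cases a <;> rfl) rfl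
    replace b10 := (hS.reg 10 rfl).trans b10
    replace b13 := (hS.reg 13 rfl).trans b13
    replace b16 := (hS.reg 16 rfl).trans b16
    clear hS l8 l9 b9 b11 b14 b15
    obtain ⟨v, hv⟩ : ∃ v, v = 2 * I.N - 1 - k := ⟨_, rfl⟩
    have hv1 : 1 ≤ v := by omega
    have hv2 : v < 2 * I.N := by omega
    have hv' : 2 * I.N - 1 - (k + 1) = v - 1 := by omega
    rw [← hv] at d8 d9 i14
    have hoff := off_pred hv1 hv2
    have hoff' := I.off_le (Nat.zero_le (v - 1))
    have hszt := I.sz_le_ntop v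
    have hfin : ∀ σ'' : St, σ''.reg 14 = I.off (v - 1) → σ''.ln 8 = 2 * I.N → σ''.ln 9 = 2 * I.N →
      (∀ x, σ''.rd 8 x = if x = v then I.sz v else σ'.rd 8 x) →
      (∀ x, σ''.rd 9 x = if x = v then I.off v else σ'.rd 9 x) →
      σ''.ln 8 = 2 * I.N ∧ σ''.ln 9 = 2 * I.N ∧
      (∀ x, v - 1 < x → x < 2 * I.N → σ''.rd 8 x = I.sz x) ∧
      (∀ x, v - 1 < x → x < 2 * I.N → σ''.rd 9 x = I.off x) ∧ σ''.reg 14 = I.off (v - 1) := by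
      intro σ'' h1 h2 h3 h4 h5
      refine ⟨h2, h3, fun x hx hx' => ?_, fun x hx hx' => ?_, h1⟩
      · rw [h4]; split
        · simp [*]
        · exact d8 x (by omega) hx'
      · rw [h5]; split
        · simp [*]
        · exact d9 x (by omega) hx'
    rw [hv']
    have hmin : ∀ a, I.ntop - (I.ntop - a) = min I.ntop a := fun a => Nat.sub_sub_eq_min _ _
    suffices h : ∀ P : St → Prop, (∀ σ'' : St, σ''.reg 14 = I.off (v - 1) → σ''.ln 8 = 2 * I.N →
        σ''.ln 9 = 2 * I.N → (∀ x, σ''.rd 8 x = if x = v then I.sz v else σ'.rd 8 x) →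
        (∀ x, σ''.rd 9 x = if x = v then I.off v else σ'.rd 9 x) → P σ'') → Det w _ σ' 120 P from
      h _ fun σ'' h1 h2 h3 h4 h5 => hfin _ (by simpa using h1) h2 h3 h4 h5
    intro P hP
    clear hfin
    refine Det.straight_le hw rfl ?_
    by_cases hvN : v < I.N
    · have e1 := d8 (v + v) (by omega) (by omega)
      have e2 := d8 (v + v + 1) (by omega) (by omega)
      have hsz := sz_inner hv1 hvN
      have t1 := I.sz_le_ntop (v + v)
      have t2 := I.sz_le_ntop (v + v + 1)
      rw [two_mul v] at hsz
      simp [hk', b16, b10, ← hv, hvN, e1, e2, hI'.r12, hmin, ← hsz, i14]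
      repeat' apply And.intro
      any_goals omega
      apply hP <;> simp [i8, i9, hv2, hoff]
    · have hsz := sz_leaf (I := I) (not_lt.1 hvN)
      obtain ⟨l, hl⟩ : ∃ l, l = v - I.N := ⟨_, rfl⟩
      have hll := leafSz_lt hF l
      have hle := I.leafSz_eq l
      rw [← hl] at hsz
      obtain ⟨g, hg⟩ : ∃ g, g = l / (I.Q * I.Q) := ⟨_, rfl⟩
      rw [← hg] at hle
      have hg1 : g ≤ l := hg ▸ Nat.div_le_self _ _
      have hg2 : g % I.Mx ≤ g := Nat.mod_le _ _
      have hg3 : g / I.Mx ≤ g := Nat.div_le_self _ _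
      have hor : g % I.Mx < (if g / I.Mx < I.C then I.M (g / I.Mx) else 0) ∨
        ¬ g % I.Mx < (if g / I.Mx < I.C then I.M (g / I.Mx) else 0) := em _
      simp [hk', b16, b10, ← hv, hvN, hI'.r12, hmin, i14, hI'.r7, ← hl, ← hg, b13,
        hI'.rd5, hI'.rd6]
      rcases hor with hor | hor
      · rw [if_pos hor] at hle
        simp [hor, ← hle, ← hsz]
        repeat' apply And.intro
        any_goals omega
        apply hP <;> simp [i8, i9, hv2, hoff]
      · rw [if_neg hor] at hle
        rw [hle] at hsz
        simp [hor, not_lt.1 hor, ← hsz]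
        repeat' apply And.intro
        any_goals omega
        apply hP <;> simp [i8, i9, hv2, hoff]
  · intro σ' hS hq
    obtain ⟨-, -, -, d8, d9, i14⟩ := hq
    refine ⟨?_, hI'.of_same hS (fun a ha => by interval_cases a <;> rfl) rfl
      (fun a ha => by interval_cases a <;> rfl) rfl, (hS.reg _ rfl).trans b9,
      (hS.reg _ rfl).trans b10, (hS.reg _ rfl).trans b11, (hS.reg _ rfl).trans b13, ?_,
      (hS.reg _ rfl).trans b15, (hS.reg _ rfl).trans b16, fun v h1 h2 => d8 v (by omega) h2,
      fun v h1 h2 => d9 v (by omega) h2⟩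
    · clear * - hN0
      simp [RamExpr.cost]
      omega
    · rw [i14, Nat.sub_self]

end KP

namespace KP
variable {I : KP} {w : ℕ}

/-- All tables of fixed content are in the memory, and the other arrays are allocated. -/
structure Ctx (I : KP) (σ : St) : Prop extends I.Layout σ where
  ln10 : σ.ln 10 = I.off 0
  ln11 : σ.ln 11 = 2 * I.N
  ln7 : σ.ln 7 = I.n
  r17 : σ.reg 17 = I.R

/-- The lengths of the arrays `7`, `10` and `11` are assumed rather than their contents, since
these are written after their allocation. -/
theorem Ctx.of_same {c : RamProg} {σ σ' : St} (h : I.Ctx σ) (hs : SameOn c σ σ')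
    (ha : ∀ a < 10, a ≠ 7 → modA c a = false) (ha' : modA c 12 = false)
    (hr : ∀ x < 18, modR c x = false) (h10 : σ'.ln 10 = σ.ln 10) (h11 : σ'.ln 11 = σ.ln 11)
    (h7 : σ'.ln 7 = σ.ln 7) : I.Ctx σ' where
  toLayout := h.toLayout.of_same hs ha ha' fun x hx => hr x (by omega)
  ln10 := h10.trans h.ln10
  ln11 := h11.trans h.ln11
  ln7 := h7.trans h.ln7
  r17 := by rw [hs.reg _ (hr _ (by norm_num)), h.r17]

theorem memory (hF : I.Fits w) {σ : St} (hI : I.Layout σ) :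
    Det w (memoryProg I.κ) σ (100 + I.off 0 + I.n + 2 * I.N + 16 * Nat.size (2 * I.N)) fun σ' =>
      I.Ctx σ' ∧ (∀ i, σ'.rd 10 i = 0) ∧ (∀ i, σ'.rd 11 i = 0) ∧ ∀ i, σ'.rd 7 i = 0 := by
  have hw := hF.hw
  have h_R := hF.h_R
  have h_κ := hF.h_κ
  have h_N := hF.h_N
  have h2w := hF.two_lt
  have eR : I.R = 13 * (Nat.size (2 * I.N) + I.κ * I.ell) := rfl
  unfold memoryProg
  apply Run.det
  refine Run.alloc hw (by simp) (Run.alloc hw (by simp) (Run.alloc hw (by simp)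
    (Run.assign hw (by simp) (Run.seq (Det.bits hw (by norm_num) (m := 2 * I.N) ?_ ?_ h2w)
    fun σ₁ hs₁ hq₁ => Run.straight hw ?_))))
  · simp [hI.r11]
  · omega
  have e5 : σ₁.reg 5 = I.ell := by simp [hs₁.reg 5 rfl, hI.r5]
  have hs : ∀ x < 20, x ≠ 17 → σ₁.reg x = σ.reg x := by
    intro x hx hx'
    interval_cases x <;> first
      | exact absurd rfl hx'
      | (rw [hs₁.reg _ rfl]; simp)
  have hr : ∀ a, a < 20 → a ≠ 7 → a ≠ 10 → a ≠ 11 → ∀ i, σ₁.rd a i = σ.rd a i := by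
    intro a _ h1 h2 h3 i
    rw [hs₁.rd rfl]
    simp [h1, h2, h3]
  have hl : ∀ a, a < 20 → a ≠ 7 → a ≠ 10 → a ≠ 11 → σ₁.ln a = σ.ln a := by
    intro a _ h1 h2 h3
    rw [hs₁.ln rfl]
    simp [h1, h2, h3]
  have hsz : 1 ≤ Nat.size (2 * I.N) := Nat.size_pos.2 (by have := I.N_pos; omega)
  simp [hq₁, e5, ← eR]
  have hz : ∀ a, a = 10 ∨ a = 11 ∨ a = 7 → ∀ i, σ₁.rd a i = 0 := by
    rintro a (rfl | rfl | rfl) i <;> simp [hs₁.rd rfl]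
  refine ⟨by omega, ?_, ⟨⟨⟨⟨⟨⟨?_, ?_, ?_⟩, ?_, ?_, ?_, ?_, ?_, ?_, ?_, ?_, ?_⟩, ?_, ?_, ?_, ?_⟩,
    ?_, ?_, ?_⟩, ?_, ?_, ?_, ?_, ?_, ?_, ?_, ?_, ?_⟩, ?_, ?_, ?_, ?_⟩,
    hz 10 (by simp), hz 11 (by simp), hz 7 (by simp)⟩
  · rw [hI.r14, hI.r11, hI.r0]
    clear * -
    simp only [RamProg.scost, RamExpr.cost]
    omega
  all_goals simp [hs, hr, hl, hI.rd0, hI.rd1, hI.ln0, hI.r0, hI.r1, hI.r2, hI.r3, hI.r4, hI.r5,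
    hI.r6, hI.r7, hI.r8, hI.rd3, hI.rd4, hI.ln12, hI.rd12, hI.rd5, hI.rd6, hI.r12, hI.r9, hI.r10,
    hI.r11, hI.r13, hI.r14, hI.r15, hI.r16]
  · exact hI.rd8
  · exact hI.rd9
  all_goals simp [hs₁.ln rfl, hI.r14, hI.r11, hI.r0]

end KP

section Rules
variable {w : ℕ} {c d : RamProg} {σ : St} {t t₁ t₂ : ℕ} {Q R : St → Prop} {f g : St → ℝ} {v : ℝ}

theorem Det.seq_rt (h : Det w c σ t₁ R)
    (h' : ∀ σ', SameOn c σ σ' → R σ' → RT w d σ' t₂ Q g v) : RT w (.seq c d) σ (t₁ + t₂) Q g v :=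
  (h.rt (f := fun _ => v) (v := v) fun _ _ _ => le_rfl).seq h'

theorem RT.assign (hw : 1 ≤ w) {x : ℕ} {e : RamExpr} (he : e.ok w σ)
    (h : RT w d (σ.setR x (e.val σ)) t Q f v) :
    RT w (.seq (.assign x e) d) σ (e.cost + 1 + t) Q f v :=
  Det.seq_rt (Det.straight (c := .assign x e) (Q := fun σ' => σ' = σ.setR x (e.val σ)) hw
    ⟨he, rfl⟩) fun σ' _ h' => by rw [h']; exact h

end Rules

/-- Toss coins until register `23` is uniformly distributed below the power of two in register
`22`. -/
theorem RT.uniform {w : ℕ} (hw : 1 ≤ w) {σ : St} {j : ℕ} (h22 : σ.reg 22 = 2 ^ j)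
    (h23 : σ.reg 23 = 0) (h24 : σ.reg 24 = 1) (hj : 2 ^ j < 2 ^ w) (F : ℕ → ℝ) :
    RT w (.loop (§ 24 <ʷ § 22) (.flip 25 ;; 23 ⇐ § 23 +ʷ § 23 +ʷ § 25 ;; 24 ⇐ § 24 +ʷ § 24)) σ
      (20 * j + 4) (fun σ' => σ'.reg 23 < 2 ^ j) (fun σ' => F (σ'.reg 23))
      ((∑ x ∈ Finset.range (2 ^ j), F x) / 2 ^ j) := by
  have h := RT.while hw (e := § 24 <ʷ § 22)
    (c := .flip 25 ;; 23 ⇐ § 23 +ʷ § 23 +ʷ § 25 ;; 24 ⇐ § 24 +ʷ § 24) (tb := 11)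
    (I := fun r σ' => ∃ i, i + r = j ∧ σ'.reg 24 = 2 ^ i ∧ σ'.reg 23 < 2 ^ i ∧ σ'.reg 22 = 2 ^ j)
    (f := fun r σ' => (∑ x ∈ Finset.range (2 ^ r), F (σ'.reg 23 * 2 ^ r + x)) / 2 ^ r)
    (by simp) ?_ ?_ j σ ⟨0, by omega, by simp [h24], by simp [h23], h22⟩
  · refine h.mono ?_ ?_ ?_ ?_
    · simp [RamExpr.cost]; omega
    · rintro σ' - ⟨i, hi, h1, h2, h3⟩
      obtain rfl : i = j := by omega
      exact h2
    · intro σ' _ _; simp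
    · simp [h23]
  · rintro σ' ⟨i, hi, h1, h2, h3⟩
    obtain rfl : i = j := by omega
    simp [h1, h3]
  · rintro r σ' ⟨i, hi, h1, h2, h3⟩
    have hp : 2 ^ (i + 1) = 2 * 2 ^ i := by rw [pow_succ, mul_comm]
    have hle : 2 ^ (i + 1) ≤ 2 ^ j := Nat.pow_le_pow_right (by norm_num) (by omega)
    refine ⟨?_, ?_⟩
    · have : 2 ^ i < 2 ^ j := by have := Nat.two_pow_pos i; omega
      simp [h1, h3, this]
    refine (RT.seq (t₁ := 1) (t₂ := 10) (RT.flip hw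
      (Q := fun σ'' => (∃ e < 2, σ'' = σ'.setR 25 e))
      (f := fun σ'' => (∑ x ∈ Finset.range (2 ^ r), F ((2 * σ''.reg 23 + σ''.reg 25) * 2 ^ r + x)) /
        2 ^ r) ⟨1, by norm_num, rfl⟩ ⟨0, by norm_num, rfl⟩ le_rfl) ?_).mono (by norm_num)
      (fun _ _ h => h) (fun _ _ _ => le_rfl) ?_
    · rintro _ - ⟨e, he, rfl⟩
      refine (Det.straight_le (Q := fun σ'' => σ''.reg 24 = 2 ^ (i + 1) ∧
        σ''.reg 23 = 2 * σ'.reg 23 + e ∧ σ''.reg 22 = 2 ^ j) hw rfl ?_).rt ?_ |>.mono le_rfl ?_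
        (fun _ _ _ => le_rfl) le_rfl
      · simp [h1, h3]
        omega
      · rintro σ'' - ⟨-, h4, -⟩
        simp [h4]
      · rintro σ'' - ⟨h4, h5, h6⟩
        exact ⟨i + 1, by omega, h4, by omega, h6⟩
    · simp only [St.reg_setR, if_true, Nat.reduceEqDiff, if_false]
      rw [pow_succ 2 r, mul_two (2 ^ r), Finset.sum_range_add, ← add_div, div_div, ← mul_two (2 ^ r)]
      rw [pow_succ]
      refine le_of_eq ?_
      congr 1
      rw [add_comm]
      congr 1 <;> refine Finset.sum_congr rfl fun x _ => ?_ <;> congr 1 <;> ring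

namespace KP
variable {I : KP} {w : ℕ}

theorem M_le_Mx (c : ℕ) : I.M c ≤ I.Mx := by
  have h1 : I.z c ≤ I.W := (min_le_right _ _).trans (Nat.div_le_self _ _)
  unfold M Mx pow2
  rcases Nat.lt_or_ge 1 (I.z c) with h | h
  · have h2 := Nat.pow_pred_clog_lt_self (b := 2) (by norm_num) h
    have h3 : 0 < Nat.clog 2 (I.z c) := Nat.clog_pos (by norm_num) h
    have h4 : 2 ^ Nat.clog 2 (I.z c) = 2 * 2 ^ (Nat.clog 2 (I.z c)).pred := by
      rw [mul_comm, ← pow_succ]; congr 1; have := Nat.succ_pred_eq_of_pos h3; omega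
    omega
  · rw [Nat.clog_of_right_le_one h]; omega

theorem M_pos (c : ℕ) : 0 < I.M c := pow2_pos _

/-! ### The load of the buckets -/

/-- The number of items of `S` below `k` in bucket `g`. -/
def load (S : Finset ℕ) (k : ℕ) (a : ℕ → ℕ) (g : ℕ) : ℕ := (S.filter fun t => t < k ∧ a t = g).card

/-- The number of items of `S` from `k` on in class `c`. -/
def rem (I : KP) (S : Finset ℕ) (k c : ℕ) : ℕ := (S.filter fun t => k ≤ t ∧ I.cls t = c).card

/-- The contribution of bucket `β` of class `c` to the potential. -/
noncomputable def term (I : KP) (S : Finset ℕ) (k : ℕ) (a : ℕ → ℕ) (c β : ℕ) : ℝ :=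
  2 ^ load S k a (c * I.Mx + β) * (1 + 1 / (I.M c : ℝ)) ^ I.rem S k c

/-- The potential: the conditional expectation of the sum of `2 ^ load` over all buckets, after the
buckets of the items below `k` have been chosen. -/
noncomputable def pot (I : KP) (S : Finset ℕ) (k : ℕ) (a : ℕ → ℕ) : ℝ :=
  ∑ c ∈ Finset.range I.C, ∑ β ∈ Finset.range (I.M c), I.term S k a c β

theorem load_succ (S : Finset ℕ) (k : ℕ) (a : ℕ → ℕ) (g : ℕ) :
    load S (k + 1) a g = load S k a g + if k ∈ S ∧ a k = g then 1 else 0 := by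
  unfold load
  have : (S.filter fun t => t < k + 1 ∧ a t = g) =
      (S.filter fun t => t < k ∧ a t = g) ∪ (S.filter fun t => t = k ∧ a k = g) := by
    ext t
    simp only [Finset.mem_filter, Finset.mem_union]
    constructor
    · rintro ⟨h1, h2, h3⟩
      rcases Nat.lt_succ_iff_lt_or_eq.1 h2 with h | h
      · exact Or.inl ⟨h1, h, h3⟩
      · exact Or.inr ⟨h1, h, h ▸ h3⟩
    · rintro (⟨h1, h2, h3⟩ | ⟨h1, rfl, h3⟩)
      · exact ⟨h1, by omega, h3⟩
      · exact ⟨h1, by omega, h3⟩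
  rw [this, Finset.card_union_of_disjoint]
  · congr 1
    split_ifs with h
    · rw [Finset.card_eq_one]
      exact ⟨k, by ext t; simp only [Finset.mem_filter, Finset.mem_singleton]; aesop⟩
    · rw [Finset.card_eq_zero, Finset.filter_eq_empty_iff]
      rintro t ht ⟨rfl, h'⟩
      exact h ⟨ht, h'⟩
  · rw [Finset.disjoint_filter]
    rintro t - ⟨h1, -⟩ ⟨h2, -⟩
    omega

theorem load_congr (S : Finset ℕ) (k : ℕ) {a a' : ℕ → ℕ} (h : ∀ t < k, a t = a' t) (g : ℕ) :
    load S k a g = load S k a' g := by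
  unfold load
  congr 1
  refine Finset.filter_congr fun t _ => ?_
  exact ⟨fun ⟨h1, h2⟩ => ⟨h1, h t h1 ▸ h2⟩, fun ⟨h1, h2⟩ => ⟨h1, (h t h1).trans h2⟩⟩

theorem rem_succ (S : Finset ℕ) (k c : ℕ) :
    I.rem S k c = I.rem S (k + 1) c + if k ∈ S ∧ I.cls k = c then 1 else 0 := by
  unfold rem
  have : (S.filter fun t => k ≤ t ∧ I.cls t = c) =
      (S.filter fun t => k + 1 ≤ t ∧ I.cls t = c) ∪ (S.filter fun t => t = k ∧ I.cls k = c) := by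
    ext t
    simp only [Finset.mem_filter, Finset.mem_union]
    constructor
    · rintro ⟨h1, h2, h3⟩
      rcases h2.lt_or_eq with h | h
      · exact Or.inl ⟨h1, h, h3⟩
      · exact Or.inr ⟨h1, h.symm, h ▸ h3⟩
    · rintro (⟨h1, h2, h3⟩ | ⟨h1, rfl, h3⟩)
      · exact ⟨h1, by omega, h3⟩
      · exact ⟨h1, by omega, h3⟩
  rw [this, Finset.card_union_of_disjoint]
  · congr 1
    split_ifs with h
    · rw [Finset.card_eq_one]
      exact ⟨k, by ext t; simp only [Finset.mem_filter, Finset.mem_singleton]; aesop⟩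
    · rw [Finset.card_eq_zero, Finset.filter_eq_empty_iff]
      rintro t ht ⟨rfl, h'⟩
      exact h ⟨ht, h'⟩
  · rw [Finset.disjoint_filter]
    rintro t - ⟨h1, -⟩ ⟨h2, -⟩
    omega

theorem pot_succ_of_notMem {S : Finset ℕ} {k : ℕ} (hk : k ∉ S) {a a' : ℕ → ℕ}
    (h : ∀ t < k, a t = a' t) : I.pot S (k + 1) a' = I.pot S k a := by
  unfold pot term
  refine Finset.sum_congr rfl fun c _ => Finset.sum_congr rfl fun β _ => ?_
  rw [load_succ, if_neg (by tauto), rem_succ (k := k), if_neg (by tauto), load_congr S k h]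
  rfl

theorem bucket_inj {Mx c c' β β' : ℕ} (h : β < Mx) (h' : β' < Mx)
    (e : c * Mx + β = c' * Mx + β') : c = c' ∧ β = β' := by
  have h1 := congrArg (· / Mx) e
  have h2 := congrArg (· % Mx) e
  simp only [mul_comm _ Mx] at h1 h2
  simp only [Nat.mul_add_mod, Nat.mod_eq_of_lt h, Nat.mod_eq_of_lt h',
    Nat.mul_add_div (by omega : 0 < Mx), Nat.div_eq_of_lt h, Nat.div_eq_of_lt h'] at h1 h2
  exact ⟨by simpa using h1, h2⟩

/-- Choosing the bucket of item `k` at random does not change the expectation of the potential: a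
term of its class is doubled with probability `1 / M`, and the factor `1 + 1 / M` for the item is
lost. -/
theorem pot_succ {S : Finset ℕ} {k : ℕ} {a : ℕ → ℕ} :
    (∑ x ∈ Finset.range (I.M (I.cls k)),
      I.pot S (k + 1) (Function.update a k (I.cls k * I.Mx + x))) / (I.M (I.cls k) : ℝ) =
      I.pot S k a := by
  have hM := I.M_pos (I.cls k)
  have hM' : (I.M (I.cls k) : ℝ) ≠ 0 := by positivity
  have hM1 := I.M_le_Mx (I.cls k)
  by_cases hk : k ∈ S
  swap
  · rw [Finset.sum_congr rfl (g := fun _ => I.pot S k a) fun x _ =>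
      pot_succ_of_notMem hk fun t ht => by rw [Function.update_of_ne (by omega)]]
    simp only [Finset.sum_const, Finset.card_range, nsmul_eq_mul]
    field_simp
  unfold pot
  rw [Finset.sum_comm, Finset.sum_div]
  refine Finset.sum_congr rfl fun c _ => ?_
  rw [Finset.sum_comm, Finset.sum_div]
  refine Finset.sum_congr rfl fun β hβ => ?_
  have hβ' : β < I.Mx := (Finset.mem_range.1 hβ).trans_le (I.M_le_Mx c)
  have hl : ∀ x, load S k (Function.update a k x) (c * I.Mx + β) = load S k a (c * I.Mx + β) :=
    fun x => load_congr S k (fun t ht => by rw [Function.update_of_ne (by omega)]) _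
  simp only [term, load_succ, rem_succ (k := k), hl, hk, true_and, Function.update_self]
  by_cases hc : I.cls k = c
  · subst hc
    simp only [if_true]
    have he : ∀ x, x ∈ Finset.range (I.M (I.cls k)) →
        (2 : ℝ) ^ (load S k a (I.cls k * I.Mx + β) +
          if I.cls k * I.Mx + x = I.cls k * I.Mx + β then 1 else 0) *
          (1 + 1 / (I.M (I.cls k) : ℝ)) ^ I.rem S (k + 1) (I.cls k) =
        (2 : ℝ) ^ load S k a (I.cls k * I.Mx + β) *
          (1 + 1 / (I.M (I.cls k) : ℝ)) ^ I.rem S (k + 1) (I.cls k) * (1 + if x = β then 1 else 0) := by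
      intro x _
      simp only [Nat.add_left_cancel_iff]
      split_ifs <;> ring
    rw [Finset.sum_congr rfl he, ← Finset.mul_sum, Finset.sum_add_distrib, Finset.sum_ite_eq' ,
      if_pos hβ]
    simp only [Finset.sum_const, Finset.card_range, nsmul_eq_mul]
    rw [pow_succ]
    generalize (1 + 1 / (I.M (I.cls k) : ℝ)) ^ I.rem S (k + 1) (I.cls k) = q
    field_simp
  · rw [Finset.sum_congr rfl (g := fun _ => (2 : ℝ) ^ load S k a (c * I.Mx + β) *
      (1 + 1 / (I.M c : ℝ)) ^ I.rem S (k + 1) c)]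
    · simp only [Finset.sum_const, Finset.card_range, nsmul_eq_mul, hc, if_false]
      field_simp
      simp
    · intro x hx
      rw [if_neg]
      · simp
      · intro e
        exact hc (bucket_inj ((Finset.mem_range.1 hx).trans_le hM1) hβ' e).1

/-- The initial value of the potential is at most `(1 + 1 / M) ^ M ≤ 3` per bucket. -/
theorem pot_zero_le {S : Finset ℕ} (hS : ∀ c < I.C, I.rem S 0 c ≤ I.M c) (a : ℕ → ℕ) :
    I.pot S 0 a ≤ 3 * ∑ c ∈ Finset.range I.C, (I.M c : ℝ) := by
  unfold pot
  rw [Finset.mul_sum]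
  refine Finset.sum_le_sum fun c hc => ?_
  have hM : (0 : ℝ) < I.M c := by exact_mod_cast I.M_pos c
  have h1 : ∀ β ∈ Finset.range (I.M c), I.term S 0 a c β ≤ 3 := by
    intro β _
    have h2 : load S 0 a (c * I.Mx + β) = 0 := by simp [load]
    rw [term, h2, pow_zero, one_mul]
    calc (1 + 1 / (I.M c : ℝ)) ^ I.rem S 0 c ≤ (1 + 1 / (I.M c : ℝ)) ^ I.M c :=
          pow_le_pow_right₀ (by simp) (hS c (Finset.mem_range.1 hc))
      _ ≤ (Real.exp (1 / (I.M c : ℝ))) ^ I.M c := by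
          refine pow_le_pow_left₀ (by positivity) ?_ _
          rw [add_comm]; exact Real.add_one_le_exp _
      _ = Real.exp 1 := by rw [← Real.exp_nat_mul]; congr 1; field_simp
      _ ≤ 3 := by linarith [Real.exp_one_lt_d9]
  calc _ ≤ ∑ β ∈ Finset.range (I.M c), (3 : ℝ) := Finset.sum_le_sum h1
    _ = 3 * I.M c := by simp [mul_comm]

/-- A bucket of large load makes the potential large. -/
theorem pot_ge {S : Finset ℕ} {k : ℕ} {a : ℕ → ℕ} {c β : ℕ} (hc : c < I.C) (hβ : β < I.M c) :
    2 ^ load S k a (c * I.Mx + β) ≤ I.pot S k a := by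
  have h0 : ∀ c β, 0 ≤ I.term S k a c β := fun c β => by unfold term; positivity
  calc (2 : ℝ) ^ load S k a (c * I.Mx + β) ≤ I.term S k a c β := by
        unfold term
        refine le_mul_of_one_le_right (by positivity) (one_le_pow₀ ?_)
        have : (0 : ℝ) ≤ 1 / (I.M c : ℝ) := by positivity
        linarith
    _ ≤ ∑ β ∈ Finset.range (I.M c), I.term S k a c β :=
        Finset.single_le_sum (f := fun β => I.term S k a c β) (fun β _ => h0 c β)
          (Finset.mem_range.2 hβ)
    _ ≤ I.pot S k a := by
        unfold pot
        exact Finset.single_le_sum (f := fun c => ∑ β ∈ Finset.range (I.M c), I.term S k a c β)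
          (fun c _ => Finset.sum_nonneg fun β _ => h0 c β) (Finset.mem_range.2 hc)

theorem pot_nonneg (S : Finset ℕ) (k : ℕ) (a : ℕ → ℕ) : 0 ≤ I.pot S k a :=
  Finset.sum_nonneg fun c _ => Finset.sum_nonneg fun β _ => by unfold term; positivity

/-! ### Choosing the buckets -/

/-- Every item that has to be decided is in some bucket of its class. -/
structure Hashed (I : KP) (σ : St) : Prop extends I.Ctx σ where
  rd7 : ∀ t, I.Valid t → ∃ β < I.M (I.cls t), σ.rd 7 t = I.cls t * I.Mx + β
  rd10 : ∀ i, σ.rd 10 i = 0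
  rd11 : ∀ i, σ.rd 11 i = 0

theorem M_eq (c : ℕ) : ∃ j ≤ I.LW, I.M c = 2 ^ j := ⟨_, I.clog_z_le c, rfl⟩

theorem hash_step (hF : I.Fits w) {σ' : St} (hI' : I.Ctx σ') (S : Finset ℕ) {k : ℕ}
    (hk : k < I.n) (hk' : σ'.reg 20 = k) (hv : I.Valid k) :
    RT w (21 ⇐ .read 3 (§ 20) -ʷ ♯ 1 ;; 22 ⇐ .read 5 (§ 21) ;; 23 ⇐ ♯ 0 ;; 24 ⇐ ♯ 1 ;;
      .loop (§ 24 <ʷ § 22) (.flip 25 ;; 23 ⇐ § 23 +ʷ § 23 +ʷ § 25 ;; 24 ⇐ § 24 +ʷ § 24) ;;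
      .write 7 (§ 20) (§ 21 *ʷ § 13 +ʷ § 23)) σ' (20 * I.LW + 47)
      (fun σ'' => σ''.ln 7 = σ'.ln 7 ∧ ∃ β < I.M (I.cls k), ∀ t, σ''.rd 7 t =
        if t = k then I.cls k * I.Mx + β else σ'.rd 7 t)
      (fun σ'' => I.pot S (k + 1) (σ''.rd 7)) (I.pot S k (σ'.rd 7)) := by
  have hw := hF.hw
  have h_N := hF.h_N
  have hGN : I.G * I.Q ≤ I.N := Nat.le_mul_of_pos_right _ I.Q_pos
  have hG : I.G ≤ I.G * I.Q := Nat.le_mul_of_pos_right _ I.Q_pos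
  have hci : I.ci k = I.cls k + 1 := if_pos hv
  have hcC := hv.cls_lt
  obtain ⟨j, hj, hM⟩ := I.M_eq (I.cls k)
  have hMw := hF.h_M _ hcC
  have hcg : I.cls k * I.Mx + I.Mx ≤ I.C * I.Mx := by
    rw [← Nat.succ_mul]; exact Nat.mul_le_mul_right _ hcC
  have hGe : I.G = I.C * I.Mx + 1 := rfl
  have hMMx := I.M_le_Mx (I.cls k)
  have hCw := hF.h_C
  have hl := hI'.ln7
  have e : 4 + 1 + (2 + 1 + (1 + 1 + (1 + 1 + (20 * j + 4 + 7)))) ≤ 20 * I.LW + 47 := by omega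
  have hp := pot_succ (I := I) (S := S) (k := k) (a := σ'.rd 7)
  rw [hM] at hp
  push_cast at hp
  refine RT.mono (RT.assign hw ?_ (RT.assign hw ?_ (RT.assign hw (by simp) (RT.assign hw
    (by simp; omega) (RT.seq (RT.uniform hw (j := j) ?_ ?_ ?_ (hM ▸ hMw)
      (fun x => I.pot S (k + 1) (Function.update (σ'.rd 7) k (I.cls k * I.Mx + x))))
      (t₂ := 7) (fun σ₁ hs₁ h23 => ?_)))))) ?_
    (fun _ _ h => h) (fun _ _ _ => le_rfl) hp.le
  · simp [hk', hI'.rd3, hci]; omega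
  · simp
  · simp [hk', hI'.rd3, hci, hI'.rd5, hcC, hM]
  · simp
  · simp
  · have f20 : σ₁.reg 20 = k := by simp [hs₁.reg 20 rfl, hk']
    have f21 : σ₁.reg 21 = I.cls k := by simp [hs₁.reg 21 rfl, hk', hI'.rd3, hci]
    have f13 : σ₁.reg 13 = I.Mx := by simp [hs₁.reg 13 rfl, hI'.r13]
    have l7 : σ₁.ln 7 = I.n := by simp [hs₁.ln (a := 7) rfl, hl]
    have d7 : ∀ t, σ₁.rd 7 t = σ'.rd 7 t := fun t => by simp [hs₁.rd (a := 7) rfl]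
    rw [← hM] at h23
    have hd : Det w (.write 7 (§ 20) (§ 21 *ʷ § 13 +ʷ § 23)) σ₁ 7 fun σ'' => σ''.ln 7 = I.n ∧
        σ''.rd 7 = Function.update (σ'.rd 7) k (I.cls k * I.Mx + σ₁.reg 23) := by
      refine Det.straight_le hw rfl ?_
      simp [f20, f21, f13, l7]
      refine ⟨⟨by omega, by omega⟩, ?_⟩
      ext t
      simp [d7, hk, Function.update_apply, l7]
    refine (hd.rt (f := fun σ'' => I.pot S (k + 1) (σ''.rd 7)) ?_).mono le_rfl ?_
      (fun _ _ _ => le_rfl) le_rfl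
    · rintro σ'' - ⟨-, h⟩; rw [h]
    · rintro σ'' - ⟨h1, h2⟩
      exact ⟨h1.trans hl.symm, _, h23, fun t => by rw [h2, Function.update_apply]⟩
  · simpa [RamExpr.cost] using e

theorem hash (hF : I.Fits w) {σ : St} (hI : I.Ctx σ) (h10 : ∀ i, σ.rd 10 i = 0)
    (h11 : ∀ i, σ.rd 11 i = 0) {S : Finset ℕ} (hS : ∀ t ∈ S, I.Valid t) :
    RT w hashProg σ (6 + I.n * (20 * I.LW + 60)) I.Hashed
      (fun σ' => I.pot S I.n (σ'.rd 7)) (I.pot S 0 (σ.rd 7)) := by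
  have hw := hF.hw
  have h_sum := hF.h_sum
  have hctx : ∀ {σ' : St}, SameOn hashProg σ σ' → σ'.ln 7 = I.n → I.Ctx σ' := fun hS h7 =>
    hI.of_same hS (fun a ha _ => by interval_cases a <;> first | rfl | contradiction) rfl
      (fun a ha => by interval_cases a <;> rfl) (hS.ln rfl) (hS.ln rfl) (h7.trans hI.ln7.symm)
  refine (RT.for hw (fun _ => 20 * I.LW + 50) (fun k σ' => σ'.ln 7 = I.n ∧ ∀ t < k, I.Valid t →
      ∃ β < I.M (I.cls t), σ'.rd 7 t = I.cls t * I.Mx + β)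
    (fun k σ' => I.pot S k (σ'.rd 7)) hI.r0 (by omega) (by norm_num) rfl rfl ?_ ?_).mono ?_ ?_
    (fun _ _ _ => le_rfl) le_rfl
  · simpa using hI.ln7
  · intro k hk σ' hsame hk' ⟨hl, hinv⟩
    have hI' := hctx hsame hl
    have hcost : (RamExpr.read 3 (§ 20)).cost + (20 * I.LW + 47) + 1 = 20 * I.LW + 50 := by
      simp [RamExpr.cost]; omega
    refine RT.mono (RT.ite hw (t := 20 * I.LW + 47) (by simp) (fun h0 => ?_) (fun h0 => ?_)) hcost.le
      (fun _ _ h => h) (fun _ _ _ => le_rfl) le_rfl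
    · simp only [RamExpr.val, hk', hI'.rd3] at h0
      have hv : I.Valid k := by by_contra h; simp [ci, h] at h0
      refine (hash_step hF hI' S hk hk' hv).mono le_rfl ?_ (fun _ _ _ => le_rfl) le_rfl
      rintro σ'' - ⟨h1, β, hβ, h2⟩
      refine ⟨h1.trans hl, fun t ht hvt => ?_⟩
      rw [St.rd_setR, h2]
      rcases Nat.lt_succ_iff_lt_or_eq.1 ht with ht | rfl
      · rw [if_neg (by omega)]; exact hinv t ht hvt
      · exact ⟨β, hβ, by simp⟩
    · simp only [RamExpr.val, hk', hI'.rd3] at h0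
      have hv : ¬ I.Valid k := by intro h; simp [ci, h] at h0
      have hd : Det w .skip σ' (20 * I.LW + 47) fun σ'' => σ'' = σ' :=
        (Det.straight (c := .skip) (Q := fun σ'' => σ'' = σ') hw (by simp)).mono (by simp [RamProg.scost])
          fun _ _ h => h
      refine (hd.rt (f := fun σ'' => I.pot S (k + 1) (σ''.rd 7)) ?_).mono le_rfl ?_
        (fun _ _ _ => le_rfl) le_rfl
      · rintro σ'' - rfl
        exact (pot_succ_of_notMem (fun h => hv (hS k h)) fun _ _ => rfl).le
      · rintro σ'' - rfl
        refine ⟨by simpa using hl, fun t ht hvt => ?_⟩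
        have : t ≠ k := by rintro rfl; exact hv hvt
        exact hinv t (by omega) hvt
  · simp
    exact Nat.mul_le_mul_left _ (by omega)
  · rintro σ' hS ⟨-, h1, h2⟩
    exact ⟨hctx hS h1, fun t ht => h2 t ht.1 ht, fun i => (hS.rd rfl i).trans (h10 i),
      fun i => (hS.rd rfl i).trans (h11 i)⟩

end KP

namespace KP
variable {I : KP} {w : ℕ}

/-! ### Leaves -/

/-- `h` maps each item to a bucket of its class. -/
def HashOK (I : KP) (h : ℕ → ℕ) : Prop :=
  ∀ t, I.Valid t → ∃ β < I.M (I.cls t), h t = I.cls t * I.Mx + β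

/-- The leaf of item `t` for colour `q`, if `h` is the assignment of the buckets. The items of a
bucket are coloured by their remainders modulo `q + 1`. -/
def leafOf (I : KP) (h : ℕ → ℕ) (t q : ℕ) : ℕ := I.N + ((h t * I.Q + q) * I.Q + t % (q + 1))

theorem HashOK.lt {h : ℕ → ℕ} (hh : I.HashOK h) {t : ℕ} (ht : I.Valid t) : h t + 1 < I.G := by
  obtain ⟨β, hβ, e⟩ := hh t ht
  have h1 := I.M_le_Mx (I.cls t)
  have hcg : I.cls t * I.Mx + I.Mx ≤ I.C * I.Mx := by
    rw [← Nat.succ_mul]; exact Nat.mul_le_mul_right _ ht.cls_lt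
  unfold G
  omega

theorem HashOK.leafOf_lt {h : ℕ → ℕ} (hh : I.HashOK h) {t q : ℕ} (ht : I.Valid t) (hq : q < I.Q) :
    I.leafOf h t q < 2 * I.N := by
  have h1 := hh.lt ht
  have h2 : t % (q + 1) < I.Q := (Nat.mod_lt _ (by omega)).trans_le hq
  have h3 : h t * I.Q + q < I.G * I.Q := by
    calc h t * I.Q + q < h t * I.Q + I.Q := by omega
      _ = (h t + 1) * I.Q := by ring
      _ ≤ I.G * I.Q := Nat.mul_le_mul_right _ (by omega)
  have h4 : (h t * I.Q + q) * I.Q + t % (q + 1) < I.N := by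
    calc (h t * I.Q + q) * I.Q + t % (q + 1) < (h t * I.Q + q) * I.Q + I.Q := by omega
      _ = (h t * I.Q + q + 1) * I.Q := by ring
      _ ≤ I.N := Nat.mul_le_mul_right _ (by omega)
  unfold leafOf
  omega

theorem leafOf_ge (h : ℕ → ℕ) (t q : ℕ) : I.N ≤ I.leafOf h t q := Nat.le_add_right _ _

theorem leafOf_div {h : ℕ → ℕ} {t q : ℕ} (hq : q < I.Q) :
    (I.leafOf h t q - I.N) / (I.Q * I.Q) = h t := by
  have h2 : t % (q + 1) < I.Q := (Nat.mod_lt _ (by omega)).trans_le hq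
  unfold leafOf
  rw [Nat.add_sub_cancel_left, ← Nat.div_div_eq_div_mul, mul_comm, Nat.mul_add_div I.Q_pos,
    Nat.div_eq_of_lt h2, add_zero, mul_comm, Nat.mul_add_div I.Q_pos, Nat.div_eq_of_lt hq, add_zero]

theorem HashOK.leafSz {h : ℕ → ℕ} (hh : I.HashOK h) {t q : ℕ} (ht : I.Valid t) (hq : q < I.Q) :
    I.leafSz (I.leafOf h t q - I.N) = I.u (I.cls t) := by
  obtain ⟨β, hβ, e⟩ := hh t ht
  have h1 : β < I.Mx := hβ.trans_le (I.M_le_Mx _)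
  unfold KP.leafSz
  rw [leafOf_div hq, e, mul_comm, Nat.mul_add_div I.Mx_pos, Nat.div_eq_of_lt h1, add_zero,
    Nat.mul_add_mod, Nat.mod_eq_of_lt h1, if_pos ⟨ht.cls_lt, hβ⟩]

theorem Valid.cls_div {t : ℕ} (ht : I.Valid t) : I.cls t / I.LP = Nat.size (I.wt t) - 1 := by
  have h2 : Nat.size (I.p t) ≤ I.LP := Nat.size_le_size ht.p_le
  have h4 : 1 ≤ Nat.size (I.p t) := Nat.size_pos.2 ht.2.2.2
  unfold cls
  rw [mul_comm, Nat.mul_add_div (by omega), Nat.div_eq_of_lt (by omega), add_zero]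

theorem Valid.cls_mod {t : ℕ} (ht : I.Valid t) : I.cls t % I.LP = Nat.size (I.p t) - 1 := by
  have h2 : Nat.size (I.p t) ≤ I.LP := Nat.size_le_size ht.p_le
  have h4 : 1 ≤ Nat.size (I.p t) := Nat.size_pos.2 ht.2.2.2
  unfold cls
  rw [mul_comm, Nat.mul_add_mod, Nat.mod_eq_of_lt (by omega)]

theorem two_pow_size_pred_le {a : ℕ} (h : 1 ≤ a) : 2 ^ (Nat.size a - 1) ≤ a := by
  have := Nat.size_pos.2 h
  by_contra h'
  have := Nat.size_le.2 (not_le.1 h')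
  omega

theorem lt_two_mul_two_pow_size_pred (a : ℕ) (h : 1 ≤ a) : a < 2 * 2 ^ (Nat.size a - 1) := by
  have h1 := Nat.size_pos.2 h
  have h2 := Nat.lt_size_self a
  obtain ⟨s, hs⟩ : ∃ s, Nat.size a = s + 1 := ⟨Nat.size a - 1, by omega⟩
  rw [hs] at h2 ⊢
  rw [pow_succ] at h2
  simp only [Nat.add_sub_cancel]
  omega

theorem Valid.wt_lt_u {t : ℕ} (ht : I.Valid t) : I.wt t < I.u (I.cls t) := by
  have h1 := lt_two_mul_two_pow_size_pred (I.wt t) ht.2.1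
  unfold u
  rw [ht.cls_div, ht.cls_mod]
  exact h1.trans_le (Nat.mul_le_mul_left _ (Nat.pow_le_pow_right (by norm_num) (le_max_left _ _)))

theorem Valid.p_lt_u {t : ℕ} (ht : I.Valid t) : I.p t < I.u (I.cls t) := by
  have h1 := lt_two_mul_two_pow_size_pred (I.p t) ht.2.2.2
  unfold u
  rw [ht.cls_div, ht.cls_mod]
  exact h1.trans_le (Nat.mul_le_mul_left _ (Nat.pow_le_pow_right (by norm_num) (le_max_right _ _)))

theorem Valid.z_pos {t : ℕ} (ht : I.Valid t) : 1 ≤ I.z (I.cls t) := by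
  unfold z
  refine le_min ?_ ?_
  · unfold cnt
    rw [Nat.one_le_iff_ne_zero, Finset.card_ne_zero]
    exact ⟨t, by rw [Finset.mem_filter, Finset.mem_range]; exact ⟨ht.1, if_pos ht⟩⟩
  · rw [ht.cls_div, Nat.one_le_div_iff (by positivity)]
    exact (two_pow_size_pred_le ht.2.1).trans ht.2.2.1

theorem Valid.u_le {t : ℕ} (ht : I.Valid t) : I.u (I.cls t) ≤ I.ntop := by
  have h1 : I.z (I.cls t) * I.u (I.cls t) ≤ ∑ c ∈ Finset.range I.C, I.z c * I.u c :=
    Finset.single_le_sum (f := fun c => I.z c * I.u c) (fun _ _ => Nat.zero_le _)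
      (Finset.mem_range.2 ht.cls_lt)
  have h2 : I.u (I.cls t) ≤ I.z (I.cls t) * I.u (I.cls t) := Nat.le_mul_of_pos_left _ ht.z_pos
  unfold ntop
  omega

theorem HashOK.sz_leafOf {h : ℕ → ℕ} (hh : I.HashOK h) {t q : ℕ} (ht : I.Valid t) (hq : q < I.Q) :
    I.sz (I.leafOf h t q) = I.u (I.cls t) := by
  rw [sz_leaf (leafOf_ge h t q), hh.leafSz ht hq, min_eq_right ht.u_le]

theorem off_add_lt {v k : ℕ} (h1 : 1 ≤ v) (h2 : v < 2 * I.N) (hk : k ≤ I.sz v) :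
    I.off v + k < I.off (v - 1) := by
  rw [off_pred h1 h2]; omega

theorem off_add_lt' {v k : ℕ} (h1 : 1 ≤ v) (h2 : v < 2 * I.N) (hk : k ≤ I.sz v) :
    I.off v + k < I.off 0 := (off_add_lt h1 h2 hk).trans_le (I.off_le (Nat.zero_le _))

theorem off_inj {v v' k k' : ℕ} (h1 : 1 ≤ v) (h2 : v < 2 * I.N) (hk : k ≤ I.sz v) (h1' : 1 ≤ v')
    (h2' : v' < 2 * I.N) (hk' : k' ≤ I.sz v') (e : I.off v + k = I.off v' + k') :
    v = v' ∧ k = k' := by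
  rcases lt_trichotomy v v' with h | rfl | h
  · have := off_add_lt h1' h2' hk'
    have := I.off_le (show v ≤ v' - 1 by omega)
    omega
  · omega
  · have := off_add_lt h1 h2 hk
    have := I.off_le (show v' ≤ v - 1 by omega)
    omega

/-! ### Entering the items -/

/-- The buckets of the items are given by `h`. -/
structure Tab (I : KP) (h : ℕ → ℕ) (σ : St) : Prop extends I.Ctx σ where
  rd7 : ∀ t, I.Valid t → σ.rd 7 t = h t

theorem Tab.of_same {h : ℕ → ℕ} {c : RamProg} {σ σ' : St} (hI : I.Tab h σ) (hs : SameOn c σ σ')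
    (ha : ∀ a < 10, modA c a = false) (ha' : modA c 12 = false)
    (hr : ∀ x < 18, modR c x = false) (h10 : σ'.ln 10 = σ.ln 10) (h11 : σ'.ln 11 = σ.ln 11) :
    I.Tab h σ' where
  toCtx := hI.toCtx.of_same hs (fun a h _ => ha a h) ha' hr h10 h11 (hs.ln (ha 7 (by norm_num)))
  rd7 t ht := by rw [hs.rd (ha 7 (by norm_num)), hI.rd7 t ht]

/-- The position of item `t` in the heap, for colour `q`. -/
def posOf (I : KP) (h : ℕ → ℕ) (t q : ℕ) : ℕ := I.off (I.leafOf h t q) + I.wt t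

/-- The items are in the leaves. -/
structure Filled (I : KP) (h : ℕ → ℕ) (σ : St) : Prop where
  sound : ∀ i, σ.rd 10 i ≠ 0 → ∃ t q, I.Valid t ∧ q < I.Q ∧ I.posOf h t q = i ∧ I.p t = σ.rd 10 i
  complete : ∀ t q, I.Valid t → q < I.Q → I.p t ≤ σ.rd 10 (I.posOf h t q)

/-- The instruction for item `20` and colour `22`. -/
theorem fill_step (hF : I.Fits w) {h : ℕ → ℕ} (hh : I.HashOK h) {σ : St} (hI : I.Tab h σ) {k q : ℕ}
    (hv : I.Valid k) (hq : q < I.Q) (h20 : σ.reg 20 = k) (h21 : σ.reg 21 = h k)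
    (h22 : σ.reg 22 = q) :
    Det w (23 ⇐ leafExpr ;; 24 ⇐ .read 9 (§ 23) +ʷ .read 1 (§ 20) ;;
      .ite (.read 10 (§ 24) <ʷ .read 0 (§ 20)) (.write 10 (§ 24) (.read 0 (§ 20))) .skip) σ 50
      fun σ' => σ'.ln 10 = σ.ln 10 ∧ ∀ i, σ'.rd 10 i =
        if i = I.posOf h k q then max (σ.rd 10 i) (I.p k) else σ.rd 10 i := by
  have hw := hF.hw
  have h_sum := hF.h_sum
  have h2w := hF.two_lt
  have h_N := hF.h_N
  have h_off := hF.h_off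
  have hlt := hh.leafOf_lt hv hq
  have hge := I.leafOf_ge h k q
  have hN := I.N_pos
  have hu := hv.wt_lt_u
  have hpos : I.posOf h k q < I.off 0 :=
    off_add_lt' (by omega) hlt (by rw [hh.sz_leafOf hv hq]; omega)
  have e9 : σ.rd 9 (I.leafOf h k q) = I.off (I.leafOf h k q) := hI.rd9 _ (by omega) hlt
  have el : I.leafOf h k q = I.N + ((h k * I.Q + q) * I.Q + k % (q + 1)) := rfl
  have ep : I.posOf h k q = I.off (I.leafOf h k q) + I.wt k := rfl
  have e0 := hI.rd0 k
  have e1 := hI.rd1 k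
  have hk := hv.1
  have hQQ := hF.h_Q
  have hQ : I.Q ≤ I.Q * I.Q := Nat.le_mul_self _
  have hm1 : h k * I.Q + q ≤ (h k * I.Q + q) * I.Q := Nat.le_mul_of_pos_right _ I.Q_pos
  have l10 := hI.ln10
  suffices hP : ∀ P : St → Prop, (∀ σ' : St, σ'.ln 10 = σ.ln 10 → (∀ i, σ'.rd 10 i =
      if i = I.posOf h k q then max (σ.rd 10 i) (I.p k) else σ.rd 10 i) → P σ') →
      Det w _ σ 50 P from hP _ fun _ h1 h2 => ⟨h1, h2⟩
  intro P hP
  refine Det.straight_le hw rfl ?_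
  simp only [leafExpr]
  have hmod : k % (q + 1) ≤ k := Nat.mod_le _ _
  simp only [WP, RamExpr.ok, RamExpr.val, BinOp.apply, h20, h21, h22, hI.r10, hI.r7, ← el,
    St.reg_setR, St.rd_setR, if_true, Nat.reduceEqDiff, if_false, e9, e1, e0, ← ep]
  have hm2 : h k * I.Q ≤ h k * I.Q + q := Nat.le_add_right _ _
  have hs : I.posOf h k q < 2 ^ w ∧ I.leafOf h k q < 2 ^ w ∧ (h k * I.Q + q) * I.Q < 2 ^ w ∧
      k % (q + 1) < 2 ^ w ∧ q + 1 < 2 ^ w ∧ h k * I.Q < 2 ^ w ∧ h k * I.Q + q < 2 ^ w ∧ 1 < 2 ^ w ∧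
      (h k * I.Q + q) * I.Q + k % (q + 1) < 2 ^ w := by
    refine ⟨?_, ?_, ?_, ?_, ?_, ?_, ?_, ?_, ?_⟩ <;> omega
  simp only [hs, true_and, and_true]
  refine ⟨fun hlt => ?_, fun hge => ?_⟩
  · refine hP _ (by simp) fun i => ?_
    have : σ.rd 10 (I.posOf h k q) < I.p k := by by_contra h; simp [h] at hlt
    simp [l10, hpos]
    by_cases hi : i = I.posOf h k q
    · subst hi; simp [this.le]
    · simp [hi]
  · refine hP _ rfl fun i => ?_
    have : I.p k ≤ σ.rd 10 (I.posOf h k q) := by by_contra h; simp [not_le.1 h] at hge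
    simp
    by_cases hi : i = I.posOf h k q
    · subst hi; simp [this]
    · simp [hi]

theorem fill (hF : I.Fits w) {h : ℕ → ℕ} (hh : I.HashOK h) {σ : St} (hI : I.Tab h σ)
    (h10 : ∀ i, σ.rd 10 i = 0) :
    Det w fillProg σ (6 + I.n * (100 + 60 * I.Q)) fun σ' => I.Tab h σ' ∧ I.Filled h σ' := by
  have hw := hF.hw
  have h_sum := hF.h_sum
  have hQ' : I.Q < 2 ^ w := (Nat.le_mul_self _).trans_lt hF.h_Q
  have htab : ∀ {σ' : St}, SameOn fillProg σ σ' → σ'.ln 10 = σ.ln 10 → I.Tab h σ' := fun hS h7 =>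
    hI.of_same hS (fun a ha => by interval_cases a <;> rfl) rfl
      (fun a ha => by interval_cases a <;> rfl) h7 (hS.ln rfl)
  let A : (ℕ → ℕ → Prop) → St → Prop := fun B σ' => σ'.ln 10 = σ.ln 10 ∧
    (∀ i, σ'.rd 10 i ≠ 0 → ∃ t q, I.Valid t ∧ q < I.Q ∧ I.posOf h t q = i ∧ I.p t = σ'.rd 10 i) ∧
    ∀ t q, B t q → I.Valid t → q < I.Q → I.p t ≤ σ'.rd 10 (I.posOf h t q)
  refine (Det.for hw (fun _ => 90 + 58 * I.Q) (fun k => A fun t _ => t < k) hI.r0 (by omega)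
    (by norm_num) rfl rfl ⟨rfl, ?_, ?_⟩ ?_).mono ?_ ?_
  · intro i hi; exact absurd (by simpa using h10 i) hi
  · intro t q ht; omega
  · intro k hk σ₁ hS hk' ⟨hl, hs, hc⟩
    have hI₁ := htab hS hl
    have hcost : (RamExpr.read 3 (§ 20)).cost + (80 + 58 * I.Q) + 1 ≤ 90 + 58 * I.Q := by
      simp [RamExpr.cost]; omega
    refine Det.mono (Det.ite hw (t := 80 + 58 * I.Q) (by simp) (fun h0 => ?_) (fun h0 => ?_)) hcost
      (fun _ _ h => h)
    · simp only [RamExpr.val, hk', hI₁.rd3] at h0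
      have hv : I.Valid k := by by_contra h; simp [ci, h] at h0
      refine Run.det (Run.assign hw (by simp) (Run.last (Det.for hw (fun _ => 50)
        (fun q => A fun t q' => t < k ∨ t = k ∧ q' < q) (n := I.Q) ?_ hQ' (by norm_num) rfl rfl
        ⟨by simpa using hl, ?_, ?_⟩ ?_) ?_))
      · simp [hI₁.r7]
      · exact hs
      · intro t q ht; exact hc t q (by omega)
      · intro q hq σ₂ hS₂ hq' ⟨hl₂, hs₂, hc₂⟩
        have hI₂ : I.Tab h σ₂ := by
          have : I.Tab h (σ₁.setR 21 (σ₁.rd 7 (σ₁.reg 20))) :=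
            hI₁.of_same (c := .assign 21 (.const 0)) ⟨fun x hx => by
              simp [modR] at hx; simp [Ne.symm hx], fun a _ => rfl⟩
              (fun a ha => by interval_cases a <;> rfl) rfl
              (fun a ha => by interval_cases a <;> rfl) rfl rfl
          exact this.of_same hS₂ (fun a ha => by interval_cases a <;> rfl) rfl
            (fun a ha => by interval_cases a <;> rfl) (by rw [hl₂]; simpa using hl.symm) (hS₂.ln rfl)
        refine (fill_step hF hh hI₂ hv hq ?_ ?_ hq').mono le_rfl ?_
        · simp [hS₂.reg 20 rfl, hk']
        · simp [hS₂.reg 21 rfl, hk', hI₁.rd7 k hv]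
        rintro σ₃ - ⟨h1, h2⟩
        refine ⟨h1.trans hl₂, fun i hi => ?_, fun t q' ht hvt hq' => ?_⟩
        · simp only [St.rd_setR] at hi ⊢
          rw [h2] at hi ⊢
          split_ifs at hi ⊢ with hi'
          · rcases le_total (σ₂.rd 10 i) (I.p k) with hle | hle
            · exact ⟨k, q, hv, hq, hi'.symm, by rw [max_eq_right hle]⟩
            · rw [max_eq_left hle] at hi ⊢
              exact hs₂ i hi
          · exact hs₂ i hi
        · simp only [St.rd_setR]
          rw [h2]
          by_cases hn : t < k ∨ t = k ∧ q' < q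
          · have := hc₂ t q' hn hvt hq'
            split_ifs
            · exact this.trans (le_max_left _ _)
            · exact this
          · have h3 : t = k ∧ q' = q := by omega
            obtain ⟨rfl, rfl⟩ := h3
            rw [if_pos rfl]
            exact le_max_right _ _
      · rintro σ₂ - ⟨-, hl₂, hs₂, hc₂⟩
        refine ⟨?_, hl₂, hs₂, fun t q ht hvt hq => hc₂ t q (by omega) hvt hq⟩
        simp [RamExpr.cost]; omega
    · simp only [RamExpr.val, hk', hI₁.rd3] at h0
      have hv : ¬ I.Valid k := by intro h; simp [ci, h] at h0
      refine (Det.straight (c := .skip) (Q := fun σ'' => σ'' = σ₁) hw (by simp)).mono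
        (by simp [RamProg.scost]; omega) ?_
      rintro _ - rfl
      refine ⟨hl, hs, fun t q ht hvt hq => ?_⟩
      have : t ≠ k := by rintro rfl; exact hv hvt
      exact hc t q (by omega) hvt hq
  · simp
    exact Nat.mul_le_mul_left _ (by omega)
  · rintro σ' hS ⟨-, hl, hs, hc⟩
    exact ⟨htab hS hl, hs, fun t q ht hq => hc t q ht.1 ht hq⟩

end KP

/-! ### Calling the subroutine -/

/-- A bound for the registers and arrays that a program may change. -/
def modBound : RamProg → ℕ
  | .skip => 0
  | .assign x _ => x + 1
  | .write a _ _ => a + 1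
  | .alloc a _ => a + 1
  | .flip x => x + 1
  | .seq c d => max (modBound c) (modBound d)
  | .ite _ c d => max (modBound c) (modBound d)
  | .loop _ c => modBound c

theorem mod_of_modBound_le {c : RamProg} {x : ℕ} (h : modBound c ≤ x) :
    modR c x = false ∧ modA c x = false := by
  induction c with
  | skip => exact ⟨rfl, rfl⟩
  | assign y e => simp only [modBound] at h; exact ⟨by simp [modR]; omega, rfl⟩
  | write y i e => simp only [modBound] at h; exact ⟨rfl, by simp [modA]; omega⟩
  | alloc y e => simp only [modBound] at h; exact ⟨rfl, by simp [modA]; omega⟩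
  | flip y => simp only [modBound] at h; exact ⟨by simp [modR]; omega, rfl⟩
  | seq c d hc hd =>
    simp only [modBound, max_le_iff] at h
    simp [modR, modA, hc h.1, hd h.2]
  | ite e c d hc hd =>
    simp only [modBound, max_le_iff] at h
    simp [modR, modA, hc h.1, hd h.2]
  | loop e c hc => exact hc h

/-- The registers and arrays from `k` on have not been used. -/
structure Clean (k : ℕ) (σ : St) : Prop where
  reg : ∀ x, k ≤ x → σ.reg x = 0
  arr : ∀ a, k ≤ a → σ.arr a = []

theorem Clean.of_same {k : ℕ} {c : RamProg} {σ σ' : St} (h : Clean k σ) (hs : SameOn c σ σ')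
    (hc : ∀ x, k ≤ x → modR c x = false ∧ modA c x = false) : Clean k σ' :=
  ⟨fun x hx => (hs.reg x (hc x hx).1).trans (h.reg x hx),
    fun x hx => (hs.arr x (hc x hx).2).trans (h.arr x hx)⟩

/-- An algorithm can be used as a subroutine. -/
theorem SolvesInTime.call {ι : Type} {P : RamProg} {Q : CompProblem ι} {t : ι → ℕ} {p : ι → ℝ}
    (hP : SolvesInTime P Q t p) (k : ℕ) : ∃ c : ℕ, ∀ (I : ι) (w : ℕ),
      (inputMagnitude (Q.input I) + 2) ^ c ≤ 2 ^ w → ∀ σ : St, (∀ x, k ≤ x → σ.reg x = 0) →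
      (∀ a, σ.arr (a + k) = (Q.input I).getD a []) → ∀ (φ : St → Prop) [DecidablePred φ],
      (∀ σ', Q.correct I (σ'.arr k) → φ σ') →
      RT w (P.shift k) σ (t I) (fun _ => True) (fun σ' => if φ σ' then 0 else 1) (1 - p I) := by
  obtain ⟨c, -, h⟩ := hP
  refine ⟨c, fun I w hw σ hr ha φ _ hφ => ?_⟩
  obtain ⟨h1, h2⟩ := h I w hw
  let τ : St := ⟨fun _ => 0, fun a => (Q.input I).getD a []⟩
  have hτ : ∀ ω, RamState.init (Q.input I) ω = τ.wc ω := fun ω => rfl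
  have hσ : St.merge k σ τ = σ := by
    have h3 : (St.merge k σ τ).reg = σ.reg := by
      ext x
      by_cases hx : x < k
      · simp [St.merge, hx]
      · simp [St.merge, hx, τ, hr x (not_lt.1 hx)]
    have h4 : (St.merge k σ τ).arr = σ.arr := by
      ext1 a
      by_cases hx : a < k
      · simp [St.merge, hx]
      · have := ha (a - k)
        rw [Nat.sub_add_cancel (not_lt.1 hx)] at this
        simp [St.merge, hx, τ, this]
    calc St.merge k σ τ = ⟨(St.merge k σ τ).reg, (St.merge k σ τ).arr⟩ := rfl
      _ = σ := by rw [h3, h4]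
  simp only [hτ] at h1 h2
  obtain ⟨tr, htr⟩ := exists_coinTree h1
  have hshift : ∀ ω, ∃ τ' ≤ t I, RamExec w (P.shift k) (σ.wc ω)
      (((tr.bind fun a => .leaf (St.merge k σ a)).run ω).1.wc
        ((tr.bind fun a => .leaf (St.merge k σ a)).run ω).2) τ' := by
    intro ω
    obtain ⟨τ', h3, h4⟩ := htr ω
    have h5 := h4.shift k σ
    rw [CoinTree.run_bind]
    simp only [St.wc_st, hσ] at h5
    exact ⟨τ', h3, h5⟩
  refine ⟨_, CoinTree.all_of_run fun _ => trivial, ?_, hshift⟩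
  have h5 : {ω | ∃ (s' : RamState) (τ' : ℕ), RamExec w P (τ.wc ω) s' τ' ∧
      Q.correct I (s'.arr 0)} ⊆ {ω | φ (St.merge k σ (tr.run ω).1)} := by
    rintro ω ⟨s', τ', h3, h4⟩
    obtain ⟨τ'', -, h6⟩ := htr ω
    have h7 := h3.unique h6
    refine hφ _ ?_
    rw [h7] at h4
    simpa [St.merge, St.wc] using h4
  have h6 := h2.trans (measureReal_mono h5)
  rw [coinMeasure_run (fun a => φ (St.merge k σ a))] at h6
  have h7 : (tr.bind fun a => .leaf (St.merge k σ a)).mean (fun σ' => if φ σ' then (0 : ℝ) else 1) ≤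
      tr.mean (fun a => (-1) * (if φ (St.merge k σ a) then 1 else 0) + 1) := by
    refine CoinTree.mean_bind_le (p := fun _ => True) (CoinTree.all_of_run fun _ => trivial)
      fun a _ => ?_
    simp only [CoinTree.mean]
    split_ifs with h8 <;> simp
  rw [CoinTree.mean_affine] at h7
  have h8 : (tr.mean fun a => if φ (St.merge k σ a) then (1 : ℝ) else 0) =
      tr.mean fun a => @ite ℝ (φ (St.merge k σ a)) (Classical.propDecidable _) 1 0 := by
    congr 1; ext a; split_ifs <;> rfl
  linarith

theorem reset_spec {w : ℕ} (hw : 1 ≤ w) (B : ℕ) (σ : St) :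
    Det w (resetProg B) σ (4 * B + 1) fun σ' =>
      (∀ x, 100 ≤ x → x < 100 + B → σ'.reg x = 0) ∧ ∀ a, 100 ≤ a → a < 100 + B → σ'.arr a = [] := by
  induction B with
  | zero =>
    refine (Det.straight (c := .skip) (Q := fun _ => True) hw trivial).mono le_rfl ?_
    intro σ' _ _
    exact ⟨fun x _ _ => by omega, fun x _ _ => by omega⟩
  | succ k ih =>
    apply Run.det
    refine Run.seq ih fun σ₁ _ hq => Run.assign hw (by simp) (Run.last
      (Det.alloc (Q := fun σ' => σ' = (σ₁.setR (k + 100) 0).al (k + 100) 0) hw (by simp) rfl) ?_)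
    rintro σ' - rfl
    refine ⟨by simp [RamExpr.cost]; omega, fun x h1 h2 => ?_, fun a h1 h2 => ?_⟩
    · by_cases hx : x = k + 100
      · simp [hx]
      · simp [hx]; exact hq.1 x h1 (by omega)
    · by_cases hx : a = k + 100
      · simp [hx, St.al]
      · simp [hx, St.al]; exact hq.2 a h1 (by omega)

theorem modBound_reset (B : ℕ) : modBound (resetProg B) ≤ 100 + B := by
  induction B with
  | zero => simp [resetProg, modBound]
  | succ k ih => simp [resetProg, modBound]; omega

theorem mod_reset_lt (B : ℕ) {x : ℕ} (hx : x < 100) :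
    modR (resetProg B) x = false ∧ modA (resetProg B) x = false := by
  induction B with
  | zero => exact ⟨rfl, rfl⟩
  | succ k ih => simp [resetProg, modR, modA, ih]; omega

/-! ### The profile of an inner node -/

/-- The data of an inner node: its size and offset, the sizes and offsets of its children, and the
profiles of its children, extended to constants beyond their sizes. -/
structure Node where
  s : ℕ
  o : ℕ
  nl : ℕ
  ol : ℕ
  nr : ℕ
  or : ℕ
  A : ℕ → ℕ
  B : ℕ → ℕ

/-- The data of the node `D` is in the registers `22` to `28` and in array `10`. -/
structure Node.At (D : Node) (w : ℕ) (σ : St) : Prop where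
  r22 : σ.reg 22 = D.s
  r23 : σ.reg 23 = D.o
  r24 : σ.reg 24 = D.s + 1
  r25 : σ.reg 25 = D.nl
  r26 : σ.reg 26 = D.ol
  r27 : σ.reg 27 = D.nr
  r28 : σ.reg 28 = D.or
  hs : 2 * D.s + 2 < 2 ^ w
  hnl : D.nl ≤ D.s
  hnr : D.nr ≤ D.s
  hol : D.ol + D.nl < D.o
  hor : D.or + D.nr < D.o
  ho : D.o + D.s < σ.ln 10
  hln : σ.ln 10 < 2 ^ w
  rdl : ∀ i, σ.rd 10 (D.ol + min i D.nl) = D.A i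
  rdr : ∀ i, σ.rd 10 (D.or + min i D.nr) = D.B i
  monA : Monotone D.A
  monB : Monotone D.B
  leA : ∀ i, D.A i ≤ D.s
  leB : ∀ i, D.B i ≤ D.s

theorem Node.At.of_same' {D : Node} {w : ℕ} {σ σ' : St} (h : D.At w σ)
    (hr : ∀ x, 22 ≤ x → x ≤ 28 → σ'.reg x = σ.reg x) (hl : σ'.ln 10 = σ.ln 10)
    (hd : ∀ i < D.o, σ'.rd 10 i = σ.rd 10 i) : D.At w σ' where
  r22 := (hr _ (by norm_num) (by norm_num)).trans h.r22
  r23 := (hr _ (by norm_num) (by norm_num)).trans h.r23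
  r24 := (hr _ (by norm_num) (by norm_num)).trans h.r24
  r25 := (hr _ (by norm_num) (by norm_num)).trans h.r25
  r26 := (hr _ (by norm_num) (by norm_num)).trans h.r26
  r27 := (hr _ (by norm_num) (by norm_num)).trans h.r27
  r28 := (hr _ (by norm_num) (by norm_num)).trans h.r28
  hs := h.hs
  hnl := h.hnl
  hnr := h.hnr
  hol := h.hol
  hor := h.hor
  ho := by rw [hl]; exact h.ho
  hln := by rw [hl]; exact h.hln
  rdl i := by rw [hd _ (by have := h.hol; omega), h.rdl]
  rdr i := by rw [hd _ (by have := h.hor; omega), h.rdr]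
  monA := h.monA
  monB := h.monB
  leA := h.leA
  leB := h.leB

theorem Node.At.of_same {D : Node} {w : ℕ} {c : RamProg} {σ σ' : St} (h : D.At w σ)
    (hS : SameOn c σ σ') (hr : ∀ x, 22 ≤ x → x ≤ 28 → modR c x = false)
    (ha : modA c 10 = false) : D.At w σ' :=
  h.of_same' (fun x h1 h2 => hS.reg x (hr x h1 h2)) (hS.ln ha) fun i _ => hS.rd ha i

/-- The (max,+)-convolution. -/
def cv (A B : ℕ → ℕ) (k : ℕ) : ℕ := (Finset.range (k + 1)).sup fun i => A i + B (k - i)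

theorem maxConv_eq {s : ℕ} (A B : ℕ → ℕ) {k : ℕ} (hk : k ≤ s) :
    maxConv (n := s) (fun i => ((A i : ℕ) : WithBot ℕ)) (fun i => ((B i : ℕ) : WithBot ℕ))
      ⟨k, by omega⟩ = ((cv A B k : ℕ) : WithBot ℕ) := by
  unfold maxConv cv
  refine le_antisymm (Finset.sup_le fun q hq => ?_) ?_
  · simp only [Finset.mem_filter, Finset.mem_univ, true_and] at hq
    have h1 : A q.1 + B (k - q.1) ≤ (Finset.range (k + 1)).sup fun i => A i + B (k - i) :=
      Finset.le_sup (f := fun i => A i + B (k - i)) (Finset.mem_range.2 (by omega))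
    have h2 : k - (q.1 : ℕ) = q.2 := by omega
    rw [h2] at h1
    show ((A q.1 : ℕ) : WithBot ℕ) + ((B q.2 : ℕ) : WithBot ℕ) ≤ _
    exact_mod_cast h1
  · obtain ⟨i, hi, h⟩ := Finset.exists_mem_eq_sup (Finset.range (k + 1)) ⟨0, by simp⟩
      fun i => A i + B (k - i)
    rw [h]
    have hi' := Finset.mem_range.1 hi
    have := Finset.le_sup (f := fun q : Fin (s + 1) × Fin (s + 1) =>
      ((A q.1 : ℕ) : WithBot ℕ) + ((B q.2 : ℕ) : WithBot ℕ))
      (s := Finset.univ.filter fun q : Fin (s + 1) × Fin (s + 1) => (q.1 : ℕ) + (q.2 : ℕ) = k)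
      (b := (⟨i, by omega⟩, ⟨k - i, by omega⟩)) (by simp; omega)
    exact_mod_cast this

theorem cv_mono {A B : ℕ → ℕ} (hB : Monotone B) : Monotone (cv A B) := by
  intro k k' h
  refine Finset.sup_le fun i hi => ?_
  have hi' := Finset.mem_range.1 hi
  exact (Nat.add_le_add_left (hB (by omega : k - i ≤ k' - i)) _).trans
    (Finset.le_sup (f := fun i => A i + B (k' - i)) (Finset.mem_range.2 (by omega)))

/-- The program `P`, shifted by `100`, computes convolutions of size at most `m` with probability
`2 / 3`. -/
def ConvOK (P : RamProg) (T : ℕ → ℕ) (w m : ℕ) : Prop :=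
  ∀ s ≤ m, ∀ A B : ℕ → ℕ, Monotone A → Monotone B → (∀ i, A i ≤ s) → (∀ i, B i ≤ s) →
    ∀ σ : St, (∀ x, 100 ≤ x → σ.reg x = 0) →
    σ.arr 100 = List.ofFn (fun i : Fin (s + 1) => A i + 1) →
    σ.arr 101 = List.ofFn (fun i : Fin (s + 1) => B i + 1) → (∀ a, 102 ≤ a → σ.arr a = []) →
    ∀ (φ : St → Prop) [DecidablePred φ],
    (∀ σ', (∀ k ≤ s, σ'.rd 100 k = cv A B k + 1) → φ σ') →
    RT w (P.shift 100) σ (T s) (fun _ => True) (fun σ' => if φ σ' then 0 else 1) (1 / 3)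

theorem list_sum_ofFn_le {m b : ℕ} {f : Fin m → ℕ} (h : ∀ i, f i ≤ b) :
    (List.ofFn f).sum ≤ m * b := by
  rw [List.sum_ofFn]
  calc ∑ i, f i ≤ ∑ _i : Fin m, b := Finset.sum_le_sum fun i _ => h i
    _ = m * b := by simp

theorem SolvesInTime.convOK {P : RamProg} {K : ℕ} (hK : 1 ≤ K) {T : ℕ → ℕ}
    (hP : SolvesInTime P (bmMaxConv K) (fun I => T I.n) (fun _ => 2 / 3)) :
    ∃ c : ℕ, ∀ w m : ℕ, (2 * (m + 2) * (m + 2)) ^ c ≤ 2 ^ w → ConvOK P T w m := by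
  obtain ⟨c, h⟩ := hP.call 100
  refine ⟨c, fun w m hw s hs A B mA mB lA lB σ hr h0 h1 h2 φ _ hφ => ?_⟩
  have hKs : s ≤ K * s := Nat.le_mul_of_pos_left _ hK
  let J : BMMaxConvInstance K :=
    { n := s
      A := fun i => ((A i : ℕ) : WithBot ℕ)
      B := fun i => ((B i : ℕ) : WithBot ℕ)
      monotone_A := fun i j hij => by
        show ((A i : ℕ) : WithBot ℕ) ≤ ((A j : ℕ) : WithBot ℕ)
        exact_mod_cast mA (by exact_mod_cast hij : (i : ℕ) ≤ j)
      monotone_B := fun i j hij => by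
        show ((B i : ℕ) : WithBot ℕ) ≤ ((B j : ℕ) : WithBot ℕ)
        exact_mod_cast mB (by exact_mod_cast hij : (i : ℕ) ≤ j)
      bounded_A := fun i => by
        show ((A i : ℕ) : WithBot ℕ) ≤ ((K * s : ℕ) : WithBot ℕ)
        exact_mod_cast (lA i).trans hKs
      bounded_B := fun i => by
        show ((B i : ℕ) : WithBot ℕ) ≤ ((K * s : ℕ) : WithBot ℕ)
        exact_mod_cast (lB i).trans hKs }
  have hin : (bmMaxConv K).input J = [List.ofFn (fun i : Fin (s + 1) => A i + 1),
    List.ofFn (fun i : Fin (s + 1) => B i + 1)] := rfl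
  have hmag : inputMagnitude ((bmMaxConv K).input J) + 2 ≤ 2 * (m + 2) * (m + 2) := by
    rw [hin]
    have e1 := list_sum_ofFn_le (m := s + 1) (b := s + 1) (f := fun i => A i + 1)
      fun i => by have := lA i; omega
    have e2 := list_sum_ofFn_le (m := s + 1) (b := s + 1) (f := fun i => B i + 1)
      fun i => by have := lB i; omega
    simp only [inputMagnitude, List.map_cons, List.map_nil, List.sum_cons, List.sum_nil,
      List.length_ofFn] at *
    have e3 : (s + 1) * (s + 1) ≤ (m + 1) * (m + 1) := Nat.mul_le_mul (by omega) (by omega)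
    nlinarith
  have := h J w ((Nat.pow_le_pow_left hmag c).trans hw) σ hr ?_ φ ?_
  · refine this.mono le_rfl (fun _ _ h => h) (fun _ _ _ => le_rfl) (by norm_num)
  · rintro (_ | _ | a)
    · simpa [hin] using h0
    · simpa [hin] using h1
    · rw [hin, h2 _ (by omega)]; simp
  · intro σ' hc
    refine hφ σ' fun k hk => ?_
    have hc' : σ'.arr 100 = List.ofFn fun k => encodeEntry (maxConv J.A J.B k) := hc
    have h3 := maxConv_eq A B hk
    have h4 : k < 2 * s + 1 := by omega
    rw [St.rd, hc', List.getD_eq_getElem?_getD, List.getElem?_ofFn]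
    have h5 : maxConv J.A J.B ⟨k, h4⟩ = ((cv A B k : ℕ) : WithBot ℕ) := h3
    have h6 : k < 2 * J.n + 1 := h4
    rw [dif_pos h6]
    simp only [Option.getD_some]
    erw [h5]
    rfl

/-! ### One round of a convolution -/

theorem load_spec {w : ℕ} (hw : 1 ≤ w) {D : Node} {σ : St} (hD : D.At w σ) :
    Det w loadProg σ (30 + 60 * (D.s + 1)) fun σ' =>
      σ'.arr 100 = List.ofFn (fun i : Fin (D.s + 1) => D.A i + 1) ∧
      σ'.arr 101 = List.ofFn (fun i : Fin (D.s + 1) => D.B i + 1) := by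
  unfold loadProg
  have hs := hD.hs
  have hol := hD.hol
  have hor := hD.hor
  have ho := hD.ho
  have hln := hD.hln
  apply Run.det
  refine Run.alloc hw (by simp) (Run.alloc hw (by simp) ?_)
  generalize hτ : (σ.al 100 (RamExpr.val σ (§ 24))).al 101
    (RamExpr.val (σ.al 100 (RamExpr.val σ (§ 24))) (§ 24)) = τ
  have hD' : D.At w τ := by
    subst hτ; exact hD.of_same' (fun _ _ _ => by simp) (by simp) (fun _ _ => by simp)
  have l0 : τ.ln 100 = D.s + 1 := by subst hτ; simp [hD.r24]
  have l1 : τ.ln 101 = D.s + 1 := by subst hτ; simp [hD.r24]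
  have hv : RamExpr.val σ (§ 24) = D.s + 1 := hD.r24
  have hv' : RamExpr.val (σ.al 100 (RamExpr.val σ (§ 24))) (§ 24) = D.s + 1 := by simp [hD.r24]
  rw [hv', hv]
  clear hτ
  refine Run.last (Det.for hw (fun _ => 50) (fun k σ' => σ'.ln 100 = D.s + 1 ∧ σ'.ln 101 = D.s + 1 ∧
    (∀ i < k, σ'.rd 100 i = D.A i + 1) ∧ ∀ i < k, σ'.rd 101 i = D.B i + 1) hD'.r24 (by omega)
    (by norm_num) rfl rfl (by simp [l0, l1]) ?_) ?_
  · intro k hk σ' hS hk' ⟨m0, m1, d0, d1⟩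
    have hD' := hD'.of_same hS (fun a _ _ => by interval_cases a <;> rfl) rfl
    have e1 := hD'.rdl k
    have e2 := hD'.rdr k
    have e3 := hD'.leA k
    have e4 := hD'.leB k
    refine Det.straight_le hw rfl ?_
    simp [childIdx, hk', hD'.r25, hD'.r26, hD'.r27, hD'.r28, m0, m1, Nat.sub_sub_eq_min, e1, e2, hk]
    repeat' apply And.intro
    any_goals omega
    · intro i hi
      rcases hi.lt_or_eq with h | rfl
      · simp [d0 i h, h.ne]
      · simp
    · intro i hi
      rcases hi.lt_or_eq with h | rfl
      · simp [d1 i h, h.ne]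
      · simp
  · rintro σ' - ⟨-, m0, m1, d0, d1⟩
    refine ⟨?_, St.arr_eq_ofFn m0 fun i => d0 i i.2, St.arr_eq_ofFn m1 fun i => d1 i i.2⟩
    simp [RamExpr.cost]; omega

/-- One step of a majority vote, for the candidate `q.1` with counter `q.2` and the vote `x`. -/
def voteStep (x : ℕ) (q : ℕ × ℕ) : ℕ × ℕ :=
  if q.2 = 0 then (x, 1) else if q.1 = x then (q.1, q.2 + 1) else (q.1, q.2 - 1)

theorem vote_spec {w : ℕ} (hw : 1 ≤ w) {s r : ℕ} {σ : St} (h24 : σ.reg 24 = s + 1)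
    (hs : s + 1 < 2 ^ w) (l13 : σ.ln 13 = s + 1) (l14 : σ.ln 14 = s + 1)
    (hr : r + 1 < 2 ^ w) (hc : ∀ k ≤ s, σ.rd 14 k ≤ r) :
    Det w voteProg σ (6 + 60 * (s + 1)) fun σ' => σ'.ln 13 = s + 1 ∧ σ'.ln 14 = s + 1 ∧
      ∀ k ≤ s, (σ'.rd 13 k, σ'.rd 14 k) = voteStep (σ.rd 100 k) (σ.rd 13 k, σ.rd 14 k) := by
  refine (Det.for hw (fun _ => 50) (fun k σ' => σ'.ln 13 = s + 1 ∧ σ'.ln 14 = s + 1 ∧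
    ∀ i, (σ'.rd 13 i, σ'.rd 14 i) = if i < k then voteStep (σ.rd 100 i) (σ.rd 13 i, σ.rd 14 i)
      else (σ.rd 13 i, σ.rd 14 i)) h24 (by omega)
    (by norm_num) rfl rfl (by simp [l13, l14]) ?_).mono ?_ ?_
  · intro k hk σ' hS hk' ⟨m13, m14, hd⟩
    have e0 : σ'.rd 100 k = σ.rd 100 k := hS.rd rfl k
    have e1 := hd k
    rw [if_neg (lt_irrefl k)] at e1
    simp only [Prod.mk.injEq] at e1
    have e2 := hc k (by omega)
    have e3 : 0 < 2 ^ w := by positivity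
    suffices hP : ∀ P : St → Prop, (∀ σ'' : St, σ''.ln 13 = s + 1 → σ''.ln 14 = s + 1 →
        (∀ i, i ≠ k → σ''.rd 13 i = σ'.rd 13 i) → (∀ i, i ≠ k → σ''.rd 14 i = σ'.rd 14 i) →
        (σ''.rd 13 k, σ''.rd 14 k) = voteStep (σ.rd 100 k) (σ.rd 13 k, σ.rd 14 k) → P σ'') →
        Det w _ σ' 50 P from hP _ fun σ'' h1 h2 h3 h4 h5 => by
      refine ⟨h1, h2, fun i => ?_⟩
      simp only [St.rd_setR]
      rcases lt_trichotomy i k with h | h | h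
      · rw [h3 i h.ne, h4 i h.ne, hd i, if_pos h, if_pos (by omega)]
      · subst h; rw [h5, if_pos (by omega)]
      · rw [h3 i h.ne', h4 i h.ne', hd i, if_neg (by omega), if_neg (by omega)]
    intro P hP
    refine Det.straight_le hw rfl ?_
    simp only [voteStep] at hP
    by_cases h1 : σ.rd 14 k = 0
    · simp [hk', e1, h1]
      refine ⟨by omega, hP _ (by simp [m13]) (by simp [m14]) (fun i hi => by simp [hi])
        (fun i hi => by simp [hi]) ?_⟩
      simp [m13, m14, e0, h1, hk]
    · by_cases h2 : σ.rd 13 k = σ.rd 100 k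
      · simp [hk', e1, e0, h1, h2]
        refine ⟨by omega, hP _ (by simp [m13]) (by simp [m14]) (fun i hi => by simp [hi])
          (fun i hi => by simp [hi]) ?_⟩
        simp [e1, m14, h1, h2, hk]
      · simp [hk', e1, e0, h1, h2]
        refine ⟨by omega, hP _ (by simp [m13]) (by simp [m14]) (fun i hi => by simp [hi])
          (fun i hi => by simp [hi]) ?_⟩
        simp [e1, m14, h1, h2, hk]
  · simp; omega
  · rintro σ' - ⟨-, m13, m14, hd⟩
    exact ⟨m13, m14, fun k hk => by rw [hd k, if_pos (by omega)]⟩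

/-! ### Majority votes -/

/-- The lead of the value `x` in a majority vote with candidate `q.1` and counter `q.2`: the
counter, with a minus sign if the candidate differs from `x`. -/
def lead (x : ℕ) (q : ℕ × ℕ) : ℤ := if q.1 = x then q.2 else -q.2

/-- A vote for `x` increases the lead of `x`. -/
theorem lead_voteStep_self (x : ℕ) (q : ℕ × ℕ) : lead x (voteStep x q) = lead x q + 1 := by
  unfold lead voteStep
  split_ifs <;> simp_all
  omega

theorem lead_voteStep_ge (x y : ℕ) (q : ℕ × ℕ) : lead x q - 1 ≤ lead x (voteStep y q) := by
  unfold lead voteStep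
  split_ifs <;> simp_all <;> omega

/-- The least lead of the correct values `x 0, …, x s` in the majority votes in the arrays `13` and
`14`. -/
def minLead (s : ℕ) (x : ℕ → ℕ) (σ : St) : ℤ :=
  (Finset.range (s + 1)).inf' Finset.nonempty_range_add_one fun k => lead (x k) (σ.rd 13 k, σ.rd 14 k)

theorem minLead_congr {s : ℕ} {x : ℕ → ℕ} {σ σ' : St} (h : ∀ k ≤ s, σ'.rd 13 k = σ.rd 13 k)
    (h' : ∀ k ≤ s, σ'.rd 14 k = σ.rd 14 k) : minLead s x σ' = minLead s x σ := by
  unfold minLead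
  refine Finset.inf'_congr _ rfl fun k hk => ?_
  have := Finset.mem_range.1 hk
  rw [h k (by omega), h' k (by omega)]

theorem minLead_add_le {s : ℕ} {x : ℕ → ℕ} {σ σ' : St} {e : ℤ}
    (h : ∀ k ≤ s, lead (x k) (σ.rd 13 k, σ.rd 14 k) + e ≤ lead (x k) (σ'.rd 13 k, σ'.rd 14 k)) :
    minLead s x σ + e ≤ minLead s x σ' := by
  unfold minLead
  rw [Finset.le_inf'_iff]
  intro k hk
  have := Finset.mem_range.1 hk
  refine le_trans ?_ (h k (by omega))
  exact add_le_add_left (Finset.inf'_le _ hk) e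

theorem rd13_of_minLead_pos {s : ℕ} {x : ℕ → ℕ} {σ : St} (h : 0 < minLead s x σ) {k : ℕ}
    (hk : k ≤ s) : σ.rd 13 k = x k := by
  have h1 : minLead s x σ ≤ lead (x k) (σ.rd 13 k, σ.rd 14 k) :=
    Finset.inf'_le (f := fun k => lead (x k) (σ.rd 13 k, σ.rd 14 k)) (Finset.mem_range.2 (by omega))
  by_contra hne
  unfold lead at h1
  rw [if_neg hne] at h1
  omega

/-- One round of the votes. The potential is `(3 / 2) ^ (-lead)` for the least lead of a correct
value: a correct run, of probability `2 / 3`, divides it by `3 / 2`, any other run multiplies it by at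
most `3 / 2`, and `2 / 3 * (2 / 3) + 1 / 3 * (3 / 2) = 17 / 18`. -/
theorem round_spec {P : RamProg} {T : ℕ → ℕ} {w B : ℕ} (hw : 1 ≤ w)
    {D : Node} {σ : St} (hP : ConvOK P T w D.s) (hD : D.At w σ) (hC : Clean (100 + B) σ) {r : ℕ} (hr : r + 1 < 2 ^ w)
    (l13 : σ.ln 13 = D.s + 1) (l14 : σ.ln 14 = D.s + 1) (hc : ∀ k ≤ D.s, σ.rd 14 k ≤ r) :
    RT w (resetProg B ;; loadProg ;; P.shift 100 ;; voteProg) σ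
      (4 * B + 1 + (30 + 60 * (D.s + 1) + (T D.s + (6 + 60 * (D.s + 1)))))
      (fun σ' => σ'.ln 13 = D.s + 1 ∧ σ'.ln 14 = D.s + 1 ∧ ∀ k ≤ D.s, σ'.rd 14 k ≤ r + 1)
      (fun σ' => (3 / 2 : ℝ) ^ (-minLead D.s (fun k => cv D.A D.B k + 1) σ'))
      (17 / 18 * (3 / 2 : ℝ) ^ (-minLead D.s (fun k => cv D.A D.B k + 1) σ)) := by
  have hs := hD.hs
  set x : ℕ → ℕ := fun k => cv D.A D.B k + 1 with hx
  refine Det.seq_rt (reset_spec hw B σ) fun σ₁ hS₁ ⟨hr₁, ha₁⟩ => ?_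
  have hR : ∀ y, y < 100 → modR (resetProg B) y = false ∧ modA (resetProg B) y = false :=
    fun y hy => mod_reset_lt B hy
  have hD₁ : D.At w σ₁ := hD.of_same hS₁ (fun y _ _ => (hR y (by omega)).1) (hR 10 (by norm_num)).2
  have hC₁ : Clean 100 σ₁ := by
    refine ⟨fun y hy => ?_, fun a ha => ?_⟩
    · rcases Nat.lt_or_ge y (100 + B) with h | h
      · exact hr₁ y hy h
      · rw [hS₁.reg y (mod_of_modBound_le ((modBound_reset B).trans h)).1, hC.reg y h]
    · rcases Nat.lt_or_ge a (100 + B) with h | h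
      · exact ha₁ a ha h
      · rw [hS₁.arr a (mod_of_modBound_le ((modBound_reset B).trans h)).2, hC.arr a h]
  refine Det.seq_rt (load_spec hw hD₁) fun σ₂ hS₂ ⟨h0, h1⟩ => ?_
  have hreg : ∀ y, 100 ≤ y → σ₂.reg y = 0 := fun y hy => by
    rw [hS₂.reg y (by simp [FOR, modR, loadProg, childIdx]; omega), hC₁.reg y hy]
  have harr : ∀ a, 102 ≤ a → σ₂.arr a = [] := fun y hy => by
    rw [hS₂.arr y (mod_of_modBound_le (le_trans (by decide) hy)).2, hC₁.arr y (by omega)]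
  have hD₂ : D.At w σ₂ := hD₁.of_same hS₂ (fun y _ _ => by interval_cases y <;> rfl) rfl
  have e13 : ∀ k, σ₂.rd 13 k = σ.rd 13 k := fun k =>
    (hS₂.rd rfl k).trans (hS₁.rd (hR 13 (by norm_num)).2 k)
  have e14 : ∀ k, σ₂.rd 14 k = σ.rd 14 k := fun k =>
    (hS₂.rd rfl k).trans (hS₁.rd (hR 14 (by norm_num)).2 k)
  have m13 : σ₂.ln 13 = D.s + 1 := ((hS₂.ln rfl).trans (hS₁.ln (hR 13 (by norm_num)).2)).trans l13
  have m14 : σ₂.ln 14 = D.s + 1 := ((hS₂.ln rfl).trans (hS₁.ln (hR 14 (by norm_num)).2)).trans l14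
  classical
  -- the potential after the vote is an affine function of the failure of this run
  set d := minLead D.s x σ with hd
  have hcall := hP D.s le_rfl D.A D.B hD.monA hD.monB hD.leA hD.leB σ₂ hreg h0 h1 harr
    (fun σ' => ∀ k ≤ D.s, σ'.rd 100 k = x k) (fun σ' h => h)
  have hq : (0 : ℝ) < (3 / 2 : ℝ) ^ (-d) := by positivity
  have haff := hcall.affine ((3 / 2 - 2 / 3) * (3 / 2 : ℝ) ^ (-d)) (2 / 3 * (3 / 2 : ℝ) ^ (-d))
    (by positivity)
  refine RT.seq (haff.mono le_rfl (fun _ _ h => h) (fun _ _ _ => le_rfl) (le_of_eq (by ring)))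
    fun σ₃ hS₃ _ => ?_
  have hsh : ∀ y, y < 100 → modR (P.shift 100) y = false ∧ modA (P.shift 100) y = false :=
    fun y hy => ⟨modR_shift P hy, modA_shift P hy⟩
  have f13 : ∀ k, σ₃.rd 13 k = σ.rd 13 k := fun k =>
    (hS₃.rd (hsh 13 (by norm_num)).2 k).trans (e13 k)
  have f14 : ∀ k, σ₃.rd 14 k = σ.rd 14 k := fun k =>
    (hS₃.rd (hsh 14 (by norm_num)).2 k).trans (e14 k)
  have hvote := vote_spec hw (σ := σ₃) (s := D.s) (r := r)
    ((hS₃.reg 24 (hsh 24 (by norm_num)).1).trans hD₂.r24) (by omega)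
    ((hS₃.ln (hsh 13 (by norm_num)).2).trans m13) ((hS₃.ln (hsh 14 (by norm_num)).2).trans m14) hr
    (fun k hk => by rw [f14]; exact hc k hk)
  refine (hvote.rt (f := fun σ' => (3 / 2 : ℝ) ^ (-minLead D.s x σ')) ?_).mono le_rfl ?_
    (fun _ _ _ => le_rfl) le_rfl
  · rintro σ₄ - ⟨-, -, h4⟩
    simp only [f13, f14] at h4
    split_ifs with hcorr
    · have : d + 1 ≤ minLead D.s x σ₄ := minLead_add_le fun k hk => by
        rw [h4 k hk, hcorr k hk, lead_voteStep_self]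
      calc (3 / 2 : ℝ) ^ (-minLead D.s x σ₄) ≤ (3 / 2 : ℝ) ^ (-d - 1) :=
            zpow_le_zpow_right₀ (by norm_num) (by omega)
        _ = _ := by rw [zpow_sub₀ (by norm_num)]; norm_num; ring
    · have : d + -1 ≤ minLead D.s x σ₄ := minLead_add_le fun k hk => by
        rw [h4 k hk]; exact lead_voteStep_ge _ _ _
      calc (3 / 2 : ℝ) ^ (-minLead D.s x σ₄) ≤ (3 / 2 : ℝ) ^ (-d + 1) :=
            zpow_le_zpow_right₀ (by norm_num) (by omega)
        _ = _ := by rw [zpow_add₀ (by norm_num)]; norm_num; ring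
  · rintro σ₄ - ⟨h1, h2, h4⟩
    refine ⟨h1, h2, fun k hk => ?_⟩
    have h5 := congrArg Prod.snd (h4 k hk)
    simp only [f13, f14] at h5
    have h6 := hc k hk
    rw [h5]
    unfold voteStep
    split_ifs <;> simp <;> omega

/-- The convolution fails with a probability that is exponentially small in the number `R` of
runs. -/
theorem conv_spec {P : RamProg} {T : ℕ → ℕ} {w B : ℕ} (hw : 1 ≤ w)
    (hB : ∀ x, B ≤ x → modR P x = false ∧ modA P x = false) (hB2 : 2 ≤ B) {D : Node} {σ : St}
    (hP : ConvOK P T w D.s) (hD : D.At w σ) (hC : Clean (100 + B) σ) {R : ℕ} (h17 : σ.reg 17 = R)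
    (hR : R < 2 ^ w) :
    RT w (convProg P B) σ (50 + 100 * (D.s + 1) + R * (4 * B + T D.s + 200 * (D.s + 1)))
      (fun σ' => σ'.ln 10 = σ.ln 10 ∧ ∀ i, (i < D.o ∨ D.o + D.s < i) → σ'.rd 10 i = σ.rd 10 i)
      (fun σ' => @ite ℝ (∀ k ≤ D.s, σ'.rd 10 (D.o + k) = min D.s (cv D.A D.B k))
        (Classical.propDecidable _) 0 1)
      ((17 / 18) ^ R) := by
  have hs := hD.hs
  have hln := hD.hln
  have ho := hD.ho
  set x : ℕ → ℕ := fun k => cv D.A D.B k + 1 with hx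
  unfold convProg
  have h24 := hD.r24
  have hD₁ : D.At w ((σ.al 13 (D.s + 1)).al 14 (D.s + 1)) :=
    hD.of_same' (fun _ _ _ => by simp) (by simp) (fun _ _ => by simp)
  refine RT.mono (t₁ := 1 + (D.s + 1) + 1 + (1 + (D.s + 1) + 1 + ((6 + R * (4 * B + 1 +
    (30 + 60 * (D.s + 1) + (T D.s + (6 + 60 * (D.s + 1)))) + 8)) + (6 + 40 * (D.s + 1)))))
    (Det.seq_rt (R := fun σ' => σ' = σ.al 13 (D.s + 1)) ?_ ?_) ?_
    (fun _ _ h => h) (fun _ _ _ => le_rfl) le_rfl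
  · have := Det.alloc (w := w) hw (a := 13) (e := § 24) (σ := σ)
      (Q := fun σ' => σ' = σ.al 13 (D.s + 1)) (by simp) (by simp [h24])
    simpa [RamExpr.cost, h24] using this
  · rintro _ - rfl
    refine Det.seq_rt (R := fun σ' => σ' = (σ.al 13 (D.s + 1)).al 14 (D.s + 1)) ?_ ?_
    · have := Det.alloc (w := w) hw (a := 14) (e := § 24) (σ := σ.al 13 (D.s + 1))
        (Q := fun σ' => σ' = (σ.al 13 (D.s + 1)).al 14 (D.s + 1)) (by simp) (by simp [h24])
      simpa [RamExpr.cost, h24] using this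
    rintro _ - rfl
    have hC₁ : Clean (100 + B) ((σ.al 13 (D.s + 1)).al 14 (D.s + 1)) := by
      refine ⟨fun x hx => by simpa using hC.reg x hx, fun a ha => ?_⟩
      have h1 : a ≠ 13 := by omega
      have h2 : a ≠ 14 := by omega
      simpa [St.al, Function.update_apply, h1, h2] using hC.arr a ha
    have l13 : ((σ.al 13 (D.s + 1)).al 14 (D.s + 1)).ln 13 = D.s + 1 := by simp
    have l14 : ((σ.al 13 (D.s + 1)).al 14 (D.s + 1)).ln 14 = D.s + 1 := by simp
    have d14 : ∀ k, ((σ.al 13 (D.s + 1)).al 14 (D.s + 1)).rd 14 k = 0 := by simp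
    have e17 : ((σ.al 13 (D.s + 1)).al 14 (D.s + 1)).reg 17 = R := by simp [h17]
    have b10 : ∀ i, ((σ.al 13 (D.s + 1)).al 14 (D.s + 1)).rd 10 i = σ.rd 10 i := by simp
    have bl10 : ((σ.al 13 (D.s + 1)).al 14 (D.s + 1)).ln 10 = σ.ln 10 := by simp
    generalize (σ.al 13 (D.s + 1)).al 14 (D.s + 1) = τ at *
    have hmodR : ∀ y, (y < 100 ∧ y ≠ 31 ∧ y ≠ 33 ∧ y ≠ 34) → y ≠ 37 →
        modR (FOR 37 17 (resetProg B ;; loadProg ;; P.shift 100 ;; voteProg)) y = false := by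
      rintro y ⟨h1, h2, h3, h4⟩ h5
      simp [FOR, modR, loadProg, childIdx, voteProg, (mod_reset_lt B h1).1, modR_shift P h1]
      omega
    have hmodA : ∀ y, (y < 100 ∧ y ≠ 13 ∧ y ≠ 14) →
        modA (FOR 37 17 (resetProg B ;; loadProg ;; P.shift 100 ;; voteProg)) y = false := by
      rintro y ⟨h1, h2, h3⟩
      simp [FOR, modA, loadProg, childIdx, voteProg, (mod_reset_lt B h1).2, modA_shift P h1]
      omega
    have hmodC : ∀ y, 100 + B ≤ y →
        modR (FOR 37 17 (resetProg B ;; loadProg ;; P.shift 100 ;; voteProg)) y = false ∧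
        modA (FOR 37 17 (resetProg B ;; loadProg ;; P.shift 100 ;; voteProg)) y = false := by
      intro y hy
      have h1 := mod_of_modBound_le ((modBound_reset B).trans hy)
      obtain ⟨z, rfl⟩ : ∃ z, y = z + 100 := ⟨y - 100, by omega⟩
      have h2 := hB z (by omega)
      rw [← modR_shift_add (k := 100), ← modA_shift_add (k := 100)] at h2
      constructor
      · simp [FOR, modR, loadProg, childIdx, voteProg, h1, h2]
      · simp [FOR, modA, loadProg, childIdx, voteProg, h1, h2]
        omega
    refine RT.seq (R := fun σ' => D.At w σ' ∧ σ'.ln 13 = D.s + 1 ∧ σ'.ln 10 = σ.ln 10 ∧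
        ∀ i, σ'.rd 10 i = σ.rd 10 i)
      (f := fun σ' => (3 / 2 : ℝ) ^ (-minLead D.s x σ')) ?_ fun σ₂ hS₂ ⟨hD₂, l13₂, l10, d10⟩ => ?_
    · refine (RT.for hw (n := R) (fun _ => 4 * B + 1 + (30 + 60 * (D.s + 1) +
          (T D.s + (6 + 60 * (D.s + 1))))) (fun r σ' => σ'.ln 13 = D.s + 1 ∧ σ'.ln 14 = D.s + 1 ∧
          ∀ k ≤ D.s, σ'.rd 14 k ≤ r)
        (fun r σ' => (17 / 18 : ℝ) ^ (R - r) * (3 / 2 : ℝ) ^ (-minLead D.s x σ'))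
        e17 hR (by norm_num) ?_ ?_ ?_ ?_).mono ?_ ?_ ?_ ?_
      · simp [modR, loadProg, childIdx, voteProg, (mod_reset_lt B _).1, modR_shift P _, FOR]
      · simp [modR, loadProg, childIdx, voteProg, (mod_reset_lt B _).1, modR_shift P _, FOR]
      · simp [l13, l14, d14]
      · intro r hr σ' hS hr' ⟨k13, k14, hc⟩
        have hD' : D.At w σ' := hD₁.of_same hS (fun y h1 h2 => hmodR y (by omega) (by omega))
          (hmodA 10 (by norm_num))
        have hC' := hC₁.of_same hS hmodC
        have hmul := (round_spec hw hP hD' hC' (r := r) (by omega) k13 k14 hc).affine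
          ((17 / 18 : ℝ) ^ (R - (r + 1))) 0 (by positivity)
        refine hmul.mono le_rfl ?_ ?_ ?_
        · rintro σ'' - h
          exact h
        · rintro σ'' - -
          rw [minLead_congr (σ := σ'') (by simp) (by simp), add_zero]
        · have : R - r = R - (r + 1) + 1 := by omega
          rw [this, pow_succ, add_zero, mul_assoc]
      · simp
      · rintro σ' hS ⟨-, k13, -⟩
        exact ⟨hD₁.of_same hS (fun y h1 h2 => hmodR y (by omega) (by omega))
          (hmodA 10 (by norm_num)), k13, (hS.ln (hmodA 10 (by norm_num))).trans bl10,
          fun i => (hS.rd (hmodA 10 (by norm_num)) i).trans (b10 i)⟩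
      · rintro σ' - -
        simp
      · have hz : 0 ≤ minLead D.s x (τ.setR 37 0) := by
          unfold minLead
          rw [Finset.le_inf'_iff]
          intro k _
          simp [lead, d14]
        have : (3 / 2 : ℝ) ^ (-minLead D.s x (τ.setR 37 0)) ≤ 1 := by
          rw [← zpow_zero (3 / 2 : ℝ)]
          exact zpow_le_zpow_right₀ (by norm_num) (by omega)
        calc _ ≤ (17 / 18 : ℝ) ^ (R - 0) * 1 :=
              mul_le_mul_of_nonneg_left this (by positivity)
          _ = _ := by simp
    · have hfor : Det w (FOR 31 24 (.write 10 (§ 23 +ʷ § 31)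
          ((§ 24 -ʷ (§ 24 -ʷ .read 13 (§ 31))) -ʷ ♯ 1))) σ₂ (6 + 40 * (D.s + 1)) fun σ' =>
          σ'.ln 10 = σ.ln 10 ∧ ∀ i, σ'.rd 10 i = if D.o ≤ i ∧ i < D.o + (D.s + 1) then
            min (D.s + 1) (σ₂.rd 13 (i - D.o)) - 1 else σ.rd 10 i := by
        refine (Det.for hw (fun _ => 30) (fun k σ' => σ'.ln 10 = σ.ln 10 ∧ ∀ i, σ'.rd 10 i =
          if D.o ≤ i ∧ i < D.o + k then min (D.s + 1) (σ₂.rd 13 (i - D.o)) - 1 else σ.rd 10 i)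
          hD₂.r24 (by omega) (by norm_num) rfl rfl ⟨l10, fun i => ?_⟩ ?_).mono ?_ ?_
        · rw [if_neg (by omega)]; exact d10 i
        · intro k hk σ' hS hk' ⟨hl, hd⟩
          have e13 : σ'.rd 13 k = σ₂.rd 13 k := hS.rd rfl k
          have e23 : σ'.reg 23 = D.o := (hS.reg 23 rfl).trans hD₂.r23
          have e24 : σ'.reg 24 = D.s + 1 := (hS.reg 24 rfl).trans hD₂.r24
          refine Det.straight_le hw rfl ?_
          simp [hk', e13, e23, e24, Nat.sub_sub_eq_min, hl]
          repeat' apply And.intro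
          any_goals omega
          intro i
          rw [hd i]
          by_cases hi : i = D.o + k
          · subst hi
            rw [if_pos ⟨rfl, by omega⟩, if_pos (by omega), Nat.add_sub_cancel_left]
          · rw [if_neg (by tauto)]
            by_cases h1 : D.o ≤ i ∧ i < D.o + k
            · rw [if_pos h1, if_pos (by omega)]
            · rw [if_neg h1, if_neg (by omega)]
        · simp; omega
        · rintro σ' - ⟨-, h⟩; exact h
      refine (hfor.rt (f := fun σ' =>
        @ite ℝ (∀ k ≤ D.s, σ'.rd 10 (D.o + k) = min D.s (cv D.A D.B k))
          (Classical.propDecidable _) 0 1) ?_).mono le_rfl ?_ (fun _ _ _ => le_rfl) le_rfl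
      · rintro σ₃ - ⟨-, h3⟩
        split_ifs with hcor
        · positivity
        -- without a positive lead the potential is at least `1`
        · have hneg : minLead D.s x σ₂ ≤ 0 := by
            by_contra hpos
            apply hcor
            intro k hk
            rw [h3, if_pos (by omega), Nat.add_sub_cancel_left,
              rd13_of_minLead_pos (not_le.1 hpos) hk]
            simp only [hx]
            omega
          rw [← zpow_zero (3 / 2 : ℝ)]
          exact zpow_le_zpow_right₀ (by norm_num) (by omega)
      · rintro σ₃ - ⟨h1, h2⟩
        exact ⟨h1, fun i hi => by rw [h2, if_neg (by omega)]⟩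
  · have e1 : R * (4 * B + 1 + (30 + 60 * (D.s + 1) + (T D.s + (6 + 60 * (D.s + 1)))) + 8) ≤
        R * (4 * B + T D.s + 200 * (D.s + 1)) := Nat.mul_le_mul_left _ (by omega)
    omega

theorem ConvOK.mono {P : RamProg} {T : ℕ → ℕ} {w m m' : ℕ} (h : ConvOK P T w m) (hm : m' ≤ m) :
    ConvOK P T w m' := fun s hs => h s (hs.trans hm)

theorem max_spec {w : ℕ} (hw : 1 ≤ w) {D : Node} {σ : St} (hD : D.At w σ) :
    Det w maxProg σ (6 + 80 * (D.s + 1)) fun σ' => σ'.ln 10 = σ.ln 10 ∧ ∀ i, σ'.rd 10 i =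
      if D.o ≤ i ∧ i < D.o + (D.s + 1) then max (D.A (i - D.o)) (D.B (i - D.o)) else σ.rd 10 i := by
  have hs := hD.hs
  have hol := hD.hol
  have hor := hD.hor
  have ho := hD.ho
  have hln := hD.hln
  refine (Det.for hw (fun _ => 70) (fun k σ' => σ'.ln 10 = σ.ln 10 ∧ ∀ i, σ'.rd 10 i =
    if D.o ≤ i ∧ i < D.o + k then max (D.A (i - D.o)) (D.B (i - D.o)) else σ.rd 10 i) hD.r24
    (by omega) (by norm_num) rfl rfl ?_ ?_).mono ?_ ?_
  · refine ⟨by simp, fun i => ?_⟩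
    rw [if_neg (by omega), St.rd_setR]
  · intro k hk σ' hS hk' ⟨hl, hd⟩
    have hD' : D.At w σ' := hD.of_same'
      (fun y _ _ => hS.reg y (by interval_cases y <;> rfl)) hl
      fun i hi => by rw [hd i, if_neg (by omega)]
    have e1 := hD'.rdl k
    have e2 := hD'.rdr k
    have e3 := hD'.leA k
    have e4 := hD'.leB k
    have e5 : D.A k + (D.B k - D.A k) = max (D.A k) (D.B k) := by omega
    refine Det.straight_le hw rfl ?_
    simp [childIdx, hk', hD'.r25, hD'.r26, hD'.r27, hD'.r28, hD'.r23, Nat.sub_sub_eq_min, e1, e2,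
      hl, e5]
    repeat' apply And.intro
    any_goals omega
    intro i
    rw [hd i]
    by_cases hi : i = D.o + k
    · subst hi
      rw [if_pos ⟨rfl, by omega⟩, if_pos (by omega), Nat.add_sub_cancel_left]
    · rw [if_neg (by tauto)]
      by_cases h1 : D.o ≤ i ∧ i < D.o + k
      · rw [if_pos h1, if_pos (by omega)]
      · rw [if_neg h1, if_neg (by omega)]
  · simp; omega
  · rintro σ' - ⟨-, h⟩; exact h

/-- The running maxima of the sequence `g`, truncated at `s`. -/
def runMax (s : ℕ) (g : ℕ → ℕ) (k : ℕ) : ℕ := (Finset.range (k + 1)).sup fun j => min s (g j)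

theorem runMax_succ (s : ℕ) (g : ℕ → ℕ) (k : ℕ) :
    runMax s g (k + 1) = max (runMax s g k) (min s (g (k + 1))) := by
  unfold runMax
  rw [Finset.range_add_one, Finset.sup_insert, max_comm]

theorem runMax_mono (s : ℕ) (g : ℕ → ℕ) : Monotone (runMax s g) :=
  fun _ _ h => Finset.sup_mono (Finset.range_subset_range.2 (by omega))

theorem runMax_le (s : ℕ) (g : ℕ → ℕ) (k : ℕ) : runMax s g k ≤ s :=
  Finset.sup_le fun _ _ => min_le_left _ _

theorem runMax_eq {s : ℕ} {g f : ℕ → ℕ} {k : ℕ} (hf : Monotone f) (h : ∀ j ≤ k, min s (g j) = f j) :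
    runMax s g k = f k := by
  unfold runMax
  refine le_antisymm (Finset.sup_le fun j hj => ?_) ?_
  · have hj' := Finset.mem_range.1 hj
    rw [h j (by omega)]; exact hf (by omega)
  · rw [← h k le_rfl]
    exact Finset.le_sup (f := fun j => min s (g j)) (Finset.mem_range.2 (by omega))

theorem sanitize_spec {w : ℕ} (hw : 1 ≤ w) {s o : ℕ} {σ : St} (h22 : σ.reg 22 = s)
    (h23 : σ.reg 23 = o) (h24 : σ.reg 24 = s + 1) (hs : 2 * s + 2 < 2 ^ w) (ho : o + s < σ.ln 10)
    (hln : σ.ln 10 < 2 ^ w) :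
    Det w sanitizeProg σ (8 + 50 * (s + 1)) fun σ' => σ'.ln 10 = σ.ln 10 ∧ ∀ i, σ'.rd 10 i =
      if o ≤ i ∧ i < o + (s + 1) then runMax s (fun j => σ.rd 10 (o + j)) (i - o)
        else σ.rd 10 i := by
  unfold sanitizeProg
  apply Run.det
  refine Run.assign hw (by simp) (Run.last (Det.for hw (fun _ => 40) (fun k σ' =>
    (σ'.reg 30 = if k = 0 then 0 else runMax s (fun j => σ.rd 10 (o + j)) (k - 1)) ∧
    σ'.ln 10 = σ.ln 10 ∧ ∀ i, σ'.rd 10 i = if o ≤ i ∧ i < o + k then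
      runMax s (fun j => σ.rd 10 (o + j)) (i - o) else σ.rd 10 i) (n := s + 1) (by simp [h24])
    (by omega) (by norm_num) rfl rfl ?_ ?_) ?_)
  · refine ⟨by simp, by simp, fun i => ?_⟩
    rw [if_neg (by omega)]; rfl
  · intro k hk σ' hS hk' ⟨h30, hl, hd⟩
    have e22 : σ'.reg 22 = s := (hS.reg 22 rfl).trans (by simpa using h22)
    have e23 : σ'.reg 23 = o := (hS.reg 23 rfl).trans (by simpa using h23)
    have e1 : σ'.rd 10 (o + k) = σ.rd 10 (o + k) := by rw [hd, if_neg (by omega)]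
    have e30 : σ'.reg 30 ≤ s := by
      rw [h30]; split_ifs
      · omega
      · exact runMax_le _ _ _
    have e2 : σ'.reg 30 + (min s (σ.rd 10 (o + k)) - σ'.reg 30) =
        runMax s (fun j => σ.rd 10 (o + j)) k := by
      rw [h30]
      rcases k with _ | k
      · simp [runMax]
      · rw [if_neg (by omega), runMax_succ, Nat.add_sub_cancel]
        omega
    have e3 := runMax_le s (fun j => σ.rd 10 (o + j)) k
    refine Det.straight_le hw rfl ?_
    simp [hk', e22, e23, e1, Nat.sub_sub_eq_min, hl, e2]
    repeat' apply And.intro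
    any_goals omega
    intro i
    rw [hd i]
    by_cases hi : i = o + k
    · subst hi
      rw [if_pos ⟨rfl, by omega⟩, if_pos (by omega), Nat.add_sub_cancel_left]
    · rw [if_neg (by tauto)]
      by_cases h1 : o ≤ i ∧ i < o + k
      · rw [if_pos h1, if_pos (by omega)]
      · rw [if_neg h1, if_neg (by omega)]
  · rintro σ' - ⟨-, -, h1, h2⟩
    exact ⟨by simp [RamExpr.cost]; omega, h1, h2⟩

namespace KP
variable {I : KP} {w : ℕ}

/-! ### The profiles of all nodes -/

/-- The profile of node `v`. -/
def prof (I : KP) (σ : St) (v k : ℕ) : ℕ := σ.rd 10 (I.off v + k)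

/-- The profile of node `v`, extended to a constant beyond the size of `v`. -/
def ext (I : KP) (F : ℕ → ℕ → ℕ) (v k : ℕ) : ℕ := F v (min k (I.sz v))

/-- The nodes that are convolutions; the others are maxima. -/
def IsConv (I : KP) (v : ℕ) : Prop := v < I.G ∨ I.G * I.Q ≤ v
instance : DecidablePred I.IsConv := fun _ => by unfold IsConv; infer_instance

/-- The profile of an inner node, computed from those of its children. -/
def spec (I : KP) (F : ℕ → ℕ → ℕ) (v k : ℕ) : ℕ :=
  min (I.sz v) (if I.IsConv v then cv (I.ext F (2 * v)) (I.ext F (2 * v + 1)) k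
    else max (I.ext F (2 * v) k) (I.ext F (2 * v + 1) k))

/-- The profile of `v` is monotone and bounded by the size of `v`. -/
def Sane (I : KP) (F : ℕ → ℕ → ℕ) (v : ℕ) : Prop :=
  (∀ k k', k ≤ k' → k' ≤ I.sz v → F v k ≤ F v k') ∧ ∀ k ≤ I.sz v, F v k ≤ I.sz v

theorem Sane.ext_mono {F : ℕ → ℕ → ℕ} {v : ℕ} (h : I.Sane F v) : Monotone (I.ext F v) :=
  fun _ _ hk => h.1 _ _ (min_le_min_right _ hk) (min_le_right _ _)

theorem Sane.ext_le {F : ℕ → ℕ → ℕ} {v : ℕ} (h : I.Sane F v) (k : ℕ) : I.ext F v k ≤ I.sz v :=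
  h.2 _ (min_le_right _ _)

theorem spec_mono {F : ℕ → ℕ → ℕ} {v : ℕ} (h : I.Sane F (2 * v)) (h' : I.Sane F (2 * v + 1)) :
    Monotone (I.spec F v) := by
  intro k k' hk
  unfold spec
  refine min_le_min_left _ ?_
  split_ifs
  · exact cv_mono h'.ext_mono hk
  · exact max_le_max (h.ext_mono hk) (h'.ext_mono hk)

theorem sz_child_le {v : ℕ} (h1 : 1 ≤ v) (h2 : v < I.N) :
    I.sz (2 * v) ≤ I.sz v ∧ I.sz (2 * v + 1) ≤ I.sz v := by
  rw [sz_inner h1 h2]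
  have := I.sz_le_ntop (2 * v)
  have := I.sz_le_ntop (2 * v + 1)
  omega

/-- The data of the inner node `v`. -/
def node (I : KP) (F : ℕ → ℕ → ℕ) (v : ℕ) : Node where
  s := I.sz v
  o := I.off v
  nl := I.sz (2 * v)
  ol := I.off (2 * v)
  nr := I.sz (2 * v + 1)
  or := I.off (2 * v + 1)
  A := I.ext F (2 * v)
  B := I.ext F (2 * v + 1)

/-- The registers `22` to `24` describe node `v`. -/
structure NodeRegs (I : KP) (v : ℕ) (σ : St) : Prop where
  r21 : σ.reg 21 = v
  r22 : σ.reg 22 = I.sz v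
  r23 : σ.reg 23 = I.off v
  r24 : σ.reg 24 = I.sz v + 1

theorem children_spec (hF : I.Fits w) {k : ℕ} (hk : 40 ≤ k) {σ : St} (hI : I.Ctx σ)
    (hC : Clean k σ) {v : ℕ} (hv1 : 1 ≤ v) (hv2 : v < I.N) (hv : I.NodeRegs v σ)
    (hl : I.Sane (I.prof σ) (2 * v)) (hr : I.Sane (I.prof σ) (2 * v + 1)) :
    Det w childrenProg σ 40 fun σ' => (I.node (I.prof σ) v).At w σ' ∧ σ'.arr = σ.arr ∧
      σ'.reg 9 = I.G ∧ σ'.reg 15 = I.G * I.Q ∧ σ'.reg 17 = I.R ∧ σ'.reg 21 = v ∧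
      Clean k σ' := by
  have hw := hF.hw
  have h_N := hF.h_N
  have h_ntop := hF.h_ntop
  have h_off := hF.h_off
  have hsz := I.sz_le_ntop v
  have hszc := sz_child_le hv1 hv2
  have e8l := hI.rd8 (2 * v) (by omega) (by omega)
  have e8r := hI.rd8 (2 * v + 1) (by omega) (by omega)
  have e9l := hI.rd9 (2 * v) (by omega) (by omega)
  have e9r := hI.rd9 (2 * v + 1) (by omega) (by omega)
  have hol : I.off (2 * v) + I.sz (2 * v) < I.off v :=
    (off_add_lt (by omega) (by omega) le_rfl).trans_le (I.off_le (by omega))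
  have hor : I.off (2 * v + 1) + I.sz (2 * v + 1) < I.off v :=
    (off_add_lt (by omega) (by omega) le_rfl).trans_le (I.off_le (by omega))
  have hoo : I.off v + I.sz v < I.off 0 := off_add_lt' hv1 (by omega) le_rfl
  have h2w := hF.two_lt
  refine (Det.straight_le (t := 40) (Q := fun σ' => σ'.reg 25 = I.sz (2 * v) ∧
    σ'.reg 26 = I.off (2 * v) ∧ σ'.reg 27 = I.sz (2 * v + 1) ∧ σ'.reg 28 = I.off (2 * v + 1))
    hw rfl ?_).mono le_rfl ?_
  · simp [childrenProg, hv.r21, ← two_mul, e8l, e8r, e9l, e9r]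
    omega
  · rintro σ' hS ⟨h25, h26, h27, h28⟩
    have harr : σ'.arr = σ.arr := by ext1 a; exact hS.arr a rfl
    have hrd : ∀ a i, σ'.rd a i = σ.rd a i := fun a i => hS.rd rfl i
    have hln : ∀ a, σ'.ln a = σ.ln a := fun a => hS.ln rfl
    refine ⟨⟨(hS.reg 22 rfl).trans hv.r22, (hS.reg 23 rfl).trans hv.r23,
      (hS.reg 24 rfl).trans hv.r24, h25, h26, h27, h28, ?_, hszc.1, hszc.2, hol, hor, ?_, ?_, ?_,
      ?_, hl.ext_mono, hr.ext_mono, fun i => ?_, fun i => ?_⟩, harr, (hS.reg 9 rfl).trans hI.r9,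
      (hS.reg 15 rfl).trans hI.r15, (hS.reg 17 rfl).trans hI.r17, (hS.reg 21 rfl).trans hv.r21,
      hC.of_same hS fun x hx => ⟨by simp [childrenProg, modR]; omega, rfl⟩⟩
    · show 2 * I.sz v + 2 < 2 ^ w
      omega
    · rw [hln, hI.ln10]; exact hoo
    · rw [hln, hI.ln10]; exact h_off
    · intro i; rw [hrd]; rfl
    · intro i; rw [hrd]; rfl
    · exact (hl.ext_le i).trans hszc.1
    · exact (hr.ext_le i).trans hszc.2
theorem inner_spec {P : RamProg} {T : ℕ → ℕ} {B : ℕ} (hF : I.Fits w)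
    (hB : ∀ x, B ≤ x → modR P x = false ∧ modA P x = false) (hB2 : 2 ≤ B)
    (hP : ConvOK P T w I.ntop) {σ : St} (hI : I.Ctx σ) (hC : Clean (100 + B) σ) {v : ℕ}
    (hv1 : 1 ≤ v) (hv2 : v < I.N) (hv : I.NodeRegs v σ) (hl : I.Sane (I.prof σ) (2 * v))
    (hr : I.Sane (I.prof σ) (2 * v + 1)) :
    RT w (childrenProg ;; .ite isConvExpr (convProg P B) maxProg) σ
      (120 + 100 * (I.sz v + 1) + I.R * (4 * B + T (I.sz v) + 200 * (I.sz v + 1)))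
      (fun σ' => σ'.ln 10 = σ.ln 10 ∧
        ∀ i, (i < I.off v ∨ I.off v + I.sz v < i) → σ'.rd 10 i = σ.rd 10 i)
      (fun σ' => @ite ℝ (∀ k ≤ I.sz v, min (I.sz v) (σ'.rd 10 (I.off v + k)) =
        I.spec (I.prof σ) v k) (Classical.propDecidable _) 0 1)
      ((17 / 18) ^ I.R) := by
  have hw := hF.hw
  have h2w := hF.two_lt
  have hsz := I.sz_le_ntop v
  have hGQ : I.G ≤ I.G * I.Q := Nat.le_mul_of_pos_right _ I.Q_pos
  refine (Det.seq_rt (children_spec hF (by omega) hI hC hv1 hv2 hv hl hr) (t₂ := 70 + 100 * (I.sz v + 1) +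
    I.R * (4 * B + T (I.sz v) + 200 * (I.sz v + 1))) ?_).mono (by omega) (fun _ _ h => h)
    (fun _ _ _ => le_rfl) le_rfl
  rintro σ₁ hS₁ ⟨hD, harr, h9, h15, h17, h21, hC₁⟩
  have hl1 : σ₁.ln 10 = σ.ln 10 := by unfold St.ln; rw [harr]
  have hd1 : ∀ i, σ₁.rd 10 i = σ.rd 10 i := fun i => by unfold St.rd; rw [harr]
  refine (RT.ite hw (t := 50 + 100 * (I.sz v + 1) +
    I.R * (4 * B + T (I.sz v) + 200 * (I.sz v + 1))) ?_ (fun h0 => ?_) (fun h0 => ?_)).mono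
    (t₁ := isConvExpr.cost + (50 + 100 * (I.sz v + 1) +
    I.R * (4 * B + T (I.sz v) + 200 * (I.sz v + 1))) + 1) ?_
    (fun _ _ h => h) (fun _ _ _ => le_rfl) le_rfl
  · simp only [isConvExpr, RamExpr.ok, RamExpr.val, BinOp.apply]
    have hle : ∀ (p : Prop) [Decidable p], (if p then 1 else 0) ≤ 1 := fun p _ => by
      split_ifs <;> simp
    exact ⟨⟨trivial, trivial⟩, ⟨by omega, ⟨trivial, trivial⟩, (Nat.sub_le _ _).trans_lt (by omega)⟩,
      (Nat.add_le_add (hle _) (Nat.sub_le _ _)).trans_lt h2w⟩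
  · have hconv : I.IsConv v := by
      simp only [isConvExpr, RamExpr.val, BinOp.apply, h9, h15, h21] at h0
      unfold IsConv
      by_contra h
      rw [if_neg fun h' => h (Or.inl h'), if_pos (not_le.1 fun h' => h (Or.inr h'))] at h0
      exact h0 rfl
    refine (conv_spec hw hB hB2 (hP.mono hsz) hD hC₁ h17 hF.h_R).mono le_rfl ?_ ?_ le_rfl
    · rintro σ₂ - ⟨h1, h2⟩
      exact ⟨h1.trans hl1, fun i hi => (h2 i hi).trans (hd1 i)⟩
    · rintro σ₂ - -
      split_ifs with h1 h2 h2 <;> try norm_num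
      apply h1
      intro k hk
      have h3 : σ₂.rd 10 (I.off v + k) = min (I.sz v) (cv (I.ext (I.prof σ) (2 * v))
        (I.ext (I.prof σ) (2 * v + 1)) k) := h2 k hk
      rw [h3, spec, if_pos hconv, ← min_assoc, min_self]
  · have hconv : ¬ I.IsConv v := by
      simp only [isConvExpr, RamExpr.val, BinOp.apply, h9, h15, h21] at h0
      unfold IsConv
      rintro (h | h)
      · rw [if_pos h] at h0
        exact Nat.succ_ne_zero _ ((Nat.add_comm _ _).trans h0)
      · rw [if_neg (not_lt.2 h)] at h0
        exact Nat.succ_ne_zero _ h0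
    refine ((max_spec hw hD).rt (v := (17 / 18 : ℝ) ^ I.R) (f := fun σ' => @ite ℝ (∀ k ≤ I.sz v, min (I.sz v) (σ'.rd 10 (I.off v + k)) =
        I.spec (I.prof σ) v k) (Classical.propDecidable _) 0 1) ?_).mono ?_ ?_
        (fun _ _ _ => le_rfl) le_rfl
    · rintro σ₂ - ⟨-, h2⟩
      rw [if_pos]
      · positivity
      · intro k hk
        rw [h2]
        have : (I.node (I.prof σ) v).o = I.off v := rfl
        have h3 : (I.node (I.prof σ) v).s = I.sz v := rfl
        rw [this, h3, if_pos (by omega), Nat.add_sub_cancel_left, spec, if_neg hconv]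
        rfl
    · show 6 + 80 * (I.sz v + 1) ≤ _
      omega
    · rintro σ₂ - ⟨h1, h2⟩
      refine ⟨h1.trans hl1, fun i hi => ?_⟩
      rw [h2, if_neg, hd1]
      show ¬ (I.off v ≤ i ∧ i < I.off v + (I.sz v + 1))
      omega
  · simp [isConvExpr, RamExpr.cost]; omega

end KP

namespace KP
variable {I : KP} {w : ℕ}

/-- The body of the loop of `evalProg`. -/
def evalBody (P : RamProg) (B : ℕ) : RamProg :=
  21 ⇐ § 16 -ʷ § 20 ;; 22 ⇐ .read 8 (§ 21) ;; 23 ⇐ .read 9 (§ 21) ;; 24 ⇐ § 22 +ʷ ♯ 1 ;;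
    .ite (§ 21 <ʷ § 10) (childrenProg ;; .ite isConvExpr (convProg P B) maxProg) .skip ;;
    sanitizeProg

theorem evalProg_eq (P : RamProg) (B : ℕ) : evalProg P B = FOR 20 16 (evalBody P B) := rfl

/-- A bound for the time that is needed for node `v`. -/
def evalTime (I : KP) (B : ℕ) (T : ℕ → ℕ) (v : ℕ) : ℕ :=
  200 + 200 * (I.sz v + 1) + I.R * (4 * B + T (I.sz v) + 200 * (I.sz v + 1))

theorem modR_evalBody (P : RamProg) (B : ℕ) {y : ℕ} (h : y < 100) (h' : y < 21 ∨ 38 ≤ y) :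
    modR (evalBody P B) y = false := by
  simp [evalBody, modR, childrenProg, convProg, FOR, loadProg, childIdx, voteProg,
    (mod_reset_lt B h).1, modR_shift P h, maxProg, sanitizeProg]
  omega

theorem modA_evalBody (P : RamProg) (B : ℕ) {y : ℕ} (h : y < 100) (h1 : y ≠ 10) (h2 : y ≠ 13)
    (h3 : y ≠ 14) : modA (evalBody P B) y = false := by
  simp [evalBody, modA, childrenProg, convProg, FOR, loadProg, childIdx, voteProg,
    (mod_reset_lt B h).2, modA_shift P h, maxProg, sanitizeProg]
  omega

theorem mod_evalBody_ge {P : RamProg} {B : ℕ} (hB : ∀ x, B ≤ x → modR P x = false ∧ modA P x = false)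
    (hB2 : 2 ≤ B) {y : ℕ} (hy : 100 + B ≤ y) :
    modR (evalBody P B) y = false ∧ modA (evalBody P B) y = false := by
  have h1 := mod_of_modBound_le ((modBound_reset B).trans hy)
  obtain ⟨z, rfl⟩ : ∃ z, y = z + 100 := ⟨y - 100, by omega⟩
  have h2 := hB z (by omega)
  rw [← modR_shift_add (k := 100), ← modA_shift_add (k := 100)] at h2
  constructor
  · simp [evalBody, modR, childrenProg, convProg, FOR, loadProg, childIdx, voteProg, maxProg,
      sanitizeProg, h1, h2]
  · simp [evalBody, modA, childrenProg, convProg, FOR, loadProg, childIdx, voteProg, maxProg,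
      sanitizeProg, h1, h2]
    omega

theorem spec_congr {F F' : ℕ → ℕ → ℕ} {v : ℕ} (h : ∀ k ≤ I.sz (2 * v), F (2 * v) k = F' (2 * v) k)
    (h' : ∀ k ≤ I.sz (2 * v + 1), F (2 * v + 1) k = F' (2 * v + 1) k) (k : ℕ) :
    I.spec F v k = I.spec F' v k := by
  have e1 : I.ext F (2 * v) = I.ext F' (2 * v) := by ext j; exact h _ (min_le_right _ _)
  have e2 : I.ext F (2 * v + 1) = I.ext F' (2 * v + 1) := by ext j; exact h' _ (min_le_right _ _)
  unfold spec
  rw [e1, e2]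

theorem eval_step {P : RamProg} {T : ℕ → ℕ} {B : ℕ} (hF : I.Fits w)
    (hB : ∀ x, B ≤ x → modR P x = false ∧ modA P x = false) (hB2 : 2 ≤ B)
    (hP : ConvOK P T w I.ntop) {σ : St} (hI : I.Ctx σ) (hC : Clean (100 + B) σ) {v k : ℕ}
    (hk : σ.reg 20 = k) (hkv : v = 2 * I.N - 1 - k)
    (hv1 : 1 ≤ v) (hv2 : v < 2 * I.N) (hch : v < I.N → I.Sane (I.prof σ) (2 * v) ∧
      I.Sane (I.prof σ) (2 * v + 1)) :
    RT w (evalBody P B) σ (I.evalTime B T v)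
      (fun σ' => σ'.ln 10 = σ.ln 10 ∧
        (∀ i, (i < I.off v ∨ I.off v + I.sz v < i) → σ'.rd 10 i = σ.rd 10 i) ∧
        I.Sane (I.prof σ') v ∧
        (I.N ≤ v → ∀ k ≤ I.sz v, I.prof σ' v k = runMax (I.sz v) (I.prof σ v) k))
      (fun σ' => @ite ℝ (v < I.N → ∀ k ≤ I.sz v, I.prof σ' v k = I.spec (I.prof σ) v k)
        (Classical.propDecidable _) 0 1)
      ((17 / 18) ^ I.R) := by
  have hw := hF.hw
  have h2w := hF.two_lt
  have h_ntop := hF.h_ntop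
  have h_off := hF.h_off
  have hsz := I.sz_le_ntop v
  have hoo : I.off v + I.sz v < I.off 0 := off_add_lt' hv1 hv2 le_rfl
  have e8 := hI.rd8 v hv1 hv2
  have e9 := hI.rd9 v hv1 hv2
  unfold evalBody
  let τ : St := (((σ.setR 21 v).setR 22 (I.sz v)).setR 23 (I.off v)).setR 24 (I.sz v + 1)
  have hτr : ∀ y, y < 21 ∨ 25 ≤ y → τ.reg y = σ.reg y := fun y hy => by
    simp only [τ, St.reg_setR]
    rw [if_neg (by omega), if_neg (by omega), if_neg (by omega), if_neg (by omega)]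
  have hIτ : I.Ctx τ := hI.of_same (c := 21 ⇐ ♯ 0 ;; 22 ⇐ ♯ 0 ;; 23 ⇐ ♯ 0 ;; 24 ⇐ ♯ 0)
    ⟨fun y hy => hτr y (by simp [modR] at hy; omega), fun _ _ => rfl⟩ (fun _ _ _ => rfl) rfl
    (fun y hy => by interval_cases y <;> rfl) rfl rfl rfl
  have hCτ : Clean (100 + B) τ := ⟨fun y hy => (hτr y (by omega)).trans (hC.reg y hy), hC.arr⟩
  have hτv : I.NodeRegs v τ := ⟨by simp [τ], by simp [τ], by simp [τ], by simp [τ]⟩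
  have hτp : I.prof τ = I.prof σ := rfl
  have h10 : τ.reg 10 = I.N := hIτ.r10
  have hτd : ∀ i, τ.rd 10 i = σ.rd 10 i := fun _ => rfl
  have hτl : τ.ln 10 = σ.ln 10 := rfl
  have key : RT w (.ite (§ 21 <ʷ § 10) (childrenProg ;; .ite isConvExpr (convProg P B) maxProg) .skip ;;
      sanitizeProg) τ (134 + 150 * (I.sz v + 1) + I.R * (4 * B + T (I.sz v) + 200 * (I.sz v + 1)))
      (fun σ' => σ'.ln 10 = σ.ln 10 ∧
        (∀ i, (i < I.off v ∨ I.off v + I.sz v < i) → σ'.rd 10 i = σ.rd 10 i) ∧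
        I.Sane (I.prof σ') v ∧
        (I.N ≤ v → ∀ k ≤ I.sz v, I.prof σ' v k = runMax (I.sz v) (I.prof σ v) k))
      (fun σ' => @ite ℝ (v < I.N → ∀ k ≤ I.sz v, I.prof σ' v k = I.spec (I.prof σ) v k)
        (Classical.propDecidable _) 0 1)
      ((17 / 18) ^ I.R) := by
    refine (RT.seq (R := fun σ' => σ'.ln 10 = σ.ln 10 ∧
        (∀ i, (i < I.off v ∨ I.off v + I.sz v < i) → σ'.rd 10 i = σ.rd 10 i) ∧
        σ'.reg 22 = I.sz v ∧ σ'.reg 23 = I.off v ∧ σ'.reg 24 = I.sz v + 1 ∧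
        (I.N ≤ v → ∀ i, σ'.rd 10 i = σ.rd 10 i))
      (f := fun σ' => @ite ℝ (v < I.N → ∀ k ≤ I.sz v, min (I.sz v) (σ'.rd 10 (I.off v + k)) =
        I.spec (I.prof σ) v k) (Classical.propDecidable _) 0 1)
      (RT.ite hw (t := 120 + 100 * (I.sz v + 1) +
        I.R * (4 * B + T (I.sz v) + 200 * (I.sz v + 1))) (by simp) (fun h0 => ?_) (fun h0 => ?_))
      (t₂ := 8 + 50 * (I.sz v + 1)) ?_).mono ?_ (fun _ _ h => h) (fun _ _ _ => le_rfl) le_rfl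
    · have hvN : v < I.N := by
        simp only [RamExpr.val, BinOp.apply, hτv.r21, h10] at h0
        by_contra h; exact h0 (if_neg h)
      refine (inner_spec hF hB hB2 hP hIτ hCτ hv1 hvN hτv (hch hvN).1 (hch hvN).2).mono le_rfl ?_ ?_
        le_rfl
      · rintro σ₁ hS ⟨h1, h2⟩
        refine ⟨h1, h2, ?_, ?_, ?_, fun h => by omega⟩
        · rw [hS.reg _ ?_, hτv.r22]
          simp [modR, childrenProg, convProg, FOR, loadProg, childIdx, voteProg, maxProg,
            (mod_reset_lt B _).1, modR_shift P _]
        · rw [hS.reg _ ?_, hτv.r23]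
          simp [modR, childrenProg, convProg, FOR, loadProg, childIdx, voteProg, maxProg,
            (mod_reset_lt B _).1, modR_shift P _]
        · rw [hS.reg _ ?_, hτv.r24]
          simp [modR, childrenProg, convProg, FOR, loadProg, childIdx, voteProg, maxProg,
            (mod_reset_lt B _).1, modR_shift P _]
      · rintro σ₁ - -
        split_ifs with h1 h2 h2 <;> try norm_num
        exact h1 fun _ => h2
    · have hvN : ¬ v < I.N := by
        simp only [RamExpr.val, BinOp.apply, hτv.r21, h10] at h0
        intro h; rw [if_pos h] at h0; omega
      refine ((Det.straight (c := .skip) (Q := fun σ'' => σ'' = τ) hw (by simp)).rt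
        (f := fun σ' => @ite ℝ (v < I.N → ∀ k ≤ I.sz v, min (I.sz v) (σ'.rd 10 (I.off v + k)) =
        I.spec (I.prof σ) v k) (Classical.propDecidable _) 0 1) (v := (17 / 18) ^ I.R) ?_).mono
        (by simp [RamProg.scost]; omega) ?_ (fun _ _ _ => le_rfl) le_rfl
      · rintro _ - rfl
        rw [if_pos fun h => absurd h hvN]
        positivity
      · rintro _ - rfl
        exact ⟨rfl, fun _ _ => rfl, hτv.r22, hτv.r23, hτv.r24, fun _ _ => rfl⟩
    · rintro σ₁ - ⟨h1, h2, h22, h23, h24, hleaf⟩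
      have hsan := sanitize_spec hw h22 h23 h24 (by omega) (by rw [h1, hI.ln10]; exact hoo)
        (by rw [h1, hI.ln10]; exact h_off)
      have hprof : ∀ {σ₂ : St}, (∀ i, σ₂.rd 10 i = if I.off v ≤ i ∧ i < I.off v + (I.sz v + 1) then
          runMax (I.sz v) (fun j => σ₁.rd 10 (I.off v + j)) (i - I.off v) else σ₁.rd 10 i) →
          ∀ k ≤ I.sz v, I.prof σ₂ v k = runMax (I.sz v) (I.prof σ₁ v) k := by
        intro σ₂ h k hk
        unfold prof
        rw [h, if_pos (by omega), Nat.add_sub_cancel_left]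
      refine (hsan.rt (f := fun σ' => @ite ℝ (v < I.N → ∀ k ≤ I.sz v, I.prof σ' v k =
        I.spec (I.prof σ) v k) (Classical.propDecidable _) 0 1) ?_).mono le_rfl ?_
        (fun _ _ _ => le_rfl) le_rfl
      · rintro σ₂ - ⟨-, h4⟩
        by_cases hg : v < I.N → ∀ k ≤ I.sz v, min (I.sz v) (σ₁.rd 10 (I.off v + k)) =
            I.spec (I.prof σ) v k
        · rw [if_pos, if_pos hg]
          intro hvN k hk
          rw [hprof h4 k hk]
          exact runMax_eq (spec_mono (hch hvN).1 (hch hvN).2) fun j hj =>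
            hg hvN j (hj.trans hk)
        · rw [if_neg hg]
          split_ifs <;> norm_num
      · rintro σ₂ - ⟨h3, h4⟩
        refine ⟨h3.trans h1, fun i hi => ?_, ⟨fun k k' hk hk' => ?_, fun k hk => ?_⟩,
          fun hv k hk => ?_⟩
        · rw [h4, if_neg (by omega), h2 i hi]
        · rw [hprof h4 k (hk.trans hk'), hprof h4 k' hk']; exact runMax_mono _ _ hk
        · rw [hprof h4 k hk]; exact runMax_le _ _ _
        · rw [hprof h4 k hk]
          congr 1
          ext j
          exact hleaf hv _
    · simp [RamExpr.cost]; omega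
  have e1 : RamExpr.val σ (§ 16 -ʷ § 20) = v := by simp [hI.r16, hk, hkv]
  have h_N := hF.h_N
  refine (RT.assign hw ?_ (RT.assign hw (by simp) (RT.assign hw (by simp) (RT.assign hw ?_
    (t := 134 + 150 * (I.sz v + 1) + I.R * (4 * B + T (I.sz v) + 200 * (I.sz v + 1))) ?_)))).mono
    ?_ (fun _ _ h => h) (fun _ _ _ => le_rfl) le_rfl
  · simp [hI.r16, hk]; omega
  · rw [e1]; simp [e8]; omega
  · rw [e1]
    have e2 : RamExpr.val (σ.setR 21 v) (.read 8 (§ 21)) = I.sz v := by simp [e8]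
    have e3 : RamExpr.val ((σ.setR 21 v).setR 22 (I.sz v)) (.read 9 (§ 21)) = I.off v := by simp [e9]
    have e4 : RamExpr.val (((σ.setR 21 v).setR 22 (I.sz v)).setR 23 (I.off v)) (§ 22 +ʷ ♯ 1) =
      I.sz v + 1 := by simp
    rw [e2, e3, e4]
    exact key
  · simp [RamExpr.cost, evalTime]; omega

/-- The profiles have been computed, not necessarily correctly. -/
structure Evaled (I : KP) (h : ℕ → ℕ) (σ₀ σ : St) : Prop extends I.Tab h σ where
  sane : ∀ v, 1 ≤ v → v < 2 * I.N → I.Sane (I.prof σ) v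
  leaf : ∀ v, I.N ≤ v → v < 2 * I.N → ∀ k ≤ I.sz v,
    I.prof σ v k = runMax (I.sz v) (I.prof σ₀ v) k

/-- The profiles of the inner nodes are correct. -/
def Correct (I : KP) (F : ℕ → ℕ → ℕ) : Prop :=
  ∀ v, 1 ≤ v → v < I.N → ∀ k ≤ I.sz v, F v k = I.spec F v k

theorem eval {P : RamProg} {T : ℕ → ℕ} {B : ℕ} (hF : I.Fits w)
    (hB : ∀ x, B ≤ x → modR P x = false ∧ modA P x = false) (hB2 : 2 ≤ B)
    (hP : ConvOK P T w I.ntop) {h : ℕ → ℕ} {σ : St} (hI : I.Tab h σ) (hC : Clean (100 + B) σ) :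
    RT w (evalProg P B) σ
      (6 + ∑ k ∈ Finset.range (2 * I.N - 1), (I.evalTime B T (2 * I.N - 1 - k) + 8))
      (I.Evaled h σ)
      (fun σ' => @ite ℝ (I.Correct (I.prof σ')) (Classical.propDecidable _) 0 1)
      (2 * I.N * (17 / 18) ^ I.R) := by
  have hw := hF.hw
  have h_N := hF.h_N
  have hN := I.N_pos
  rw [evalProg_eq]
  have htab : ∀ {σ' : St}, SameOn (FOR 20 16 (evalBody P B)) σ σ' → σ'.ln 10 = σ.ln 10 →
      I.Tab h σ' := fun hS h7 => by
    have hA : ∀ a, a < 100 → a ≠ 10 → a ≠ 13 → a ≠ 14 →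
        modA (FOR 20 16 (evalBody P B)) a = false := fun a h0 h1 h2 h3 => by
      simp [FOR, modA, modA_evalBody P B h0 h1 h2 h3]
    exact hI.of_same hS (fun a ha => hA a (by omega) (by omega) (by omega) (by omega))
      (hA 12 (by norm_num) (by norm_num) (by norm_num) (by norm_num))
      (fun a ha => by
        simp [FOR, modR, modR_evalBody P B (show a < 100 by omega) (Or.inl (by omega))]
        omega) h7
      (hS.ln (hA 11 (by norm_num) (by norm_num) (by norm_num) (by norm_num)))
  refine (RT.for hw (n := 2 * I.N - 1) (fun k => I.evalTime B T (2 * I.N - 1 - k))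
    (fun k σ' => σ'.ln 10 = σ.ln 10 ∧
      (∀ v, 2 * I.N - 1 - k < v → v < 2 * I.N → I.Sane (I.prof σ') v) ∧
      (∀ v, 2 * I.N - 1 - k < v → I.N ≤ v → v < 2 * I.N → ∀ j ≤ I.sz v,
        I.prof σ' v j = runMax (I.sz v) (I.prof σ v) j) ∧
      ∀ i, I.off (2 * I.N - 1 - k) ≤ i → σ'.rd 10 i = σ.rd 10 i)
    (fun k σ' => @ite ℝ (∀ v, 2 * I.N - 1 - k < v → v < I.N → ∀ j ≤ I.sz v,
      I.prof σ' v j = I.spec (I.prof σ') v j) (Classical.propDecidable _) 0 1 +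
      ((2 * I.N - 1 - k : ℕ) : ℝ) * (17 / 18) ^ I.R)
    hI.r16 (by omega) (by norm_num) ?_ ?_ ?_ ?_).mono le_rfl ?_ ?_ ?_
  · exact modR_evalBody P B (by norm_num) (Or.inl (by norm_num))
  · exact modR_evalBody P B (by norm_num) (Or.inl (by norm_num))
  · refine ⟨rfl, fun v h1 h2 => by omega, fun v h1 h2 h3 => by omega, fun i _ => rfl⟩
  · intro k hk σ₁ hS hk' ⟨hl, hs, hlf, hd⟩
    have hI₁ := htab hS hl
    have hC₁ : Clean (100 + B) σ₁ := hC.of_same hS fun y hy => by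
      have := mod_evalBody_ge hB hB2 hy
      constructor
      · simp [FOR, modR, this]; omega
      · simp [FOR, modA, this]
    obtain ⟨v, hv⟩ : ∃ v, v = 2 * I.N - 1 - k := ⟨_, rfl⟩
    have hv' : 2 * I.N - 1 - (k + 1) = v - 1 := by omega
    rw [← hv] at hs hlf hd
    rw [hv', ← hv]
    have hv1 : 1 ≤ v := by omega
    have hv2 : v < 2 * I.N := by omega
    have hstep := (eval_step hF hB hB2 hP hI₁.toCtx hC₁ hk' hv hv1 hv2 fun hvN =>
      ⟨hs _ (by omega) (by omega), hs _ (by omega) (by omega)⟩).affine 1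
      (@ite ℝ (∀ v', v < v' → v' < I.N → ∀ j ≤ I.sz v',
      I.prof σ₁ v' j = I.spec (I.prof σ₁) v' j) (Classical.propDecidable _) 0 1 +
      ((v - 1 : ℕ) : ℝ) * (17 / 18) ^ I.R) zero_le_one
    have hsame : ∀ {σ₂ : St}, (∀ i, (i < I.off v ∨ I.off v + I.sz v < i) →
        σ₂.rd 10 i = σ₁.rd 10 i) → ∀ v', v < v' → v' < 2 * I.N → ∀ k ≤ I.sz v',
        I.prof σ₂ v' k = I.prof σ₁ v' k := by
      intro σ₂ h v' h1 h2 k hk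
      refine h _ (Or.inl ?_)
      exact (off_add_lt (by omega) h2 hk).trans_le (I.off_le (by omega))
    refine hstep.mono le_rfl ?_ ?_ ?_
    · rintro σ₂ - ⟨h1, h2, h3, h4⟩
      refine ⟨h1.trans hl, fun v' hv' hv'' => ?_, fun v' hv' hN hv'' j hj => ?_, fun i hi => ?_⟩
      · rcases (show v = v' ∨ v < v' by omega) with rfl | h5
        · exact h3
        · have h6 := hs v' h5 hv''
          have h7 := hsame h2 v' h5 hv''
          refine ⟨fun a b hab hb => ?_, fun a ha => ?_⟩
          · show I.prof σ₂ v' a ≤ I.prof σ₂ v' b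
            rw [h7 a (hab.trans hb), h7 b hb]; exact h6.1 a b hab hb
          · show I.prof σ₂ v' a ≤ _
            rw [h7 a ha]; exact h6.2 a ha
      · show I.prof σ₂ v' j = _
        rcases (show v = v' ∨ v < v' by omega) with rfl | h5
        · rw [h4 hN j hj]
          unfold runMax
          refine Finset.sup_congr rfl fun a ha => ?_
          have := Finset.mem_range.1 ha
          unfold prof
          rw [hd _ (Nat.le_add_right _ _)]
        · rw [hsame h2 v' h5 hv'' j hj]
          exact hlf v' h5 hN hv'' j hj
      · show σ₂.rd 10 i = _
        have := off_pred hv1 hv2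
        rw [h2 i (Or.inr (by omega)), hd i (by omega)]
    · rintro σ₂ - ⟨h1, h2, h3, h4⟩
      have hp : I.prof (σ₂.setR 20 (k + 1)) = I.prof σ₂ := rfl
      rw [hp]
      rw [one_mul, ← add_assoc]
      refine add_le_add ?_ le_rfl
      by_cases hA : v < I.N → ∀ k ≤ I.sz v, I.prof σ₂ v k = I.spec (I.prof σ₁) v k
      · by_cases hBd : ∀ v', v < v' → v' < I.N → ∀ j ≤ I.sz v',
          I.prof σ₁ v' j = I.spec (I.prof σ₁) v' j
        · rw [if_pos, if_pos hA, if_pos hBd, add_zero]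
          intro v' hv' hN j hj
          have hsp : I.spec (I.prof σ₂) v' j = I.spec (I.prof σ₁) v' j :=
            spec_congr (hsame h2 _ (by omega) (by omega)) (hsame h2 _ (by omega) (by omega)) j
          rw [hsp]
          rcases (show v = v' ∨ v < v' by omega) with rfl | h5
          · exact hA hN j hj
          · rw [hsame h2 v' h5 (by omega) j hj]
            exact hBd v' h5 hN j hj
        · rw [if_pos hA, if_neg hBd]
          split_ifs <;> norm_num
      · rw [if_neg hA]
        split_ifs <;> norm_num
    · have : ((v : ℕ) : ℝ) = ((v - 1 : ℕ) : ℝ) + 1 := by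
        rw [← Nat.cast_succ]; congr 1; omega
      rw [this]
      refine le_of_eq ?_
      ring
  · rintro σ' hS ⟨-, hl, hs, hlf, -⟩
    exact ⟨htab hS hl, fun v h1 h2 => hs v (by omega) h2, fun v h1 h2 => hlf v (by omega) h1 h2⟩
  · rintro σ' - -
    have h0 : 2 * I.N - 1 - (2 * I.N - 1) = 0 := Nat.sub_self _
    rw [h0]
    split_ifs with h1 h2 h2
    · simp
    · simp
    · exact absurd h2 h1
    · simp
  · rw [if_pos (fun v h1 h2 => by omega)]
    have : ((2 * I.N - 1 - 0 : ℕ) : ℝ) ≤ 2 * I.N := by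
      have : 2 * I.N - 1 - 0 ≤ 2 * I.N := by omega
      exact_mod_cast this
    rw [zero_add]
    exact mul_le_mul_of_nonneg_right this (by positivity)

end KP

/-! ### Demands -/

theorem sum_update_add {n x c : ℕ} (hx : x < n) (g : ℕ → ℕ → ℕ) (D : ℕ → ℕ) :
    ∑ i ∈ Finset.range n, g i (Function.update D x c i) + g x (D x) =
      ∑ i ∈ Finset.range n, g i (D i) + g x c := by
  have hx' := Finset.mem_range.2 hx
  rw [← Finset.add_sum_erase _ _ hx', ← Finset.add_sum_erase _ (fun i => g i (D i)) hx',
    Function.update_self, Finset.sum_congr rfl (g := fun i => g i (D i))]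
  · ring
  · intro i hi
    rw [Function.update_of_ne (Finset.ne_of_mem_erase hi)]

/-- The demand `d` with value `y` of node `v` has to be passed to the children. -/
structure DemAt (w v d y : ℕ) (D : Node) (σ : St) : Prop where
  r21 : σ.reg 21 = v
  r22 : σ.reg 22 = y
  r40 : σ.reg 40 = d
  r25 : σ.reg 25 = D.nl
  r26 : σ.reg 26 = D.ol
  r27 : σ.reg 27 = D.nr
  r28 : σ.reg 28 = D.or
  hs : 2 * D.s + 2 < 2 ^ w
  hnl : D.nl ≤ D.s
  hnr : D.nr ≤ D.s
  hol : D.ol + D.nl < 2 ^ w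
  hor : D.or + D.nr < 2 ^ w
  rdl : ∀ i, σ.rd 10 (D.ol + min i D.nl) = D.A i
  rdr : ∀ i, σ.rd 10 (D.or + min i D.nr) = D.B i
  leA : ∀ i, D.A i ≤ D.s
  leB : ∀ i, D.B i ≤ D.s
  hd : d + 1 < 2 ^ w
  hv : 2 * v + 1 < 2 ^ w
  ln11 : 2 * v + 1 < σ.ln 11

theorem DemAt.of_same {w v d y : ℕ} {D : Node} {c : RamProg} {σ σ' : St} (h : DemAt w v d y D σ)
    (hS : SameOn c σ σ') (hr : ∀ x, 21 ≤ x → x ≤ 28 → x ≠ 24 → modR c x = false)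
    (hr' : modR c 40 = false) (ha : modA c 10 = false) (h11 : σ'.ln 11 = σ.ln 11) :
    DemAt w v d y D σ' where
  r21 := (hS.reg _ (hr _ (by norm_num) (by norm_num) (by norm_num))).trans h.r21
  r22 := (hS.reg _ (hr _ (by norm_num) (by norm_num) (by norm_num))).trans h.r22
  r40 := (hS.reg _ hr').trans h.r40
  r25 := (hS.reg _ (hr _ (by norm_num) (by norm_num) (by norm_num))).trans h.r25
  r26 := (hS.reg _ (hr _ (by norm_num) (by norm_num) (by norm_num))).trans h.r26
  r27 := (hS.reg _ (hr _ (by norm_num) (by norm_num) (by norm_num))).trans h.r27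
  r28 := (hS.reg _ (hr _ (by norm_num) (by norm_num) (by norm_num))).trans h.r28
  hs := h.hs
  hnl := h.hnl
  hnr := h.hnr
  hol := h.hol
  hor := h.hor
  rdl i := by rw [hS.rd ha, h.rdl]
  rdr i := by rw [hS.rd ha, h.rdr]
  leA := h.leA
  leB := h.leB
  hd := h.hd
  hv := h.hv
  ln11 := by rw [h11]; exact h.ln11

/-- Either the demand `d` can be split into `i` and `d - i` with sufficient total value, and some
such split is passed to the children, or nothing is passed on. The latter is possible only after a
failure. -/
theorem split_spec {w v d y : ℕ} (hw : 1 ≤ w) {D : Node} {σ : St} (hD : DemAt w v d y D σ) :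
    Det w splitProg σ (10 + 70 * (d + 1)) fun σ' => σ'.ln 11 = σ.ln 11 ∧
      (((∀ i ≤ d, D.A i + D.B (d - i) < y) ∧ σ'.rd 11 = σ.rd 11) ∨
      ∃ i ≤ d, y ≤ D.A i + D.B (d - i) ∧ σ'.rd 11 = Function.update (Function.update (σ.rd 11)
        (2 * v) (min i D.nl + 1)) (2 * v + 1) (min (d - i) D.nr + 1)) := by
  unfold splitProg
  have hd := hD.hd
  have hv := hD.hv
  apply Run.det
  refine Run.assign hw (by simp [hD.r40]; omega) ?_
  have hD' : DemAt w v d y D (σ.setR 24 (d + 1)) :=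
    hD.of_same (c := 24 ⇐ ♯ 0) ⟨fun x hx => by simp [modR] at hx; simp [Ne.symm hx], fun _ _ => rfl⟩
      (fun x h1 h2 h3 => by simp [modR]; omega) rfl rfl rfl
  have e1 : RamExpr.val σ (§ 40 +ʷ ♯ 1) = d + 1 := by simp [hD.r40]
  rw [e1]
  refine Run.last (Det.for hw (fun _ => 60) (fun k σ' => σ'.ln 11 = σ.ln 11 ∧
    (((∀ i < k, D.A i + D.B (d - i) < y) ∧ σ'.rd 11 = σ.rd 11) ∨
      ∃ i ≤ d, y ≤ D.A i + D.B (d - i) ∧ σ'.rd 11 = Function.update (Function.update (σ.rd 11)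
        (2 * v) (min i D.nl + 1)) (2 * v + 1) (min (d - i) D.nr + 1))) (n := d + 1) (by simp)
    hd (by norm_num) rfl rfl ?_ ?_) ?_
  · exact ⟨rfl, Or.inl ⟨fun i hi => by omega, rfl⟩⟩
  · intro k hk σ' hS hk' ⟨hl, hinv⟩
    have hD' := hD'.of_same hS (fun x h1 h2 h3 => by
      interval_cases x <;> rfl) rfl rfl hl
    have e1 := hD'.rdl k
    have e2 := hD'.rdr (d - k)
    have e3 := hD'.leA k
    have e4 := hD'.leB (d - k)
    have h1 := hD'.hs
    have h2 := hD'.hnl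
    have h3 := hD'.hnr
    have h4 := hD'.hol
    have h5 := hD'.hor
    have h6 := hD'.ln11
    suffices hP : ∀ P : St → Prop, (∀ σ'' : St, σ''.ln 11 = σ'.ln 11 →
        (D.A k + D.B (d - k) < y ∧ σ''.rd 11 = σ'.rd 11 ∨ y ≤ D.A k + D.B (d - k) ∧ σ''.rd 11 =
          Function.update (Function.update (σ'.rd 11) (2 * v) (min k D.nl + 1)) (2 * v + 1)
            (min (d - k) D.nr + 1)) → P σ'') → Det w _ σ' 60 P from hP _ fun σ'' g1 g2 => by
      refine ⟨g1.trans hl, ?_⟩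
      show ((∀ i < k + 1, D.A i + D.B (d - i) < y) ∧ σ''.rd 11 = σ.rd 11) ∨
        ∃ i ≤ d, y ≤ D.A i + D.B (d - i) ∧ σ''.rd 11 = _
      rcases g2 with ⟨g2, g3⟩ | ⟨g2, g3⟩
      · rw [g3]
        rcases hinv with ⟨g4, g5⟩ | g4
        · refine Or.inl ⟨fun i hi => ?_, g5⟩
          rcases Nat.lt_succ_iff_lt_or_eq.1 hi with g | rfl
          · exact g4 i g
          · exact g2
        · exact Or.inr g4
      · refine Or.inr ⟨k, by omega, g2, ?_⟩
        rw [g3]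
        rcases hinv with ⟨-, g5⟩ | ⟨i, -, -, g5⟩
        · rw [g5]
        · rw [g5]
          ext j
          simp only [Function.update_apply]
          split_ifs <;> rfl
    intro P hP
    refine Det.straight_le hw rfl ?_
    simp [childIdx, hk', hD'.r25, hD'.r26, hD'.r27, hD'.r28, hD'.r21, hD'.r22, hD'.r40,
      Nat.sub_sub_eq_min, e1, e2, ← two_mul]
    repeat' apply And.intro
    any_goals omega
    · intro hlt
      exact hP _ (by simp) (Or.inl ⟨hlt, rfl⟩)
    · intro hle
      repeat' apply And.intro
      any_goals omega
      refine hP _ (by simp) (Or.inr ⟨hle, ?_⟩)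
      ext j
      simp [Function.update_apply, h6, show 2 * v < σ'.ln 11 by omega]
  · rintro σ' - ⟨-, h1, h2⟩
    refine ⟨by simp [RamExpr.cost]; omega, h1, ?_⟩
    rcases h2 with ⟨h2, h3⟩ | h2
    · exact Or.inl ⟨fun i hi => h2 i (by omega), h3⟩
    · exact Or.inr h2

theorem choose_spec {w v d y : ℕ} (hw : 1 ≤ w) {D : Node} {σ : St} (hD : DemAt w v d y D σ) :
    Det w chooseProg σ 60 fun σ' => σ'.ln 11 = σ.ln 11 ∧
      ((D.A d < y ∧ σ'.rd 11 = Function.update (σ.rd 11) (2 * v + 1) (min d D.nr + 1)) ∨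
      (y ≤ D.A d ∧ σ'.rd 11 = Function.update (σ.rd 11) (2 * v) (min d D.nl + 1))) := by
  have e1 := hD.rdl d
  have h1 := hD.hs
  have h2 := hD.hnl
  have h3 := hD.hnr
  have h4 := hD.hol
  have h5 := hD.hor
  have h6 := hD.ln11
  have hd := hD.hd
  have hv := hD.hv
  suffices hP : ∀ P : St → Prop, (∀ σ'' : St, σ''.ln 11 = σ.ln 11 →
      ((D.A d < y ∧ σ''.rd 11 = Function.update (σ.rd 11) (2 * v + 1) (min d D.nr + 1)) ∨
      (y ≤ D.A d ∧ σ''.rd 11 = Function.update (σ.rd 11) (2 * v) (min d D.nl + 1))) → P σ'') →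
      Det w _ σ 60 P from hP _ fun σ'' g1 g2 => ⟨g1, g2⟩
  intro P hP
  refine Det.straight_le hw rfl ?_
  simp [chooseProg, childIdx, hD.r25, hD.r26, hD.r27, hD.r21, hD.r22, hD.r40,
      Nat.sub_sub_eq_min, e1, ← two_mul]
  repeat' apply And.intro
  any_goals omega
  · intro hlt
    repeat' apply And.intro
    any_goals omega
    refine hP _ (by simp) (Or.inl ⟨hlt, ?_⟩)
    ext j
    simp [Function.update_apply, h6]
  · intro hle
    repeat' apply And.intro
    any_goals omega
    refine hP _ (by simp) (Or.inr ⟨hle, ?_⟩)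
    ext j
    simp [Function.update_apply, show 2 * v < σ.ln 11 by omega]

/-! ### The tree -/

/-- The node `l` is in the subtree of `v`. -/
def Below (v l : ℕ) : Prop := ∃ k, l / 2 ^ k = v

theorem Below.parent {v l : ℕ} (h : Below v l) : Below (v / 2) l := by
  obtain ⟨k, rfl⟩ := h
  exact ⟨k + 1, by rw [pow_succ, Nat.div_div_eq_div_mul]⟩

theorem below_siblings {v l : ℕ} (hv : 1 ≤ v) (h : Below (2 * v) l) (h' : Below (2 * v + 1) l) :
    False := by
  obtain ⟨k, hk⟩ := h
  obtain ⟨j, hj⟩ := h'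
  rcases lt_trichotomy k j with hlt | rfl | hlt
  · obtain ⟨d, rfl⟩ := Nat.exists_eq_add_of_lt hlt
    rw [show k + d + 1 = k + (d + 1) by ring, pow_add, ← Nat.div_div_eq_div_mul, hk, pow_succ', ← Nat.div_div_eq_div_mul] at hj
    have := Nat.div_le_self (2 * v / 2) (2 ^ d)
    omega
  · omega
  · obtain ⟨d, rfl⟩ := Nat.exists_eq_add_of_lt hlt
    rw [show j + d + 1 = j + (d + 1) by ring, pow_add, ← Nat.div_div_eq_div_mul, hj, pow_succ', ← Nat.div_div_eq_div_mul] at hk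
    have := Nat.div_le_self ((2 * v + 1) / 2) (2 ^ d)
    omega

namespace KP
variable {I : KP} {w : ℕ}

/-- No item has leaves below both nodes. -/
def Apart (I : KP) (h : ℕ → ℕ) (u u' : ℕ) : Prop :=
  ∀ t q q', I.Valid t → q < I.Q → q' < I.Q → Below u (I.leafOf h t q) →
    Below u' (I.leafOf h t q') → False

theorem Apart.symm {h : ℕ → ℕ} {u u' : ℕ} (H : I.Apart h u u') : I.Apart h u' u :=
  fun t q q' ht hq hq' h1 h2 => H t q' q ht hq' hq h2 h1

theorem Apart.child {h : ℕ → ℕ} {v v' u : ℕ} (H : I.Apart h v u) (hv : v' / 2 = v) :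
    I.Apart h v' u := fun t q q' ht hq hq' h1 h2 => H t q q' ht hq hq' (hv ▸ h1.parent) h2

theorem Q_eq_pow : ∃ e, I.Q = 2 ^ e := ⟨_, rfl⟩

/-- The ancestor of a leaf at the level of the colours. -/
theorem leafOf_div_Q {h : ℕ → ℕ} {t q : ℕ} (hq : q < I.Q) :
    I.leafOf h t q / I.Q = I.G * I.Q + (h t * I.Q + q) := by
  have h2 : t % (q + 1) < I.Q := (Nat.mod_lt _ (by omega)).trans_le hq
  unfold leafOf N
  rw [← add_assoc, ← add_mul, mul_comm, Nat.mul_add_div I.Q_pos, Nat.div_eq_of_lt h2, add_zero]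

/-- The ancestor of a leaf at the level of the buckets. -/
theorem leafOf_div_QQ {h : ℕ → ℕ} {t q : ℕ} (hq : q < I.Q) :
    I.leafOf h t q / I.Q / I.Q = I.G + h t := by
  rw [leafOf_div_Q hq, ← add_assoc, ← add_mul, mul_comm, Nat.mul_add_div I.Q_pos,
    Nat.div_eq_of_lt hq, add_zero]

theorem HashOK.color_lt {h : ℕ → ℕ} (hh : I.HashOK h) {t q : ℕ} (ht : I.Valid t) (hq : q < I.Q) :
    h t * I.Q + q < I.G * I.Q := by
  have h1 := hh.lt ht
  calc h t * I.Q + q < h t * I.Q + I.Q := by omega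
    _ = (h t + 1) * I.Q := by ring
    _ ≤ I.G * I.Q := Nat.mul_le_mul_right _ (by omega)

theorem div_two_pow_lt_half {l k a m : ℕ} (h : l / 2 ^ a < 2 * m) (hk : a < k) : l / 2 ^ k < m := by
  obtain ⟨d, rfl⟩ := Nat.exists_eq_add_of_lt hk
  rw [show a + d + 1 = a + 1 + d by ring, pow_add, pow_succ, ← Nat.div_div_eq_div_mul,
    ← Nat.div_div_eq_div_mul]
  exact (Nat.div_le_self _ _).trans_lt (by omega)

theorem below_of_div {v l k : ℕ} (h : l / 2 ^ k = v) {a : ℕ} (ha : a ≤ k) : Below v (l / 2 ^ a) := by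
  obtain ⟨d, rfl⟩ := Nat.exists_eq_add_of_le ha
  exact ⟨d, by rw [Nat.div_div_eq_div_mul, ← pow_add, h]⟩

/-- The children of a convolution have no items in common. -/
theorem IsConv.apart {h : ℕ → ℕ} (hh : I.HashOK h) {v : ℕ} (hv : 1 ≤ v) (hc : I.IsConv v) :
    I.Apart h (2 * v) (2 * v + 1) := by
  intro t q q' ht hq hq' h1 h2
  obtain ⟨e, he⟩ := I.Q_eq_pow
  rcases hc with hc | hc
  · have key : ∀ u q, (u = 2 * v ∨ u = 2 * v + 1) → q < I.Q → Below u (I.leafOf h t q) →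
        Below u (I.G + h t) := by
      rintro u q hu hq ⟨k, hk⟩
      have h3 := leafOf_div_QQ (I := I) (h := h) (t := t) hq
      rw [Nat.div_div_eq_div_mul, he, ← pow_add] at h3
      rw [← h3]
      refine below_of_div hk ?_
      by_contra hlt
      have h4 := div_two_pow_lt_half (m := I.G) (by rw [hk]; omega) (not_le.1 hlt)
      omega
    exact below_siblings hv (key _ q (Or.inl rfl) hq h1) (key _ q' (Or.inr rfl) hq' h2)
  · have key : ∀ u q, (u = 2 * v ∨ u = 2 * v + 1) → q < I.Q → Below u (I.leafOf h t q) →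
        ∃ a, v / 2 ^ a = I.G * I.Q + (h t * I.Q + q) := by
      rintro u q hu hq ⟨k, hk⟩
      have h3 := leafOf_div_Q (I := I) (h := h) (t := t) hq
      have h4 := hh.color_lt ht hq
      obtain ⟨c, hc'⟩ : ∃ c, c = I.G * I.Q + (h t * I.Q + q) := ⟨_, rfl⟩
      rw [← hc', he] at h3
      rw [← hc']
      have hke : k < e := by
        by_contra hle
        obtain ⟨d, rfl⟩ := Nat.exists_eq_add_of_le (not_lt.1 hle)
        rw [pow_add, ← Nat.div_div_eq_div_mul, h3] at hk
        have := Nat.div_le_self c (2 ^ d)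
        omega
      obtain ⟨d, rfl⟩ := Nat.exists_eq_add_of_lt hke
      refine ⟨d, ?_⟩
      have huv : u / 2 = v := by omega
      rw [← h3, ← huv, ← hk, Nat.div_div_eq_div_mul, Nat.div_div_eq_div_mul]
      congr 1
      ring
    obtain ⟨a, ha⟩ := key _ q (Or.inl rfl) hq h1
    obtain ⟨b, hb⟩ := key _ q' (Or.inr rfl) hq' h2
    have c1 := hh.color_lt ht hq
    have c2 := hh.color_lt ht hq'
    rcases lt_trichotomy a b with hab | rfl | hab
    · have := div_two_pow_lt_half (m := I.G * I.Q) (by rw [ha]; omega) hab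
      omega
    · have : q = q' := by omega
      subst this
      exact below_siblings hv h1 h2
    · have := div_two_pow_lt_half (m := I.G * I.Q) (by rw [hb]; omega) hab
      omega

end KP

namespace KP
variable {I : KP} {w : ℕ}

/-- The total value of the demands `D`; a demand of `d` is represented by `d + 1`. -/
def demVal (I : KP) (F : ℕ → ℕ → ℕ) (D : ℕ → ℕ) : ℕ :=
  ∑ u ∈ Finset.range (2 * I.N), if D u = 0 then 0 else F u (D u - 1)

/-- The total weight of the demands `D`. -/
def demWt (I : KP) (D : ℕ → ℕ) : ℕ := ∑ u ∈ Finset.range (2 * I.N), (D u - 1)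

/-- The demands `D` after the nodes below `k` have been processed: they fit into the capacity, no
item can be used for two of them, and their total value is at least that of the root at `W` if the profiles are correct.
The root is exempt from `le_sz`, since `W` may exceed its size. -/
structure DemInv (I : KP) (h : ℕ → ℕ) (F : ℕ → ℕ → ℕ) (D : ℕ → ℕ) (k : ℕ) : Prop where
  ran : ∀ u, D u ≠ 0 → u < 2 * I.N ∧ k ≤ u ∧ (u < 2 * k ∨ u = 1)
  le_W : ∀ u, D u - 1 ≤ I.W
  le_sz : ∀ u, D u ≠ 0 → u ≠ 1 → D u - 1 ≤ I.sz u
  wt : I.demWt D ≤ I.W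
  apart : ∀ u u', D u ≠ 0 → D u' ≠ 0 → u ≠ u' → I.Apart h u u'
  val : I.Correct F → F 1 I.W ≤ I.demVal F D

theorem demVal_update {F : ℕ → ℕ → ℕ} {D : ℕ → ℕ} {x c : ℕ} (hx : x < 2 * I.N) :
    I.demVal F (Function.update D x c) + (if D x = 0 then 0 else F x (D x - 1)) =
      I.demVal F D + if c = 0 then 0 else F x (c - 1) :=
  sum_update_add hx (fun u a => if a = 0 then 0 else F u (a - 1)) D

theorem demWt_update {D : ℕ → ℕ} {x c : ℕ} (hx : x < 2 * I.N) :
    I.demWt (Function.update D x c) + (D x - 1) = I.demWt D + (c - 1) :=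
  sum_update_add hx (fun _ a => a - 1) D

theorem DemInv.skip {h : ℕ → ℕ} {F : ℕ → ℕ → ℕ} {D : ℕ → ℕ} {k : ℕ} (H : I.DemInv h F D k)
    (hk : D k = 0) : I.DemInv h F D (k + 1) where
  ran u hu := by
    have := H.ran u hu
    have : u ≠ k := by rintro rfl; exact hu hk
    omega
  le_W := H.le_W
  le_sz := H.le_sz
  wt := H.wt
  apart := H.apart
  val := H.val

/-- A demand may be dropped if the profiles are not correct: feasibility is kept. -/
theorem DemInv.drop {h : ℕ → ℕ} {F : ℕ → ℕ → ℕ} {D : ℕ → ℕ} {k : ℕ} (H : I.DemInv h F D k)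
    (hk : k < I.N) (hc : ¬ I.Correct F) : I.DemInv h F (Function.update D k 0) (k + 1) where
  ran u hu := by
    by_cases huk : u = k
    · simp [huk] at hu
    · rw [Function.update_of_ne huk] at hu
      have := H.ran u hu
      omega
  le_W u := by
    by_cases huk : u = k
    · simp [huk]
    · rw [Function.update_of_ne huk]; exact H.le_W u
  le_sz u hu h1 := by
    by_cases huk : u = k
    · simp [huk]
    · rw [Function.update_of_ne huk] at hu ⊢; exact H.le_sz u hu h1
  wt := by
    have := demWt_update (I := I) (D := D) (x := k) (c := 0) (by omega)
    have := H.wt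
    omega
  apart u u' hu hu' hne := by
    by_cases huk : u = k
    · simp [huk] at hu
    by_cases huk' : u' = k
    · simp [huk'] at hu'
    rw [Function.update_of_ne huk] at hu
    rw [Function.update_of_ne huk'] at hu'
    exact H.apart u u' hu hu' hne
  val hc' := absurd hc' hc

/-- The demand of a maximum is passed to the child `c`, possibly reduced to the size of `c`. -/
theorem DemInv.choose {h : ℕ → ℕ} {F : ℕ → ℕ → ℕ} {D : ℕ → ℕ} {k : ℕ} (H : I.DemInv h F D k)
    (hk : k < I.N) (h0 : D k ≠ 0) {c a : ℕ} (hc : c = 2 * k ∨ c = 2 * k + 1) (ha : a ≤ D k - 1)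
    (has : a ≤ I.sz c) (hv : I.Correct F → F k (D k - 1) ≤ F c a) :
    I.DemInv h F (Function.update (Function.update D k 0) c (a + 1)) (k + 1) := by
  have hr := H.ran k h0
  have hk1 : 1 ≤ k := by omega
  have hck : c ≠ k := by omega
  have hD : D c = 0 := by
    by_contra hne
    have := H.ran c hne
    omega
  have key : ∀ u, Function.update (Function.update D k 0) c (a + 1) u ≠ 0 →
      u = c ∨ (u ≠ c ∧ u ≠ k ∧ D u ≠ 0 ∧
        Function.update (Function.update D k 0) c (a + 1) u = D u) := by
    intro u hu
    by_cases h1 : u = c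
    · exact Or.inl h1
    · rw [Function.update_of_ne h1] at hu
      by_cases h2 : u = k
      · simp [h2] at hu
      · rw [Function.update_of_ne h2] at hu
        exact Or.inr ⟨h1, h2, hu, by rw [Function.update_of_ne h1, Function.update_of_ne h2]⟩
  have hap : ∀ u, u ≠ k → D u ≠ 0 → I.Apart h c u := fun u h1 h2 =>
    (H.apart k u h0 h2 h1.symm).child (by omega)
  refine ⟨fun u hu => ?_, fun u => ?_, fun u hu h1 => ?_, ?_, fun u u' hu hu' hne => ?_,
    fun hcor => ?_⟩
  · rcases key u hu with rfl | ⟨h1, h2, h3, -⟩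
    · omega
    · have := H.ran u h3
      omega
  · by_cases h1 : u = c
    · have := H.le_W k
      rw [h1, Function.update_self]; omega
    · rw [Function.update_of_ne h1]
      by_cases h2 : u = k
      · simp [h2]
      · rw [Function.update_of_ne h2]; exact H.le_W u
  · rcases key u hu with rfl | ⟨h1', h2, h3, h4⟩
    · simpa using has
    · rw [h4]; exact H.le_sz u h3 h1
  · have e1 := demWt_update (I := I) (D := D) (x := k) (c := 0) (by omega)
    have e2 := demWt_update (I := I) (D := Function.update D k 0) (x := c) (c := a + 1) (by omega)
    rw [Function.update_of_ne hck, hD] at e2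
    have := H.wt
    omega
  · rcases key u hu with rfl | ⟨h1, h2, h3, -⟩ <;> rcases key u' hu' with rfl | ⟨h1', h2', h3', -⟩
    · exact absurd rfl hne
    · exact hap u' h2' h3'
    · exact (hap u h2 h3).symm
    · exact H.apart u u' h3 h3' hne
  · have e1 := demVal_update (I := I) (F := F) (D := D) (x := k) (c := 0) (by omega)
    have e2 := demVal_update (I := I) (F := F) (D := Function.update D k 0) (x := c) (c := a + 1)
      (by omega)
    rw [Function.update_of_ne hck, hD] at e2
    have := H.val hcor
    have := hv hcor
    simp only [h0, if_false, if_true, Nat.add_sub_cancel, Nat.succ_ne_zero] at e1 e2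
    omega

/-- The demand of a convolution is split between both children. -/
theorem DemInv.split {h : ℕ → ℕ} (hh : I.HashOK h) {F : ℕ → ℕ → ℕ} {D : ℕ → ℕ} {k : ℕ}
    (H : I.DemInv h F D k) (hk : k < I.N) (h0 : D k ≠ 0) (hc : I.IsConv k) {a b : ℕ}
    (hab : a + b ≤ D k - 1) (ha : a ≤ I.sz (2 * k)) (hb : b ≤ I.sz (2 * k + 1))
    (hv : I.Correct F → F k (D k - 1) ≤ F (2 * k) a + F (2 * k + 1) b) :
    I.DemInv h F (Function.update (Function.update (Function.update D k 0) (2 * k) (a + 1))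
      (2 * k + 1) (b + 1)) (k + 1) := by
  have hr := H.ran k h0
  have hk1 : 1 ≤ k := by omega
  have hD : ∀ c, c = 2 * k ∨ c = 2 * k + 1 → D c = 0 := by
    intro c hc
    by_contra hne
    have := H.ran c hne
    omega
  set D' := Function.update (Function.update (Function.update D k 0) (2 * k) (a + 1))
      (2 * k + 1) (b + 1) with hD'
  have hval : ∀ u, D' u = if u = 2 * k + 1 then b + 1 else if u = 2 * k then a + 1 else
      if u = k then 0 else D u := by
    intro u
    simp only [hD', Function.update_apply]
  have key : ∀ u, D' u ≠ 0 → (u = 2 * k + 1 ∧ D' u = b + 1) ∨ (u = 2 * k ∧ D' u = a + 1) ∨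
      (u ≠ k ∧ D u ≠ 0 ∧ D' u = D u) := by
    intro u hu
    have := hval u
    rw [this] at hu ⊢
    split_ifs at hu ⊢ with h1 h2 h3
    · exact Or.inl ⟨h1, rfl⟩
    · exact Or.inr (Or.inl ⟨h2, rfl⟩)
    · exact absurd rfl hu
    · exact Or.inr (Or.inr ⟨h3, hu, rfl⟩)
  have hap : ∀ c u, c = 2 * k ∨ c = 2 * k + 1 → u ≠ k → D u ≠ 0 → I.Apart h c u :=
    fun c u hc h1 h2 => (H.apart k u h0 h2 h1.symm).child (by omega)
  -- the only new pair of demands whose items could overlap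
  have hsib := hc.apart hh hk1
  refine ⟨fun u hu => ?_, fun u => ?_, fun u hu h1 => ?_, ?_, fun u u' hu hu' hne => ?_,
    fun hcor => ?_⟩
  · rcases key u hu with ⟨rfl, -⟩ | ⟨rfl, -⟩ | ⟨h1, h2, -⟩
    · omega
    · omega
    · have := H.ran u h2
      omega
  · have h1 := H.le_W k
    have h2 := H.le_W u
    rw [hval]
    split_ifs <;> omega
  · rcases key u hu with ⟨rfl, e⟩ | ⟨rfl, e⟩ | ⟨h1', h2, e⟩
    · rw [e]; simpa using hb
    · rw [e]; simpa using ha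
    · rw [e]; exact H.le_sz u h2 h1
  · have e1 := demWt_update (I := I) (D := D) (x := k) (c := 0) (by omega)
    have e2 := demWt_update (I := I) (D := Function.update D k 0) (x := 2 * k) (c := a + 1) (by omega)
    have e3 := demWt_update (I := I) (D := Function.update (Function.update D k 0) (2 * k) (a + 1))
      (x := 2 * k + 1) (c := b + 1) (by omega)
    rw [Function.update_of_ne (by omega), hD _ (Or.inl rfl)] at e2
    rw [Function.update_of_ne (by omega), Function.update_of_ne (by omega), hD _ (Or.inr rfl),
      ← hD'] at e3
    have := H.wt
    omega
  · rcases key u hu with ⟨rfl, -⟩ | ⟨rfl, -⟩ | ⟨h1, h2, -⟩ <;>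
      rcases key u' hu' with ⟨rfl, -⟩ | ⟨rfl, -⟩ | ⟨h1', h2', -⟩
    · exact absurd rfl hne
    · exact hsib.symm
    · exact hap _ _ (Or.inr rfl) h1' h2'
    · exact hsib
    · exact absurd rfl hne
    · exact hap _ _ (Or.inl rfl) h1' h2'
    · exact (hap _ _ (Or.inr rfl) h1 h2).symm
    · exact (hap _ _ (Or.inl rfl) h1 h2).symm
    · exact H.apart u u' h2 h2' hne
  · have e1 := demVal_update (I := I) (F := F) (D := D) (x := k) (c := 0) (by omega)
    have e2 := demVal_update (I := I) (F := F) (D := Function.update D k 0) (x := 2 * k)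
      (c := a + 1) (by omega)
    have e3 := demVal_update (I := I) (F := F) (D := Function.update (Function.update D k 0) (2 * k)
      (a + 1)) (x := 2 * k + 1) (c := b + 1) (by omega)
    rw [Function.update_of_ne (by omega), hD _ (Or.inl rfl)] at e2
    rw [Function.update_of_ne (by omega), Function.update_of_ne (by omega), hD _ (Or.inr rfl),
      ← hD'] at e3
    have := H.val hcor
    have := hv hcor
    simp only [h0, if_false, if_true, Nat.add_sub_cancel, Nat.succ_ne_zero] at e1 e2 e3
    omega

/-- A correct profile is attained by the children. -/
theorem Correct.exists_split {F : ℕ → ℕ → ℕ} (hF : I.Correct F) {v : ℕ} (h1 : 1 ≤ v) (h2 : v < I.N)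
    (hc : I.IsConv v) {d : ℕ} (hd : d ≤ I.sz v) :
    ∃ i ≤ d, F v d ≤ I.ext F (2 * v) i + I.ext F (2 * v + 1) (d - i) := by
  have h := hF v h1 h2 d hd
  rw [spec, if_pos hc] at h
  obtain ⟨i, hi, h3⟩ := Finset.exists_mem_eq_sup (Finset.range (d + 1)) ⟨0, by simp⟩
      fun i => I.ext F (2 * v) i + I.ext F (2 * v + 1) (d - i)
  refine ⟨i, by have := Finset.mem_range.1 hi; omega, ?_⟩
  rw [h, cv, h3]
  exact min_le_right _ _

theorem Correct.le_max {F : ℕ → ℕ → ℕ} (hF : I.Correct F) {v : ℕ} (h1 : 1 ≤ v) (h2 : v < I.N)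
    (hc : ¬ I.IsConv v) {d : ℕ} (hd : d ≤ I.sz v) :
    F v d ≤ max (I.ext F (2 * v) d) (I.ext F (2 * v + 1) d) := by
  rw [hF v h1 h2 d hd, spec, if_neg hc]
  exact min_le_right _ _

end KP

namespace KP
variable {I : KP} {w : ℕ}

/-- The body of the loop of `demandProg`. -/
def demandBody : RamProg :=
  21 ⇐ § 20 ;; .ite (.read 11 (§ 21)) (40 ⇐ .read 11 (§ 21) -ʷ ♯ 1 ;;
    22 ⇐ .read 10 (.read 9 (§ 21) +ʷ § 40) ;; .write 11 (§ 21) (♯ 0) ;; childrenProg ;;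
    .ite isConvExpr splitProg chooseProg) .skip

/-- A demand at the root may exceed its size; then its profile is read out of bounds. -/
theorem prof_root_eq_zero {σ : St} (hl : σ.ln 10 = I.off 0) {d : ℕ} (hd : I.sz 1 < d) :
    I.prof σ 1 d = 0 := by
  have hN := I.N_pos
  have := off_pred (I := I) (v := 1) le_rfl (by omega)
  exact St.rd_eq_zero (by rw [hl]; simp at this; omega)

theorem isConvExpr_spec {σ : St} {v : ℕ} (h2w : 2 < 2 ^ w) (h9 : σ.reg 9 = I.G)
    (h15 : σ.reg 15 = I.G * I.Q) (h21 : σ.reg 21 = v) :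
    isConvExpr.ok w σ ∧ (isConvExpr.val σ ≠ 0 ↔ I.IsConv v) := by
  have hGQ : I.G ≤ I.G * I.Q := Nat.le_mul_of_pos_right _ I.Q_pos
  refine ⟨?_, ?_⟩
  · simp only [isConvExpr, RamExpr.ok, RamExpr.val, BinOp.apply]
    have hle : ∀ (p : Prop) [Decidable p], (if p then 1 else 0) ≤ 1 := fun p _ => by
      split_ifs <;> simp
    exact ⟨⟨trivial, trivial⟩, ⟨by omega, ⟨trivial, trivial⟩, (Nat.sub_le _ _).trans_lt (by omega)⟩,
      (Nat.add_le_add (hle _) (Nat.sub_le _ _)).trans_lt h2w⟩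
  · simp only [isConvExpr, RamExpr.val, BinOp.apply, h9, h15, h21, IsConv]
    split_ifs <;> omega

/-- One round of the distribution of demands: by `split_spec` or a maximum if there is a demand at
node `k`, and nothing otherwise. -/
theorem demand_step (hF : I.Fits w) {h : ℕ → ℕ} (hh : I.HashOK h) {σ : St} (hI : I.Tab h σ)
    (hs : ∀ v, 1 ≤ v → v < 2 * I.N → I.Sane (I.prof σ) v) {k : ℕ} (hk : k < I.N)
    (h20 : σ.reg 20 = k) (hD : I.DemInv h (I.prof σ) (σ.rd 11) k) :
    Det w demandBody σ (300 + 70 * (I.sz k + 1 + if k = 1 then I.W else 0)) fun σ' =>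
      σ'.ln 11 = σ.ln 11 ∧ I.DemInv h (I.prof σ) (σ'.rd 11) (k + 1) := by
  have hw := hF.hw
  have h2w := hF.two_lt
  have h_N := hF.h_N
  have h_sum := hF.h_sum
  have h_ntop := hF.h_ntop
  have h_off := hF.h_off
  have h_offW := hF.h_offW
  have ln10 := hI.ln10
  have ln11 := hI.ln11
  unfold demandBody
  apply Run.det
  refine Run.assign hw (by simp) (Run.last (t := 290 + 70 * (I.sz k + 1 + if k = 1 then I.W else 0))
    (Q := fun σ' τ => 2 + τ ≤ _ ∧ σ'.ln 11 = σ.ln 11 ∧ I.DemInv h (I.prof σ) (σ'.rd 11) (k + 1))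
    (R := fun σ' => σ'.ln 11 = σ.ln 11 ∧ I.DemInv h (I.prof σ) (σ'.rd 11) (k + 1))
    ((Det.ite hw (by simp) (t := 280 + 70 * (I.sz k + 1 + if k = 1 then I.W else 0))
      (fun h0 => ?_) (fun h0 => ?_)).mono (by simp [RamExpr.cost]; omega) fun _ _ h => h)
    fun σ' _ h => ⟨by omega, h⟩)
  swap
  · simp [h20] at h0
    refine (Det.straight (c := .skip) (Q := fun σ'' => σ'' = σ.setR 21 (RamExpr.val σ (§ 20))) hw
      (by simp)).mono (by simp [RamProg.scost]; omega) ?_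
    rintro _ - rfl
    exact ⟨rfl, hD.skip h0⟩
  simp [h20] at h0
  have hr := hD.ran k h0
  have hk1 : 1 ≤ k := by omega
  obtain ⟨d, hd⟩ : ∃ d, σ.rd 11 k = d + 1 := ⟨σ.rd 11 k - 1, by omega⟩
  have hdW : d ≤ I.W := by have := hD.le_W k; omega
  have hdsz : k ≠ 1 → d ≤ I.sz k := fun h1 => by have := hD.le_sz k h0 h1; omega
  have hoff : I.off k ≤ I.off 0 := I.off_le (Nat.zero_le _)
  have e9 := hI.rd9 k hk1 (by omega)
  have e1 : RamExpr.val σ (§ 20) = k := by simp [h20]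
  have e2 : RamExpr.val (σ.setR 21 k) (.read 11 (§ 21) -ʷ ♯ 1) = d := by simp [hd]
  have e3 : RamExpr.val ((σ.setR 21 k).setR 40 d) (.read 10 (.read 9 (§ 21) +ʷ § 40)) =
    I.prof σ k d := by simp [e9]; rfl
  have e4 : ∀ σ' : St, RamExpr.val σ' (♯ 0) = 0 := fun _ => rfl
  rw [e1]
  apply Run.det
  refine Run.assign hw (by simp [hd]; omega) ?_
  rw [e2]
  refine Run.assign hw (by simp [e9]; omega) ?_
  rw [e3]
  refine Run.write hw (by simp) (by simp) ?_
  have e5 : RamExpr.val ((((σ.setR 21 k).setR 40 d).setR 22 (I.prof σ k d))) (§ 21) = k := by simp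
  rw [e5, e4]
  set τ := ((((σ.setR 21 k).setR 40 d).setR 22 (I.prof σ k d)).wr 11 k 0) with hτ
  have hτr : ∀ x < 20, τ.reg x = σ.reg x := fun x hx => by
    simp only [hτ, St.reg_wr, St.reg_setR]
    rw [if_neg (by omega), if_neg (by omega), if_neg (by omega)]
  have hIτ : I.Tab h τ := hI.of_same (c := .write 11 (♯ 0) (♯ 0) ;; 21 ⇐ ♯ 0 ;; 40 ⇐ ♯ 0 ;; 22 ⇐ ♯ 0)
    ⟨fun x hx => by
      simp [modR] at hx
      simp only [hτ, St.reg_wr, St.reg_setR]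
      rw [if_neg (by omega), if_neg (by omega), if_neg (by omega)],
    fun a ha => by
      simp [modA] at ha
      simp [hτ, St.wr, St.setR, Ne.symm ha]⟩
    (fun a ha => by interval_cases a <;> rfl) rfl (fun a ha => by interval_cases a <;> rfl)
    (by simp [hτ]) (by simp [hτ])
  have hτ10 : ∀ i, τ.rd 10 i = σ.rd 10 i := fun i => by simp [hτ]
  have hτ11 : τ.rd 11 = Function.update (σ.rd 11) k 0 := by
    ext j
    simp [hτ, Function.update_apply, show k < σ.ln 11 by omega]
  have hτl : τ.ln 11 = σ.ln 11 := by simp [hτ]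
  have hτ21 : τ.reg 21 = k := by simp [hτ]
  have hτ22 : τ.reg 22 = I.prof σ k d := by simp [hτ]
  have hτ40 : τ.reg 40 = d := by simp [hτ]
  clear_value τ
  have e8l := hIτ.rd8 (2 * k) (by omega) (by omega)
  have e8r := hIτ.rd8 (2 * k + 1) (by omega) (by omega)
  have e9l := hIτ.rd9 (2 * k) (by omega) (by omega)
  have e9r := hIτ.rd9 (2 * k + 1) (by omega) (by omega)
  have hszc := sz_child_le hk1 hk
  have hsz := I.sz_le_ntop k
  have hl := hs (2 * k) (by omega) (by omega)
  have hr' := hs (2 * k + 1) (by omega) (by omega)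
  have hol := off_add_lt' (I := I) (v := 2 * k) (by omega) (by omega) le_rfl
  have hor := off_add_lt' (I := I) (v := 2 * k + 1) (by omega) (by omega) le_rfl
  refine Run.seq (Det.straight_le (t := 40) (Q := fun σ' => σ'.reg 25 = I.sz (2 * k) ∧
    σ'.reg 26 = I.off (2 * k) ∧ σ'.reg 27 = I.sz (2 * k + 1) ∧ σ'.reg 28 = I.off (2 * k + 1))
    hw rfl ?_) fun σ₁ hS₁ ⟨h25, h26, h27, h28⟩ => ?_
  · simp [childrenProg, hτ21, ← two_mul, e8l, e8r, e9l, e9r]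
    omega
  have hl11 : σ₁.ln 11 = σ.ln 11 := (hS₁.ln rfl).trans hτl
  have hr11 : σ₁.rd 11 = Function.update (σ.rd 11) k 0 := by
    rw [← hτ11]; ext i; exact hS₁.rd rfl i
  have hDA : DemAt w k d (I.prof σ k d) (I.node (I.prof σ) k) σ₁ :=
    { r21 := (hS₁.reg 21 rfl).trans hτ21
      r22 := (hS₁.reg 22 rfl).trans hτ22
      r40 := (hS₁.reg 40 rfl).trans hτ40
      r25 := h25
      r26 := h26
      r27 := h27
      r28 := h28
      hs := by show 2 * I.sz k + 2 < 2 ^ w; omega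
      hnl := hszc.1
      hnr := hszc.2
      hol := by show I.off (2 * k) + I.sz (2 * k) < 2 ^ w; omega
      hor := by show I.off (2 * k + 1) + I.sz (2 * k + 1) < 2 ^ w; omega
      rdl := fun i => by rw [hS₁.rd rfl, hτ10]; rfl
      rdr := fun i => by rw [hS₁.rd rfl, hτ10]; rfl
      leA := fun i => (hl.ext_le i).trans hszc.1
      leB := fun i => (hr'.ext_le i).trans hszc.2
      hd := by omega
      hv := by omega
      ln11 := by omega }
  obtain ⟨hok, hcv⟩ := isConvExpr_spec (I := I) h2w ((hS₁.reg 9 rfl).trans hIτ.r9)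
    ((hS₁.reg 15 rfl).trans hIτ.r15) ((hS₁.reg 21 rfl).trans hτ21)
  have hdsz' : I.prof σ k d ≠ 0 → d ≤ I.sz k := by
    intro hne
    by_cases h1 : k = 1
    · by_contra hlt
      subst h1
      exact hne (prof_root_eq_zero ln10 (not_le.1 hlt))
    · exact hdsz h1
  have hdk : σ.rd 11 k - 1 = d := by omega
  refine Run.last (Det.ite hw (t := 60 + 70 * (d + 1)) hok (fun hc => (split_spec hw hDA).mono (by omega) ?_)
    fun hc => (choose_spec hw hDA).mono (by omega) ?_) (R := fun σ' => σ'.ln 11 = σ.ln 11 ∧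
    I.DemInv h (I.prof σ) (σ'.rd 11) (k + 1)) ?_
  · rintro σ₂ - ⟨h1, h2⟩
    refine ⟨h1.trans hl11, ?_⟩
    have hcv := hcv.1 hc
    rcases h2 with ⟨h2, h3⟩ | ⟨i, hi, h2, h3⟩
    · rw [h3, hr11]
      refine hD.drop hk fun hcor => ?_
      have h4 := h2 0 (Nat.zero_le _)
      obtain ⟨i, hi, h5⟩ := hcor.exists_split hk1 hk hcv (hdsz' (by omega))
      exact absurd h5 (not_le.2 (h2 i hi))
    · rw [h3, hr11]
      refine hD.split hh hk h0 hcv ?_ (min_le_right _ _) (min_le_right _ _) fun _ => ?_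
      · have := min_le_left i (I.sz (2 * k))
        have := min_le_left (d - i) (I.sz (2 * k + 1))
        show min i (I.sz (2 * k)) + min (d - i) (I.sz (2 * k + 1)) ≤ _
        omega
      · rw [hdk]; exact h2
  · rintro σ₂ - ⟨h1, h2⟩
    refine ⟨h1.trans hl11, ?_⟩
    have hcv : ¬ I.IsConv k := fun hx => hcv.2 hx hc
    rcases h2 with ⟨h2, h3⟩ | ⟨h2, h3⟩
    · rw [h3, hr11]
      refine hD.choose hk h0 (Or.inr rfl) (by rw [hdk]; exact min_le_left _ _) (min_le_right _ _)
        fun hcor => ?_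
      rw [hdk]
      rcases le_max_iff.1 (hcor.le_max hk1 hk hcv (hdsz' (by omega))) with h5 | h5
      · exact absurd h5 (not_le.2 h2)
      · exact h5
    · rw [h3, hr11]
      refine hD.choose hk h0 (Or.inl rfl) (by rw [hdk]; exact min_le_left _ _) (min_le_right _ _)
        fun hcor => ?_
      rw [hdk]
      exact h2
  · rintro σ₂ - h
    refine ⟨?_, h⟩
    have : d ≤ I.sz k + if k = 1 then I.W else 0 := by
      split_ifs with h1
      · omega
      · exact (hdsz h1).trans (Nat.le_add_right _ _)
    generalize (if k = 1 then I.W else 0) = z at *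
    simp [RamExpr.cost, isConvExpr]
    omega

theorem four_le_N : 4 ≤ I.N := by
  have hG := I.G_pos
  have hQ : 2 ≤ I.Q := le_trans (by unfold Q₀; omega) (Nat.le_pow_clog (by norm_num) I.Q₀)
  have : 2 * 2 ≤ I.Q * I.Q := Nat.mul_le_mul hQ hQ
  unfold N
  rw [mul_assoc]
  exact this.trans (Nat.le_mul_of_pos_left _ hG)

/-- The demand `W` at the root is distributed to the leaves. -/
theorem demand (hF : I.Fits w) {h : ℕ → ℕ} (hh : I.HashOK h) {σ : St} (hI : I.Tab h σ)
    (hs : ∀ v, 1 ≤ v → v < 2 * I.N → I.Sane (I.prof σ) v) (h11 : ∀ i, σ.rd 11 i = 0) :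
    Det w demandProg σ (20 + ∑ k ∈ Finset.range I.N,
      (308 + 70 * (I.sz k + 1 + if k = 1 then I.W else 0))) fun σ' =>
      I.Tab h σ' ∧ (∀ i, σ'.rd 10 i = σ.rd 10 i) ∧ I.DemInv h (I.prof σ) (σ'.rd 11) I.N := by
  have hw := hF.hw
  have h2w := hF.two_lt
  have h_N := hF.h_N
  have h_sum := hF.h_sum
  have hN := I.four_le_N
  have ln11 := hI.ln11
  suffices hmain : Det w demandProg σ (20 + ∑ k ∈ Finset.range I.N,
      (308 + 70 * (I.sz k + 1 + if k = 1 then I.W else 0))) fun σ' =>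
      σ'.ln 11 = σ.ln 11 ∧ I.DemInv h (I.prof σ) (σ'.rd 11) I.N by
    obtain ⟨σ', ⟨hS, h1, h2⟩, h3⟩ := hmain.frame
    exact ⟨σ', ⟨hI.of_same hS (fun a ha => by interval_cases a <;> rfl) rfl
      (fun a ha => by interval_cases a <;> rfl) (hS.ln rfl) h1, fun i => hS.rd rfl i, h2⟩, h3⟩
  unfold demandProg
  apply Run.det
  refine Run.write hw (by simp; omega) (by simp [hI.r1]; omega) ?_
  have e1 : RamExpr.val σ (§ 1 +ʷ ♯ 1) = I.W + 1 := by simp [hI.r1]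
  have e2 : RamExpr.val σ (♯ 1) = 1 := rfl
  rw [e1, e2]
  have hI' : I.Tab h (σ.wr 11 1 (I.W + 1)) := hI.of_same (c := .write 11 (♯ 0) (♯ 0))
    ⟨fun x hx => rfl, fun a ha => by
      simp [modA] at ha
      simp [St.wr, Ne.symm ha]⟩
    (fun a ha => by interval_cases a <;> rfl) rfl (fun a ha => by interval_cases a <;> rfl)
    (by simp) (by simp)
  refine Run.last (Det.for hw (n := I.N)
    (fun k => 300 + 70 * (I.sz k + 1 + if k = 1 then I.W else 0))
    (fun k σ' => σ'.ln 11 = σ.ln 11 ∧ I.DemInv h (I.prof σ) (σ'.rd 11) k)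
    hI'.r10 (by omega) (by norm_num) rfl rfl ⟨by simp, ?_⟩ ?_) ?_
  · have hz : ∀ u, u ≠ 1 → (St.rd ((σ.wr 11 1 (I.W + 1)).setR 20 0) 11) u = 0 := fun u hu => by
      simp [hu, h11]
    have h1 : (St.rd ((σ.wr 11 1 (I.W + 1)).setR 20 0) 11) 1 = I.W + 1 := by
      simp; omega
    generalize (St.rd ((σ.wr 11 1 (I.W + 1)).setR 20 0) 11) = D at *
    have hu : ∀ u, D u ≠ 0 → u = 1 := fun u hu => by by_contra hx; exact hu (hz u hx)
    refine ⟨fun u hu' => ?_, fun u => ?_, fun u hu' hne => absurd (hu u hu') hne, ?_,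
      fun u u' hu1 hu2 hne => absurd ((hu u hu1).trans (hu u' hu2).symm) hne, fun _ => ?_⟩
    · have := hu u hu'
      omega
    · by_cases hx : u = 1
      · subst hx; omega
      · rw [hz u hx]; omega
    · unfold demWt
      rw [Finset.sum_eq_single 1]
      · omega
      · intro u _ hx; simp [hz u hx]
      · intro hx; exact absurd (Finset.mem_range.2 (by omega)) hx
    · unfold demVal
      rw [Finset.sum_eq_single 1]
      · rw [h1, if_neg (by omega), Nat.add_sub_cancel]
      · intro u _ hx; rw [hz u hx]; rfl
      · intro hx; exact absurd (Finset.mem_range.2 (by omega)) hx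
  · rintro k hk σ₁ hS hk' ⟨hl, hD⟩
    have hI₁ : I.Tab h σ₁ := hI'.of_same hS (fun a ha => by interval_cases a <;> rfl) rfl
      (fun a ha => by interval_cases a <;> rfl) (hS.ln rfl) (by rw [hl]; simp)
    have hp : I.prof σ₁ = I.prof σ := by
      ext v j
      unfold prof
      rw [hS.rd rfl]
      simp
    have := demand_step hF hh hI₁ (by rw [hp]; exact hs) hk hk' (by rw [hp]; exact hD)
    refine this.mono le_rfl ?_
    rintro σ₂ - ⟨h1, h2⟩
    rw [hp] at h2
    exact ⟨h1.trans hl, h2⟩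
  · rintro σ' - ⟨-, h1, h2⟩
    refine ⟨?_, h1, h2⟩
    have : ∑ k ∈ Finset.range I.N, (308 + 70 * (I.sz k + 1 + if k = 1 then I.W else 0)) =
        ∑ k ∈ Finset.range I.N, (300 + 70 * (I.sz k + 1 + if k = 1 then I.W else 0) + 8) :=
      Finset.sum_congr rfl fun k _ => by ring
    rw [this]
    simp [RamExpr.cost]
    omega

end KP

namespace KP
variable {I : KP} {w : ℕ}

/-! ### Selecting the items -/

/-- Item `t` satisfies the demand of node `u`. -/
def Meets (I : KP) (F : ℕ → ℕ → ℕ) (D : ℕ → ℕ) (t u : ℕ) : Prop :=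
  D u ≠ 0 ∧ I.wt t ≤ D u - 1 ∧ F u (D u - 1) ≤ I.p t

/-- The items `X` have been selected, and the demands `D` of the leaves are left; `z` is the profit
of the items without weight. -/
structure SelInv (I : KP) (h : ℕ → ℕ) (F : ℕ → ℕ → ℕ) (z : ℕ) (X D : ℕ → ℕ) : Prop where
  ran : ∀ u, D u ≠ 0 → I.N ≤ u ∧ u < 2 * I.N
  le_sz : ∀ u, D u ≠ 0 → D u - 1 ≤ I.sz u
  apart : ∀ u u', D u ≠ 0 → D u' ≠ 0 → u ≠ u' → I.Apart h u u'
  le_one : ∀ t, X t ≤ 1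
  used : ∀ t, I.Valid t → X t ≠ 0 → ∀ q < I.Q, D (I.leafOf h t q) = 0
  wt : (∑ t ∈ Finset.range I.n, I.wt t * X t) + I.demWt D ≤ I.W
  val : I.Correct F → F 1 I.W + z ≤ (∑ t ∈ Finset.range I.n, I.p t * X t) + I.demVal F D

/-- Taking an item `t` for a demand keeps the invariant: the leaves of the other demands are apart
from this one, so none of them contains `t`. -/
theorem SelInv.take {h : ℕ → ℕ} {F : ℕ → ℕ → ℕ} {z : ℕ} {X D : ℕ → ℕ} (H : I.SelInv h F z X D)
    {t q : ℕ} (ht : I.Valid t) (hq : q < I.Q) (hm : I.Meets F D t (I.leafOf h t q)) :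
    I.SelInv h F z (Function.update X t 1) (Function.update D (I.leafOf h t q) 0) := by
  obtain ⟨h1, h2, h3⟩ := hm
  have hX : X t = 0 := by
    by_contra hne
    exact h1 (H.used t ht hne q hq)
  have hr := H.ran _ h1
  have hle : ∀ u, Function.update D (I.leafOf h t q) 0 u ≠ 0 → u ≠ I.leafOf h t q ∧ D u ≠ 0 ∧
      Function.update D (I.leafOf h t q) 0 u = D u := by
    intro u hu
    by_cases hx : u = I.leafOf h t q
    · simp [hx] at hu
    · rw [Function.update_of_ne hx] at hu ⊢
      exact ⟨hx, hu, rfl⟩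
  refine ⟨fun u hu => H.ran u (hle u hu).2.1, fun u hu => ?_, fun u u' hu hu' hne =>
    H.apart u u' (hle u hu).2.1 (hle u' hu').2.1 hne, fun s => ?_, fun s hs hne q' hq' => ?_, ?_,
    fun hcor => ?_⟩
  · rw [(hle u hu).2.2]; exact H.le_sz u (hle u hu).2.1
  · by_cases hs : s = t
    · subst hs; simp
    · rw [Function.update_of_ne hs]; exact H.le_one s
  · by_contra hne'
    obtain ⟨h4, h5, -⟩ := hle _ hne'
    by_cases hst : s = t
    · subst hst
      exact H.apart _ _ h5 h1 h4 s q' q hs hq' hq ⟨0, by simp⟩ ⟨0, by simp⟩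
    · rw [Function.update_of_ne hst] at hne
      exact h5 (H.used s hs hne q' hq')
  · have e1 := demWt_update (I := I) (D := D) (x := I.leafOf h t q) (c := 0) hr.2
    have e2 := sum_update_add ht.1 (fun s a => I.wt s * a) X (c := 1)
    simp only [hX, mul_zero, mul_one, add_zero] at e2
    have := H.wt
    omega
  · have e1 := demVal_update (I := I) (F := F) (D := D) (x := I.leafOf h t q) (c := 0) hr.2
    have e2 := sum_update_add ht.1 (fun s a => I.p s * a) X (c := 1)
    simp only [hX, mul_zero, mul_one, add_zero] at e2
    simp only [h1, if_false, if_true, add_zero] at e1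
    have := H.val hcor
    omega

theorem Meets.of_update {F : ℕ → ℕ → ℕ} {D : ℕ → ℕ} {t u v : ℕ}
    (h : I.Meets F (Function.update D v 0) t u) : I.Meets F D t u := by
  obtain ⟨h1, h2, h3⟩ := h
  have : u ≠ v := by rintro rfl; simp at h1
  rw [Function.update_of_ne this] at h1 h2 h3
  exact ⟨h1, h2, h3⟩

/-- The data that are used for the selection. -/
structure SelCtx (I : KP) (h : ℕ → ℕ) (F : ℕ → ℕ → ℕ) (σ : St) : Prop where
  r0 : σ.reg 0 = I.n
  r7 : σ.reg 7 = I.Q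
  r10 : σ.reg 10 = I.N
  rd0 : ∀ t, σ.rd 0 t = I.p t
  rd1 : ∀ t, σ.rd 1 t = I.wt t
  rd3 : ∀ t, σ.rd 3 t = I.ci t
  rd7 : ∀ t, I.Valid t → σ.rd 7 t = h t
  rd9 : ∀ v, 1 ≤ v → v < 2 * I.N → σ.rd 9 v = I.off v
  rd10 : ∀ v k, σ.rd 10 (I.off v + k) = F v k
  ln11 : σ.ln 11 = 2 * I.N
  ln12 : σ.ln 12 = I.n

theorem SelCtx.of_same {h : ℕ → ℕ} {F : ℕ → ℕ → ℕ} {c : RamProg} {σ σ' : St} (H : I.SelCtx h F σ)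
    (hS : SameOn c σ σ') (ha : ∀ a < 11, modA c a = false) (hr : ∀ x < 20, modR c x = false)
    (h11 : σ'.ln 11 = σ.ln 11) (h12 : σ'.ln 12 = σ.ln 12) : I.SelCtx h F σ' where
  r0 := by rw [hS.reg _ (hr _ (by norm_num)), H.r0]
  r7 := by rw [hS.reg _ (hr _ (by norm_num)), H.r7]
  r10 := by rw [hS.reg _ (hr _ (by norm_num)), H.r10]
  rd0 t := by rw [hS.rd (ha _ (by norm_num)), H.rd0]
  rd1 t := by rw [hS.rd (ha _ (by norm_num)), H.rd1]
  rd3 t := by rw [hS.rd (ha _ (by norm_num)), H.rd3]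
  rd7 t ht := by rw [hS.rd (ha _ (by norm_num)), H.rd7 t ht]
  rd9 v h1 h2 := by rw [hS.rd (ha _ (by norm_num)), H.rd9 v h1 h2]
  rd10 v k := by rw [hS.rd (ha _ (by norm_num)), H.rd10]
  ln11 := h11.trans H.ln11
  ln12 := h12.trans H.ln12

/-- The item `k` is taken if it satisfies the demand of its leaf for the colour `q`. -/
theorem select_step (hF : I.Fits w) {h : ℕ → ℕ} {F : ℕ → ℕ → ℕ} (hh : I.HashOK h) {σ : St}
    (hI : I.SelCtx h F σ) {z k q : ℕ} (hv : I.Valid k) (hq : q < I.Q) (h20 : σ.reg 20 = k)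
    (h21 : σ.reg 21 = h k) (h22 : σ.reg 22 = q) (H : I.SelInv h F z (σ.rd 12) (σ.rd 11)) :
    Det w (23 ⇐ leafExpr ;; .ite (.read 11 (§ 23)) (24 ⇐ .read 11 (§ 23) -ʷ ♯ 1 ;;
      .ite (§ 24 <ʷ .read 1 (§ 20)) .skip
        (.ite (.read 0 (§ 20) <ʷ .read 10 (.read 9 (§ 23) +ʷ § 24)) .skip
          (.write 12 (§ 20) (♯ 1) ;; .write 11 (§ 23) (♯ 0)))) .skip) σ 60
      fun σ' => (σ'.ln 11 = σ.ln 11 ∧ σ'.ln 12 = σ.ln 12) ∧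
        (¬ I.Meets F (σ.rd 11) k (I.leafOf h k q) ∧ σ'.rd 11 = σ.rd 11 ∧ σ'.rd 12 = σ.rd 12 ∨
        I.Meets F (σ.rd 11) k (I.leafOf h k q) ∧
          σ'.rd 11 = Function.update (σ.rd 11) (I.leafOf h k q) 0 ∧
          σ'.rd 12 = Function.update (σ.rd 12) k 1) := by
  have hw := hF.hw
  have h_sum := hF.h_sum
  have h2w := hF.two_lt
  have h_N := hF.h_N
  have h_off := hF.h_off
  have hlt := hh.leafOf_lt hv hq
  have hge := I.leafOf_ge h k q
  have hN := I.N_pos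
  have e9 : σ.rd 9 (I.leafOf h k q) = I.off (I.leafOf h k q) := hI.rd9 _ (by omega) hlt
  have el : I.leafOf h k q = I.N + ((h k * I.Q + q) * I.Q + k % (q + 1)) := rfl
  have e0 := hI.rd0 k
  have e1 := hI.rd1 k
  have hk := hv.1
  have hQQ := hF.h_Q
  have hQ : I.Q ≤ I.Q * I.Q := Nat.le_mul_self _
  have hm1 : h k * I.Q + q ≤ (h k * I.Q + q) * I.Q := Nat.le_mul_of_pos_right _ I.Q_pos
  have hm2 : h k * I.Q ≤ h k * I.Q + q := Nat.le_add_right _ _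
  have hmod : k % (q + 1) ≤ k := Nat.mod_le _ _
  have l11 := hI.ln11
  have l12 := hI.ln12
  have hoff : ∀ d, d ≤ I.sz (I.leafOf h k q) → I.off (I.leafOf h k q) + d < I.off 0 := fun d hd =>
    off_add_lt' (by omega) hlt hd
  have hsz := H.le_sz (I.leafOf h k q)
  have e10 := hI.rd10 (I.leafOf h k q) (σ.rd 11 (I.leafOf h k q) - 1)
  have hle1 : σ.rd 11 (I.leafOf h k q) - 1 < 2 ^ w := by
    by_cases h0 : σ.rd 11 (I.leafOf h k q) = 0
    · omega
    · have := hoff _ (hsz h0); omega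
  suffices hP : ∀ P : St → Prop, (∀ σ' : St, σ'.ln 11 = σ.ln 11 → σ'.ln 12 = σ.ln 12 →
        (¬ I.Meets F (σ.rd 11) k (I.leafOf h k q) ∧ σ'.rd 11 = σ.rd 11 ∧ σ'.rd 12 = σ.rd 12 ∨
        I.Meets F (σ.rd 11) k (I.leafOf h k q) ∧
          σ'.rd 11 = Function.update (σ.rd 11) (I.leafOf h k q) 0 ∧
          σ'.rd 12 = Function.update (σ.rd 12) k 1) → P σ') →
      Det w _ σ 60 P from hP _ fun _ h1 h2 h3 => ⟨⟨h1, h2⟩, h3⟩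
  intro P hP
  refine Det.straight_le hw rfl ?_
  simp only [leafExpr]
  simp only [WP, RamExpr.ok, RamExpr.val, BinOp.apply, h20, h21, h22, hI.r10, hI.r7, ← el,
    St.reg_setR, St.rd_setR, if_true, Nat.reduceEqDiff, if_false, e9, e1, e0]
  have hs : I.leafOf h k q < 2 ^ w ∧ (h k * I.Q + q) * I.Q < 2 ^ w ∧
      k % (q + 1) < 2 ^ w ∧ q + 1 < 2 ^ w ∧ h k * I.Q < 2 ^ w ∧ h k * I.Q + q < 2 ^ w ∧ 1 < 2 ^ w ∧
      (h k * I.Q + q) * I.Q + k % (q + 1) < 2 ^ w ∧ 0 < 2 ^ w := by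
    refine ⟨?_, ?_, ?_, ?_, ?_, ?_, ?_, ?_, ?_⟩ <;> omega
  simp only [hs, true_and, and_true, e10]
  refine ⟨fun h0 => ⟨hle1, fun h3 => ?_, fun h3 => ⟨?_, fun h4 => ?_, fun h4 => ?_⟩⟩, fun h0 => ?_⟩
  · have : ¬ I.wt k ≤ σ.rd 11 (I.leafOf h k q) - 1 := fun hx => by simp [not_lt.2 hx] at h3
    exact hP _ rfl rfl (Or.inl ⟨fun hm => this hm.2.1, rfl, rfl⟩)
  · have := hoff _ (hsz h0); omega
  · have : ¬ F (I.leafOf h k q) (σ.rd 11 (I.leafOf h k q) - 1) ≤ I.p k := fun hx => by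
      simp [not_lt.2 hx] at h4
    exact hP _ rfl rfl (Or.inl ⟨fun hm => this hm.2.2, rfl, rfl⟩)
  · have h5 : I.wt k ≤ σ.rd 11 (I.leafOf h k q) - 1 := by
      by_contra hx; simp [not_le.1 hx] at h3
    have h6 : F (I.leafOf h k q) (σ.rd 11 (I.leafOf h k q) - 1) ≤ I.p k := by
      by_contra hx; simp [not_le.1 hx] at h4
    refine hP _ (by simp) (by simp) (Or.inr ⟨⟨h0, h5, h6⟩, ?_, ?_⟩)
    · ext j
      simp [Function.update_apply, l11, hlt]
    · ext j
      simp [Function.update_apply, l12, hk]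
  · exact hP _ rfl rfl (Or.inl ⟨fun hm => hm.1 h0, rfl, rfl⟩)

/-- A leaf with a demand of positive value has an item that satisfies it. -/
theorem exists_meets {h : ℕ → ℕ} (hh : I.HashOK h) {σ₀ : St} (hfill : I.Filled h σ₀)
    {F : ℕ → ℕ → ℕ} (hleaf : ∀ v, I.N ≤ v → v < 2 * I.N → ∀ k ≤ I.sz v,
      F v k = runMax (I.sz v) (I.prof σ₀ v) k) {D : ℕ → ℕ} {u : ℕ} (h0 : D u ≠ 0) (h1 : I.N ≤ u)
    (h2 : u < 2 * I.N) (h3 : D u - 1 ≤ I.sz u) (h4 : F u (D u - 1) ≠ 0) :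
    ∃ t q, I.Valid t ∧ q < I.Q ∧ I.leafOf h t q = u ∧ I.Meets F D t u := by
  have hN := I.N_pos
  have hF := hleaf u h1 h2 _ h3
  unfold runMax at hF
  obtain ⟨j, hj, h5⟩ := Finset.exists_mem_eq_sup (Finset.range (D u - 1 + 1)) ⟨0, by simp⟩
    fun j => min (I.sz u) (I.prof σ₀ u j)
  rw [h5] at hF
  have hj' : j ≤ D u - 1 := by have := Finset.mem_range.1 hj; omega
  have h6 : σ₀.rd 10 (I.off u + j) ≠ 0 := by
    intro hx
    apply h4
    rw [hF]
    unfold prof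
    rw [hx, Nat.min_zero]
  obtain ⟨t, q, ht, hq, hpos, hp⟩ := hfill.sound _ h6
  have hge := I.leafOf_ge h t q
  obtain ⟨e1, e2⟩ := off_inj (by omega) (hh.leafOf_lt ht hq)
    (by rw [hh.sz_leafOf ht hq]; exact ht.wt_lt_u.le) (by omega) h2 (hj'.trans h3) hpos
  refine ⟨t, q, ht, hq, e1, h0, by omega, ?_⟩
  rw [hF, hp]
  exact min_le_right _ _

/-- At the end all demands of positive value are satisfied: a leaf with such a demand contains an
item that satisfies it, and no item that has been examined does so any more. -/
theorem select (hF : I.Fits w) {h : ℕ → ℕ} {F : ℕ → ℕ → ℕ} (hh : I.HashOK h) {σ σ₀ : St}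
    (hI : I.SelCtx h F σ) {z : ℕ} (H : I.SelInv h F z (σ.rd 12) (σ.rd 11))
    (hfill : I.Filled h σ₀) (hleaf : ∀ v, I.N ≤ v → v < 2 * I.N → ∀ k ≤ I.sz v,
      F v k = runMax (I.sz v) (I.prof σ₀ v) k) :
    Det w selectProg σ (6 + I.n * (100 + 70 * I.Q)) fun σ' => σ'.reg 0 = I.n ∧ σ'.ln 12 = I.n ∧
      (∀ t, σ'.rd 12 t ≤ 1) ∧ (∑ t ∈ Finset.range I.n, I.wt t * σ'.rd 12 t) ≤ I.W ∧
      (I.Correct F → F 1 I.W + z ≤ ∑ t ∈ Finset.range I.n, I.p t * σ'.rd 12 t) := by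
  have hw := hF.hw
  have h_sum := hF.h_sum
  have hQ' : I.Q < 2 ^ w := (Nat.le_mul_self _).trans_lt hF.h_Q
  -- `B t q` says that item `t` has been examined for colour `q`
  let A : (ℕ → ℕ → Prop) → St → Prop := fun B σ' => (σ'.ln 11 = σ.ln 11 ∧ σ'.ln 12 = σ.ln 12) ∧
    I.SelInv h F z (σ'.rd 12) (σ'.rd 11) ∧
    ∀ t q, B t q → I.Valid t → q < I.Q → ¬ I.Meets F (σ'.rd 11) t (I.leafOf h t q)
  refine (Det.for hw (fun _ => 90 + 70 * I.Q) (fun k => A fun t _ => t < k) hI.r0 (by omega)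
    (by norm_num) rfl rfl ⟨⟨rfl, rfl⟩, H, fun t q ht => by omega⟩ ?_).mono ?_ ?_
  · intro k hk σ₁ hS hk' ⟨hl, hs, hc⟩
    have hI₁ : I.SelCtx h F σ₁ := hI.of_same hS (fun a ha => by interval_cases a <;> rfl)
      (fun a ha => by interval_cases a <;> rfl) hl.1 hl.2
    have hcost : (RamExpr.read 3 (§ 20)).cost + (80 + 70 * I.Q) + 1 ≤ 90 + 70 * I.Q := by
      simp [RamExpr.cost]; omega
    refine Det.mono (Det.ite hw (t := 80 + 70 * I.Q) (by simp) (fun h0 => ?_) (fun h0 => ?_)) hcost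
      (fun _ _ h => h)
    · simp only [RamExpr.val, hk', hI₁.rd3] at h0
      have hv : I.Valid k := by by_contra h; simp [ci, h] at h0
      refine Run.det (Run.assign hw (by simp) (Run.last (Det.for hw (fun _ => 60)
        (fun q => A fun t q' => t < k ∨ t = k ∧ q' < q) (n := I.Q) ?_ hQ' (by norm_num) rfl rfl
        ⟨by simpa using hl, hs, ?_⟩ ?_) ?_))
      · simp [hI₁.r7]
      · intro t q ht; exact hc t q (by omega)
      · intro q hq σ₂ hS₂ hq' ⟨hl₂, hs₂, hc₂⟩
        have hI₂ : I.SelCtx h F σ₂ := by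
          have : I.SelCtx h F (σ₁.setR 21 (σ₁.rd 7 (σ₁.reg 20))) :=
            hI₁.of_same (c := .assign 21 (.const 0)) ⟨fun x hx => by
              simp [modR] at hx; simp [Ne.symm hx], fun a _ => rfl⟩
              (fun a ha => by interval_cases a <;> rfl)
              (fun a ha => by interval_cases a <;> rfl) rfl rfl
          exact this.of_same hS₂ (fun a ha => by interval_cases a <;> rfl)
            (fun a ha => by interval_cases a <;> rfl) (by rw [hl₂.1]; simpa using hl.1.symm)
            (by rw [hl₂.2]; simpa using hl.2.symm)
        refine (select_step hF hh hI₂ hv hq ?_ ?_ hq' hs₂).mono le_rfl ?_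
        · simp [hS₂.reg 20 rfl, hk']
        · simp [hS₂.reg 21 rfl, hk', hI₁.rd7 k hv]
        rintro σ₃ - ⟨h1, h2⟩
        refine ⟨⟨h1.1.trans hl₂.1, h1.2.trans hl₂.2⟩, ?_⟩
        show I.SelInv h F z (σ₃.rd 12) (σ₃.rd 11) ∧ ∀ t q', t < k ∨ t = k ∧ q' < q + 1 →
          I.Valid t → q' < I.Q → ¬ I.Meets F (σ₃.rd 11) t (I.leafOf h t q')
        rcases h2 with ⟨h2, h3, h4⟩ | ⟨h2, h3, h4⟩
        · rw [h3, h4]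
          refine ⟨hs₂, fun t q' ht hvt hq' => ?_⟩
          by_cases hn : t < k ∨ t = k ∧ q' < q
          · exact hc₂ t q' hn hvt hq'
          · have h3 : t = k ∧ q' = q := by omega
            obtain ⟨rfl, rfl⟩ := h3
            exact h2
        · rw [h3, h4]
          refine ⟨hs₂.take hv hq h2, fun t q' ht hvt hq' hm => ?_⟩
          by_cases hn : t < k ∨ t = k ∧ q' < q
          · exact hc₂ t q' hn hvt hq' hm.of_update
          · have h3 : t = k ∧ q' = q := by omega
            obtain ⟨rfl, rfl⟩ := h3
            exact hm.1 (by simp)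
      · rintro σ₂ - ⟨-, hl₂, hs₂, hc₂⟩
        refine ⟨?_, hl₂, hs₂, fun t q ht hvt hq => hc₂ t q (by omega) hvt hq⟩
        simp [RamExpr.cost]; omega
    · simp only [RamExpr.val, hk', hI₁.rd3] at h0
      have hv : ¬ I.Valid k := by intro h; simp [ci, h] at h0
      refine (Det.straight (c := .skip) (Q := fun σ'' => σ'' = σ₁) hw (by simp)).mono
        (by simp [RamProg.scost]; omega) ?_
      rintro _ - rfl
      refine ⟨hl, hs, fun t q ht hvt hq => ?_⟩
      have : t ≠ k := by rintro rfl; exact hv hvt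
      exact hc t q (by omega) hvt hq
  · simp
    exact Nat.mul_le_mul_left _ (by omega)
  · rintro σ' hS ⟨-, hl, hs, hc⟩
    refine ⟨(hS.reg 0 rfl).trans hI.r0, hl.2.trans hI.ln12, hs.le_one,
      (Nat.le_add_right _ _).trans hs.wt, fun hcor => ?_⟩
    have h0 : I.demVal F (σ'.rd 11) = 0 := by
      refine Finset.sum_eq_zero fun u hu => ?_
      split_ifs with h0
      · rfl
      · by_contra hne
        have hr := hs.ran u h0
        obtain ⟨t, q, ht, hq, rfl, hm⟩ := exists_meets hh hfill hleaf h0 hr.1 hr.2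
          (hs.le_sz u h0) hne
        exact hc t q ht.1 ht hq hm
    have := hs.val hcor
    omega

/-- The solution is copied to the output. -/
theorem output (hF : I.Fits w) {σ : St} (h0 : σ.reg 0 = I.n) (h12 : σ.ln 12 = I.n) :
    Det w outputProg σ (20 + 20 * I.n) fun σ' =>
      σ'.ln 0 = I.n ∧ ∀ t < I.n, σ'.rd 0 t = σ.rd 12 t := by
  have hw := hF.hw
  have h_sum := hF.h_sum
  unfold outputProg
  apply Run.det
  refine Run.alloc hw (by simp) ?_
  have e1 : RamExpr.val σ (§ 0) = I.n := h0
  rw [e1]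
  refine Run.last (Det.for hw (fun _ => 10) (fun k σ' => σ'.ln 0 = I.n ∧
    ∀ t < k, σ'.rd 0 t = σ.rd 12 t) (n := I.n) (by simpa using h0) (by omega) (by norm_num) rfl rfl
    ⟨by simp, fun t ht => by omega⟩ ?_) ?_
  · intro k hk σ₁ hS hk' ⟨hl, hd⟩
    have e2 : σ₁.rd 12 k = σ.rd 12 k := by rw [hS.rd rfl]; simp
    refine Det.straight_le hw rfl ?_
    simp [hk', e2, hl]
    intro t ht
    by_cases htk : t = k
    · subst htk; simp [hk]
    · simp [htk]; exact hd t (by omega)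
  · rintro σ' - ⟨-, h1, h2⟩
    exact ⟨by simp [RamExpr.cost]; omega, h1, h2⟩

end KP

/-! ### Colours that separate the items of a bucket -/

theorem two_pow_le_centralBinom (n : ℕ) : 2 ^ n ≤ Nat.centralBinom n := by
  induction n with
  | zero => simp
  | succ n ih =>
    have h := Nat.succ_mul_centralBinom_succ n
    have h1 : (n + 1) * (2 * Nat.centralBinom n) ≤ (n + 1) * Nat.centralBinom (n + 1) := by
      rw [h]
      calc (n + 1) * (2 * Nat.centralBinom n) = 2 * (n + 1) * Nat.centralBinom n := by ring
        _ ≤ 2 * (2 * n + 1) * Nat.centralBinom n := Nat.mul_le_mul_right _ (by omega)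
    have h2 := Nat.le_of_mul_le_mul_left h1 (Nat.succ_pos n)
    rw [pow_succ]
    omega

/-- A nonzero number that is divisible by all of `1, …, 2 * n` is at least `2 ^ n`, since it is
divisible by the central binomial coefficient, whose prime powers are at most `2 * n`. -/
theorem two_pow_le_of_forall_dvd {n D : ℕ} (hD : D ≠ 0) (h : ∀ m, 1 ≤ m → m ≤ 2 * n → m ∣ D) :
    2 ^ n ≤ D := by
  rcases Nat.eq_zero_or_pos n with rfl | hn
  · simpa using Nat.one_le_iff_ne_zero.2 hD
  refine (two_pow_le_centralBinom n).trans (Nat.le_of_dvd (Nat.pos_of_ne_zero hD) ?_)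
  rw [← Nat.factorization_le_iff_dvd (Nat.centralBinom_ne_zero n) hD]
  intro p
  by_cases hp : p.Prime
  · rw [← hp.pow_dvd_iff_le_factorization hD]
    exact h _ (Nat.pos_of_ne_zero (pow_ne_zero _ hp.ne_zero))
      (by rw [Nat.centralBinom_eq_two_mul_choose]; exact Nat.pow_factorization_choose_le (by omega))
  · simp [Nat.factorization_eq_zero_of_not_prime _ hp]

/-- Among the first few moduli there is one that separates the elements of a small set of small
numbers: otherwise the product of all differences would be a common multiple of all of them, and too
small for that. -/
theorem exists_separating {S : Finset ℕ} {L ℓ Q : ℕ} (hS : S.card ≤ L) (hl : ∀ t ∈ S, t < 2 ^ ℓ)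
    (hQ : 2 * ℓ * (L * L) + 2 ≤ Q) :
    ∃ q < Q, ∀ t ∈ S, ∀ t' ∈ S, t % (q + 1) = t' % (q + 1) → t = t' := by
  by_contra hne
  push Not at hne
  set D := ∏ x ∈ S.offDiag, ((x.1 - x.2) + (x.2 - x.1)) with hDdef
  have hD : D ≠ 0 := by
    rw [hDdef, Finset.prod_ne_zero_iff]
    intro x hx
    have := (Finset.mem_offDiag.1 hx).2.2
    omega
  have hdvd : ∀ m, 1 ≤ m → m ≤ 2 * (ℓ * (L * L) + 1) → m ∣ D := by
    intro m h1 h2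
    have e : 2 * (ℓ * (L * L) + 1) = 2 * ℓ * (L * L) + 2 := by ring
    obtain ⟨t, ht, t', ht', h3, h4⟩ := hne (m - 1) (by omega)
    rw [Nat.sub_add_cancel h1] at h3
    refine dvd_trans ?_ (Finset.dvd_prod_of_mem (fun x : ℕ × ℕ => (x.1 - x.2) + (x.2 - x.1))
      (Finset.mem_offDiag.2 ⟨ht, ht', h4⟩ : (t, t') ∈ S.offDiag))
    have a1 : m ∣ t - t' := Nat.dvd_of_mod_eq_zero (Nat.sub_mod_eq_zero_of_mod_eq h3)
    have a2 : m ∣ t' - t := Nat.dvd_of_mod_eq_zero (Nat.sub_mod_eq_zero_of_mod_eq h3.symm)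
    exact dvd_add a1 a2
  have h1 := two_pow_le_of_forall_dvd hD hdvd
  have h2 : D ≤ (2 ^ ℓ) ^ (L * L) := by
    refine (Finset.prod_le_pow_card _ _ (2 ^ ℓ) fun x hx => ?_).trans
      (Nat.pow_le_pow_right (by positivity) ?_)
    · have hx' := Finset.mem_offDiag.1 hx
      have := hl _ hx'.1
      have := hl _ hx'.2.1
      omega
    · rw [Finset.offDiag_card]
      exact (Nat.sub_le _ _).trans (Nat.mul_le_mul hS hS)
  rw [← pow_mul] at h2
  have h3 := h1.trans h2
  have h4 := (Nat.pow_le_pow_iff_right (by norm_num : 1 < 2)).1 h3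
  omega

namespace KP
variable {I : KP} {w : ℕ}

/-! ### The sizes of the nodes -/

theorem sz_pos (v : ℕ) (hv : I.N ≤ v) : 1 ≤ I.sz v := by
  rw [sz_leaf hv]
  refine le_min (by unfold ntop; omega) ?_
  unfold leafSz
  split_ifs
  · unfold u
    exact Nat.mul_pos two_pos (Nat.two_pow_pos _)
  · exact le_rfl

/-- From one level of the tree to the next, `m` is replaced by its children. -/
theorem sum_level_succ (f : ℕ → ℕ) {m : ℕ} (hm : 1 ≤ m) :
    ∑ v ∈ Finset.Ico (m + 1) (2 * (m + 1)), f v + f m =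
      ∑ v ∈ Finset.Ico m (2 * m), f v + (f (2 * m) + f (2 * m + 1)) := by
  rw [show 2 * (m + 1) = 2 * m + 1 + 1 by ring, Finset.sum_Ico_succ_top (by omega),
    Finset.sum_Ico_succ_top (by omega), Finset.sum_eq_sum_Ico_succ_bot (by omega : m < 2 * m)]
  ring

/-- The size of the root is the total size of a level, up to truncation at `ntop`. -/
theorem min_sum_level_le {m : ℕ} (hm : 1 ≤ m) (hN : m ≤ I.N) :
    min I.ntop (∑ v ∈ Finset.Ico m (2 * m), I.sz v) ≤ I.sz 1 := by
  induction m, hm using Nat.le_induction with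
  | base => simp
  | succ m hm ih =>
    refine le_trans ?_ (ih (by omega))
    have h1 := sum_level_succ I.sz hm
    have h2 := I.sz_inner hm (by omega)
    have h3 : I.sz m ≤ ∑ v ∈ Finset.Ico m (2 * m), I.sz v :=
      Finset.single_le_sum (f := I.sz) (fun _ _ => Nat.zero_le _) (Finset.mem_Ico.2 ⟨le_rfl, by omega⟩)
    omega

/-- If there are items at all, there are enough leaves for the root to have an entry for `W`. -/
theorem W_le_sz_one {t : ℕ} (ht : I.Valid t) : I.W ≤ I.sz 1 := by
  refine le_trans (le_min ?_ ?_) (min_sum_level_le I.N_pos le_rfl)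
  · unfold ntop; omega
  · have h1 : I.N ≤ ∑ v ∈ Finset.Ico I.N (2 * I.N), I.sz v := by
      calc I.N = ∑ v ∈ Finset.Ico I.N (2 * I.N), 1 := by simp; omega
        _ ≤ _ := Finset.sum_le_sum fun v hv => I.sz_pos v (Finset.mem_Ico.1 hv).1
    have h2 : I.Mx ≤ I.C * I.Mx := Nat.le_mul_of_pos_left _ (Nat.zero_lt_of_lt ht.cls_lt)
    have h3 : I.G ≤ I.N := by
      unfold N; rw [mul_assoc]; exact Nat.le_mul_of_pos_right _ (Nat.mul_pos I.Q_pos I.Q_pos)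
    unfold G at h3
    unfold Mx at *
    omega

/-! ### Completeness -/

theorem _root_.Below.eq_of_le {v l : ℕ} (h : Below v l) (hv : l < 2 * v) : v = l := by
  obtain ⟨k, rfl⟩ := h
  rcases k with _ | k
  · simp
  · rw [pow_succ', ← Nat.div_div_eq_div_mul] at hv
    have := Nat.div_le_self (l / 2) (2 ^ k)
    have h1 : l / 2 / 2 ^ k = l / 2 ^ (k + 1) := by rw [pow_succ', ← Nat.div_div_eq_div_mul]
    omega

theorem _root_.Below.child {v l : ℕ} (h : Below v l) (hl : v < l) :
    Below (2 * v) l ∨ Below (2 * v + 1) l := by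
  obtain ⟨k, rfl⟩ := h
  rcases k with _ | k
  · simp at hl
  · have h1 : l / 2 ^ (k + 1) = l / 2 ^ k / 2 := by rw [pow_succ, ← Nat.div_div_eq_div_mul]
    have : l / 2 ^ k = 2 * (l / 2 ^ (k + 1)) ∨ l / 2 ^ k = 2 * (l / 2 ^ (k + 1)) + 1 := by omega
    rcases this with h2 | h2
    · exact Or.inl ⟨k, h2⟩
    · exact Or.inr ⟨k, h2⟩

theorem below_one {l : ℕ} (hl : 1 ≤ l) : Below 1 l := by
  refine ⟨Nat.log 2 l, ?_⟩
  have h1 := Nat.pow_log_le_self 2 (show l ≠ 0 by omega)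
  have h2 := Nat.lt_pow_succ_log_self (b := 2) (by norm_num) l
  rw [Nat.div_eq_iff (by positivity)]
  rw [pow_succ] at h2
  omega

/-- A leaf accounts for each of its items, whatever weight and profit it has. -/
theorem leaf_complete {h : ℕ → ℕ} (hh : I.HashOK h) {σ₀ : St} (hfill : I.Filled h σ₀)
    {F : ℕ → ℕ → ℕ} (hleaf : ∀ v, I.N ≤ v → v < 2 * I.N → ∀ k ≤ I.sz v,
      F v k = runMax (I.sz v) (I.prof σ₀ v) k) {t q : ℕ} (ht : I.Valid t) (hq : q < I.Q) :
    I.p t ≤ F (I.leafOf h t q) (I.wt t) := by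
  have hsz := hh.sz_leafOf ht hq
  rw [hleaf _ (I.leafOf_ge h t q) (hh.leafOf_lt ht hq) _ (by rw [hsz]; exact ht.wt_lt_u.le)]
  have hp : I.p t ≤ I.sz (I.leafOf h t q) := by rw [hsz]; exact ht.p_lt_u.le
  refine le_trans (le_min hp (hfill.complete t q ht hq)) ?_
  exact Finset.le_sup (f := fun j => min (I.sz (I.leafOf h t q)) (I.prof σ₀ (I.leafOf h t q) j))
    (Finset.mem_range.2 (Nat.lt_succ_self _))

open Classical in
/-- The items of `S` whose leaf is below `v`. -/
noncomputable def under (S : Finset ℕ) (lf : ℕ → ℕ) (v : ℕ) : Finset ℕ :=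
  S.filter fun t => Below v (lf t)

theorem mem_under {S : Finset ℕ} {lf : ℕ → ℕ} {v t : ℕ} :
    t ∈ under S lf v ↔ t ∈ S ∧ Below v (lf t) := by unfold under; simp

theorem sum_under (S : Finset ℕ) (lf : ℕ → ℕ) {v : ℕ} (hv : 1 ≤ v) (hl : ∀ t ∈ S, v < lf t)
    (f : ℕ → ℕ) : ∑ t ∈ under S lf v, f t =
      ∑ t ∈ under S lf (2 * v), f t + ∑ t ∈ under S lf (2 * v + 1), f t := by
  rw [← Finset.sum_union]
  · congr 1
    ext t
    rw [Finset.mem_union, mem_under, mem_under, mem_under, ← and_or_left]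
    refine and_congr_right fun ht => ⟨fun h => h.child (hl t ht), ?_⟩
    rintro (h | h)
    · have := h.parent; rwa [show 2 * v / 2 = v by omega] at this
    · have := h.parent; rwa [show (2 * v + 1) / 2 = v by omega] at this
  · rw [Finset.disjoint_left]
    intro t h1 h2
    exact below_siblings hv (mem_under.1 h1).2 (mem_under.1 h2).2

/-- Below a maximum, the items of `S` are all below the same child. -/
theorem under_child {h qq : ℕ → ℕ} (hh : I.HashOK h) {S : Finset ℕ} (hS : ∀ t ∈ S, I.Valid t)
    (hqq : ∀ b, qq b < I.Q) {v : ℕ} (hc : ¬ I.IsConv v) :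
    ∃ c, (c = 2 * v ∨ c = 2 * v + 1) ∧
      under S (fun t => I.leafOf h t (qq (h t))) v = under S (fun t => I.leafOf h t (qq (h t))) c := by
  obtain ⟨e, he⟩ := I.Q_eq_pow
  have hG : I.G ≤ v ∧ v < I.G * I.Q := by unfold IsConv at hc; omega
  rcases Finset.eq_empty_or_nonempty (under S (fun t => I.leafOf h t (qq (h t))) v) with he' | ⟨t, ht⟩
  · refine ⟨2 * v, Or.inl rfl, ?_⟩
    rw [he', eq_comm, Finset.eq_empty_iff_forall_notMem]
    intro t ht
    have h1 := mem_under.1 ht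
    have h2 := h1.2.parent
    rw [show 2 * v / 2 = v by omega] at h2
    have : t ∈ under S (fun t => I.leafOf h t (qq (h t))) v := mem_under.2 ⟨h1.1, h2⟩
    rw [he'] at this
    exact absurd this (Finset.notMem_empty t)
  -- The items below `v` have a common bucket, and hence a common colour.
  have key : ∀ s ∈ under S (fun t => I.leafOf h t (qq (h t))) v,
      Below v (I.G * I.Q + (h s * I.Q + qq (h s))) ∧ Below (I.G + h s) v := by
    intro s hs
    obtain ⟨h1, k, hk⟩ := mem_under.1 hs
    have h3 := leafOf_div_Q (I := I) (h := h) (t := s) (hqq (h s))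
    have h4 := hh.color_lt (hS s h1) (hqq (h s))
    have h5 := leafOf_div_QQ (I := I) (h := h) (t := s) (hqq (h s))
    rw [Nat.div_div_eq_div_mul, he, ← pow_add] at h5
    have h6 := hh.lt (hS s h1)
    constructor
    · rw [← h3, he]
      refine below_of_div hk ?_
      by_contra hlt
      rw [he] at h3
      have : I.leafOf h s (qq (h s)) / 2 ^ e ≤ v := by
        rw [← hk]
        exact Nat.div_le_div_left (Nat.pow_le_pow_right (by norm_num) (by omega)) (by positivity)
      rw [h3, ← he] at this
      omega
    · rw [← h5]
      rw [← hk]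
      refine below_of_div rfl ?_
      by_contra hlt
      have h7 := div_two_pow_lt_half (l := I.leafOf h s (qq (h s))) (m := I.G) (by rw [h5]; omega) (not_le.1 hlt)
      omega
  -- nodes of the heap at the same level are equal if they have a common descendant
  have same : ∀ s ∈ under S (fun t => I.leafOf h t (qq (h t))) v, h s = h t := by
    intro s hs
    obtain ⟨a, ha⟩ := (key s hs).2
    obtain ⟨b, hb⟩ := (key t ht).2
    have c1 := hh.lt (hS s (mem_under.1 hs).1)
    have c2 := hh.lt (hS t (mem_under.1 ht).1)
    rcases lt_trichotomy a b with hab | rfl | hab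
    · have := div_two_pow_lt_half (m := I.G) (by rw [ha]; omega) hab
      omega
    · omega
    · have := div_two_pow_lt_half (m := I.G) (by rw [hb]; omega) hab
      omega
  have hchild := (key t ht).1.child (by omega)
  obtain ⟨c, hc, hcb⟩ : ∃ c, (c = 2 * v ∨ c = 2 * v + 1) ∧
      Below c (I.G * I.Q + (h t * I.Q + qq (h t))) := by
    rcases hchild with h1 | h1
    · exact ⟨_, Or.inl rfl, h1⟩
    · exact ⟨_, Or.inr rfl, h1⟩
  refine ⟨c, hc, ?_⟩
  ext s
  rw [mem_under, mem_under]
  refine ⟨fun hs => ⟨hs.1, ?_⟩, fun hs => ⟨hs.1, ?_⟩⟩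
  · obtain ⟨k, hk⟩ := hcb
    rw [← same s (mem_under.2 hs), ← leafOf_div_Q (hqq _), he, Nat.div_div_eq_div_mul, ← pow_add] at hk
    exact ⟨_, hk⟩
  · have := hs.2.parent
    rwa [show c / 2 = v by omega] at this

/-- If the profiles are correct, then they account for all items that are separated by their
colours. -/
theorem Correct.le_root {h qq : ℕ → ℕ} (hh : I.HashOK h) {σ₀ : St} (hfill : I.Filled h σ₀)
    {F : ℕ → ℕ → ℕ} (hleaf : ∀ v, I.N ≤ v → v < 2 * I.N → ∀ k ≤ I.sz v,
      F v k = runMax (I.sz v) (I.prof σ₀ v) k) (hcor : I.Correct F)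
    (hsane : ∀ v, 1 ≤ v → v < 2 * I.N → I.Sane F v) {S : Finset ℕ} (hS : ∀ t ∈ S, I.Valid t)
    (hqq : ∀ b, qq b < I.Q)
    (hsep : ∀ t ∈ S, ∀ t' ∈ S, h t = h t' → t % (qq (h t) + 1) = t' % (qq (h t) + 1) → t = t')
    (hW : ∑ t ∈ S, I.wt t ≤ I.W) (hp : ∑ t ∈ S, I.p t ≤ I.ntop) :
    ∑ t ∈ S, I.p t ≤ F 1 I.W := by
  rcases S.eq_empty_or_nonempty with rfl | ⟨t₀, ht₀⟩
  · simp
  have hN := I.four_le_N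
  set lf : ℕ → ℕ := fun t => I.leafOf h t (qq (h t)) with hlf
  have hwn : I.W ≤ I.ntop := by unfold ntop; omega
  have hsub : ∀ v (f : ℕ → ℕ), ∑ t ∈ under S lf v, f t ≤ ∑ t ∈ S, f t := fun v f =>
    Finset.sum_le_sum_of_subset fun t ht => (mem_under.1 ht).1
  have hinj : ∀ t ∈ S, ∀ t' ∈ S, lf t = lf t' → t = t' := by
    intro t ht t' ht' e
    have e1 : h t = h t' := by
      rw [← leafOf_div (I := I) (h := h) (t := t) (hqq (h t)), ← leafOf_div (I := I) (h := h) (t := t') (hqq (h t'))]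
      simp only [hlf] at e
      rw [e]
    refine hsep t ht t' ht' e1 ?_
    simp only [hlf, leafOf, e1] at e
    rw [e1]
    omega
  -- by induction from the leaves to the root
  have main : ∀ d v, 2 * I.N - v = d → 1 ≤ v → v < 2 * I.N →
      ∑ t ∈ under S lf v, I.wt t ≤ I.sz v ∧ ∑ t ∈ under S lf v, I.p t ≤ I.sz v ∧
      ∑ t ∈ under S lf v, I.p t ≤ F v (∑ t ∈ under S lf v, I.wt t) := by
    intro d
    induction d using Nat.strong_induction_on with
    | _ d ih =>
      intro v hd hv1 hv2
      by_cases hvN : v < I.N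
      -- an inner node: truncation is harmless, since the sums are at most `ntop`
      · obtain ⟨l1, l2, l3⟩ := ih (2 * I.N - 2 * v) (by omega) (2 * v) rfl (by omega) (by omega)
        obtain ⟨r1, r2, r3⟩ := ih (2 * I.N - (2 * v + 1)) (by omega) (2 * v + 1) rfl (by omega) (by omega)
        have hlt : ∀ t ∈ S, v < lf t := fun t _ => hvN.trans_le (I.leafOf_ge _ _ _)
        have hsw := sum_under S lf hv1 hlt I.wt
        have hsp := sum_under S lf hv1 hlt I.p
        have hszv := I.sz_inner hv1 hvN
        have h1 := (hsub v I.wt).trans hW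
        have h2 := (hsub v I.p).trans hp
        have hw : ∑ t ∈ under S lf v, I.wt t ≤ I.sz v := by omega
        have hpp : ∑ t ∈ under S lf v, I.p t ≤ I.sz v := by omega
        refine ⟨hw, hpp, ?_⟩
        rw [hcor v hv1 hvN _ hw, spec]
        refine le_min hpp ?_
        split_ifs with hc
        · have e1 : ∑ t ∈ under S lf v, I.p t ≤ I.ext F (2 * v) (∑ t ∈ under S lf (2 * v), I.wt t) +
              I.ext F (2 * v + 1) (∑ t ∈ under S lf v, I.wt t - ∑ t ∈ under S lf (2 * v), I.wt t) := by
            unfold ext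
            rw [hsw, Nat.add_sub_cancel_left, min_eq_left l1, min_eq_left r1]
            omega
          refine e1.trans ?_
          unfold cv
          exact Finset.le_sup (f := fun i => I.ext F (2 * v) i +
            I.ext F (2 * v + 1) (∑ t ∈ under S lf v, I.wt t - i)) (Finset.mem_range.2 (by omega))
        · obtain ⟨c, hc', he⟩ := under_child hh hS hqq hc
          have he' : under S lf v = under S lf c := he
          rw [he']
          unfold ext
          rcases hc' with rfl | rfl
          · refine le_max_of_le_left ?_
            rw [min_eq_left l1]; exact l3
          · refine le_max_of_le_right ?_
            rw [min_eq_left r1]; exact r3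
      -- a leaf contains at most one item of `S`
      · rcases Finset.eq_empty_or_nonempty (under S lf v) with he | ⟨t, ht⟩
        · rw [he]; simp
        · have hmem := mem_under.1 ht
          have hlt := hh.leafOf_lt (hS t hmem.1) (hqq (h t))
          have heq : v = lf t := hmem.2.eq_of_le (by show lf t < _; simp only [hlf]; omega)
          have hs : under S lf v = {t} := by
            ext s
            rw [Finset.mem_singleton]
            refine ⟨fun hs => ?_, fun hs => hs ▸ ht⟩
            have hm := mem_under.1 hs
            have hlt' := hh.leafOf_lt (hS s hm.1) (hqq (h s))
            have : v = lf s := hm.2.eq_of_le (by show lf s < _; simp only [hlf]; omega)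
            exact hinj s hm.1 t hmem.1 (this.symm.trans heq)
          have hvt := hS t hmem.1
          have hsz : I.sz v = I.u (I.cls t) := by rw [heq]; exact hh.sz_leafOf hvt (hqq _)
          rw [hs, Finset.sum_singleton, Finset.sum_singleton, hsz]
          refine ⟨hvt.wt_lt_u.le, hvt.p_lt_u.le, ?_⟩
          rw [heq]
          exact leaf_complete hh hfill hleaf hvt (hqq _)
  obtain ⟨-, -, h3⟩ := main _ 1 rfl le_rfl (by omega)
  have hu : under S lf 1 = S := by
    ext t
    rw [mem_under]
    refine ⟨fun h => h.1, fun h => ⟨h, below_one ?_⟩⟩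
    have : I.N ≤ lf t := I.leafOf_ge _ _ _
    omega
  rw [hu] at h3
  exact h3.trans ((hsane 1 le_rfl (by omega)).1 _ _ hW (W_le_sz_one (hS t₀ ht₀)))

end KP

namespace KP
variable {I : KP} {w : ℕ}

/-! ### The whole algorithm -/

/-- A feasible set contains at most `z c` items of class `c`. -/
theorem rem_le_z {S : Finset ℕ} (hS : ∀ t ∈ S, I.Valid t) (hW : ∑ t ∈ S, I.wt t ≤ I.W) (c : ℕ) :
    I.rem S 0 c ≤ I.z c := by
  unfold rem z
  refine le_min (Finset.card_le_card fun t ht => ?_) ?_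
  · have h := Finset.mem_filter.1 ht
    have hv := hS t h.1
    exact Finset.mem_filter.2 ⟨Finset.mem_range.2 hv.1, by rw [ci, if_pos hv, h.2.2]⟩
  · rw [Nat.le_div_iff_mul_le (by positivity)]
    calc _ = ∑ t ∈ S.filter (fun t => 0 ≤ t ∧ I.cls t = c), 2 ^ (c / I.LP) := by simp
      _ ≤ ∑ t ∈ S.filter (fun t => 0 ≤ t ∧ I.cls t = c), I.wt t := by
        refine Finset.sum_le_sum fun t ht => ?_
        have h := Finset.mem_filter.1 ht
        have hv := hS t h.1
        rw [← h.2.2, hv.cls_div]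
        exact two_pow_size_pred_le hv.2.1
      _ ≤ ∑ t ∈ S, I.wt t := Finset.sum_le_sum_of_subset (Finset.filter_subset _ _)
      _ ≤ I.W := hW

theorem z_le_M (c : ℕ) : I.z c ≤ I.M c := Nat.le_pow_clog (by norm_num) _

theorem sum_p_le_ntop {S : Finset ℕ} (hS : ∀ t ∈ S, I.Valid t) (hW : ∑ t ∈ S, I.wt t ≤ I.W) :
    ∑ t ∈ S, I.p t ≤ I.ntop := by
  rw [← Finset.sum_fiberwise_of_maps_to (t := Finset.range I.C) (g := I.cls)
    fun t ht => Finset.mem_range.2 (hS t ht).cls_lt]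
  refine le_trans (Finset.sum_le_sum fun c _ => ?_) (Nat.le_add_left _ _)
  refine le_trans ?_ (Nat.mul_le_mul_right _ (rem_le_z hS hW c))
  unfold rem
  rw [← smul_eq_mul]
  have e : S.filter (fun t => 0 ≤ t ∧ I.cls t = c) = S.filter (fun t => I.cls t = c) := by simp
  rw [e]
  refine Finset.sum_le_card_nsmul _ _ _ fun t ht => ?_
  have h := Finset.mem_filter.1 ht
  rw [← h.2]
  exact (hS t h.1).p_lt_u.le

/-- Items of positive weight and items without weight together contain everything useful. -/
theorem sum_p_le {S : Finset ℕ} (hS : ∀ t ∈ S, t < I.n) (hW : ∑ t ∈ S, I.wt t ≤ I.W) :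
    ∑ t ∈ S, I.p t ≤ ∑ t ∈ S.filter I.Valid, I.p t +
      ∑ t ∈ Finset.range I.n, if I.wt t = 0 then I.p t else 0 := by
  have h1 : ∑ t ∈ S, (if I.wt t = 0 then I.p t else 0) ≤
      ∑ t ∈ Finset.range I.n, if I.wt t = 0 then I.p t else 0 :=
    Finset.sum_le_sum_of_subset fun t ht => Finset.mem_range.2 (hS t ht)
  refine le_trans ?_ (Nat.add_le_add_left h1 _)
  rw [Finset.sum_filter, ← Finset.sum_add_distrib]
  refine Finset.sum_le_sum fun t ht => ?_
  have h2 : I.wt t ≤ I.W := (Finset.single_le_sum (fun _ _ => Nat.zero_le _) ht).trans hW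
  by_cases h3 : I.wt t = 0
  · rw [if_pos h3]; omega
  · by_cases h4 : I.p t = 0
    · omega
    · rw [if_pos ⟨hS t ht, by omega, h2, by omega⟩]; omega

/-- If no bucket is overloaded, each bucket has a colour that separates its items of `S`. -/
theorem exists_colours {h : ℕ → ℕ} (hh : I.HashOK h) {S : Finset ℕ} (hS : ∀ t ∈ S, I.Valid t)
    (hl : ∀ c < I.C, ∀ β < I.M c, load S I.n h (c * I.Mx + β) ≤ I.L) :
    ∃ qq : ℕ → ℕ, (∀ b, qq b < I.Q) ∧ ∀ t ∈ S, ∀ t' ∈ S, h t = h t' →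
      t % (qq (h t) + 1) = t' % (qq (h t) + 1) → t = t' := by
  have key : ∀ b, ∃ q < I.Q, ∀ t ∈ S.filter (fun t => h t = b), ∀ t' ∈ S.filter (fun t => h t = b),
      t % (q + 1) = t' % (q + 1) → t = t' := by
    intro b
    refine exists_separating (L := I.L) (ℓ := I.ell) ?_ (fun t ht => ?_)
      (Nat.le_pow_clog (by norm_num) I.Q₀)
    · rcases Finset.eq_empty_or_nonempty (S.filter fun t => h t = b) with he | ⟨t, ht⟩
      · rw [he]; simp
      · have h1 := Finset.mem_filter.1 ht
        have hv := hS t h1.1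
        obtain ⟨β, hβ, e⟩ := hh t hv
        have h2 := hl _ hv.cls_lt β hβ
        rw [← e, h1.2] at h2
        refine le_trans (Finset.card_le_card fun s hs => ?_) h2
        have h3 := Finset.mem_filter.1 hs
        exact Finset.mem_filter.2 ⟨h3.1, (hS s h3.1).1, h3.2⟩
    · have h1 := (hS t (Finset.mem_filter.1 ht).1).1
      have h2 := Nat.lt_size_self (I.n + I.W + I.pm + 2)
      unfold ell
      omega
  choose qq h1 h2 using key
  exact ⟨qq, h1, fun t ht t' ht' e => h2 (h t) t (Finset.mem_filter.2 ⟨ht, rfl⟩) t'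
    (Finset.mem_filter.2 ⟨ht', e.symm⟩)⟩

/-- The time of the demand and selection phases. -/
def backTime (I : KP) : ℕ :=
  (20 + ∑ k ∈ Finset.range I.N, (308 + 70 * (I.sz k + 1 + if k = 1 then I.W else 0))) +
  ((6 + I.n * (100 + 70 * I.Q)) + (20 + 20 * I.n))

/-- The demand and selection phases, for computed profiles. -/
theorem back (hF : I.Fits w) {h : ℕ → ℕ} (hh : I.HashOK h) {σ σ₀ : St} (hI : I.Evaled h σ₀ σ)
    (h11 : ∀ i, σ.rd 11 i = 0) (hfill : I.Filled h σ₀) :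
    Det w (demandProg ;; selectProg ;; outputProg) σ I.backTime fun σ' =>
      σ'.ln 0 = I.n ∧ (∀ t < I.n, σ'.rd 0 t ≤ 1) ∧
      (∑ t ∈ Finset.range I.n, I.wt t * σ'.rd 0 t) ≤ I.W ∧
      (I.Correct (I.prof σ) → I.prof σ 1 I.W + (∑ t ∈ Finset.range I.n,
        if I.wt t = 0 then I.p t else 0) ≤ ∑ t ∈ Finset.range I.n, I.p t * σ'.rd 0 t) := by
  have hN := I.four_le_N
  unfold backTime
  refine (demand hF hh hI.toTab hI.sane h11).seq fun σ₁ _ ⟨hI₁, h10, hD⟩ => ?_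
  have hctx : I.SelCtx h (I.prof σ) σ₁ := ⟨hI₁.r0, hI₁.r7, hI₁.r10, hI₁.rd0, hI₁.rd1, hI₁.rd3,
    hI₁.rd7, hI₁.rd9, fun v k => h10 _, hI₁.ln11, hI₁.ln12⟩
  have hX := hI₁.rd12
  have hinv : I.SelInv h (I.prof σ) (∑ t ∈ Finset.range I.n, if I.wt t = 0 then I.p t else 0)
      (σ₁.rd 12) (σ₁.rd 11) := by
    refine ⟨fun u hu => ?_, fun u hu => ?_, hD.apart, fun t => ?_, fun t ht hne => ?_, ?_,
      fun hcor => ?_⟩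
    · have := hD.ran u hu; omega
    · have := hD.ran u hu
      exact hD.le_sz u hu (by omega)
    · rw [hX]; split_ifs <;> simp
    · rw [hX, if_neg (by have := ht.2.1; omega)] at hne
      exact absurd rfl hne
    · have : ∑ t ∈ Finset.range I.n, I.wt t * σ₁.rd 12 t = 0 := Finset.sum_eq_zero fun t _ => by
        rw [hX]; split_ifs with h1 <;> simp [h1]
      rw [this, zero_add]
      exact hD.wt
    · have : ∑ t ∈ Finset.range I.n, I.p t * σ₁.rd 12 t =
          ∑ t ∈ Finset.range I.n, if I.wt t = 0 then I.p t else 0 :=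
        Finset.sum_congr rfl fun t ht => by
          have := Finset.mem_range.1 ht
          rw [hX]; simp [this]
      rw [this, add_comm]
      exact Nat.add_le_add_left (hD.val hcor) _
  refine (select hF hh hctx hinv hfill hI.leaf).seq fun σ₂ _ ⟨h0, h12, hle, hw, hv⟩ => ?_
  refine (output hF h0 h12).mono le_rfl fun σ₃ _ ⟨hl, hd⟩ => ⟨hl, fun t ht => ?_, ?_, fun hcor => ?_⟩
  · rw [hd t ht]; exact hle t
  · refine le_trans (le_of_eq (Finset.sum_congr rfl fun t ht => ?_)) hw
    rw [hd t (Finset.mem_range.1 ht)]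
  · refine (hv hcor).trans (le_of_eq (Finset.sum_congr rfl fun t ht => ?_))
    rw [hd t (Finset.mem_range.1 ht)]

/-- The time of the whole algorithm, where the subroutine needs time `T`. -/
def totalTime (I : KP) (B : ℕ) (T : ℕ → ℕ) : ℕ :=
  (200 + 30 * I.n + 16 * (I.LW + I.LP + I.ell) + 8 * Nat.clog 2 I.Q₀) +
  ((100 + 2 * I.n + I.C + I.n * (16 * (I.LW + I.LP) + 100)) +
  ((30 + 2 * I.C + I.C * (8 * I.LW + 120)) +
  ((100 + 300 * I.N) +
  ((100 + I.off 0 + I.n + 2 * I.N + 16 * Nat.size (2 * I.N)) +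
  ((6 + I.n * (20 * I.LW + 60)) +
  ((6 + I.n * (100 + 60 * I.Q)) +
  ((6 + ∑ k ∈ Finset.range (2 * I.N - 1), (I.evalTime B T (2 * I.N - 1 - k) + 8)) +
  I.backTime)))))))

/-- The algorithm outputs a feasible solution, and with high probability it is at least as good as
the solution `S`. -/
theorem knapsack {P : RamProg} {T : ℕ → ℕ} {B : ℕ} (hF : I.Fits w)
    (hB : ∀ x, B ≤ x → modR P x = false ∧ modA P x = false) (hB2 : 2 ≤ B)
    (hP : ConvOK P T w I.ntop) {σ : St} (hI : I.Input σ) (h2 : σ.rd 2 0 = I.W)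
    (hC : Clean (100 + B) σ) {S : Finset ℕ} (hS : ∀ t ∈ S, t < I.n)
    (hW : ∑ t ∈ S, I.wt t ≤ I.W) :
    RT w (knapsackProg P B I.κ) σ (I.totalTime B T)
      (fun σ' => σ'.ln 0 = I.n ∧ (∀ t < I.n, σ'.rd 0 t ≤ 1) ∧
        (∑ t ∈ Finset.range I.n, I.wt t * σ'.rd 0 t) ≤ I.W)
      (fun σ' => if ∑ t ∈ S, I.p t ≤ ∑ t ∈ Finset.range I.n, I.p t * σ'.rd 0 t then 0 else 1)
      (3 * (∑ c ∈ Finset.range I.C, (I.M c : ℝ)) / 2 ^ (I.L + 1) + 2 * I.N * (17 / 18) ^ I.R) := by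
  have hSv : ∀ t ∈ S.filter I.Valid, I.Valid t := fun t ht => (Finset.mem_filter.1 ht).2
  have hWv : ∑ t ∈ S.filter I.Valid, I.wt t ≤ I.W :=
    (Finset.sum_le_sum_of_subset (Finset.filter_subset _ _)).trans hW
  have hmod : ∀ {c : RamProg}, modBound c ≤ 100 → ∀ x, 100 + B ≤ x →
      modR c x = false ∧ modA c x = false := fun h x hx => mod_of_modBound_le (h.trans (by omega))
  unfold knapsackProg totalTime
  refine (sizes hF hI h2).seq_rt fun σ₁ hS₁ h₁ => (classes_loop hF h₁).seq_rt fun σ₂ hS₂ h₂ =>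
    (buckets_loop hF h₂).seq_rt fun σ₃ hS₃ h₃ => (layout hF h₃).seq_rt fun σ₄ hS₄ h₄ =>
    (memory hF h₄).seq_rt fun σ₅ hS₅ ⟨h₅, h10, h11, h7⟩ => ?_
  have hC₅ : Clean (100 + B) σ₅ := ((((hC.of_same hS₁ (hmod (Nat.le_of_ble_eq_true rfl))).of_same hS₂
    (hmod (Nat.le_of_ble_eq_true rfl))).of_same hS₃ (hmod (Nat.le_of_ble_eq_true rfl))).of_same hS₄ (hmod (Nat.le_of_ble_eq_true rfl))).of_same hS₅
    (hmod (Nat.le_of_ble_eq_true rfl))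
  -- the potential of the buckets, scaled so that it is at least `1` if some bucket is overloaded;
  -- the probability that some convolution fails is added
  have hhash := (hash hF h₅ h10 h11 hSv).affine (1 / 2 ^ (I.L + 1)) (2 * I.N * (17 / 18) ^ I.R)
    (by positivity)
  refine (hhash.seq (t₂ := (6 + I.n * (100 + 60 * I.Q)) +
    ((6 + ∑ k ∈ Finset.range (2 * I.N - 1), (I.evalTime B T (2 * I.N - 1 - k) + 8)) + I.backTime))
    fun σ₆ hS₆ h₆ => ?_).mono le_rfl (fun _ _ h => h) (fun _ _ _ => le_rfl) ?_
  swap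
  · have h := pot_zero_le (I := I) (S := S.filter I.Valid)
      (fun c _ => (rem_le_z hSv hWv c).trans (I.z_le_M c)) (σ₅.rd 7)
    have h' := mul_le_mul_of_nonneg_left h (show (0 : ℝ) ≤ 1 / 2 ^ (I.L + 1) by positivity)
    refine add_le_add (h'.trans (le_of_eq ?_)) le_rfl
    ring
  have hC₆ := hC₅.of_same hS₆ (hmod (Nat.le_of_ble_eq_true rfl))
  set h : ℕ → ℕ := σ₆.rd 7 with hh_def
  have hh : I.HashOK h := h₆.rd7
  have hT₆ : I.Tab h σ₆ := ⟨h₆.toCtx, fun t _ => rfl⟩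
  refine (fill hF hh hT₆ h₆.rd10).seq_rt fun σ₇ hS₇ ⟨h₇, hfill⟩ => ?_
  have hC₇ := hC₆.of_same hS₇ (hmod (Nat.le_of_ble_eq_true rfl))
  have h11₇ : ∀ i, σ₇.rd 11 i = 0 := fun i => (hS₇.rd rfl i).trans (h₆.rd11 i)
  have heval := (eval hF hB hB2 hP h₇ hC₇).affine 1
    (1 / 2 ^ (I.L + 1) * I.pot (S.filter I.Valid) I.n h) zero_le_one
  refine (heval.seq fun σ₈ hS₈ h₈ => ?_).mono le_rfl (fun _ _ h => h) (fun _ _ _ => le_rfl)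
    (by linarith)
  have h11₈ : ∀ i, σ₈.rd 11 i = 0 := fun i => by
    rw [hS₈.rd, h11₇]
    rw [evalProg_eq]
    simp [FOR, modA, modA_evalBody P B]
  refine ((back hF hh h₈ h11₈ hfill).rt fun σ₉ _ h₉ => ?_).mono le_rfl
    (fun _ _ h => ⟨h.1, h.2.1, h.2.2.1⟩) (fun _ _ _ => le_rfl) le_rfl
  have hpot := I.pot_nonneg (S.filter I.Valid) I.n h
  have hpot' : 0 ≤ 1 / 2 ^ (I.L + 1) * I.pot (S.filter I.Valid) I.n h := by positivity
  -- the output can be worse than `S` only if a convolution failed or a bucket is overloaded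
  by_cases hl : ∀ c < I.C, ∀ β < I.M c, load (S.filter I.Valid) I.n h (c * I.Mx + β) ≤ I.L
  · by_cases hcor : I.Correct (I.prof σ₈)
    · rw [if_pos hcor, if_pos]
      · simpa using hpot'
      · obtain ⟨qq, hq, hsep⟩ := exists_colours hh hSv hl
        have h1 := hcor.le_root hh hfill h₈.leaf h₈.sane hSv hq hsep hWv (sum_p_le_ntop hSv hWv)
        have h2 := h₉.2.2.2 hcor
        have h3 := sum_p_le hS hW
        omega
    · rw [if_neg hcor]
      split_ifs <;> linarith
  · push Not at hl
    obtain ⟨c, hc, β, hβ, hlt⟩ := hl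
    have h1 := pot_ge (I := I) (S := S.filter I.Valid) (k := I.n) (a := h) hc hβ
    have h2 : (2 : ℝ) ^ (I.L + 1) ≤ I.pot (S.filter I.Valid) I.n h :=
      (pow_le_pow_right₀ (by norm_num) hlt).trans h1
    have h3 : 1 ≤ 1 / 2 ^ (I.L + 1) * I.pot (S.filter I.Valid) I.n h := by
      rw [one_div, inv_mul_eq_div, one_le_div (by positivity)]
      exact h2
    split_ifs <;> norm_num at * <;> linarith

end KP

/-! ### Knapsack instances -/

namespace KnapsackInstance

/-- The instance with items indexed by `ℕ`; the items from `n` on are empty. -/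
def kp (J : KnapsackInstance) (κ : ℕ) : KP where
  n := J.n
  W := J.W
  κ := κ
  p t := if h : t < J.n then J.p ⟨t, h⟩ else 0
  wt t := if h : t < J.n then J.w ⟨t, h⟩ else 0

theorem sum_eq_sum_range {n : ℕ} (f : Fin n → ℕ) (x : ℕ → ℕ) :
    ∑ i, f i * x i = ∑ t ∈ Finset.range n, (if h : t < n then f ⟨t, h⟩ else 0) * x t := by
  rw [Finset.sum_range fun t => (if h : t < n then f ⟨t, h⟩ else 0) * x t]
  exact Finset.sum_congr rfl fun i _ => by simp

variable (J : KnapsackInstance) (κ : ℕ)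

/-- A feasible set of items has profit at most `opt`. -/
theorem le_opt {S : Finset ℕ} (hS : ∀ t ∈ S, t < J.n) (hW : ∑ t ∈ S, (J.kp κ).wt t ≤ J.W) :
    ∑ t ∈ S, (J.kp κ).p t ≤ J.opt := by
  have key : ∀ f : Fin J.n → ℕ, ∑ i, f i * ((if (i : ℕ) ∈ S then 1 else 0 : Fin 2) : ℕ) =
      ∑ t ∈ S, if h : t < J.n then f ⟨t, h⟩ else 0 := by
    intro f
    have h1 : ∀ i : Fin J.n, ((if (i : ℕ) ∈ S then 1 else 0 : Fin 2) : ℕ) =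
        if (i : ℕ) ∈ S then 1 else 0 := fun i => by split_ifs <;> rfl
    simp only [h1]
    rw [sum_eq_sum_range f fun t => if t ∈ S then 1 else 0]
    simp only [mul_ite, mul_one, mul_zero]
    rw [← Finset.sum_filter]
    refine Finset.sum_congr ?_ fun _ _ => rfl
    ext t
    simp only [Finset.mem_filter, Finset.mem_range]
    exact ⟨fun h => h.2, fun h => ⟨hS t h, h⟩⟩
  have h1 := Finset.le_sup (f := J.profit) (s := Finset.univ.filter fun x : Fin J.n → Fin 2 =>
    J.weight x ≤ J.W) (b := fun i => if (i : ℕ) ∈ S then 1 else 0)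
    (by
      simp only [Finset.mem_filter, Finset.mem_univ, true_and]
      unfold weight
      rw [key]
      exact hW)
  unfold opt
  refine le_trans (le_of_eq ?_) h1
  unfold profit
  rw [key]
  rfl

/-- The optimum is attained by a set of items. -/
theorem exists_opt : ∃ S : Finset ℕ, (∀ t ∈ S, t < J.n) ∧ ∑ t ∈ S, (J.kp κ).wt t ≤ J.W ∧
    ∑ t ∈ S, (J.kp κ).p t = J.opt := by
  obtain ⟨x, hx, h⟩ := Finset.exists_mem_eq_sup (Finset.univ.filter fun x : Fin J.n → Fin 2 =>
    J.weight x ≤ J.W) ⟨fun _ => 0, by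
      rw [Finset.mem_filter]; exact ⟨Finset.mem_univ _, by simp [weight]⟩⟩ J.profit
  have hx' := (Finset.mem_filter.1 hx).2
  have key : ∀ f : Fin J.n → ℕ, ∑ t ∈ (Finset.univ.filter fun i => x i = 1).map
      Fin.valEmbedding, (if h : t < J.n then f ⟨t, h⟩ else 0) = ∑ i, f i * (x i : ℕ) := by
    intro f
    rw [Finset.sum_map, Finset.sum_filter]
    refine Finset.sum_congr rfl fun i _ => ?_
    have hi : (x i = 0) ∨ (x i = 1) := by
      rcases x i with ⟨a, ha⟩
      interval_cases a
      · exact Or.inl rfl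
      · exact Or.inr rfl
    rcases hi with h | h <;> simp [h]
  refine ⟨(Finset.univ.filter fun i => x i = 1).map Fin.valEmbedding, fun t ht => ?_, ?_, ?_⟩
  · obtain ⟨i, -, rfl⟩ := Finset.mem_map.1 ht
    exact i.2
  · exact (key J.w).trans_le hx'
  · exact (key J.p).trans h.symm

theorem pm_le_opt : (J.kp κ).pm ≤ J.opt := by
  refine Finset.sup_le fun t ht => ?_
  split_ifs with h
  · have := J.le_opt κ (S := {t})
      (fun s hs => by rw [Finset.mem_singleton.1 hs]; exact Finset.mem_range.1 ht)
      (by rw [Finset.sum_singleton]; exact h)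
    simpa using this
  · exact Nat.zero_le _

theorem opt_le : J.opt ≤ J.n * (J.kp κ).pm := by
  obtain ⟨S, h1, h2, h3⟩ := J.exists_opt κ
  rw [← h3]
  have hc : S.card ≤ J.n := by
    have := Finset.card_le_card (show S ⊆ Finset.range J.n from fun t ht => Finset.mem_range.2 (h1 t ht))
    simpa using this
  refine (Finset.sum_le_card_nsmul _ _ (J.kp κ).pm fun t ht => ?_).trans (Nat.mul_le_mul_right _ hc)
  have h4 : (J.kp κ).wt t ≤ J.W := (Finset.single_le_sum (fun _ _ => Nat.zero_le _) ht).trans h2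
  have := Finset.le_sup (f := fun t => if (J.kp κ).wt t ≤ (J.kp κ).W then (J.kp κ).p t else 0)
    (Finset.mem_range.2 (h1 t ht))
  have h5 : (J.kp κ).wt t ≤ (J.kp κ).W := h4
  simp only [h5, if_true] at this
  exact this

end KnapsackInstance

namespace KP
variable {I : KP}

/-! ### Bounds for the parameters -/

theorem two_pow_div_le {c : ℕ} (hc : c < I.C) : 2 ^ (c / I.LP) ≤ I.W ∧ 2 ^ (c % I.LP) ≤ I.pm := by
  unfold C at hc
  have h1 : 0 < I.LP := Nat.pos_of_ne_zero fun h => by rw [h] at hc; simp at hc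
  have h2 : c / I.LP < I.LW := by rw [Nat.div_lt_iff_lt_mul h1]; exact hc
  have h3 := Nat.mod_lt c h1
  have key : ∀ a s, s < Nat.size a → 2 ^ s ≤ a := fun a s h => by
    by_contra h'
    have := Nat.size_le.2 (not_le.1 h')
    omega
  exact ⟨key _ _ h2, key _ _ h3⟩

theorem u_le_add {c : ℕ} (hc : c < I.C) : I.u c ≤ 2 * (I.W + I.pm) := by
  obtain ⟨h1, h2⟩ := two_pow_div_le hc
  unfold u
  rcases le_total (c / I.LP) (c % I.LP) with h | h
  · rw [max_eq_right h]; omega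
  · rw [max_eq_left h]; omega

theorem z_mul_wt_le (c : ℕ) : I.z c * 2 ^ (c / I.LP) ≤ I.W :=
  (Nat.mul_le_mul_right _ (min_le_right _ _)).trans (Nat.div_mul_le_self _ _)

/-- At least a third of `z c` items of class `c` fit at once. -/
theorem z_mul_p_le {O : ℕ} (hO : ∀ S : Finset ℕ, (∀ t ∈ S, t < I.n) → ∑ t ∈ S, I.wt t ≤ I.W →
    ∑ t ∈ S, I.p t ≤ O) (c : ℕ) : I.z c * 2 ^ (c % I.LP) ≤ 3 * O := by
  rcases Nat.eq_zero_or_pos (I.z c) with h0 | h0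
  · rw [h0]; simp
  have hcl : ∀ t ∈ (Finset.range I.n).filter fun t => I.ci t = c + 1, I.Valid t ∧ I.cls t = c := by
    intro t ht
    have h := (Finset.mem_filter.1 ht).2
    unfold ci at h
    split_ifs at h with hv
    exact ⟨hv, by omega⟩
  have hp : ∀ t ∈ (Finset.range I.n).filter fun t => I.ci t = c + 1, 2 ^ (c % I.LP) ≤ I.p t := by
    intro t ht
    obtain ⟨hv, h⟩ := hcl t ht
    rw [← h, hv.cls_mod]
    exact two_pow_size_pred_le hv.2.2.2
  have hz : I.z c ≤ ((Finset.range I.n).filter fun t => I.ci t = c + 1).card := min_le_left _ _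
  rcases Nat.lt_or_ge (I.z c) 2 with h1 | h1
  · obtain ⟨t, ht⟩ := Finset.card_pos.1 (lt_of_lt_of_le h0 hz)
    obtain ⟨hv, -⟩ := hcl t ht
    have h2 := hO {t} (by simpa using hv.1) (by simpa using hv.2.2.1)
    have h3 := hp t ht
    rw [Finset.sum_singleton] at h2
    have h4 : I.z c = 1 := by omega
    rw [h4]
    omega
  · obtain ⟨S, hS, hcard⟩ := Finset.exists_subset_card_eq ((Nat.div_le_self (I.z c) 2).trans hz)
    have h2 := hO S (fun t ht => (hcl t (hS ht)).1.1) ?_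
    · have h3 := Finset.card_nsmul_le_sum S I.p (2 ^ (c % I.LP)) fun t ht => hp t (hS ht)
      rw [hcard, smul_eq_mul] at h3
      have h4 : I.z c ≤ 3 * (I.z c / 2) := by omega
      calc I.z c * 2 ^ (c % I.LP) ≤ 3 * (I.z c / 2) * 2 ^ (c % I.LP) := Nat.mul_le_mul_right _ h4
        _ = 3 * (I.z c / 2 * 2 ^ (c % I.LP)) := by ring
        _ ≤ 3 * O := Nat.mul_le_mul_left _ (h3.trans h2)
    · have h3 := Finset.sum_le_card_nsmul S I.wt (2 * 2 ^ (c / I.LP)) fun t ht => by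
        obtain ⟨hv, h⟩ := hcl t (hS ht)
        rw [← h, hv.cls_div]
        exact (lt_two_mul_two_pow_size_pred _ hv.2.1).le
      rw [hcard, smul_eq_mul] at h3
      calc ∑ t ∈ S, I.wt t ≤ I.z c / 2 * (2 * 2 ^ (c / I.LP)) := h3
        _ = I.z c / 2 * 2 * 2 ^ (c / I.LP) := by ring
        _ ≤ I.z c * 2 ^ (c / I.LP) := Nat.mul_le_mul_right _ (Nat.div_mul_le_self _ _)
        _ ≤ I.W := I.z_mul_wt_le c

/-- The maximal size of a node is `Õ(W + O)`, if `O` bounds the profit of every feasible set. -/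
theorem ntop_le {O : ℕ} (hO : ∀ S : Finset ℕ, (∀ t ∈ S, t < I.n) → ∑ t ∈ S, I.wt t ≤ I.W →
    ∑ t ∈ S, I.p t ≤ O) : I.ntop ≤ I.W + 1 + I.C * (2 * I.W + 6 * O) := by
  unfold ntop
  refine Nat.add_le_add_left ?_ _
  refine (Finset.sum_le_card_nsmul _ _ (2 * I.W + 6 * O) fun c _ => ?_).trans (by simp)
  have h1 := I.z_mul_wt_le c
  have h2 := z_mul_p_le hO c
  unfold u
  have h3 : 2 ^ max (c / I.LP) (c % I.LP) ≤ 2 ^ (c / I.LP) + 2 ^ (c % I.LP) := by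
    rcases le_total (c / I.LP) (c % I.LP) with h | h
    · rw [max_eq_right h]; exact Nat.le_add_left _ _
    · rw [max_eq_left h]; exact Nat.le_add_right _ _
  calc I.z c * (2 * 2 ^ max (c / I.LP) (c % I.LP))
      ≤ I.z c * (2 * (2 ^ (c / I.LP) + 2 ^ (c % I.LP))) := by gcongr
    _ = 2 * (I.z c * 2 ^ (c / I.LP)) + 2 * (I.z c * 2 ^ (c % I.LP)) := by ring
    _ ≤ _ := by omega

theorem pow2_le (s : ℕ) : pow2 s ≤ 2 * s + 1 := by
  unfold pow2
  rcases Nat.lt_or_ge 1 s with h | h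
  · have h2 := Nat.pow_pred_clog_lt_self (b := 2) (by norm_num) h
    have h3 : 0 < Nat.clog 2 s := Nat.clog_pos (by norm_num) h
    have h4 : 2 ^ Nat.clog 2 s = 2 * 2 ^ (Nat.clog 2 s).pred := by
      rw [← pow_succ']; congr 1; exact (Nat.succ_pred_eq_of_pos h3).symm
    omega
  · interval_cases s <;> simp

theorem Q_le : I.Q ≤ 2 * I.Q₀ + 1 := pow2_le _

/-- The total size of a level of the tree grows from the root to the leaves. -/
theorem sum_level_le {m : ℕ} (hm : 1 ≤ m) (hN : m ≤ I.N) :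
    ∑ v ∈ Finset.Ico m (2 * m), I.sz v ≤ ∑ v ∈ Finset.Ico I.N (2 * I.N), I.sz v := by
  refine Nat.decreasingInduction' (P := fun m => ∑ v ∈ Finset.Ico m (2 * m), I.sz v ≤
    ∑ v ∈ Finset.Ico I.N (2 * I.N), I.sz v) (fun k hk hmk ih => ?_) hN le_rfl
  have h1 := sum_level_succ I.sz (m := k) (by omega)
  have h2 := I.sz_inner (v := k) (by omega) hk
  have h3 : I.sz k ≤ ∑ v ∈ Finset.Ico k (2 * k), I.sz v :=
    Finset.single_le_sum (f := I.sz) (fun _ _ => Nat.zero_le _) (Finset.mem_Ico.2 ⟨le_rfl, by omega⟩)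
  omega

theorem sum_sz_le : ∑ v ∈ Finset.Ico 1 (2 * I.N), I.sz v ≤
    (Nat.size I.N + 1) * ∑ v ∈ Finset.Ico I.N (2 * I.N), I.sz v := by
  have key : ∀ j, 2 ^ j ≤ 2 * I.N → ∑ v ∈ Finset.Ico 1 (2 ^ j), I.sz v ≤
      j * ∑ v ∈ Finset.Ico I.N (2 * I.N), I.sz v := by
    intro j
    induction j with
    | zero => simp
    | succ j ih =>
      intro hj
      rw [pow_succ'] at hj ⊢
      rw [← Finset.sum_Ico_consecutive _ Nat.one_le_two_pow (by omega : 2 ^ j ≤ 2 * 2 ^ j), add_mul,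
        one_mul]
      exact Nat.add_le_add (ih (by omega)) (sum_level_le Nat.one_le_two_pow (by omega))
  have hN := I.N_pos
  have h1 := Nat.lt_size_self I.N
  have hs1 : 1 ≤ Nat.size I.N := Nat.size_pos.2 hN
  have h2 := two_pow_size_pred_le hN
  generalize Nat.size I.N = s at *
  have h3 : 2 ^ s = 2 * 2 ^ (s - 1) := by rw [← pow_succ']; congr 1; omega
  calc ∑ v ∈ Finset.Ico 1 (2 * I.N), I.sz v
      ≤ ∑ v ∈ Finset.Ico 1 (2 ^ s) ∪ Finset.Ico I.N (2 * I.N), I.sz v :=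
        Finset.sum_le_sum_of_subset fun v hv => by
          simp only [Finset.mem_union, Finset.mem_Ico] at hv ⊢
          rcases Nat.lt_or_ge v (2 ^ s) with h | h
          · exact Or.inl ⟨hv.1, h⟩
          · exact Or.inr ⟨h1.le.trans h, hv.2⟩
    _ ≤ ∑ v ∈ Finset.Ico 1 (2 ^ s), I.sz v + ∑ v ∈ Finset.Ico I.N (2 * I.N), I.sz v := by
        rw [← Finset.sum_union_inter]; exact Nat.le_add_right _ _
    _ ≤ _ := by
        rw [add_mul, one_mul]
        exact Nat.add_le_add_right (key s (by omega)) _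

theorem sum_range_mul (f : ℕ → ℕ → ℕ) (a : ℕ) {b : ℕ} (hb : 0 < b) :
    ∑ i ∈ Finset.range (a * b), f (i / b) (i % b) =
      ∑ i ∈ Finset.range a, ∑ j ∈ Finset.range b, f i j := by
  induction a with
  | zero => simp
  | succ a ih =>
    rw [add_mul, one_mul, Finset.sum_range_add, ih, Finset.sum_range_succ]
    congr 1
    refine Finset.sum_congr rfl fun j hj => ?_
    have hj' := Finset.mem_range.1 hj
    rw [mul_comm, Nat.mul_add_div hb, Nat.div_eq_of_lt hj', Nat.mul_add_mod, Nat.mod_eq_of_lt hj',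
      add_zero]

theorem G_le : I.G ≤ (2 * I.C + 1) * I.ntop := by
  have h1 : I.W + 1 ≤ I.ntop := Nat.le_add_right _ _
  have h2 : I.C * I.Mx ≤ I.C * (2 * I.ntop) := Nat.mul_le_mul_left _ (by unfold Mx; omega)
  unfold G
  calc I.C * I.Mx + 1 ≤ I.C * (2 * I.ntop) + I.ntop := by omega
    _ = _ := by ring

/-- The leaves have total size at most `ntop`, up to lower order factors: the buckets of a class
`c` contribute `M c * u c`, where `M c` is about `z c`, and the other leaves have size `1`. -/
theorem sum_leaves_le : ∑ v ∈ Finset.Ico I.N (2 * I.N), I.sz v ≤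
    3 * (I.C + 1) * (I.Q * I.Q) * I.ntop := by
  have hQQ : 0 < I.Q * I.Q := Nat.mul_pos I.Q_pos I.Q_pos
  have h1 : ∀ b, min I.ntop (if b / I.Mx < I.C ∧ b % I.Mx < I.M (b / I.Mx) then I.u (b / I.Mx)
      else 1) ≤ 1 + if b / I.Mx < I.C ∧ b % I.Mx < I.M (b / I.Mx) then
        min I.ntop (I.u (b / I.Mx)) else 0 := fun b => by
    split_ifs
    · exact Nat.le_add_left _ _
    · exact min_le_right _ _
  have h2 : ∑ b ∈ Finset.range I.G, (if b / I.Mx < I.C ∧ b % I.Mx < I.M (b / I.Mx) then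
        min I.ntop (I.u (b / I.Mx)) else 0) ≤
      ∑ c ∈ Finset.range I.C, I.M c * min I.ntop (I.u c) := by
    unfold G
    rw [Finset.sum_range_succ, Nat.mul_div_cancel _ I.Mx_pos, if_neg (by simp), add_zero,
      sum_range_mul (fun c β => if c < I.C ∧ β < I.M c then min I.ntop (I.u c) else 0) _ I.Mx_pos]
    refine Finset.sum_le_sum fun c hc => ?_
    rw [← Finset.sum_filter]
    refine (Finset.sum_le_card_nsmul _ _ _ fun _ _ => le_rfl).trans ?_
    rw [smul_eq_mul]
    refine Nat.mul_le_mul_right _ ?_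
    calc _ ≤ (Finset.range (I.M c)).card := Finset.card_le_card fun β hβ => by
          have := (Finset.mem_filter.1 hβ).2.2
          exact Finset.mem_range.2 this
      _ = I.M c := Finset.card_range _
  have h3 : ∑ c ∈ Finset.range I.C, I.M c * min I.ntop (I.u c) ≤ (I.C + 2) * I.ntop := by
    calc ∑ c ∈ Finset.range I.C, I.M c * min I.ntop (I.u c)
        ≤ ∑ c ∈ Finset.range I.C, (2 * (I.z c * I.u c) + I.ntop) := Finset.sum_le_sum fun c _ => by
          calc I.M c * min I.ntop (I.u c) ≤ (2 * I.z c + 1) * min I.ntop (I.u c) :=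
                Nat.mul_le_mul_right _ (pow2_le _)
            _ = 2 * (I.z c * min I.ntop (I.u c)) + min I.ntop (I.u c) := by ring
            _ ≤ 2 * (I.z c * I.u c) + I.ntop := by
                gcongr
                · exact min_le_right _ _
                · exact min_le_left _ _
      _ = 2 * ∑ c ∈ Finset.range I.C, I.z c * I.u c + I.C * I.ntop := by
          rw [Finset.sum_add_distrib, ← Finset.mul_sum]; simp
      _ ≤ 2 * I.ntop + I.C * I.ntop := by
          have : ∑ c ∈ Finset.range I.C, I.z c * I.u c ≤ I.ntop := Nat.le_add_left _ _
          omega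
      _ = _ := by ring
  calc ∑ v ∈ Finset.Ico I.N (2 * I.N), I.sz v
      = ∑ l ∈ Finset.range (I.G * (I.Q * I.Q)), min I.ntop (I.leafSz l) := by
        rw [Finset.sum_Ico_eq_sum_range, show 2 * I.N - I.N = I.G * (I.Q * I.Q) by
          rw [← mul_assoc]; show 2 * I.N - I.N = I.N; omega]
        refine Finset.sum_congr rfl fun l _ => ?_
        rw [sz_leaf (Nat.le_add_right _ _), Nat.add_sub_cancel_left]
    _ = ∑ b ∈ Finset.range I.G, ∑ _j ∈ Finset.range (I.Q * I.Q), min I.ntop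
          (if b / I.Mx < I.C ∧ b % I.Mx < I.M (b / I.Mx) then I.u (b / I.Mx) else 1) :=
        sum_range_mul (fun b _ => min I.ntop
          (if b / I.Mx < I.C ∧ b % I.Mx < I.M (b / I.Mx) then I.u (b / I.Mx) else 1)) _ hQQ
    _ = (I.Q * I.Q) * ∑ b ∈ Finset.range I.G, min I.ntop
          (if b / I.Mx < I.C ∧ b % I.Mx < I.M (b / I.Mx) then I.u (b / I.Mx) else 1) := by
        simp only [Finset.sum_const, Finset.card_range, smul_eq_mul, Finset.mul_sum]
    _ ≤ (I.Q * I.Q) * ((2 * I.C + 1) * I.ntop + (I.C + 2) * I.ntop) := by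
        refine Nat.mul_le_mul_left _ ((Finset.sum_le_sum fun b _ => h1 b).trans ?_)
        rw [Finset.sum_add_distrib]
        refine Nat.add_le_add ?_ (h2.trans h3)
        simpa using I.G_le
    _ = _ := by ring

end KP

/-! ### Polynomial growth -/

/-- `f` is bounded by a polynomial in `b`. -/
def PolyIn {ι : Type} (b f : ι → ℕ) : Prop := ∃ C k : ℕ, ∀ i, f i ≤ C * b i ^ k

namespace PolyIn
variable {ι : Type} {b f g : ι → ℕ}

theorem const (b : ι → ℕ) (c : ℕ) : PolyIn b fun _ => c := ⟨c, 0, fun i => by simp⟩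

theorem self (b : ι → ℕ) : PolyIn b b := ⟨1, 1, fun i => by simp⟩

theorem mono (hg : PolyIn b g) (h : ∀ i, f i ≤ g i) : PolyIn b f :=
  let ⟨C, k, hC⟩ := hg; ⟨C, k, fun i => (h i).trans (hC i)⟩

theorem add (hb : ∀ i, 1 ≤ b i) (hf : PolyIn b f) (hg : PolyIn b g) :
    PolyIn b fun i => f i + g i := by
  obtain ⟨C, k, hC⟩ := hf
  obtain ⟨D, l, hD⟩ := hg
  refine ⟨C + D, max k l, fun i => ?_⟩
  rw [add_mul]
  exact Nat.add_le_add
    ((hC i).trans (Nat.mul_le_mul_left _ (Nat.pow_le_pow_right (hb i) (le_max_left _ _))))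
    ((hD i).trans (Nat.mul_le_mul_left _ (Nat.pow_le_pow_right (hb i) (le_max_right _ _))))

theorem mul (hf : PolyIn b f) (hg : PolyIn b g) : PolyIn b fun i => f i * g i := by
  obtain ⟨C, k, hC⟩ := hf
  obtain ⟨D, l, hD⟩ := hg
  refine ⟨C * D, k + l, fun i => (Nat.mul_le_mul (hC i) (hD i)).trans (le_of_eq ?_)⟩
  ring

theorem exists_pow (hb : ∀ i, 2 ≤ b i) (hf : PolyIn b f) : ∃ k, ∀ i, f i < b i ^ k := by
  obtain ⟨C, k, hC⟩ := hf
  refine ⟨C + k, fun i => (hC i).trans_lt ?_⟩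
  rw [pow_add]
  exact Nat.mul_lt_mul_of_pos_right (Nat.lt_two_pow_self.trans_le (Nat.pow_le_pow_left (hb i) C))
    (Nat.pow_pos (by have := hb i; omega))

end PolyIn

theorem size_le_self (a : ℕ) : Nat.size a ≤ a := Nat.size_le.2 Nat.lt_two_pow_self

namespace KnapsackInstance

/-- The magnitude of the input, plus two. -/
def mag (J : KnapsackInstance) : ℕ := inputMagnitude (zeroOneKnapsack.input J) + 2

theorem lt_mag (J : KnapsackInstance) (κ : ℕ) : J.n + J.W + (J.kp κ).pm + 2 < J.mag := by
  have h1 : J.mag = J.n + (∑ i, J.p i) + (J.n + (∑ i, J.w i) + (1 + J.W)) + 2 := by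
    simp [mag, inputMagnitude, zeroOneKnapsack, List.sum_ofFn]
  have h2 : (J.kp κ).pm ≤ ∑ i, J.p i := by
    refine Finset.sup_le fun t ht => ?_
    have ht' : t < J.n := Finset.mem_range.1 ht
    split_ifs
    · have : (J.kp κ).p t = J.p ⟨t, ht'⟩ := by simp [kp, ht']
      rw [this]
      exact Finset.single_le_sum (f := J.p) (fun _ _ => Nat.zero_le _) (Finset.mem_univ _)
    · exact Nat.zero_le _
  omega

theorem off_le_mul (I : KP) : I.off 0 ≤ 2 * I.N * (I.ntop + 1) := by
  unfold KP.off
  refine (Finset.sum_le_card_nsmul _ _ (I.ntop + 1) fun v _ => Nat.succ_le_succ (I.sz_le_ntop v)).trans ?_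
  rw [smul_eq_mul, Nat.card_Ioo]
  exact Nat.mul_le_mul_right _ (by omega)

theorem one_le_mag (J : KnapsackInstance) : 1 ≤ J.mag := by have := J.lt_mag 0; omega

theorem sum_poly (κ : ℕ) : PolyIn mag fun J => J.n + J.W + (J.kp κ).pm + 2 :=
  (PolyIn.self mag).mono fun J => (J.lt_mag κ).le

theorem ntop_poly (κ : ℕ) : PolyIn mag fun J => (J.kp κ).ntop := by
  have hW : PolyIn mag W := (sum_poly κ).mono fun J => by omega
  have hpm : PolyIn mag fun J => (J.kp κ).pm := (sum_poly κ).mono fun J => by omega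
  have hC : PolyIn mag fun J => (J.kp κ).C := (hW.mul hpm).mono fun J =>
    Nat.mul_le_mul (size_le_self _) (size_le_self _)
  have hu : PolyIn mag fun J => 2 * (J.W + (J.kp κ).pm) :=
    (PolyIn.const mag 2).mul (hW.add one_le_mag hpm)
  refine ((hW.add one_le_mag (PolyIn.const mag 1)).add one_le_mag
    (hC.mul (hW.mul hu))).mono fun J => ?_
  refine Nat.add_le_add_left ((Finset.sum_le_card_nsmul _ _ (J.W * (2 * (J.W + (J.kp κ).pm)))
    fun x hx => ?_).trans (by simp)) _
  exact Nat.mul_le_mul ((min_le_right _ _).trans (Nat.div_le_self _ _))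
    (KP.u_le_add (Finset.mem_range.1 hx))

/-- All numbers that occur are polynomial in the magnitude of the input. -/
theorem fits (κ : ℕ) : ∃ c, ∀ (J : KnapsackInstance) (w : ℕ), J.mag ^ c ≤ 2 ^ w →
    (J.kp κ).Fits w := by
  have hb := one_le_mag
  have c (k : ℕ) := PolyIn.const mag k
  have hS := sum_poly κ
  have hW : PolyIn mag W := hS.mono fun J => by omega
  have hpm : PolyIn mag fun J => (J.kp κ).pm := hS.mono fun J => by omega
  have hell : PolyIn mag fun J => (J.kp κ).ell := hS.mono fun J => size_le_self _
  have hC : PolyIn mag fun J => (J.kp κ).C := (hW.mul hpm).mono fun J =>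
    Nat.mul_le_mul (size_le_self _) (size_le_self _)
  have hL : PolyIn mag fun J => (J.kp κ).L := (c κ).mul hell
  have hQ₀ : PolyIn mag fun J => (J.kp κ).Q₀ := (((c 2).mul hell).mul (hL.mul hL)).add hb (c 2)
  have hQ : PolyIn mag fun J => (J.kp κ).Q := (((c 2).mul hQ₀).add hb (c 1)).mono fun J => KP.Q_le
  have hu : PolyIn mag fun J => 2 * (J.W + (J.kp κ).pm) := (c 2).mul (hW.add hb hpm)
  have hntop := ntop_poly κ
  have hMx : PolyIn mag fun J => (J.kp κ).Mx := ((c 2).mul hW).add hb (c 1)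
  have hN : PolyIn mag fun J => (J.kp κ).N := ((((hC.mul hMx).add hb (c 1)).mul hQ).mul hQ)
  have hoff : PolyIn mag fun J => (J.kp κ).off 0 :=
    (((c 2).mul hN).mul (hntop.add hb (c 1))).mono fun J => off_le_mul _
  have hR : PolyIn mag fun J => (J.kp κ).R := ((c 13).mul (((c 2).mul hN).add hb
    ((c κ).mul hell))).mono fun J =>
      Nat.mul_le_mul_left _ (Nat.add_le_add_right (size_le_self (2 * (J.kp κ).N)) _)
  obtain ⟨k, hk⟩ := (((((((((((hS.add hb hC).add hb (c κ)).add hb hQ₀).add hb (hQ.mul hQ)).add hb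
    hMx).add hb hu).add hb (hntop.add hb hntop)).add hb (hN.add hb hN)).add hb
    (hoff.add hb hW)).add hb hR).add hb ((hell.add hb hell).add hb (c 2))).exists_pow fun J => by
      have := J.lt_mag κ; omega
  refine ⟨k, fun J w hw => ?_⟩
  have h := (hk J).trans_le hw
  have eW : (J.kp κ).W = J.W := rfl
  have en : (J.kp κ).n = J.n := rfl
  have eκ : (J.kp κ).κ = κ := rfl
  have hMle : ∀ x < (J.kp κ).C, (J.kp κ).M x < 2 ^ w := fun x _ =>
    ((J.kp κ).M_le_Mx x).trans_lt (by omega)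
  have hule : ∀ x < (J.kp κ).C, (J.kp κ).u x < 2 ^ w := fun x hx =>
    (KP.u_le_add hx).trans_lt (by rw [eW]; omega)
  refine ⟨?_, ?_, ?_, ?_, ?_, ?_, hMle, hule, ?_, ?_, ?_, ?_, ?_, ?_⟩
  · rcases w with _ | w
    · simp at h
    · omega
  all_goals omega

end KnapsackInstance

/-! ### Running times up to polylogarithmic factors -/

namespace SoftO
variable {ι : Type} {f h g : ι → ℕ}

theorem one_le_log (g : ι → ℕ) (i : ι) : 1 ≤ Nat.log 2 (g i + 2) :=
  Nat.log_pos (by norm_num) (by omega)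

theorem mono (hh : SoftO h g) (H : ∀ i, f i ≤ h i) : SoftO f g :=
  let ⟨C, k, hC⟩ := hh; ⟨C, k, fun i => (H i).trans (hC i)⟩

theorem add (hf : SoftO f g) (hh : SoftO h g) : SoftO (fun i => f i + h i) g := by
  obtain ⟨C, k, hC⟩ := hf
  obtain ⟨D, l, hD⟩ := hh
  refine ⟨C + D, max k l, fun i => ?_⟩
  have h1 := one_le_log g i
  rw [add_mul]
  refine Nat.add_le_add ((hC i).trans ?_) ((hD i).trans ?_) <;> gcongr
  · exact le_max_left _ _
  · exact le_max_right _ _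

theorem mul_poly (hh : SoftO h g) (hf : PolyIn (fun i => Nat.log 2 (g i + 2)) f) :
    SoftO (fun i => f i * h i) g := by
  obtain ⟨C, k, hC⟩ := hf
  obtain ⟨D, l, hD⟩ := hh
  refine ⟨C * D, k + l, fun i => (Nat.mul_le_mul (hC i) (hD i)).trans (le_of_eq ?_)⟩
  ring

theorem const_mul (hh : SoftO h g) (c : ℕ) : SoftO (fun i => c * h i) g :=
  hh.mul_poly (PolyIn.const _ c)

theorem of_le (H : ∀ i, f i ≤ g i) : SoftO f g := ⟨1, 0, fun i => by simpa using H i⟩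

theorem of_poly (hg : ∀ i, 1 ≤ g i) (hf : PolyIn (fun i => Nat.log 2 (g i + 2)) f) : SoftO f g :=
  ((of_le fun _ => le_rfl).mul_poly hf).mono fun i => Nat.le_mul_of_pos_right _ (hg i)

end SoftO

theorem size_le_log (m : ℕ) : Nat.size m ≤ 2 * Nat.log 2 (m + 2) := by
  have h1 : 1 ≤ Nat.log 2 (m + 2) := Nat.log_pos (by norm_num) (by omega)
  have h2 : Nat.size m ≤ Nat.log 2 (m + 2) + 1 :=
    Nat.size_le.2 (lt_of_le_of_lt (by omega) (Nat.lt_pow_succ_log_self (by norm_num) (m + 2)))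
  omega

theorem size_mul_le (a b : ℕ) : Nat.size (a * b) ≤ Nat.size a + Nat.size b := by
  rw [Nat.size_le, pow_add]
  exact Nat.mul_lt_mul'' (Nat.lt_size_self a) (Nat.lt_size_self b)

/-- A time bound for convolution is positive, and at least linear: the output has to be written. -/
theorem SolvesInTime.le_time {P : RamProg} {K : ℕ} {T : ℕ → ℕ}
    (hP : SolvesInTime P (bmMaxConv K) (fun I => T I.n) (fun _ => 2 / 3)) (m : ℕ) :
    1 ≤ T m ∧ m ≤ T m := by
  obtain ⟨c, -, h⟩ := hP
  let J : BMMaxConvInstance K := ⟨m, fun _ => ⊥, fun _ => ⊥, monotone_const, monotone_const,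
    fun _ => bot_le, fun _ => bot_le⟩
  obtain ⟨h1, h2⟩ := h J _ ((Nat.pow_le_pow_left Nat.lt_two_pow_self.le c).trans
    (pow_mul 2 _ c).symm.le)
  obtain ⟨ω, s, τ, h3, h4⟩ := nonempty_of_measureReal_ne_zero (ne_of_gt (lt_of_lt_of_le
    (by norm_num) h2))
  obtain ⟨s', τ', h5, h6⟩ := h1 ω
  obtain rfl := h3.unique h5
  have h7 := h5.length_le 0
  have h8 : s.arr 0 = _ := h4
  have h9 := h5.time_pos
  have h10 : ((RamState.init ((bmMaxConv K).input J) ω).arr 0).length = m + 1 := by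
    simp [RamState.init, bmMaxConv, J]
  rw [h8, h10, List.length_ofFn] at h7
  have h11 : J.n = m := rfl
  simp only [h11] at h6 h7
  omega

namespace NiceTimeBound
variable {T : ℕ → ℕ}

/-- The maximum of `T` over all arguments up to nearly linear size is `Õ(T)`. -/
theorem exists_max (hT : NiceTimeBound T) (hpos : ∀ m, 1 ≤ T m) : ∃ U : ℕ → ℕ, SoftO U T ∧
    ∀ m x, x ≤ (6 * Nat.size m ^ 2 + 1) * (m + 1) → T x ≤ U m := by
  have key := fun m => Finset.exists_max_image
    (Finset.range ((6 * Nat.size m ^ 2 + 1) * (m + 1) + 1)) T ⟨0, by simp⟩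
  choose h h1 h2 using key
  refine ⟨fun m => T (h m), ?_, fun m x hx => h2 m x (Finset.mem_range.2 (by omega))⟩
  -- `Õ(m)` is `0` at `m = 0`, so this argument is excluded here and treated separately
  obtain ⟨C, k, hC⟩ := hT.softO_comp (fun m => if m = 0 then 0 else h m) ⟨50, 2, fun m => by
    show (if m = 0 then 0 else h m) ≤ 50 * (m * Nat.log 2 (m + 2) ^ 2)
    split_ifs with hm
    · omega
    · have h3 := Finset.mem_range.1 (h1 m)
      have h4 := size_le_log m
      have h5 : 1 ≤ Nat.log 2 (m + 2) := Nat.log_pos (by norm_num) (by omega)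
      calc h m ≤ (6 * Nat.size m ^ 2 + 1) * (m + 1) := by omega
        _ ≤ (6 * (2 * Nat.log 2 (m + 2)) ^ 2 + Nat.log 2 (m + 2) ^ 2) * (2 * m) := by
          gcongr
          · exact Nat.one_le_pow _ _ h5
          · omega
        _ = 50 * (m * Nat.log 2 (m + 2) ^ 2) := by ring⟩
  refine ⟨C + T (h 0), k, fun m => ?_⟩
  have h5 : 1 ≤ T m * Nat.log 2 (T m + 2) ^ k :=
    Nat.mul_pos (hpos m) (Nat.pow_pos (SoftO.one_le_log T m))
  rcases Nat.eq_zero_or_pos m with rfl | hm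
  · exact (Nat.le_add_left _ _).trans (Nat.le_mul_of_pos_right _ h5)
  · have := hC m
    simp only [hm.ne', if_false] at this
    exact this.trans (Nat.mul_le_mul_right _ (Nat.le_add_right _ _))

/-- By superlinearity, jobs of size at most `M` and of total size `a * M` need at most the time for
`2 * a` jobs of size about `M`, up to a constant factor. -/
theorem sum_le {C₁ : ℕ} (hC : ∀ k n, 1 ≤ k → 1 ≤ n → k * T n ≤ C₁ * T (k * n)) {M U a : ℕ}
    (hM : 1 ≤ M) (hU : ∀ x ≤ M, T x ≤ U) {s : Finset ℕ} {f : ℕ → ℕ} (hf : ∀ v ∈ s, 1 ≤ f v)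
    (hf' : ∀ v ∈ s, f v ≤ M) (hs : ∑ v ∈ s, f v ≤ a * M) :
    ∑ v ∈ s, T (f v) ≤ 2 * C₁ * a * U := by
  refine Nat.le_of_mul_le_mul_left (c := M) ?_ hM
  calc M * ∑ v ∈ s, T (f v) ≤ ∑ v ∈ s, 2 * C₁ * U * f v := by
        rw [Finset.mul_sum]
        refine Finset.sum_le_sum fun v hv => ?_
        have h1 := hf v hv
        have h2 : 1 ≤ M / f v := (Nat.one_le_div_iff h1).2 (hf' v hv)
        have h3 : M ≤ 2 * (M / f v) * f v := by
          have h5 : f v * (M / f v + 1) ≤ 2 * (M / f v) * f v := by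
            rw [mul_comm]; exact Nat.mul_le_mul_right _ (by omega)
          have h6 := Nat.lt_mul_div_succ M h1
          omega
        calc M * T (f v) ≤ 2 * (M / f v) * f v * T (f v) := Nat.mul_le_mul_right _ h3
          _ = 2 * f v * (M / f v * T (f v)) := by ring
          _ ≤ 2 * f v * (C₁ * U) := Nat.mul_le_mul_left _ ((hC _ _ h2 h1).trans
            (Nat.mul_le_mul_left _ (hU _ (Nat.div_mul_le_self _ _))))
          _ = _ := by ring
    _ = 2 * C₁ * U * ∑ v ∈ s, f v := (Finset.mul_sum _ _ _).symm
    _ ≤ 2 * C₁ * U * (a * M) := Nat.mul_le_mul_left _ hs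
    _ = _ := by ring

end NiceTimeBound

theorem KP.one_le_sz {I : KP} {v : ℕ} (hv : 1 ≤ v) : 1 ≤ I.sz v := by
  induction h : I.N - v using Nat.strong_induction_on generalizing v with
  | _ d ih =>
    rcases Nat.lt_or_ge v I.N with h1 | h1
    · rw [sz_inner hv h1]
      have := ih (I.N - 2 * v) (by omega) (v := 2 * v) (by omega) rfl
      exact le_min (by unfold ntop; omega) (by omega)
    · exact I.sz_pos v h1

/-! ### The running time of the algorithm -/

namespace KnapsackInstance

theorem ntop_le (J : KnapsackInstance) (κ : ℕ) :
    (J.kp κ).ntop ≤ (6 * (J.kp κ).C + 1) * (J.W + J.opt + 1) := by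
  refine (KP.ntop_le fun S hS hW => J.le_opt κ hS hW).trans ?_
  have h1 : (J.kp κ).C * (2 * J.W + 6 * J.opt) ≤ (J.kp κ).C * (6 * (J.W + J.opt + 1)) :=
    Nat.mul_le_mul_left _ (by omega)
  calc J.W + 1 + (J.kp κ).C * (2 * J.W + 6 * J.opt)
      ≤ (J.W + J.opt + 1) + (J.kp κ).C * (6 * (J.W + J.opt + 1)) := by omega
    _ = _ := by ring

theorem C_le (J : KnapsackInstance) (κ : ℕ) : (J.kp κ).C ≤ Nat.size (J.W + J.opt) ^ 2 := by
  rw [pow_two]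
  exact Nat.mul_le_mul (Nat.size_le_size (Nat.le_add_right _ _))
    (Nat.size_le_size ((J.pm_le_opt κ).trans (Nat.le_add_left _ _)))

theorem N_le (J : KnapsackInstance) (κ : ℕ) : (J.kp κ).N ≤
    ((2 * (J.kp κ).C + 1) * ((J.kp κ).Q * (J.kp κ).Q)) * (J.kp κ).ntop := by
  unfold KP.N
  calc (J.kp κ).G * (J.kp κ).Q * (J.kp κ).Q
      ≤ (2 * (J.kp κ).C + 1) * (J.kp κ).ntop * (J.kp κ).Q * (J.kp κ).Q := by
        gcongr; exact KP.G_le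
    _ = _ := by ring

/-- The running time, in terms of the number of nodes, their total size, and the total time of
one convolution at every node. -/
theorem totalTime_le (I : KP) (B : ℕ) (T : ℕ → ℕ) : I.totalTime B T ≤
    (2000 + I.R * (4 * B + 200)) * (2 * I.N) +
    (1000 + 200 * I.R) * (I.ntop + ∑ v ∈ Finset.Ico 1 (2 * I.N), I.sz v) +
    I.R * ∑ v ∈ Finset.Ico 1 (2 * I.N), T (I.sz v) +
    (1000 + 100 * (I.LW + I.LP) + 200 * I.Q) * I.n +
    (1000 + 16 * (I.LW + I.LP + I.ell) + 8 * I.Q₀ + 16 * Nat.size (2 * I.N) +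
      I.C * (8 * I.LW + 200)) := by
  have h1 : ∑ k ∈ Finset.range (2 * I.N - 1), (I.evalTime B T (2 * I.N - 1 - k) + 8) =
      ∑ v ∈ Finset.Ico 1 (2 * I.N), (I.evalTime B T v + 8) := by
    rw [Finset.sum_Ico_eq_sum_range, ← Finset.sum_range_reflect]
    refine Finset.sum_congr rfl fun k hk => ?_
    have := Finset.mem_range.1 hk
    rw [show 2 * I.N - 1 - (2 * I.N - 1 - 1 - k) = 1 + k by omega]
  have h2 : ∑ v ∈ Finset.Ico 1 (2 * I.N), (I.evalTime B T v + 8) =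
      (2 * I.N - 1) * (408 + I.R * (4 * B + 200)) +
      (200 + 200 * I.R) * ∑ v ∈ Finset.Ico 1 (2 * I.N), I.sz v +
      I.R * ∑ v ∈ Finset.Ico 1 (2 * I.N), T (I.sz v) := by
    rw [Finset.mul_sum, Finset.mul_sum, ← smul_eq_mul (2 * I.N - 1), ← Nat.card_Ico 1,
      ← Finset.sum_const, ← Finset.sum_add_distrib, ← Finset.sum_add_distrib]
    refine Finset.sum_congr rfl fun v _ => ?_
    unfold KP.evalTime
    ring
  have h3 : I.off 0 ≤ ∑ v ∈ Finset.Ico 1 (2 * I.N), I.sz v + 2 * I.N := by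
    have : I.off 0 = ∑ v ∈ Finset.Ico 1 (2 * I.N), (I.sz v + 1) := rfl
    rw [this, Finset.sum_add_distrib]
    simp
  have h4 : ∑ k ∈ Finset.range I.N, (308 + 70 * (I.sz k + 1 + if k = 1 then I.W else 0)) ≤
      378 * I.N + 70 * (I.ntop + ∑ v ∈ Finset.Ico 1 (2 * I.N), I.sz v) + 70 * I.ntop := by
    have h5 : ∑ k ∈ Finset.range I.N, (if k = 1 then I.W else 0) ≤ I.ntop := by
      rw [Finset.sum_ite_eq']
      split_ifs
      · unfold KP.ntop; omega
      · exact Nat.zero_le _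
    have h6 : ∑ k ∈ Finset.range I.N, I.sz k ≤
        I.ntop + ∑ v ∈ Finset.Ico 1 (2 * I.N), I.sz v := by
      have hN := I.N_pos
      rw [← Finset.sum_erase_add _ _ (Finset.mem_range.2 hN), add_comm]
      refine Nat.add_le_add (I.sz_le_ntop 0) (Finset.sum_le_sum_of_subset fun v hv => ?_)
      simp only [Finset.mem_erase, Finset.mem_range, Finset.mem_Ico] at hv ⊢
      omega
    have h7 : ∑ k ∈ Finset.range I.N, (308 + 70 * (I.sz k + 1 + if k = 1 then I.W else 0)) =
        378 * I.N + 70 * ∑ k ∈ Finset.range I.N, I.sz k +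
        70 * ∑ k ∈ Finset.range I.N, (if k = 1 then I.W else 0) := by
      simp only [mul_add, Finset.sum_add_distrib, Finset.mul_sum, Finset.sum_const,
        Finset.card_range, smul_eq_mul]
      ring
    omega
  have h8 : Nat.clog 2 I.Q₀ ≤ I.Q₀ := Nat.clog_le_of_le_pow Nat.lt_two_pow_self.le
  have hN := I.N_pos
  have h9 : (2 * I.N - 1) * (408 + I.R * (4 * B + 200)) ≤
      2 * I.N * (408 + I.R * (4 * B + 200)) := Nat.mul_le_mul_right _ (by omega)
  unfold KP.totalTime KP.backTime
  rw [h1, h2]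
  generalize ∑ v ∈ Finset.Ico 1 (2 * I.N), I.sz v = s at *
  generalize ∑ v ∈ Finset.Ico 1 (2 * I.N), T (I.sz v) = τ at *
  generalize Nat.size (2 * I.N) = a at *
  generalize ∑ k ∈ Finset.range I.N, (308 + 70 * (I.sz k + 1 + if k = 1 then I.W else 0)) = b at *
  generalize I.ntop = m at *
  have h10 : (2 * I.N - 1) ≤ 2 * I.N := by omega
  generalize 2 * I.N - 1 = d at *
  nlinarith [Nat.zero_le (I.R * m), Nat.zero_le (I.n * I.LW), Nat.zero_le (I.n * I.LP), Nat.zero_le (I.n * I.Q)]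

/-- The algorithm needs time `Õ(n + T (W + opt))`. -/
theorem softO_totalTime {T : ℕ → ℕ} (hT : NiceTimeBound T) (hle : ∀ m, 1 ≤ T m ∧ m ≤ T m)
    (κ B : ℕ) : SoftO (fun J : KnapsackInstance => (J.kp κ).totalTime B T)
      fun J => J.n + T (J.W + J.opt) := by
  obtain ⟨U, hU, hmax⟩ := hT.exists_max fun m => (hle m).1
  obtain ⟨C₁, hC₁⟩ := hT.mul_le
  set g : KnapsackInstance → ℕ := fun J => J.n + T (J.W + J.opt) with hg
  have hm : ∀ J, J.n + (J.W + J.opt) ≤ g J := fun J => Nat.add_le_add_left (hle _).2 _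
  have hg1 : ∀ J, 1 ≤ g J := fun J => (hle (J.W + J.opt)).1.trans (Nat.le_add_left _ _)
  have hb := SoftO.one_le_log g
  set b : KnapsackInstance → ℕ := fun J => Nat.log 2 (g J + 2) with hb_def
  have c (k : ℕ) := PolyIn.const b k
  have hs : PolyIn b fun J => Nat.size (g J + 2) := ((c 4).mul (PolyIn.self b)).mono fun J => by
    have h1 : Nat.size (g J + 2) ≤ b J + 1 := Nat.size_le.2
      (Nat.lt_pow_succ_log_self (by norm_num) _)
    have : 1 ≤ b J := hb J
    omega
  have hpm := fun J : KnapsackInstance => J.pm_le_opt κ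
  have hell : PolyIn b fun J => (J.kp κ).ell := hs.mono fun J => Nat.size_le_size (by
    have h1 := hpm J
    have h2 := hm J
    show J.n + J.W + _ + 2 ≤ _
    omega)
  have hLW : PolyIn b fun J => (J.kp κ).LW := hell.mono fun J => Nat.size_le_size (by omega)
  have hLP : PolyIn b fun J => (J.kp κ).LP := hell.mono fun J => Nat.size_le_size (by omega)
  have hC : PolyIn b fun J => (J.kp κ).C := hLW.mul hLP
  have hL : PolyIn b fun J => (J.kp κ).L := (c κ).mul hell
  have hQ₀ : PolyIn b fun J => (J.kp κ).Q₀ := (((c 2).mul hell).mul (hL.mul hL)).add hb (c 2)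
  have hQ : PolyIn b fun J => (J.kp κ).Q := (((c 2).mul hQ₀).add hb (c 1)).mono fun J => KP.Q_le
  have h6C := ((c 6).mul hC).add hb (c 1)
  have h2C := (((c 2).mul hC).add hb (c 1)).mul (hQ.mul hQ)
  have hm1 : SoftO (fun J : KnapsackInstance => J.W + J.opt + 1) g :=
    ((SoftO.of_le hm).add (SoftO.of_le hg1)).mono fun J => by omega
  have hntop : SoftO (fun J => (J.kp κ).ntop) g := (hm1.mul_poly h6C).mono fun J => J.ntop_le κ
  have hN : SoftO (fun J => (J.kp κ).N) g := (hntop.mul_poly h2C).mono fun J => J.N_le κ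
  have hs2N : PolyIn b fun J => Nat.size (2 * (J.kp κ).N) :=
    (((c 2).add hb (h2C.add hb h6C)).add hb hs).mono fun J => by
      refine (size_mul_le _ _).trans ?_
      have h1 := Nat.size_le_size ((J.N_le κ).trans (Nat.mul_le_mul_left _ (J.ntop_le κ)))
      refine (Nat.add_le_add_left (h1.trans ((size_mul_le _ _).trans (Nat.add_le_add
        (size_le_self _) ((size_mul_le _ _).trans (Nat.add_le_add (size_le_self _)
          (Nat.size_le_size (n := g J + 2) ?_)))))) _).trans ?_
      · have := hm J; omega
      · have : Nat.size 2 = 2 := by decide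
        omega
  have hR : PolyIn b fun J => (J.kp κ).R := (c 13).mul (hs2N.add hb ((c κ).mul hell))
  have ha : PolyIn b fun J => (Nat.size (2 * (J.kp κ).N) + 1) *
      (3 * ((J.kp κ).C + 1) * ((J.kp κ).Q * (J.kp κ).Q)) :=
    (hs2N.add hb (c 1)).mul (((c 3).mul (hC.add hb (c 1))).mul (hQ.mul hQ))
  have hsz : ∀ J : KnapsackInstance, ∑ v ∈ Finset.Ico 1 (2 * (J.kp κ).N), (J.kp κ).sz v ≤
      (Nat.size (2 * (J.kp κ).N) + 1) * (3 * ((J.kp κ).C + 1) * ((J.kp κ).Q * (J.kp κ).Q)) *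
        (J.kp κ).ntop := fun J => by
    rw [mul_assoc]
    refine KP.sum_sz_le.trans (Nat.mul_le_mul (Nat.succ_le_succ (Nat.size_le_size ?_))
      KP.sum_leaves_le)
    omega
  have hsum := (hntop.mul_poly ha).mono hsz
  have hUg : SoftO (fun J : KnapsackInstance => U (J.W + J.opt)) g := by
    obtain ⟨D, k, hD⟩ := hU
    refine ⟨D, k, fun J => (hD _).trans (Nat.mul_le_mul_left _ (Nat.mul_le_mul
      (Nat.le_add_left _ _) (Nat.pow_le_pow_left (Nat.log_mono_right ?_) k)))⟩
    exact Nat.add_le_add_right (Nat.le_add_left _ _) 2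
  have hτ : SoftO (fun J => ∑ v ∈ Finset.Ico 1 (2 * (J.kp κ).N), T ((J.kp κ).sz v)) g :=
    (hUg.mul_poly ((c (2 * C₁)).mul ha)).mono fun J => by
      refine NiceTimeBound.sum_le hC₁ (M := (J.kp κ).ntop) (by unfold KP.ntop; omega)
        (fun x hx => hmax _ x (hx.trans ((J.ntop_le κ).trans (Nat.mul_le_mul_right _ ?_))))
        (fun v hv => KP.one_le_sz (Finset.mem_Ico.1 hv).1) (fun v _ => KP.sz_le_ntop v) (hsz J)
      have := J.C_le κ
      omega
  have hn : SoftO (fun J : KnapsackInstance => J.n) g := SoftO.of_le fun J => Nat.le_add_right _ _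
  have hLL := hLW.add hb hLP
  refine ((((((hN.const_mul 2).mul_poly ((c 2000).add hb (hR.mul (c (4 * B + 200))))).add
    ((hntop.add hsum).mul_poly ((c 1000).add hb ((c 200).mul hR)))).add (hτ.mul_poly hR)).add
    (hn.mul_poly (((c 1000).add hb ((c 100).mul hLL)).add hb ((c 200).mul hQ)))).add
    (SoftO.of_poly hg1 (((((c 1000).add hb ((c 16).mul (hLL.add hb hell))).add hb
      ((c 8).mul hQ₀)).add hb ((c 16).mul hs2N)).add hb
      (hC.mul (((c 8).mul hLW).add hb (c 200)))))).mono fun J => totalTime_le (J.kp κ) B T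

end KnapsackInstance

/-! ### The probability of failure and the correctness of the output -/

namespace KnapsackInstance

/-- With `κ = 2 * c + 5`, overloaded buckets and failed convolutions contribute at most
`2 ^ (-2 * c * ell) / 2` each: the initial potential is at most `2 ^ (5 * ell)`, and `R` is large
enough for a union bound over all nodes. Moreover `n + W + opt + 2 ≤ 2 ^ (2 * ell)`. -/
theorem failure_le (J : KnapsackInstance) (c : ℕ) :
    3 * (∑ x ∈ Finset.range (J.kp (2 * c + 5)).C, ((J.kp (2 * c + 5)).M x : ℝ)) /
        2 ^ ((J.kp (2 * c + 5)).L + 1) +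
      2 * (J.kp (2 * c + 5)).N * (17 / 18) ^ (J.kp (2 * c + 5)).R ≤
    1 / ((J.n + J.W + J.opt + 2 : ℕ) : ℝ) ^ c := by
  set I := J.kp (2 * c + 5) with hI
  have hL : I.L = (2 * c + 5) * I.ell := rfl
  have hlt : J.n + J.W + I.pm + 2 < 2 ^ I.ell := Nat.lt_size_self _
  have he : 2 ≤ I.ell := by
    by_contra h
    have : (2 : ℕ) ^ I.ell ≤ 2 ^ 1 := Nat.pow_le_pow_right (by norm_num) (by omega)
    omega
  have hopt := J.opt_le (2 * c + 5)
  rw [← hI] at hopt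
  have h1 : 3 * ∑ x ∈ Finset.range I.C, I.M x ≤ 2 ^ (5 * I.ell) := by
    have h2 : ∑ x ∈ Finset.range I.C, I.M x ≤ I.C * I.Mx :=
      (Finset.sum_le_card_nsmul _ _ _ fun x _ => I.M_le_Mx x).trans (by simp)
    have h3 : I.C ≤ 2 ^ I.ell * 2 ^ I.ell := Nat.mul_le_mul
      ((size_le_self _).trans (le_trans (by show J.W ≤ _; omega) hlt.le))
      ((size_le_self _).trans (le_trans (by omega) hlt.le))
    have h4 : I.Mx ≤ 2 * 2 ^ I.ell := by show 2 * J.W + 1 ≤ _; omega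
    calc 3 * ∑ x ∈ Finset.range I.C, I.M x
        ≤ 2 ^ 2 * ((2 ^ I.ell * 2 ^ I.ell) * (2 * 2 ^ I.ell)) :=
          Nat.mul_le_mul (by norm_num) (h2.trans (Nat.mul_le_mul h3 h4))
      _ = 2 ^ (3 * I.ell + 3) := by ring
      _ ≤ _ := Nat.pow_le_pow_right (by norm_num) (by omega)
  have h5 : 2 * I.N ≤ 2 ^ Nat.size (2 * I.N) := (Nat.lt_size_self _).le
  have h6 : J.n + J.W + J.opt + 2 ≤ (2 ^ I.ell) ^ 2 := by
    refine le_trans ?_ (Nat.pow_le_pow_left hlt.le 2)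
    nlinarith [Nat.zero_le J.n, Nat.zero_le J.W, Nat.zero_le I.pm]
  have h1' : 3 * (∑ x ∈ Finset.range I.C, (I.M x : ℝ)) ≤ 2 ^ (5 * I.ell) := by exact_mod_cast h1
  have h5' : 2 * (I.N : ℝ) ≤ 2 ^ Nat.size (2 * I.N) := by exact_mod_cast h5
  have h6' : ((J.n + J.W + J.opt + 2 : ℕ) : ℝ) ≤ (2 ^ I.ell) ^ 2 := by exact_mod_cast h6
  have hR : I.R = 13 * (Nat.size (2 * I.N) + I.L) := rfl
  clear_value I
  generalize I.ell = e at *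
  generalize I.L = L at *
  generalize I.R = R at *
  generalize Nat.size (2 * I.N) = s at *
  subst hL hR
  have h7 : 3 * (∑ x ∈ Finset.range I.C, (I.M x : ℝ)) / 2 ^ ((2 * c + 5) * e + 1) ≤
      1 / 2 ^ (2 * c * e) / 2 := by
    rw [div_div, div_le_div_iff₀ (by positivity) (by positivity), one_mul]
    calc _ ≤ (2 : ℝ) ^ (5 * e) * (2 ^ (2 * c * e) * 2) := by gcongr
      _ = 2 ^ ((2 * c + 5) * e + 1) := by ring
  have h8 : 2 * (I.N : ℝ) * (17 / 18) ^ (13 * (s + (2 * c + 5) * e)) ≤ 1 / 2 ^ (2 * c * e) / 2 := by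
    have h9 : ((17 : ℝ) / 18) ^ (13 * (s + (2 * c + 5) * e)) ≤ (1 / 2) ^ (s + (2 * c + 5) * e) := by
      rw [pow_mul]
      exact pow_le_pow_left₀ (by positivity) (by norm_num) _
    calc 2 * (I.N : ℝ) * (17 / 18) ^ (13 * (s + (2 * c + 5) * e))
        ≤ 2 ^ s * (1 / 2) ^ (s + (2 * c + 5) * e) := by gcongr
      _ = (1 / 2) ^ ((2 * c + 5) * e) := by rw [pow_add, ← mul_assoc, ← mul_pow]; norm_num
      _ ≤ (1 / 2 : ℝ) ^ (2 * c * e + 1) :=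
          pow_le_pow_of_le_one (by norm_num) (by norm_num) (by ring_nf; omega)
      _ = _ := by rw [pow_succ, one_div_pow]; ring
  calc _ ≤ 1 / 2 ^ (2 * c * e) / 2 + 1 / 2 ^ (2 * c * e) / 2 := add_le_add h7 h8
    _ = 1 / ((2 ^ e) ^ 2) ^ c := by rw [add_halves, ← pow_mul, ← pow_mul]; congr 2; ring
    _ ≤ _ := by gcongr

/-- A feasible output that is at least as good as an optimal solution is correct. -/
theorem correct_of_le (J : KnapsackInstance) (κ : ℕ) {σ : St} (hl : σ.ln 0 = J.n)
    (h1 : ∀ t < J.n, σ.rd 0 t ≤ 1)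
    (hW : ∑ t ∈ Finset.range J.n, (J.kp κ).wt t * σ.rd 0 t ≤ J.W)
    (hO : J.opt ≤ ∑ t ∈ Finset.range J.n, (J.kp κ).p t * σ.rd 0 t) :
    zeroOneKnapsack.correct J (σ.arr 0) := by
  have hx : J.weight (fun i => ⟨σ.rd 0 i, Nat.lt_succ_of_le (h1 i i.2)⟩) ≤ J.W :=
    (sum_eq_sum_range J.w fun t => σ.rd 0 t).trans_le hW
  refine ⟨fun i => ⟨σ.rd 0 i, Nat.lt_succ_of_le (h1 i i.2)⟩,
    St.arr_eq_ofFn hl fun i => rfl, hx, le_antisymm ?_ ?_⟩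
  · exact Finset.le_sup (f := J.profit) (Finset.mem_filter.2 ⟨Finset.mem_univ _, hx⟩)
  · exact hO.trans_eq (sum_eq_sum_range J.p fun t => σ.rd 0 t).symm

theorem input_ofFn (J : KnapsackInstance) (κ : ℕ) :
    (J.kp κ).Input ⟨fun _ => 0, fun a => (zeroOneKnapsack.input J).getD a []⟩ := by
  refine ⟨fun t => ?_, fun t => ?_, ?_⟩
  · by_cases h : t < J.n <;> simp [St.rd, zeroOneKnapsack, kp, h]
  · by_cases h : t < J.n <;> simp [St.rd, zeroOneKnapsack, kp, h]
  · simp [St.ln, zeroOneKnapsack, kp]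

end KnapsackInstance

theorem theorem4p2 (K : ℕ) (hK : 1 ≤ K) (T : ℕ → ℕ) (hT : NiceTimeBound T)
    (hconv : ∃ P : RamProg,
      SolvesInTime P (bmMaxConv K) (fun I => T I.n) (fun _ => 2 / 3)) (c : ℕ) :
    ∃ (Q : RamProg) (t : KnapsackInstance → ℕ),
      SoftO t (fun I => I.n + T (I.W + I.opt)) ∧
      SolvesInTime Q zeroOneKnapsack t
        (fun I => 1 - 1 / ((I.n + I.W + I.opt + 2 : ℕ) : ℝ) ^ c) := by
  obtain ⟨P, hP⟩ := hconv
  set κ := 2 * c + 5 with hκ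
  set B := max 2 (modBound P) with hB
  refine ⟨knapsackProg P B κ, fun J => (J.kp κ).totalTime B T,
    KnapsackInstance.softO_totalTime hT hP.le_time κ B, ?_⟩
  obtain ⟨c₁, h₁⟩ := KnapsackInstance.fits κ
  obtain ⟨c₂, h₂⟩ := hP.convOK hK
  have hp := (KnapsackInstance.ntop_poly κ).add KnapsackInstance.one_le_mag (PolyIn.const _ 2)
  obtain ⟨k, hk⟩ := (((PolyIn.const _ 2).mul hp).mul hp).exists_pow fun J : KnapsackInstance =>
    Nat.le_add_left _ _
  refine ⟨c₁ + k * c₂ + 1, by omega, fun J w hw => ?_⟩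
  have hw' : ∀ e ≤ c₁ + k * c₂ + 1, J.mag ^ e ≤ 2 ^ w := fun e he =>
    (Nat.pow_le_pow_right J.one_le_mag he).trans hw
  -- convolutions of size up to `ntop` are within the word length
  have hconv : ConvOK P T w (J.kp κ).ntop := h₂ w _ ((Nat.pow_le_pow_left (hk J).le c₂).trans
    ((pow_mul _ _ _).symm.trans_le (hw' _ (by omega))))
  obtain ⟨S, hS, hSW, hSO⟩ := J.exists_opt κ
  have h := KP.knapsack (h₁ J w (hw' _ (by omega)))
    (fun x hx => mod_of_modBound_le ((le_max_right 2 _).trans hx)) (le_max_left _ _) hconv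
    (J.input_ofFn κ) (by simp [St.rd, zeroOneKnapsack, KnapsackInstance.kp])
    ⟨fun x _ => rfl, fun a ha => List.getD_eq_default _ _ (by simp [zeroOneKnapsack]; omega)⟩ hS hSW
  refine ⟨fun ω => ?_, ?_⟩
  · obtain ⟨tr, -, -, he⟩ := h
    obtain ⟨τ, hτ, hx⟩ := he ω
    exact ⟨_, τ, hx, hτ⟩
  · refine le_trans (sub_le_sub_left (J.failure_le c) 1)
      (h.measure_ge (fun σ => zeroOneKnapsack.correct J (σ.arr 0)) fun σ ⟨hl, h1, hW⟩ => ?_)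
    split_ifs with h2 h3 h3
    · exact le_rfl
    · exact zero_le_one
    · exact absurd (J.correct_of_le κ hl h1 hW (hSO.symm.trans_le h3)) h2
    · exact le_rfl
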